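/- **Setting.** Let $\mathfrak g$ be a simple complex Lie algebra with a nondegenerate invariant symmetric form $(\,,)$, a Cartan subalgebra $\mathfrak h$, simple roots $\alpha_1,\dots,\alpha_r$, highest root $\theta$, heights $|\alpha|$ (with $|-\alpha|=-|\alpha|$), root vectors $E_{\pm\alpha}$ with $(E_\alpha,E_{-\alpha})=1$ (so $e_\alpha=E_\alpha$, $f_\alpha=E_{-\alpha}$ for $\alpha>0$), and $\rho\in\mathfrak h$ with $\alpha_i(\rho)=1$ for all $i$. Let $\tilde{\mathfrak g}=\mathfrak g[t,t^{-1}]\oplus\mathbb Cc\oplus\mathbb C\partial$ be the affine Lie algebra, $[xt^n,yt^m]=[x,y]t^{n+m}+n\delta_{n,-m}(x,y)c$, $[\partial,xt^n]=nxt^n$, $c$ central, with Chevalley generators $e_i=E_{\alpha_i}$, $f_i=E_{-\alpha_i}$ $(1\le i\le r)$, $e_0=E_{-\theta}t$, $f_0=E_\theta t^{-1}$. Let $T$ be an automorphism of order $N$ of the affine Dynkin diagram and let $g\ge1$ be an integer such that the degrees $\deg e_i=1$ $(i\ne0)$, $\deg e_0=g-|\theta|$ are $T$-invariant (the Coxeter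 number of $\mathfrak g$ always has this property). Let $\tilde{\mathfrak g}_\gamma\subset\tilde{\mathfrak g}$ be spanned by $c,\partial$, all $E_\alpha t^{|\alpha|+mg}$ and all $ht^{mg}$ ($h\in\mathfrak h$, $m\in\mathbb Z$), and let $\phi:\tilde{\mathfrak g}_\gamma\to\tilde{\mathfrak g}$ be the isomorphism $E_\alpha t^{|\alpha|+mg}\mapsto E_\alpha t^m$, $ht^{mg}\mapsto ht^m-\delta_{m,0}(\rho,h)c/g$, $c\mapsto c/g$, $\partial\mapsto g\partial+\rho$. Let $B$ be the lift of $T$ to $\tilde{\mathfrak g}$: $B(e_i)=e_{Ti}$, $B(f_i)=f_{Ti}$, $B(g\partial+\rho)=g\partial+\rho$. Transport $B$ to $\tilde{\mathfrak g}_\gamma$ by $\phi$, and assume that there is an automorphism $\beta$ of $\mathfrak g$ with $B(xt^m)=\beta(x)t^m$ for all $xt^m\in\tilde{\mathfrak g}_\gamma$. Put $\mathfrak l=\{h\in\mathfrak h:\ \alpha_i(h)=\alpha_{Ti}(h),\ 0\le i\le r\}$, where $\alpha_0|_{\mathfrak h}=-\theta$, and let $(x_i)_{i\in I}$ be an orthonormal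 basis of $\mathfrak h$ such that $(x_i)_{i\in I_1}$ is a basis of $\mathfrak l$ and $(x_i)_{i\in I_2}$ one of $\mathfrak l^\perp$. Let $C_T:\mathfrak l^\perp\to\mathfrak l^\perp$ be the Cayley transform: $(\alpha_i-\alpha_{Ti})(C_Tx)=(\alpha_i+\alpha_{Ti})(x)$ for all $i$. Fix $\tau$ with $\operatorname{Im}\tau>0$. Identify $\mathfrak l^*$ with $\mathfrak l$ by the form. For $\lambda\in\mathfrak l^*$ let $\tilde\lambda=\lambda-2\pi i\tau\partial/g$ (in the Cartan subalgebra of $\tilde{\mathfrak g}_\gamma$). Thus, for a root $\alpha$ of $\mathfrak g$, $(\alpha,\tilde\lambda)=(\alpha,\lambda)-2\pi i\tau|\alpha|/g$; for the root of $E_\alpha t^m\in\tilde{\mathfrak g}$, $(\alpha+m\delta,\tilde\lambda)=(\alpha,\tilde\lambda)-2\pi i\tau m$; and $(m\delta,\tilde\lambda)=-2\pi i\tau m$. With $(\hat e_a),(\hat f_a)$ the dual bases $E_\alpha t^m,\ x_it^m$ and $E_{-\alpha}t^{-m},\ x_it^{-m}$ of the positive and negative root spaces of $\tilde{\mathfrak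 g}$, $\hat\alpha_a$ the root of $\hat e_a$, and $u\wedge v=u\otimes v-v\otimes u$, put $$r_T(\tilde\lambda)=-\tfrac12\Big(\sum_{i\in I}x_i\otimes x_i+c\otimes\partial+\partial\otimes c\Big)+\tfrac12\sum_{i\in I_2}\phi(C_Tx_i)\otimes\phi(x_i)-\sum_a\hat f_a\otimes\hat e_a+\sum_a\sum_{l=1}^N\frac{e^{-l(\hat\alpha_a,\tilde\lambda)}}{1-e^{-N(\hat\alpha_a,\tilde\lambda)}}\,\hat e_a\wedge B^l\hat f_a$$ and $\bar r_T(\lambda,z)=(\mathrm{ev}_z\otimes\mathrm{ev}_1)(\phi^{-1}\otimes\phi^{-1})(r_T(\tilde\lambda))$, where $\mathrm{ev}_z(xt^n)=z^nx$, $\mathrm{ev}_z(c)=0$. Let $$\theta(u|\tau)=-\sum_{j\in\mathbb Z}e^{\pi i(j+\frac12)^2\tau+2\pi i(j+\frac12)(u+\frac12)},\quad \sigma_w(u)=\frac{\theta(w-u)\theta'(0)}{\theta(w)\theta(u)},\quad\chi(u)=\frac{\theta'(u)}{\theta(u)}.$$ **Proposition.** Call $\lambda$ generic if $e^{-N(\hat\alpha,\tilde\lambda)}\ne1$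 for all positive real roots $\hat\alpha$ of $\tilde{\mathfrak g}$. 1. For generic $\lambda$ the series $\bar r_T(\lambda,z)$ converges in the annulus $1<|z|<e^{2\pi\operatorname{Im}\tau/g}$, and $\bar r_T$ extends to a meromorphic function on $\mathfrak l^*\times\mathbb C^*$, which for $z=e^{2\pi iu/g}$ is equal to $$\begin{aligned}\bar r_T(\lambda,z)=&-\sum_{\alpha>0}\sum_{l=0}^{N-1}\frac1{2\pi i}e^{-l(\alpha,\tilde\lambda)+2\pi i|\alpha|u/g}\,\sigma_{\frac N{2\pi i}(\alpha,\tilde\lambda)}(u+l\tau|N\tau)\,e_\alpha\otimes\beta^l(f_\alpha)\\&-\sum_{\alpha>0}\sum_{l=0}^{N-1}\frac1{2\pi i}e^{l(\alpha,\tilde\lambda)-2\pi i|\alpha|u/g}\,\sigma_{-\frac N{2\pi i}(\alpha,\tilde\lambda)}(u+l\tau|N\tau)\,f_\alpha\otimes\beta^l(e_\alpha)\\&-\sum_{i\in I}\sum_{l=0}^{N-1}\Big(\tfrac12(1-\delta_{l0})+\tfrac1{2\pi i}\chi(u+l\tau|N\tau)\Big)x_i\otimes\beta^lx_i+\tfrac12\sum_{i\in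 I_2}\frac{\beta+1}{\beta-1}x_i\otimes x_i .\end{aligned}$$ 2. $\bar r_T$ is a dynamical r-matrix with spectral parameter: it is $\mathfrak l$-invariant, and for generic $\lambda$ and $z_1,z_2,z_3\in\mathbb C^*$ such that $(z_a/z_b)^g\notin e^{2\pi i\tau\mathbb Z}$ for $a<b$ it is differentiable in $\lambda$ and satisfies $$\begin{aligned}\sum_{i\in I_1}&\Big(x_i^{(1)}\partial_{x_i}r^{23}(\lambda,\tfrac{z_2}{z_3})-x_i^{(2)}\partial_{x_i}r^{13}(\lambda,\tfrac{z_1}{z_3})+x_i^{(3)}\partial_{x_i}r^{12}(\lambda,\tfrac{z_1}{z_2})\Big)\\&+[r^{12}(\lambda,\tfrac{z_1}{z_2}),r^{13}(\lambda,\tfrac{z_1}{z_3})]+[r^{13}(\lambda,\tfrac{z_1}{z_3}),r^{23}(\lambda,\tfrac{z_2}{z_3})]+[r^{12}(\lambda,\tfrac{z_1}{z_2}),r^{23}(\lambda,\tfrac{z_2}{z_3})]=0.\end{aligned}$$ The number of dynamical variables is $\dim\mathfrak l=d-1$, where $d$ is the number of orbits of $T$ on the nodes of the affine diagram. 3. If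 $T=1$, then $\bar r_T$ is, up to a gauge transformation, Felder's elliptic r-matrix $r_F(\mu,u)=\chi(u|\tau)\sum_ix_i\otimes x_i+\sum_\alpha\sigma_{\alpha(\mu)}(u|\tau)E_\alpha\otimes E_{-\alpha}$ (sum over all roots): $$\bar r_T(\lambda,e^{2\pi iu/g})=-\tfrac1{2\pi i}\big(\mathrm{Ad}(e^{2\pi iu\rho/g})\otimes1\big)\,r_F\big(\tfrac{\lambda}{2\pi i}-\tfrac{\tau\rho}{g},\,u\big).$$ 4. If $\mathfrak g=\mathfrak{sl}(n)$, with the affine nodes labelled by $\mathbb Z/n$ so that $E_{\alpha_j}=E_{j,j+1}$ and $E_{-\alpha_j}=E_{j+1,j}$ (where for the affine node $\alpha_j$ means $-\theta$), and $T$ is the rotation $j\mapsto j+k$ with $k$ prime to $n$, then $\mathfrak l=0$ and for $u\notin\mathbb Z+\tau\mathbb Z$ we have $\bar r_T(e^{2\pi iu/g})=-\frac1{2\pi i}r_B(u)$, where $r_B$ is Belavin's elliptic r-matrix $$r_B(u)=\sum_{(p,c)\ne(0,0)}e^{2\pi ipu/n}\,\sigma_{-(ck+p\tau)/n}(u|\tau)\,J_{p,c}\otimes\tfrac1nJ_{p,c}^{-1},\qquad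 J_{p,c}=\sum_{j}e^{2\pi icj/n}E_{j,j+p},$$ $p,c$ running over $0,\dots,n-1$ and matrix indices being taken modulo $n$. -/

import Mathlib

open LieAlgebra LieModule Filter Topology
open scoped TensorProduct

set_option linter.unusedSectionVars false

noncomputable section

/-! ## Finite-dimensional data -/

/-- The choices made for a simple complex Lie algebra `𝔤`: a nondegenerate invariant symmetric
form `( , )`, a Cartan subalgebra `𝔥`, simple roots, and root vectors normalised by
`(E_α, E_{-α}) = 1` (so `e_α = E_α` and `f_α = E_{-α}` for a positive root `α`). -/
structure ChevalleyData (𝔤 : Type*) [LieRing 𝔤] [LieAlgebra ℂ 𝔤] [FiniteDimensional ℂ 𝔤]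
    [LieAlgebra.IsSimple ℂ 𝔤] where
  form : LinearMap.BilinForm ℂ 𝔤
  form_symm : form.IsSymm
  form_inv : form.lieInvariant 𝔤
  form_nondeg : form.Nondegenerate
  H : LieSubalgebra ℂ 𝔤
  [cartan : H.IsCartanSubalgebra]
  base : (IsKilling.rootSystem H).Base
  E : H.root → 𝔤
  E_mem : ∀ α : H.root, E α ∈ rootSpace H (α.1 : H → ℂ)
  E_norm : ∀ α : H.root, form (E α) (E ((IsKilling.rootSystem H).reflectionPerm α α)) = 1
  /-- the highest root -/
  θ : H.root
  θ_max : ∀ α : H.root, base.height α ≤ base.height θ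
  /-- the element of `𝔥` on which all simple roots take the value `1` -/
  ρ : H
  ρ_spec : ∀ i ∈ base.support, (IsKilling.rootSystem H).root i ρ = 1

namespace ChevalleyData

variable {𝔤 : Type*} [LieRing 𝔤] [LieAlgebra ℂ 𝔤] [FiniteDimensional ℂ 𝔤]
  [LieAlgebra.IsSimple ℂ 𝔤] (D : ChevalleyData 𝔤)

instance : D.H.IsCartanSubalgebra := D.cartan

/-- The root system of `𝔤`. -/
abbrev P : RootPairing D.H.root ℂ (Module.Dual ℂ D.H) D.H := IsKilling.rootSystem D.H

/-- The root `-α`. -/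
def neg (α : D.H.root) : D.H.root := D.P.reflectionPerm α α

/-- The height `|α|` (negative for negative roots). -/
def ht (α : D.H.root) : ℤ := D.base.height α

/-- The value `(α, h) = α(h)` of a root on `h ∈ 𝔥`. -/
def rootVal (α : D.H.root) (h : D.H) : ℂ := D.P.root α h

/-- The projection of `𝔤` onto the root space `ℂ E_α`. -/
def proj (α : D.H.root) : 𝔤 →ₗ[ℂ] 𝔤 := (D.form.flip (D.E (D.neg α))).smulRight (D.E α)

/-- The projection of `𝔤` onto `𝔥`. -/
def proj₀ : 𝔤 →ₗ[ℂ] 𝔤 := LinearMap.id - ∑ α, D.proj α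

/-- The automorphism `Ad(e^h)` of `𝔤`, for `h ∈ 𝔥`. -/
def torusAd (h : D.H) : 𝔤 →ₗ[ℂ] 𝔤 :=
  D.proj₀ + ∑ α, Complex.exp (D.rootVal α h) • D.proj α

/-! ## The affine Lie algebra -/

/-- Loops `𝔤[t, t⁻¹]`: the Laurent polynomial `∑ xₙ tⁿ` is the family `n ↦ xₙ`. -/
abbrev Loop (𝔤 : Type*) [Zero 𝔤] : Type _ := ℤ →₀ 𝔤

/-- `x ↦ x tⁿ`. -/
def mono (n : ℤ) : 𝔤 →ₗ[ℂ] Loop 𝔤 := Finsupp.lsingle n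

section bilinear

variable {V : Type*} [AddCommGroup V] [Module ℂ V]

/-- The linear map on loops given by `x tⁿ ↦ f n x`. -/
def loopLift (f : ℤ → 𝔤 →ₗ[ℂ] V) : Loop 𝔤 →ₗ[ℂ] V := Finsupp.lsum ℂ f

/-- The bilinear map on loops given by `(x tⁿ, y tᵐ) ↦ f n m x y`. -/
def loopBilin (f : ℤ → ℤ → 𝔤 →ₗ[ℂ] 𝔤 →ₗ[ℂ] V) : Loop 𝔤 →ₗ[ℂ] Loop 𝔤 →ₗ[ℂ] V :=
  loopLift fun n => (loopLift fun m => (f n m).flip).flip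

@[simp] lemma loopLift_mono (f : ℤ → 𝔤 →ₗ[ℂ] V) (n : ℤ) (x : 𝔤) :
    loopLift f (mono n x) = f n x := by
  simp [loopLift, mono]

@[simp] lemma loopBilin_mono (f : ℤ → ℤ → 𝔤 →ₗ[ℂ] 𝔤 →ₗ[ℂ] V) (n m : ℤ) (x y : 𝔤) :
    loopBilin f (mono n x) (mono m y) = f n m x y := by
  simp [loopBilin]

end bilinear

@[elab_as_elim]
lemma loop_induction {p : Loop 𝔤 → Prop} (a : Loop 𝔤) (hm : ∀ n x, p (mono n x))
    (ha : ∀ a b, p a → p b → p (a + b)) : p a := by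
  induction a using Finsupp.induction_linear with
  | zero => simpa using hm 0 0
  | add f g hf hg => exact ha _ _ hf hg
  | single n x => exact hm n x

/-- The bracket `[x tⁿ, y tᵐ] = [x, y] tⁿ⁺ᵐ` of loops. -/
def loopLie : Loop 𝔤 →ₗ[ℂ] Loop 𝔤 →ₗ[ℂ] Loop 𝔤 :=
  loopBilin fun n m => (ad ℂ 𝔤 : 𝔤 →ₗ[ℂ] Module.End ℂ 𝔤).compr₂ (mono (n + m))

/-- The derivation `t d/dt`. -/
def loopDeriv : Loop 𝔤 →ₗ[ℂ] Loop 𝔤 := loopLift fun n => (n : ℂ) • mono n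

/-- The cocycle with `ω(x tⁿ, y tᵐ) = n δ_{n,-m} (x, y)`. -/
def ω : LinearMap.BilinForm ℂ (Loop 𝔤) :=
  loopBilin fun n m => if n = -m then (n : ℂ) • D.form else 0

@[simp] lemma loopLie_mono (n m : ℤ) (x y : 𝔤) :
    loopLie (mono n x) (mono m y) = mono (n + m) ⁅x, y⁆ := by
  simp [loopLie]

@[simp] lemma loopDeriv_mono (n : ℤ) (x : 𝔤) :
    loopDeriv (mono n x) = (n : ℂ) • mono n x := by
  simp [loopDeriv]

lemma ω_mono (n m : ℤ) (x y : 𝔤) :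
    D.ω (mono n x) (mono m y) = if n = -m then (n : ℂ) * D.form x y else 0 := by
  simp only [ω, loopBilin_mono]
  split_ifs <;> simp

lemma form_comm (x y : 𝔤) : D.form x y = D.form y x := by
  simpa using D.form_symm.eq x y

lemma loopLie_self (a : Loop 𝔤) : loopLie a a = 0 := by
  have hs : ∀ a b : Loop 𝔤, loopLie a b + loopLie b a = 0 := by
    intro a b
    refine loop_induction a (fun n x => loop_induction b (fun m y => ?_) ?_) ?_
    pick_goal 2
    · rw [loopLie_mono, loopLie_mono, add_comm m n, ← map_add, ← lie_skew x y, neg_add_cancel,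
        map_zero]
    all_goals
      intro b b' h h'
      simp only [map_add, LinearMap.add_apply]
      rw [add_add_add_comm, h, h', add_zero]
  have h2 := hs a a
  rw [← two_smul ℂ] at h2
  exact (smul_eq_zero.mp h2).resolve_left two_ne_zero

lemma loopLie_skew (a b : Loop 𝔤) : loopLie a b = -loopLie b a := by
  have h := loopLie_self (a + b)
  simp only [map_add, LinearMap.add_apply, loopLie_self, zero_add, add_zero] at h
  exact eq_neg_of_add_eq_zero_right h

lemma loopLie_jacobi (a b c : Loop 𝔤) :
    loopLie a (loopLie b c) = loopLie (loopLie a b) c + loopLie b (loopLie a c) := by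
  refine loop_induction a (fun n x => loop_induction b (fun m y =>
    loop_induction c (fun k z => ?_) ?_) ?_) ?_
  pick_goal 3
  · simp only [loopLie_mono]
    rw [leibniz_lie x y z, map_add, add_assoc n m k, add_left_comm m n k]
  all_goals
    intro u v h h'
    simp only [map_add, LinearMap.add_apply, h, h']
    abel

lemma loopDeriv_lie (a b : Loop 𝔤) :
    loopDeriv (loopLie a b) = loopLie (loopDeriv a) b + loopLie a (loopDeriv b) := by
  refine loop_induction a (fun n x => loop_induction b (fun m y => ?_) ?_) ?_
  pick_goal 2
  · simp [add_smul]
  all_goals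
    intro u v h h'
    simp only [map_add, LinearMap.add_apply, h, h']
    abel

lemma ω_skew (a b : Loop 𝔤) : D.ω a b = -D.ω b a := by
  refine loop_induction a (fun n x => loop_induction b (fun m y => ?_) ?_) ?_
  pick_goal 2
  · rw [ω_mono, ω_mono, D.form_comm y x]
    by_cases h : n = -m
    · rw [if_pos h, if_pos (by omega), h]; push_cast; ring
    · rw [if_neg h, if_neg (by omega), neg_zero]
  all_goals
    intro u v h h'
    simp only [map_add, LinearMap.add_apply, h, h']
    ring

lemma ω_self (a : Loop 𝔤) : D.ω a a = 0 := by
  linear_combination (1 / 2 : ℂ) * D.ω_skew a a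

lemma ω_deriv (a b : Loop 𝔤) : D.ω (loopDeriv a) b = -D.ω a (loopDeriv b) := by
  refine loop_induction a (fun n x => loop_induction b (fun m y => ?_) ?_) ?_
  pick_goal 2
  · simp only [loopDeriv_mono, map_smul, LinearMap.smul_apply, ω_mono, smul_eq_mul]
    split_ifs with h
    · subst h; push_cast; ring
    · simp
  all_goals
    intro u v h h'
    simp only [map_add, LinearMap.add_apply, h, h']
    ring

lemma ω_cocycle (a b c : Loop 𝔤) :
    D.ω a (loopLie b c) = D.ω (loopLie a b) c + D.ω b (loopLie a c) := by
  refine loop_induction a (fun n x => loop_induction b (fun m y =>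
    loop_induction c (fun k z => ?_) ?_) ?_) ?_
  pick_goal 3
  · simp only [loopLie_mono, ω_mono]
    have h1 : D.form ⁅x, y⁆ z = D.form x ⁅y, z⁆ := by
      rw [← lie_skew, map_neg, LinearMap.neg_apply, D.form_inv, neg_neg]
    have h2 : D.form y ⁅x, z⁆ = -D.form x ⁅y, z⁆ := by
      rw [← h1, D.form_inv x y z, neg_neg]
    by_cases h : n + m + k = 0
    · have e1 : n = -(m + k) := by omega
      rw [if_pos e1, if_pos (by omega), if_pos (by omega), h1, h2]
      subst e1; push_cast; ring
    · rw [if_neg (by omega), if_neg (by omega), if_neg (by omega), add_zero]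
  all_goals
    intro u v h h'
    simp only [map_add, LinearMap.add_apply, h, h']
    ring

/-- The affine Lie algebra `𝔤̃ = 𝔤[t, t⁻¹] ⊕ ℂ c ⊕ ℂ ∂`. -/
def Affine (_D : ChevalleyData 𝔤) : Type _ := Loop 𝔤 × ℂ × ℂ

instance : AddCommGroup D.Affine := inferInstanceAs (AddCommGroup (Loop 𝔤 × ℂ × ℂ))

instance : Module ℂ D.Affine := inferInstanceAs (Module ℂ (Loop 𝔤 × ℂ × ℂ))

/-- The commutation relations of `𝔤̃`:
`c` is central, `[∂, x tⁿ] = n x tⁿ` and `[x tⁿ, y tᵐ] = [x, y] tⁿ⁺ᵐ + n δ_{n,-m} (x, y) c`. -/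
instance : Bracket D.Affine D.Affine where
  bracket x y :=
    (loopLie x.1 y.1 + x.2.2 • loopDeriv y.1 - y.2.2 • loopDeriv x.1, D.ω x.1 y.1, 0)

instance : LieRing D.Affine where
  add_lie x y z := by
    refine Prod.ext ?_ (Prod.ext ?_ ?_)
    · change loopLie (x.1 + y.1) z.1 + (x.2.2 + y.2.2) • loopDeriv z.1
          - z.2.2 • loopDeriv (x.1 + y.1) =
        (loopLie x.1 z.1 + x.2.2 • loopDeriv z.1 - z.2.2 • loopDeriv x.1) +
          (loopLie y.1 z.1 + y.2.2 • loopDeriv z.1 - z.2.2 • loopDeriv y.1)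
      simp only [map_add, LinearMap.add_apply, add_smul, smul_add]; abel
    · change D.ω (x.1 + y.1) z.1 = D.ω x.1 z.1 + D.ω y.1 z.1
      simp
    · change (0 : ℂ) = 0 + 0
      simp
  lie_add x y z := by
    refine Prod.ext ?_ (Prod.ext ?_ ?_)
    · change loopLie x.1 (y.1 + z.1) + x.2.2 • loopDeriv (y.1 + z.1)
          - (y.2.2 + z.2.2) • loopDeriv x.1 =
        (loopLie x.1 y.1 + x.2.2 • loopDeriv y.1 - y.2.2 • loopDeriv x.1) +
          (loopLie x.1 z.1 + x.2.2 • loopDeriv z.1 - z.2.2 • loopDeriv x.1)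
      simp only [map_add, add_smul, smul_add]; abel
    · change D.ω x.1 (y.1 + z.1) = D.ω x.1 y.1 + D.ω x.1 z.1
      simp
    · change (0 : ℂ) = 0 + 0
      simp
  lie_self x := by
    refine Prod.ext ?_ (Prod.ext ?_ rfl)
    · change loopLie x.1 x.1 + x.2.2 • loopDeriv x.1 - x.2.2 • loopDeriv x.1 = 0
      simp [loopLie_self]
    · exact D.ω_self x.1
  leibniz_lie x y z := by
    obtain ⟨a, -, s⟩ := x
    obtain ⟨b, -, r⟩ := y
    obtain ⟨c, -, q⟩ := z
    refine Prod.ext ?_ (Prod.ext ?_ ?_)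
    · change loopLie a (loopLie b c + r • loopDeriv c - q • loopDeriv b)
          + s • loopDeriv (loopLie b c + r • loopDeriv c - q • loopDeriv b)
          - (0 : ℂ) • loopDeriv a =
        (loopLie (loopLie a b + s • loopDeriv b - r • loopDeriv a) c + (0 : ℂ) • loopDeriv c
          - q • loopDeriv (loopLie a b + s • loopDeriv b - r • loopDeriv a)) +
        (loopLie b (loopLie a c + s • loopDeriv c - q • loopDeriv a)
          + r • loopDeriv (loopLie a c + s • loopDeriv c - q • loopDeriv a)
          - (0 : ℂ) • loopDeriv b)
      simp only [map_add, map_sub, map_smul, LinearMap.add_apply, LinearMap.sub_apply,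
        LinearMap.smul_apply, loopDeriv_lie, loopLie_jacobi a b c,
        loopLie_skew b (loopDeriv a)]
      module
    · change D.ω a (loopLie b c + r • loopDeriv c - q • loopDeriv b) =
        D.ω (loopLie a b + s • loopDeriv b - r • loopDeriv a) c +
        D.ω b (loopLie a c + s • loopDeriv c - q • loopDeriv a)
      have h1 := D.ω_cocycle a b c
      have h2 := D.ω_deriv b c
      have h3 := D.ω_deriv a c
      have h4 := D.ω_deriv a b
      have h5 := D.ω_skew (loopDeriv a) b
      simp only [map_add, map_sub, map_smul, LinearMap.add_apply, LinearMap.sub_apply,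
        LinearMap.smul_apply, smul_eq_mul]
      linear_combination h1 - s * h2 + r * h3 - q * h4 + q * h5
    · change (0 : ℂ) = 0 + 0
      simp

instance : LieAlgebra ℂ D.Affine where
  lie_smul k x y := by
    refine Prod.ext ?_ (Prod.ext ?_ ?_)
    · change loopLie x.1 (k • y.1) + x.2.2 • loopDeriv (k • y.1) - (k * y.2.2) • loopDeriv x.1 =
        k • (loopLie x.1 y.1 + x.2.2 • loopDeriv y.1 - y.2.2 • loopDeriv x.1)
      simp only [map_smul]
      module
    · change D.ω x.1 (k • y.1) = k * D.ω x.1 y.1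
      simp
    · change (0 : ℂ) = k * 0
      simp

/-- The element `x tⁿ` of `𝔤̃`. -/
def loopElt (n : ℤ) (x : 𝔤) : D.Affine := (mono n x, 0, 0)

/-- The central element `c`. -/
def cElt : D.Affine := (0, 1, 0)

/-- The grading element `∂`. -/
def dElt : D.Affine := (0, 0, 1)

/-! ## The affine Dynkin diagram and its automorphisms -/

/-- The nodes of the affine Dynkin diagram: `some i` for a simple root `αᵢ` of `𝔤`, and `none` for
the affine simple root `α₀ = δ - θ`. -/
abbrev Node : Type _ := Option D.base.support

/-- The restriction to `𝔥` of the affine simple root at a node. -/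
def nodeRoot : D.Node → D.H.root
  | none => D.neg D.θ
  | some i => i.1

/-- The coefficient of `δ` in the affine simple root at a node. -/
def nodeLevel : D.Node → ℤ
  | none => 1
  | some _ => 0

/-- The generator `eᵢ` of `𝔤̃`. -/
def eGen (i : D.Node) : D.Affine := D.loopElt (D.nodeLevel i) (D.E (D.nodeRoot i))

/-- The generator `fᵢ` of `𝔤̃`. -/
def fGen (i : D.Node) : D.Affine := D.loopElt (-D.nodeLevel i) (D.E (D.neg (D.nodeRoot i)))

/-- `T` is an automorphism of the affine Dynkin diagram: it preserves the affine Cartan matrix. -/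
def IsDiagramAut (T : Equiv.Perm D.Node) : Prop :=
  ∀ i j, D.P.pairing (D.nodeRoot (T i)) (D.nodeRoot (T j)) =
    D.P.pairing (D.nodeRoot i) (D.nodeRoot j)

/-- The subspace `𝔩` of `𝔥`: the elements on which each affine simple root `αᵢ` and its image
`T αᵢ` take the same value. -/
def lSub (T : Equiv.Perm D.Node) : Submodule ℂ D.H :=
  ⨅ i, LinearMap.ker (D.P.root (D.nodeRoot (T i)) - D.P.root (D.nodeRoot i))

/-- The orthogonal complement of `𝔩` in `𝔥`. -/
def lPerp (T : Equiv.Perm D.Node) : Submodule ℂ D.H :=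
  ⨅ k : D.lSub T, LinearMap.ker
    ((D.form (k.1 : 𝔤)).comp (D.H.toSubmodule.subtype))

/-- The Cayley transform `C_T x`: the `y ∈ 𝔩^⊥` with `(α - Tα, y) = (α + Tα, x)` for all affine
simple roots `α`. -/
def cayley (T : Equiv.Perm D.Node) (x : D.H) : D.H :=
  Classical.epsilon fun y => y ∈ D.lPerp T ∧ ∀ i,
    D.rootVal (D.nodeRoot i) y - D.rootVal (D.nodeRoot (T i)) y =
      D.rootVal (D.nodeRoot i) x + D.rootVal (D.nodeRoot (T i)) x

/-- `(β + 1)/(β - 1) x`: the `y ∈ 𝔩^⊥` with `(β - 1) y = (β + 1) x`. -/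
def betaCayley (T : Equiv.Perm D.Node) (β : 𝔤 ≃ₗ⁅ℂ⁆ 𝔤) (x : D.H) : D.H :=
  Classical.epsilon fun y => y ∈ D.lPerp T ∧ β (y : 𝔤) - y = β (x : 𝔤) + x

/-- The degree in `t` at which the affine simple root vector `eᵢ` sits in `𝔤̃_γ`:
it is `1` for `i ≠ 0` and `g - |θ|` for `i = 0`. -/
def degree (g : ℕ) (i : D.Node) : ℤ := D.ht (D.nodeRoot i) + D.nodeLevel i * g

/-! ## The twisted realization, and the lift of `T` -/

/-- The isomorphism `φ⁻¹ : 𝔤̃ → 𝔤̃_γ`, where `𝔤̃_γ ⊆ 𝔤̃` is spanned by `c`, `∂` and the `a(t)` with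
`a(εt) = γ(a(t))`, `γ = Ad(e^{2πiρ/g})`, `ε = e^{2πi/g}`:
`φ⁻¹(E_α tᵐ) = E_α t^{|α| + mg}`, `φ⁻¹(x tᵐ) = x t^{mg} + δ_{m,0} (ρ, x) c` for `x ∈ 𝔥`,
`φ⁻¹(c) = g c`, `φ⁻¹(∂) = (∂ - ρ - (ρ, ρ) c) / g`. -/
def phiInv (g : ℕ) : D.Affine →ₗ[ℂ] D.Affine where
  toFun y :=
    (loopLift (fun m => ∑ α, mono (D.ht α + m * g) ∘ₗ D.proj α + mono (m * g) ∘ₗ D.proj₀) y.1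
        - (y.2.2 / g) • mono 0 (D.ρ : 𝔤),
      D.form D.ρ (y.1 0) + g * y.2.1 - y.2.2 / g * D.form D.ρ D.ρ,
      y.2.2 / g)
  map_add' y y' := by
    refine Prod.ext ?_ (Prod.ext ?_ ?_)
    · change loopLift _ (y.1 + y'.1) - ((y.2.2 + y'.2.2) / g : ℂ) • _ =
        (loopLift _ y.1 - _) + (loopLift _ y'.1 - _)
      rw [map_add]
      module
    · change D.form D.ρ (y.1 0 + y'.1 0) + g * (y.2.1 + y'.2.1)
          - (y.2.2 + y'.2.2) / g * D.form D.ρ D.ρ =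
        (D.form D.ρ (y.1 0) + g * y.2.1 - y.2.2 / g * D.form D.ρ D.ρ) +
        (D.form D.ρ (y'.1 0) + g * y'.2.1 - y'.2.2 / g * D.form D.ρ D.ρ)
      rw [map_add]
      ring
    · exact add_div y.2.2 y'.2.2 (g : ℂ)
  map_smul' k y := by
    refine Prod.ext ?_ (Prod.ext ?_ ?_)
    · change loopLift _ (k • y.1) - ((k * y.2.2) / g : ℂ) • _ =
        k • (loopLift _ y.1 - (y.2.2 / g : ℂ) • _)
      rw [map_smul]
      module
    · change D.form D.ρ (k • y.1 0) + g * (k * y.2.1) - (k * y.2.2) / g * D.form D.ρ D.ρ =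
        k * (D.form D.ρ (y.1 0) + g * y.2.1 - y.2.2 / g * D.form D.ρ D.ρ)
      rw [map_smul, smul_eq_mul]
      ring
    · exact mul_div_assoc k y.2.2 (g : ℂ)

/-- The evaluation `ev_z(x tⁿ) = zⁿ x`, `ev_z(c) = 0`. (In what follows `∂` occurs only in
`c ⊗ ∂ + ∂ ⊗ c`, so its image, here `0`, does not matter.) -/
def ev (z : ℂ) : D.Affine →ₗ[ℂ] 𝔤 where
  toFun y := loopLift (fun n => (z ^ n) • (LinearMap.id : 𝔤 →ₗ[ℂ] 𝔤)) y.1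
  map_add' y y' := map_add _ y.1 y'.1
  map_smul' k y := map_smul _ k y.1

/-- `B` is the lift of `T` to `𝔤̃`: it sends `eᵢ ↦ e_{Ti}`, `fᵢ ↦ f_{Ti}` and fixes
`φ(∂) = g ∂ + ρ`. -/
def IsLift (g : ℕ) (T : Equiv.Perm D.Node) (B : D.Affine ≃ₗ⁅ℂ⁆ D.Affine) : Prop :=
  (∀ i, B (D.eGen i) = D.eGen (T i)) ∧ (∀ i, B (D.fGen i) = D.fGen (T i)) ∧
    B ((g : ℂ) • D.dElt + D.loopElt 0 D.ρ) = (g : ℂ) • D.dElt + D.loopElt 0 D.ρ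

/-- `β` is the automorphism of `𝔤` induced by `B`: transported to `𝔤̃_γ`, the automorphism `B` acts
by `B(x tᵐ) = β(x) tᵐ` on all `x tᵐ ∈ 𝔤̃_γ`. -/
def Induces (g : ℕ) (B : D.Affine ≃ₗ⁅ℂ⁆ D.Affine) (β : 𝔤 ≃ₗ⁅ℂ⁆ 𝔤) : Prop :=
  ∀ (y : D.Affine) (m : ℤ) (x : 𝔤),
    D.phiInv g y = D.loopElt m x → D.phiInv g (B y) = D.loopElt m (β x)

/-- `x` is an orthonormal basis of `𝔥` compatible with `𝔥 = 𝔩 ⊕ 𝔩^⊥`. -/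
def IsAdapted (T : Equiv.Perm D.Node) {a b : ℕ} (x : Module.Basis (Fin a ⊕ Fin b) ℂ D.H) : Prop :=
  (∀ i j, D.form (x i : 𝔤) (x j) = if i = j then 1 else 0) ∧
    (∀ i, x (Sum.inl i) ∈ D.lSub T) ∧ (∀ i, x (Sum.inr i) ∈ D.lPerp T)

/-! ## The dynamical r-matrix of the affine algebra, and its evaluation

A point `λ ∈ 𝔩^*` is given by its coordinates `λ_j = ⟨λ, x_j⟩` in the orthonormal basis
`x_1, …, x_a` of `𝔩`; under the identification of `𝔩^*` with `𝔩` it is `∑ λ_j x_j`. -/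

section rmatrix

variable (g : ℕ) (T : Equiv.Perm D.Node) (B : D.Affine ≃ₗ⁅ℂ⁆ D.Affine) {a b : ℕ}
  (x : Module.Basis (Fin a ⊕ Fin b) ℂ D.H) (τ : ℂ) (lam : Fin a → ℂ)

/-- The element of `𝔩` corresponding to `λ ∈ 𝔩^*`. -/
def lamH : D.H := ∑ j, lam j • x (Sum.inl j)

/-- `(α, λ̃)` for `α ∈ 𝔥^*` a root and `λ̃ = λ - 2πi τ ∂ / g`, where the root vector `E_α t^{|α|}` of
`𝔤̃_γ` has `∂`-degree `|α|`. -/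
def val (α : D.H.root) : ℂ :=
  D.rootVal α (D.lamH x lam) - 2 * Real.pi * Complex.I * τ * D.ht α / g

/-- `(α + mδ, λ̃)`, where `φ⁻¹(E_α tᵐ) = E_α t^{|α| + mg}` has `∂`-degree `|α| + mg`. -/
def affVal (α : D.H.root) (m : ℤ) : ℂ := D.val g x τ lam α - 2 * Real.pi * Complex.I * τ * m

/-- The positive real roots `α + mδ` of `𝔤̃`. -/
def PosReal : Type _ := {p : D.H.root × ℤ // 0 < p.2 ∨ (p.2 = 0 ∧ 0 < D.ht p.1)}

/-- The positive roots of `𝔤̃`, with multiplicity: the real ones, and the `mδ`, `m > 0`, each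
repeated `dim 𝔥` times. -/
def PosRoot (a b : ℕ) : Type _ := D.PosReal ⊕ ({m : ℤ // 0 < m} × (Fin a ⊕ Fin b))

/-- The basis of the positive root spaces of `𝔤̃`: the `E_α tᵐ` and the `x_i tᵐ`. -/
def posE : D.PosRoot a b → D.Affine
  | Sum.inl p => D.loopElt p.1.2 (D.E p.1.1)
  | Sum.inr p => D.loopElt p.1.1 (x p.2)

/-- The dual basis of the negative root spaces: the `E_{-α} t⁻ᵐ` and the `x_i t⁻ᵐ`. -/
def posF : D.PosRoot a b → D.Affine
  | Sum.inl p => D.loopElt (-p.1.2) (D.E (D.neg p.1.1))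
  | Sum.inr p => D.loopElt (-p.1.1) (x p.2)

/-- The value `(α, λ̃)` for a positive root `α` of `𝔤̃`. -/
def posVal : D.PosRoot a b → ℂ
  | Sum.inl p => D.affVal g x τ lam p.1.1 p.1.2
  | Sum.inr p => -(2 * Real.pi * Complex.I * τ * p.1.1)

/-- The term of `r_T(λ̃)` at a positive root `α` (with multiplicity index) of `𝔤̃`:
`- f_α ⊗ e_α + ∑_{l=1}^N e^{-l(α,λ̃)} / (1 - e^{-N(α,λ̃)}) e_α ∧ B^l f_α`,
with `N` the order of `T` and `u ∧ v = u ⊗ v - v ⊗ u`. -/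
def rTerm (p : D.PosRoot a b) : D.Affine ⊗[ℂ] D.Affine :=
  -(D.posF x p ⊗ₜ[ℂ] D.posE x p) +
    ∑ l ∈ Finset.Icc 1 (orderOf T),
      (Complex.exp (-l * D.posVal g x τ lam p) /
          (1 - Complex.exp (-(orderOf T) * D.posVal g x τ lam p))) •
        (D.posE x p ⊗ₜ[ℂ] B^[l] (D.posF x p) - B^[l] (D.posF x p) ⊗ₜ[ℂ] D.posE x p)

/-- `φ(h) = h - (ρ, h) c / g` for `h ∈ 𝔥`. -/
def phiH (h : D.H) : D.Affine := D.loopElt 0 h - (D.form D.ρ h / g) • D.cElt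

/-- The Cartan part `-½ ∑ x_j ⊗ x_j + ½ ∑ C_T x_i ⊗ x_i` of `r_T`. The first sum is over an
orthonormal basis of `𝔥̃ = 𝔥 ⊕ ℂc ⊕ ℂ∂`, where `(c, ∂) = 1`; the second one is over the orthonormal
basis `φ(x_i)` of the orthogonal complement of `𝔩̃` in `𝔥̃`. -/
def rCartan : D.Affine ⊗[ℂ] D.Affine :=
  -(1 / 2 : ℂ) • (∑ i, D.loopElt 0 (x i) ⊗ₜ[ℂ] D.loopElt 0 (x i) +
      D.cElt ⊗ₜ[ℂ] D.dElt + D.dElt ⊗ₜ[ℂ] D.cElt) +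
    (1 / 2 : ℂ) • ∑ i : Fin b,
      D.phiH g (D.cayley T (x (Sum.inr i))) ⊗ₜ[ℂ] D.phiH g (x (Sum.inr i))

/-- The map `(ev_z ⊗ ev_1)(φ⁻¹ ⊗ φ⁻¹)`. -/
def evTensor (z : ℂ) : D.Affine ⊗[ℂ] D.Affine →ₗ[ℂ] 𝔤 ⊗[ℂ] 𝔤 :=
  TensorProduct.map (D.ev z ∘ₗ D.phiInv g) (D.ev 1 ∘ₗ D.phiInv g)

/-- `λ` is not a pole of a coefficient of `r_T(λ̃)`. -/
def IsGeneric : Prop :=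
  ∀ p : D.PosReal, Complex.exp (-(orderOf T) * D.affVal g x τ lam p.1.1 p.1.2) ≠ 1

/-- The series `r̄_T(λ, z) = (ev_z ⊗ ev_1)(φ⁻¹ ⊗ φ⁻¹)(r_T(λ̃))` converges to `R`. -/
def SeriesConvergesTo (z : ℂ) (R : 𝔤 ⊗[ℂ] 𝔤) : Prop :=
  ∀ ψ : Module.Dual ℂ (𝔤 ⊗[ℂ] 𝔤),
    HasSum (fun p : D.PosRoot a b => ψ (D.evTensor g z (D.rTerm g T B x τ lam p)))
      (ψ (R - D.evTensor g z (D.rCartan g T x)))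

end rmatrix

end ChevalleyData

/-! ## Theta functions -/

/-- The Jacobi theta function `θ(u, τ)`. -/
def thetaFn (u τ : ℂ) : ℂ :=
  -∑' j : ℤ, Complex.exp (Real.pi * Complex.I * (j + 1 / 2) ^ 2 * τ +
    2 * Real.pi * Complex.I * (j + 1 / 2) * (u + 1 / 2))

/-- The derivative of `θ(u, τ)` in `u`. -/
def thetaFn' (u τ : ℂ) : ℂ := deriv (fun v => thetaFn v τ) u

/-- `σ_w(u | τ) = θ(w - u) θ'(0) / (θ(w) θ(u))`. -/
def sigmaFn (w u τ : ℂ) : ℂ :=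
  thetaFn (w - u) τ * thetaFn' 0 τ / (thetaFn w τ * thetaFn u τ)

/-- `χ(u | τ) = θ'(u) / θ(u)`. -/
def chiFn (u τ : ℂ) : ℂ := thetaFn' u τ / thetaFn u τ

/-! ## Meromorphic functions of several variables -/

/-- `f` is meromorphic on `U`: near every point of `U` it is a quotient of analytic functions, with
a denominator that does not vanish identically (the values of `f` on the zero set of the denominator
are disregarded). -/
def IsMeromorphicOn {V : Type*} [NormedAddCommGroup V] [NormedSpace ℂ V] (f : V → ℂ)
    (U : Set V) : Prop :=
  ∀ p ∈ U, ∃ n d : V → ℂ, AnalyticAt ℂ n p ∧ AnalyticAt ℂ d p ∧ (∃ᶠ q in 𝓝 p, d q ≠ 0) ∧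
    ∀ᶠ q in 𝓝 p, d q ≠ 0 → f q = n q / d q

/-! ## The classical dynamical Yang-Baxter equation -/

namespace CDYBE

variable {𝔤 : Type*} [LieRing 𝔤] [LieAlgebra ℂ 𝔤]

/-- The bracket as a map `𝔤 ⊗ 𝔤 → 𝔤`. -/
def brk : 𝔤 ⊗[ℂ] 𝔤 →ₗ[ℂ] 𝔤 := (toModuleHom ℂ 𝔤 𝔤 : 𝔤 ⊗[ℂ] 𝔤 →ₗ⁅ℂ, 𝔤⁆ 𝔤)

/-- `[r¹², s¹³]`: `(a ⊗ b, c ⊗ d) ↦ [a, c] ⊗ b ⊗ d`. -/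
def br1213 (r s : 𝔤 ⊗[ℂ] 𝔤) : 𝔤 ⊗[ℂ] (𝔤 ⊗[ℂ] 𝔤) :=
  TensorProduct.map brk LinearMap.id
    (TensorProduct.tensorTensorTensorComm ℂ 𝔤 𝔤 𝔤 𝔤 (r ⊗ₜ[ℂ] s))

/-- `[r¹³, s²³]`: `(a ⊗ b, c ⊗ d) ↦ a ⊗ c ⊗ [b, d]`. -/
def br1323 (r s : 𝔤 ⊗[ℂ] 𝔤) : 𝔤 ⊗[ℂ] (𝔤 ⊗[ℂ] 𝔤) :=
  TensorProduct.assoc ℂ 𝔤 𝔤 𝔤 (TensorProduct.map LinearMap.id brk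
    (TensorProduct.tensorTensorTensorComm ℂ 𝔤 𝔤 𝔤 𝔤 (r ⊗ₜ[ℂ] s)))

/-- `[r¹², s²³]`: `(a ⊗ b, c ⊗ d) ↦ a ⊗ [b, c] ⊗ d`. -/
def br1223 (r s : 𝔤 ⊗[ℂ] 𝔤) : 𝔤 ⊗[ℂ] (𝔤 ⊗[ℂ] 𝔤) :=
  TensorProduct.map LinearMap.id
    (TensorProduct.map brk LinearMap.id ∘ₗ (TensorProduct.assoc ℂ 𝔤 𝔤 𝔤).symm.toLinearMap)
    (TensorProduct.assoc ℂ 𝔤 𝔤 (𝔤 ⊗[ℂ] 𝔤) (r ⊗ₜ[ℂ] s))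

/-- `x⁽¹⁾ r²³`. -/
def ins1 (x : 𝔤) (r : 𝔤 ⊗[ℂ] 𝔤) : 𝔤 ⊗[ℂ] (𝔤 ⊗[ℂ] 𝔤) := x ⊗ₜ[ℂ] r

/-- `x⁽²⁾ r¹³`. -/
def ins2 (x : 𝔤) (r : 𝔤 ⊗[ℂ] 𝔤) : 𝔤 ⊗[ℂ] (𝔤 ⊗[ℂ] 𝔤) :=
  TensorProduct.leftComm ℂ 𝔤 𝔤 𝔤 (x ⊗ₜ[ℂ] r)

/-- `x⁽³⁾ r¹²`. -/
def ins3 (x : 𝔤) (r : 𝔤 ⊗[ℂ] 𝔤) : 𝔤 ⊗[ℂ] (𝔤 ⊗[ℂ] 𝔤) :=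
  TensorProduct.assoc ℂ 𝔤 𝔤 𝔤 (r ⊗ₜ[ℂ] x)

/-- The dynamical Yang-Baxter equation with spectral parameter at `(λ, z₁, z₂, z₃)`, for a function
`R` of `λ` (in coordinates with respect to `x_1, …, x_a`) and `z`:
`∑_j (x_j⁽¹⁾ ∂_j R²³(λ, z₂/z₃) - x_j⁽²⁾ ∂_j R¹³(λ, z₁/z₃) + x_j⁽³⁾ ∂_j R¹²(λ, z₁/z₂))`
`+ [R¹²(λ, z₁/z₂), R¹³(λ, z₁/z₃)] + [R¹³(λ, z₁/z₃), R²³(λ, z₂/z₃)]`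
`+ [R¹²(λ, z₁/z₂), R²³(λ, z₂/z₃)] = 0`.
Differentiability of `R` in `λ` at the three points is part of the assertion. -/
def HoldsAt {a : ℕ} (x : Fin a → 𝔤) (R : (Fin a → ℂ) → ℂ → 𝔤 ⊗[ℂ] 𝔤) (lam : Fin a → ℂ)
    (z₁ z₂ z₃ : ℂ) : Prop :=
  ∃ R' : Fin a → ℂ → 𝔤 ⊗[ℂ] 𝔤,
    (∀ j, ∀ z ∈ ({z₁ / z₂, z₁ / z₃, z₂ / z₃} : Set ℂ), ∀ ψ : Module.Dual ℂ (𝔤 ⊗[ℂ] 𝔤),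
      HasDerivAt (fun s : ℂ => ψ (R (Function.update lam j s) z)) (ψ (R' j z)) (lam j)) ∧
    ∑ j, (ins1 (x j) (R' j (z₂ / z₃)) - ins2 (x j) (R' j (z₁ / z₃)) +
        ins3 (x j) (R' j (z₁ / z₂))) +
      br1213 (R lam (z₁ / z₂)) (R lam (z₁ / z₃)) +
      br1323 (R lam (z₁ / z₃)) (R lam (z₂ / z₃)) +
      br1223 (R lam (z₁ / z₂)) (R lam (z₂ / z₃)) = 0

end CDYBE

/-! ## The elliptic r-matrices -/

namespace ChevalleyData

variable {𝔤 : Type*} [LieRing 𝔤] [LieAlgebra ℂ 𝔤] [FiniteDimensional ℂ 𝔤]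
  [LieAlgebra.IsSimple ℂ 𝔤] (D : ChevalleyData 𝔤)

/-- The explicit elliptic expression. The first sum is over all roots `α` of `𝔤`: the term of a
positive `α` involves `e_α ⊗ β^l f_α`, the term of `-α` involves `f_α ⊗ β^l e_α`. -/
def ellipticR (g : ℕ) (T : Equiv.Perm D.Node) (β : 𝔤 ≃ₗ⁅ℂ⁆ 𝔤) {a b : ℕ}
    (x : Module.Basis (Fin a ⊕ Fin b) ℂ D.H) (τ : ℂ) (lam : Fin a → ℂ) (u : ℂ) : 𝔤 ⊗[ℂ] 𝔤 :=
  -(∑ α : D.H.root, ∑ l ∈ Finset.range (orderOf T),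
      (1 / (2 * Real.pi * Complex.I) *
        Complex.exp (-l * D.val g x τ lam α + 2 * Real.pi * Complex.I * D.ht α * u / g) *
        sigmaFn (orderOf T / (2 * Real.pi * Complex.I) * D.val g x τ lam α) (u + l * τ)
          (orderOf T * τ)) •
        (D.E α ⊗ₜ[ℂ] β^[l] (D.E (D.neg α)))) -
    ∑ i, ∑ l ∈ Finset.range (orderOf T),
      ((if l = 0 then 0 else 1 / 2) +
        1 / (2 * Real.pi * Complex.I) * chiFn (u + l * τ) (orderOf T * τ)) •
        ((x i : 𝔤) ⊗ₜ[ℂ] β^[l] (x i : 𝔤)) +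
    (1 / 2 : ℂ) • ∑ i : Fin b,
      (D.betaCayley T β (x (Sum.inr i)) : 𝔤) ⊗ₜ[ℂ] (x (Sum.inr i) : 𝔤)

/-- Felder's elliptic dynamical r-matrix
`χ(u | τ) ∑ x_i ⊗ x_i + ∑_α σ_{α(μ)}(u | τ) E_α ⊗ E_{-α}`, `μ ∈ 𝔥`. -/
def felderR {ι : Type*} [Fintype ι] (x : ι → D.H) (τ : ℂ) (μ : D.H) (u : ℂ) : 𝔤 ⊗[ℂ] 𝔤 :=
  chiFn u τ • ∑ i, (x i : 𝔤) ⊗ₜ[ℂ] (x i : 𝔤) +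
    ∑ α : D.H.root, sigmaFn (D.rootVal α μ) u τ • (D.E α ⊗ₜ[ℂ] D.E (D.neg α))

end ChevalleyData

/-- The inclusion of `sl(n)` into the matrices. -/
def slIncl (n : ℕ) : SpecialLinear.sl (Fin n) ℂ →ₗ[ℂ] Matrix (Fin n) (Fin n) ℂ where
  toFun A := A.1
  map_add' _ _ := rfl
  map_smul' _ _ := rfl

/-- The matrix `J_{p,c} = ∑_i ω^{ci} E_{i,i+p}`, `ω = e^{2πi/n}`, indices modulo `n`; these are the
products of powers of the clock and shift matrices. -/
def heisJ (n : ℕ) [NeZero n] (p c : Fin n) : Matrix (Fin n) (Fin n) ℂ :=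
  ∑ i : Fin n, Complex.exp (2 * Real.pi * Complex.I * (c * i : ℕ) / n) •
    Matrix.single i (i + p) 1

/-- The basis `J_{p,c}⁻¹ / n = (1/n) ∑_i ω^{-ci} E_{i+p,i}`, dual to `J_{p,c}` under the trace form. -/
def heisJdual (n : ℕ) [NeZero n] (p c : Fin n) : Matrix (Fin n) (Fin n) ℂ :=
  (1 / n : ℂ) • ∑ i : Fin n, Complex.exp (-(2 * Real.pi * Complex.I * (c * i : ℕ) / n)) •
    Matrix.single (i + p) i 1

/-- Belavin's elliptic r-matrix for `sl(n)`, with modulus `τ` and primitive root of unity given by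
`k`: the function with simple poles at `ℤ + τℤ`, residue at `0` the Casimir element
`∑ J_{p,c} ⊗ J_{p,c}⁻¹ / n`, and multipliers `ω^p`, `ω^{-kc}` on `J_{p,c}` under
`u ↦ u + 1`, `u ↦ u + τ`. -/
def belavinR (n : ℕ) [NeZero n] (k : ℕ) (τ u : ℂ) :
    Matrix (Fin n) (Fin n) ℂ ⊗[ℂ] Matrix (Fin n) (Fin n) ℂ :=
  ∑ p : Fin n, ∑ c : Fin n, if p = 0 ∧ c = 0 then 0 else
    (Complex.exp (2 * Real.pi * Complex.I * (p : ℕ) * u / n) *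
      sigmaFn (-(((c : ℕ) * k + (p : ℕ) * τ) / n)) u τ) •
      (heisJ n p c ⊗ₜ[ℂ] heisJdual n p c)

end

/-! The invariant form turns a tensor in `𝔤 ⊗ 𝔤` into an operator on `𝔤`, by contraction of the
second leg. The actions of `ad 𝔩`, of `γ = Ad(e^{2πiρ/g})` and of `β` commute and are
diagonalizable, so `𝔤` is spanned by joint eigenvectors (`IsHom`, `hom_induction`). Such a vector
has a type `(μ, j, k)`: the weight under `𝔩`, the eigenvalue `e(j/g)` of `γ` and the eigenvalue
`e(k/N)` of `β`, where `e(u) = exp(2πiu)`; only `j` modulo `g` and `k` modulo `N` matter.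

The whole theorem rests on one fact, `IsHom.pr_ellipticR`: the explicit elliptic formula acts on
vectors of type `(μ, j, k)` by the scalar `-(1/2πi) e(ju/g) σ_ω(u|τ)` with `ω = (μ,λ)/2πi - τj/g +
k/N`, and by `-(1/2πi) χ(u|τ)` on the trivial type, whose vectors all lie in `𝔩`. The sums over `l`
with modulus `Nτ` collapse to modulus `τ` by summation over the isogeny (`sum_sigmaFn`, `sum_chiFn`,
`sum_chiFn_twisted`), and the Cayley term supplies exactly the constant left over on the part of `𝔥`
where `β ≠ 1`. That the trivial type contains no root vectors comes from `not_dvd_ht`: a root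
vanishing on `𝔩` has height not divisible by `g`.

Yang-Baxter: paired with three homogeneous vectors, the equation becomes a scalar identity
(`IsHom.yangBaxter`). If none of the three types is trivial it is the three-term theta identity; if
exactly one is, it is the derivative of that identity at its degenerate point, where the derivative
in `λ` enters; if two or more are, every term vanishes. The three-term identity holds because the
difference of its two sides is a theta function of degree two with one zero too many.

Convergence: on homogeneous vectors `β` acts by a scalar, so the inner sum over `l` in the series is
geometric and the contributions of the roots `α + mδ` become terms `e(mu) q/(1-q)` of the Laurent
expansions of `σ` and `χ` in `-Im τ < Im u < 0`. A matrix coefficient involves the `β`-eigenvalues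
of both vectors: one enters at positive roots, the other at negative ones. When the two eigenvalues
are inverse to each other the halves fit together into one expansion. Otherwise the coefficient must
vanish, and it does because the sum over a `δ`-string is the same for all roots that contribute
(`IsHom.tsum_rootTerm_eq`).

The analysis is elementary. A holomorphic function on a strip with the multipliers of a degree-one
theta function is determined by one Fourier coefficient, hence is a multiple of a translate of `θ`.
Applied to `θ` times a Kronecker series, this gives the expansions of `σ` and `χ`, and also that `θ`
has exactly the lattice points as zeros, all simple.

The remaining parts are consequences. The formula is a combination of theta quotients and
exponentials, hence meromorphic. For `T = 1` one has `𝔩 = 𝔥` and `N = 1`, and the formula is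
Felder's. For `sl(n)` with a rotation one has `𝔩 = 0` and `g = N = n`; `γ` and `β` become
conjugation by the clock matrix and by a power of the shift matrix, their joint eigenvectors are the
`J_{p,c}`, of type `(0, p, -ck)`, and the scalars are Belavin's coefficients. -/

noncomputable section

/-! ## Theta functions: elementary properties -/

section Theta

open Complex

/-- `e(u) = exp(2πiu)`. -/
def ee (u : ℂ) : ℂ := exp (2 * Real.pi * I * u)

lemma ee_add (u v : ℂ) : ee (u + v) = ee u * ee v := by
  simp only [ee]; rw [← exp_add]; ring_nf

lemma ee_neg (u : ℂ) : ee (-u) = (ee u)⁻¹ := by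
  simp only [ee]; rw [← exp_neg]; ring_nf

lemma ee_sub (u v : ℂ) : ee (u - v) = ee u / ee v := by
  rw [sub_eq_add_neg, ee_add, ee_neg, div_eq_mul_inv]

lemma ee_ne_zero (u : ℂ) : ee u ≠ 0 := exp_ne_zero _

@[simp] lemma ee_zero : ee 0 = 1 := by simp [ee]

@[simp] lemma ee_int (n : ℤ) : ee n = 1 := by
  rw [ee, mul_comm]; exact exp_int_mul_two_pi_mul_I n

@[simp] lemma ee_one : ee 1 = 1 := by simpa using ee_int 1

lemma ee_int_mul (n : ℤ) (u : ℂ) : ee (n * u) = ee u ^ n := by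
  simp only [ee]; rw [← exp_int_mul]; ring_nf

lemma ee_nat_mul (n : ℕ) (u : ℂ) : ee (n * u) = ee u ^ n := by
  simpa using ee_int_mul n u

lemma norm_ee (u : ℂ) : ‖ee u‖ = Real.exp (-(2 * Real.pi * u.im)) := by
  rw [ee, norm_exp]; congr 1
  simp [mul_re, mul_im]

lemma ee_eq_one_iff (u : ℂ) : ee u = 1 ↔ ∃ n : ℤ, u = n := by
  rw [ee, exp_eq_one_iff]
  have h : (2 * Real.pi * I : ℂ) ≠ 0 := two_pi_I_ne_zero
  refine exists_congr fun n => ?_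
  rw [mul_comm (n : ℂ), mul_right_inj' h]

lemma hasDerivAt_ee (u : ℂ) : HasDerivAt ee (2 * Real.pi * I * ee u) u := by
  have := ((hasDerivAt_id u).const_mul (2 * Real.pi * I)).cexp
  simp only [id, mul_one] at this
  rw [mul_comm (exp _)] at this
  exact this

lemma differentiable_ee : Differentiable ℂ ee := fun u => (hasDerivAt_ee u).differentiableAt

@[fun_prop] lemma continuous_ee : Continuous ee := differentiable_ee.continuous

/-- Completing the square, `(j + 1/2)² = j² + j + 1/4`, gives access to the analytic results on
`jacobiTheta₂`. -/
lemma thetaFn_eq (u τ : ℂ) :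
    thetaFn u τ = -(exp (Real.pi * I * τ / 4 + Real.pi * I * (u + 1 / 2)) *
      jacobiTheta₂ (u + 1 / 2 + τ / 2) τ) := by
  rw [thetaFn, jacobiTheta₂, ← tsum_mul_left]
  congr 1
  refine tsum_congr fun j => ?_
  rw [jacobiTheta₂_term, ← exp_add]
  congr 1; ring

lemma differentiable_thetaFn {τ : ℂ} (hτ : 0 < τ.im) : Differentiable ℂ fun u => thetaFn u τ := by
  intro u
  simp only [thetaFn_eq]
  have h := (differentiableAt_jacobiTheta₂_fst (u + 1 / 2 + τ / 2) hτ).comp (f := fun u : ℂ => u + 1 / 2 + τ / 2) u (by fun_prop)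
  exact ((by fun_prop : DifferentiableAt ℂ (fun u : ℂ => exp (Real.pi * I * τ / 4 + Real.pi * I * (u + 1 / 2))) u).mul h).neg

lemma hasDerivAt_thetaFn {τ : ℂ} (hτ : 0 < τ.im) (u : ℂ) :
    HasDerivAt (fun v => thetaFn v τ) (thetaFn' u τ) u :=
  (differentiable_thetaFn hτ u).hasDerivAt

lemma thetaFn_add_one (u τ : ℂ) : thetaFn (u + 1) τ = -thetaFn u τ := by
  simp only [thetaFn_eq]
  rw [show u + 1 + 1 / 2 + τ / 2 = u + 1 / 2 + τ / 2 + 1 by ring, jacobiTheta₂_add_left,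
    show Real.pi * I * τ / 4 + Real.pi * I * (u + 1 + 1 / 2) =
      (Real.pi * I * τ / 4 + Real.pi * I * (u + 1 / 2)) + Real.pi * I by ring, exp_add, exp_pi_mul_I]
  ring

lemma thetaFn_add_tau (u τ : ℂ) :
    thetaFn (u + τ) τ = -(exp (-(Real.pi * I * τ)) * ee (-u)) * thetaFn u τ := by
  simp only [thetaFn_eq]
  rw [show u + τ + 1 / 2 + τ / 2 = u + 1 / 2 + τ / 2 + τ by ring, jacobiTheta₂_add_left', ee]
  have : exp (Real.pi * I * τ / 4 + Real.pi * I * (u + τ + 1 / 2)) *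
      exp (-Real.pi * I * (τ + 2 * (u + 1 / 2 + τ / 2))) =
      -(exp (-(Real.pi * I * τ)) * exp (2 * Real.pi * I * -u)) *
      exp (Real.pi * I * τ / 4 + Real.pi * I * (u + 1 / 2)) := by
    rw [← exp_add, neg_mul (_ * exp _), ← exp_add, ← exp_add, ← neg_one_mul (exp _), ← exp_neg_pi_mul_I,
      ← exp_add]
    congr 1; ring
  linear_combination (-jacobiTheta₂ (u + 1 / 2 + τ / 2) τ) * this

/-- The substitution `j ↦ -1 - j` turns the series at `-u` into the one at `u + 1`, the exponents
differing by multiples of `2πi`. -/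
lemma thetaFn_neg (u τ : ℂ) : thetaFn (-u) τ = -thetaFn u τ := by
  have h : thetaFn (-u) τ = thetaFn (u + 1) τ := by
    rw [thetaFn, thetaFn]
    congr 1
    rw [← (Equiv.subLeft (-1 : ℤ)).tsum_eq]
    refine tsum_congr fun j => ?_
    simp only [Equiv.subLeft_apply]
    rw [← sub_eq_zero, sub_eq_zero, exp_eq_exp_iff_exists_int]
    refine ⟨-2 * j - 1, ?_⟩
    push_cast; ring
  rw [h, thetaFn_add_one]

lemma thetaFn_zero (τ : ℂ) : thetaFn 0 τ = 0 := by
  have := thetaFn_neg 0 τ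
  rw [neg_zero] at this
  linear_combination this / 2

lemma thetaFn'_neg {τ : ℂ} (hτ : 0 < τ.im) (u : ℂ) : thetaFn' (-u) τ = thetaFn' u τ := by
  have h1 := (hasDerivAt_thetaFn hτ (-u)).scomp u (hasDerivAt_neg u)
  have h2 := (hasDerivAt_thetaFn hτ u).neg
  have : (fun v => thetaFn v τ) ∘ Neg.neg = -fun v => thetaFn v τ := by
    ext v; simp [thetaFn_neg]
  rw [this] at h1
  have := h1.unique h2
  simpa using this

lemma thetaFn'_add_one {τ : ℂ} (hτ : 0 < τ.im) (u : ℂ) : thetaFn' (u + 1) τ = -thetaFn' u τ := by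
  have h1 := (hasDerivAt_thetaFn hτ (u + 1)).comp_add_const u 1
  have h2 := (hasDerivAt_thetaFn hτ u).neg
  have : (fun v => thetaFn (v + 1) τ) = -fun v => thetaFn v τ := by
    ext v; simp [thetaFn_add_one]
  rw [this] at h1
  exact h1.unique h2

lemma thetaFn'_add_tau {τ : ℂ} (hτ : 0 < τ.im) (u : ℂ) :
    thetaFn' (u + τ) τ = -(exp (-(Real.pi * I * τ)) * ee (-u)) *
      (thetaFn' u τ - 2 * Real.pi * I * thetaFn u τ) := by
  have h1 := (hasDerivAt_thetaFn hτ (u + τ)).comp_add_const u τ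
  have h3 := (hasDerivAt_ee (-u)).scomp u (hasDerivAt_neg u)
  have h2 := ((h3.const_mul (exp (-(Real.pi * I * τ)))).neg).mul (hasDerivAt_thetaFn hτ u)
  have : (fun v => thetaFn (v + τ) τ) = fun v => -(exp (-(Real.pi * I * τ)) * ee (-v)) * thetaFn v τ := by
    ext v; rw [thetaFn_add_tau]
  rw [this] at h1
  have := h1.unique h2
  rw [this]
  simp [Function.comp]
  ring

/-! ## Fourier coefficients on a strip -/

/-- The strip `|Im u| < t`. -/
def strip (t : ℝ) : Set ℂ := {u | |u.im| < t}

lemma isOpen_strip (t : ℝ) : IsOpen (strip t) :=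
  isOpen_lt (continuous_abs.comp continuous_im) continuous_const

/-- The `n`-th Fourier coefficient of a `1`-periodic function, computed at height `y`. -/
def fourierAt (f : ℂ → ℂ) (n : ℤ) (y : ℝ) : ℂ :=
  ∫ x in (0 : ℝ)..1, f (x + y * I) * ee (-n * (x + y * I))

/-- Cauchy's theorem on the rectangle between the two heights; the vertical sides cancel by
periodicity. -/
lemma fourierAt_eq {t : ℝ} {f : ℂ → ℂ} (hf : DifferentiableOn ℂ f (strip t))
    (hp : ∀ u ∈ strip t, f (u + 1) = f u) (n : ℤ) {y₁ y₂ : ℝ} (h₁ : |y₁| < t) (h₂ : |y₂| < t) :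
    fourierAt f n y₁ = fourierAt f n y₂ := by
  have hd : DifferentiableOn ℂ (fun u => f u * ee (-n * u)) (strip t) :=
    hf.mul ((differentiable_ee.comp (by fun_prop : Differentiable ℂ fun u : ℂ => -n * u)).differentiableOn)
  have hsub : (Set.uIcc (0 : ℝ) 1 ×ℂ Set.uIcc y₁ y₂) ⊆ strip t := by
    intro u hu
    have h := hu.2
    rw [Set.mem_preimage, Set.mem_uIcc] at h
    rw [strip, Set.mem_ofPred_eq]
    rw [abs_lt] at *
    rcases h with h | h <;> constructor <;> linarith [h.1, h.2]
  have key := integral_boundary_rect_eq_zero_of_differentiableOn (fun u => f u * ee (-n * u))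
    (y₁ * I) (1 + y₂ * I) (hd.mono (by simpa using hsub))
  simp only [mul_re, ofReal_re, I_re, mul_zero, ofReal_im, I_im, mul_one, sub_self, add_re, one_re,
    add_zero, mul_im, zero_add, add_im, one_im, ofReal_one, ofReal_zero] at key
  have hv : (∫ y in y₁..y₂, f (1 + y * I) * ee (-n * (1 + y * I))) =
      ∫ y in y₁..y₂, f (y * I) * ee (-n * (y * I)) := by
    refine intervalIntegral.integral_congr fun y hy => ?_
    have hy' : ((y : ℂ) * I) ∈ strip t := hsub (by
      rw [mem_reProdIm]; simpa using hy)
    rw [add_comm (1 : ℂ), hp _ hy', mul_add, ee_add,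
      show (-n * 1 : ℂ) = ((-n : ℤ) : ℂ) by push_cast; ring, ee_int, mul_one]
  rw [hv] at key
  simp only [fourierAt]
  linear_combination key

/-- The real part of `τ` only rotates the circle of integration, so translating by `τ` amounts to
raising the height by `Im τ`. -/
lemma fourierAt_add_tau {f : ℂ → ℂ} {τ : ℂ} {y : ℝ} (n : ℤ)
    (hp : ∀ x : ℝ, f (x + 1 + (y + τ.im) * I) = f (x + (y + τ.im) * I)) :
    (∫ x in (0 : ℝ)..1, f (x + y * I + τ) * ee (-n * (x + y * I + τ))) =
      fourierAt f n (y + τ.im) := by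
  set F : ℝ → ℂ := fun x => f (x + (y + τ.im) * I) * ee (-n * (x + (y + τ.im) * I)) with hF
  have hper : Function.Periodic F 1 := by
    intro x
    simp only [hF]
    push_cast
    rw [hp, show (-n * (x + 1 + (y + τ.im) * I) : ℂ) =
      -n * (x + (y + τ.im) * I) + ((-n : ℤ) : ℂ) by push_cast; ring, ee_add, ee_int, mul_one]
  have h := hper.intervalIntegral_add_eq τ.re 0
  rw [zero_add] at h
  have h2 := intervalIntegral.integral_comp_add_right (a := 0) (b := 1) F τ.re
  rw [zero_add, add_comm 1] at h2
  rw [fourierAt]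
  simp only [ofReal_add]
  rw [← h, ← h2]
  refine intervalIntegral.integral_congr fun x _ => ?_
  simp only [hF]
  have : (x + y * I + τ : ℂ) = ((x + τ.re : ℝ) : ℂ) + (y + τ.im) * I := by
    conv_lhs => rw [← re_add_im τ]
    push_cast; ring
  rw [this]

/-- A continuous function on the circle with summable Fourier coefficients is the sum of its Fourier
series. -/
lemma eq_zero_of_fourierAt {f : ℂ → ℂ} {y : ℝ} (hc : Continuous fun x : ℝ => f (x + y * I))
    (hp : ∀ x : ℝ, f (x + 1 + y * I) = f (x + y * I)) (h0 : ∀ n, fourierAt f n y = 0) (x : ℝ) :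
    f (x + y * I) = 0 := by
  set F : ℝ → ℂ := fun x => f (x + y * I) with hF
  have hper : Function.Periodic F 1 := fun x => by simpa [hF] using hp x
  have : Fact ((0 : ℝ) < 1) := ⟨one_pos⟩
  set G : C(AddCircle (1 : ℝ), ℂ) := ⟨hper.lift, by
    refine continuous_coinduced_dom.mpr ?_
    exact hc⟩ with hG
  have hco : ∀ n, fourierCoeff G n = 0 := by
    intro n
    rw [fourierCoeff_eq_intervalIntegral _ _ 0]
    have : ∀ x : ℝ, fourier (-n) (x : AddCircle (1 : ℝ)) • G x =
        ee (n * (y * I)) * (f (x + y * I) * ee (-n * (x + y * I))) := by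
      intro x
      rw [fourier_coe_apply, smul_eq_mul]
      have e1 : G (x : AddCircle (1 : ℝ)) = f (x + y * I) := by
        simp [hG, Function.Periodic.lift_coe, hF]
      have e2 : exp (2 * Real.pi * I * (-n : ℤ) * x / (1 : ℝ)) = ee (-n * x) := by
        rw [ee]; congr 1; push_cast; ring
      have e3 := ee_ne_zero (n * (y * I))
      rw [e1, e2, show (-n * (x + y * I) : ℂ) = (-n * x) + -(n * (y * I)) by ring, ee_add, ee_neg,
        mul_left_comm, mul_left_comm (ee (n * (y * I))),
        mul_inv_cancel₀ e3, mul_one, mul_comm]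
    simp only [this]
    rw [intervalIntegral.integral_const_mul, zero_add]
    have := h0 n
    rw [fourierAt] at this
    rw [this]; simp
  have hs := hasSum_fourier_series_of_summable (f := G) (by
    have : fourierCoeff (⇑G) = 0 := funext hco
    rw [this]; exact summable_zero)
  simp only [hco, zero_smul] at hs
  have hG0 : G = 0 := hs.unique hasSum_zero
  have := congrArg (fun g : C(AddCircle (1 : ℝ), ℂ) => g (x : AddCircle (1 : ℝ))) hG0
  simpa [hG, Function.Periodic.lift_coe, hF] using this

/-- A holomorphic function on the strip `|Im u| < Im τ` with `f(u + 1) = f(u)`,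
`f(u + τ) = κ e(-u) f(u)` is determined by one Fourier coefficient. -/
lemma eqOn_zero_of_fourierAt {τ : ℂ} (hτ : 0 < τ.im) {f : ℂ → ℂ} {κ : ℂ} (hκ : κ ≠ 0)
    (hf : DifferentiableOn ℂ f (strip τ.im)) (hp : ∀ u ∈ strip τ.im, f (u + 1) = f u)
    (hq : ∀ u ∈ strip τ.im, u + τ ∈ strip τ.im → f (u + τ) = κ * ee (-u) * f u)
    (h0 : fourierAt f 0 0 = 0) : ∀ u ∈ strip τ.im, f u = 0 := by
  set t := τ.im
  have hmem : ∀ (x y : ℝ), ((x : ℂ) + y * I ∈ strip t ↔ |y| < t) := by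
    intro x y; simp [strip]
  -- The factor `e(-u)` shifts the index by one. The heights `-t/2` and `t/2`, exchanged by
  -- translation by `τ`, both lie inside the strip.
  have hrec : ∀ n : ℤ, fourierAt f n 0 = κ * ee (-n * τ) * fourierAt f (n + 1) 0 := by
    intro n
    have hy : |-(t / 2)| < t := by rw [abs_neg, abs_of_pos (by positivity)]; linarith
    have hy' : |-(t / 2) + t| < t := by
      rw [show -(t / 2) + t = t / 2 by ring, abs_of_pos (by positivity)]; linarith
    rw [fourierAt_eq hf hp n (by simpa using hτ) hy',
      fourierAt_eq hf hp (n + 1) (by simpa using hτ) hy, ← fourierAt_add_tau n, fourierAt,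
      ← intervalIntegral.integral_const_mul]
    · refine intervalIntegral.integral_congr fun x _ => ?_
      rw [hq _ ((hmem _ _).2 hy)]
      · rw [show (-n * (x + (-(t / 2) : ℝ) * I + τ) : ℂ) = -n * (x + (-(t / 2) : ℝ) * I) + -n * τ by ring,
          ee_add, show (-((n + 1 : ℤ) : ℂ) * (x + (-(t / 2) : ℝ) * I) : ℂ) =
            -n * (x + (-(t / 2) : ℝ) * I) + -(x + (-(t / 2) : ℝ) * I) by push_cast; ring, ee_add]
        ring
      · simp only [strip, Set.mem_ofPred_eq]
        simpa using hy'
    · intro x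
      have h := hp (x + ((-(t / 2) + t : ℝ) : ℂ) * I) ((hmem _ _).2 hy')
      push_cast at h ⊢
      rw [← h]; congr 1; ring
  have hall : ∀ n : ℤ, fourierAt f n 0 = 0 := by
    intro n
    induction n with
    | zero => exact h0
    | succ i hi =>
      have := hrec i
      rw [hi] at this
      exact (mul_eq_zero.mp this.symm).resolve_left (mul_ne_zero hκ (ee_ne_zero _))
    | pred i hi =>
      rw [hrec, sub_add_cancel, hi, mul_zero]
  intro u hu
  have hu' : |u.im| < t := hu
  rw [← re_add_im u]
  refine eq_zero_of_fourierAt ?_ ?_ ?_ u.re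
  · refine hf.continuousOn.comp_continuous (by fun_prop) fun x => (hmem _ _).2 hu'
  · intro x
    rw [← hp _ ((hmem x u.im).2 hu')]; congr 1; ring
  · intro n
    rw [fourierAt_eq hf hp n hu' (y₂ := 0) (by simpa using hτ), hall]

/-- The constant Fourier coefficient of `jacobiTheta₂` is `1`: integrating the series termwise over
`[0, 1]` leaves only the term `n = 0`. -/
lemma thetaFn_ne_zero_function {τ : ℂ} (hτ : 0 < τ.im) : ∃ u, thetaFn u τ ≠ 0 := by
  by_contra! h
  have hj : ∀ z, jacobiTheta₂ z τ = 0 := by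
    intro z
    have := h (z - 1 / 2 - τ / 2)
    rw [thetaFn_eq, neg_eq_zero, mul_eq_zero] at this
    have := this.resolve_left (exp_ne_zero _)
    rwa [show z - 1 / 2 - τ / 2 + 1 / 2 + τ / 2 = z by ring] at this
  have hs : HasSum (fun n : ℤ => ∫ x in (0 : ℝ)..1, jacobiTheta₂_term n x τ)
      (∫ x in (0 : ℝ)..1, ∑' n, jacobiTheta₂_term n x τ) := by
    refine intervalIntegral.hasSum_intervalIntegral_of_summable_norm
      (f := fun n : ℤ => ⟨fun x : ℝ => jacobiTheta₂_term n x τ, by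
        unfold jacobiTheta₂_term; fun_prop⟩) ?_
    refine Summable.of_nonneg_of_le (fun _ => norm_nonneg _) (fun n => ?_)
      (summable_pow_mul_jacobiTheta₂_term_bound 0 hτ 0)
    refine (ContinuousMap.norm_le _ (by positivity)).2 fun x => ?_
    simp only [ContinuousMap.restrict_apply, ContinuousMap.coe_mk, pow_zero, one_mul]
    exact norm_jacobiTheta₂_term_le hτ (by simp) le_rfl n
  have h0 : (∫ x in (0 : ℝ)..1, ∑' n, jacobiTheta₂_term n x τ) = 0 := by
    have h2 : ∀ x : ℝ, ∑' n, jacobiTheta₂_term n x τ = 0 := fun x => hj x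
    simp only [h2, intervalIntegral.integral_zero]
  have h1 : ∀ n : ℤ, n ≠ 0 → ∫ x in (0 : ℝ)..1, jacobiTheta₂_term n x τ = 0 := by
    intro n hn
    have : ∀ x : ℝ, jacobiTheta₂_term n x τ = exp (Real.pi * I * n ^ 2 * τ) * exp ((2 * Real.pi * I * n) * x) := by
      intro x; rw [jacobiTheta₂_term, ← exp_add]; ring_nf
    simp only [this]
    have hc : (2 * Real.pi * I * n : ℂ) ≠ 0 := mul_ne_zero two_pi_I_ne_zero (by exact_mod_cast hn)
    rw [intervalIntegral.integral_const_mul, integral_exp_mul_complex hc]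
    have : exp (2 * Real.pi * I * n) = 1 := ee_int n
    simp [this]
  rw [h0] at hs
  have := hs.unique (hasSum_single 0 h1)
  simp [jacobiTheta₂_term] at this

end Theta

/-! ## Zeros of the theta function and the Kronecker function -/

section Kronecker

open Complex

/-- Division of entire functions: `F / P` is entire if `P` has simple zeros at which `F` vanishes. -/
lemma exists_entire_quotient {P F : ℂ → ℂ} (hP : Differentiable ℂ P) (hF : Differentiable ℂ F)
    (hz : ∀ z, P z = 0 → deriv P z ≠ 0 ∧ F z = 0) :
    ∃ G : ℂ → ℂ, Differentiable ℂ G ∧ ∀ u, F u = P u * G u := by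
  classical
  refine ⟨fun u => if P u = 0 then deriv F u / deriv P u else F u / P u, fun z => ?_, fun u => ?_⟩
  · by_cases h : P z = 0
    · obtain ⟨h1, h2⟩ := hz z h
      have dF : DifferentiableAt ℂ (dslope F z) z :=
        ((differentiableOn_dslope (s := Set.univ) univ_mem).2 hF.differentiableOn).differentiableAt
          univ_mem
      have dP : DifferentiableAt ℂ (dslope P z) z :=
        ((differentiableOn_dslope (s := Set.univ) univ_mem).2 hP.differentiableOn).differentiableAt
          univ_mem
      have hne : dslope P z z ≠ 0 := by rwa [dslope_same]
      refine (dF.div dP hne).congr_of_eventuallyEq ?_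
      filter_upwards [dP.continuousAt.eventually_ne hne] with u hu
      by_cases huz : u = z
      · subst huz
        simp [h, dslope_same]
      · have hP' : dslope P z u = P u / (u - z) := by
          rw [dslope_of_ne _ huz, slope_def_field, h, sub_zero]
        have hF' : dslope F z u = F u / (u - z) := by
          rw [dslope_of_ne _ huz, slope_def_field, h2, sub_zero]
        have hPu : P u ≠ 0 := by
          intro h0; rw [hP', h0, zero_div] at hu; exact hu rfl
        have : u - z ≠ 0 := sub_ne_zero.2 huz
        simp only [Pi.div_apply, hP', hF', if_neg hPu]
        field_simp
    · refine ((hF z).div (hP z) h).congr_of_eventuallyEq ?_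
      filter_upwards [(hP z).continuousAt.eventually_ne h] with u hu
      simp [hu]
  · by_cases h : P u = 0
    · simp [h, (hz u h).2]
    · simp only [if_neg h]; field_simp

/-- By the identity theorem `θ` would vanish identically. -/
lemma thetaFn_eq_zero_of_eventually {τ : ℂ} (hτ : 0 < τ.im) (v z : ℂ)
    (h : ∀ᶠ u in 𝓝 z, thetaFn (u - v) τ = 0) : False := by
  obtain ⟨w, hw⟩ := thetaFn_ne_zero_function hτ
  have hd : Differentiable ℂ fun u => thetaFn (u - v) τ :=
    (differentiable_thetaFn hτ).comp (by fun_prop)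
  have := (hd.differentiableOn (s := Set.univ)).analyticOnNhd isOpen_univ
  have h0 := this.eqOn_zero_of_preconnected_of_eventuallyEq_zero isPreconnected_univ
    (Set.mem_univ z) h (Set.mem_univ (w + v))
  simp at h0
  exact hw h0

/-- Uniqueness of theta functions of degree one. -/
lemma exists_eq_mul_thetaFn {τ : ℂ} (hτ : 0 < τ.im) {Q : ℂ → ℂ} (v : ℂ)
    (hQ : DifferentiableOn ℂ Q (strip τ.im)) (h1 : ∀ u ∈ strip τ.im, Q (u + 1) = -Q u)
    (h2 : ∀ u ∈ strip τ.im, u + τ ∈ strip τ.im →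
      Q (u + τ) = -(exp (-(Real.pi * I * τ)) * ee (-u)) * ee v * Q u) :
    ∃ K, ∀ u ∈ strip τ.im, Q u = K * thetaFn (u - v) τ := by
  set κ : ℂ := -(exp (-(Real.pi * I * τ)) * exp (-(Real.pi * I * τ)) * ee v) with hκ
  have hκ0 : κ ≠ 0 := neg_ne_zero.2 (mul_ne_zero (mul_ne_zero (exp_ne_zero _) (exp_ne_zero _)) (ee_ne_zero _))
  have hstrip1 : ∀ u ∈ strip τ.im, u + 1 ∈ strip τ.im := fun u hu => by simpa [strip] using hu
  have he1 : ∀ u : ℂ, exp (-(Real.pi * I * (u + 1))) = -exp (-(Real.pi * I * u)) := by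
    intro u
    rw [show -(Real.pi * I * (u + 1)) = -(Real.pi * I * u) + -(Real.pi * I) by ring, exp_add,
      exp_neg (Real.pi * I), exp_pi_mul_I]; simp
  have he2 : ∀ u : ℂ, exp (-(Real.pi * I * (u + τ))) =
      exp (-(Real.pi * I * u)) * exp (-(Real.pi * I * τ)) := by
    intro u; rw [← exp_add]; congr 1; ring
  have hdθ : Differentiable ℂ fun u => thetaFn (u - v) τ :=
    (differentiable_thetaFn hτ).comp (by fun_prop)
  have hde : Differentiable ℂ fun u : ℂ => exp (-(Real.pi * I * u)) := by fun_prop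
  -- The factor `e^{-πiu}` makes both functions `1`-periodic, and they keep a common multiplier `κ
  -- e(-u)` under `τ`. A combination of them with vanishing constant Fourier coefficient is
  -- therefore zero.
  set g1 : ℂ → ℂ := fun u => exp (-(Real.pi * I * u)) * Q u
  set g2 : ℂ → ℂ := fun u => exp (-(Real.pi * I * u)) * thetaFn (u - v) τ
  have d1 : DifferentiableOn ℂ g1 (strip τ.im) := hde.differentiableOn.mul hQ
  have d2 : DifferentiableOn ℂ g2 (strip τ.im) := (hde.mul hdθ).differentiableOn
  have p1 : ∀ u ∈ strip τ.im, g1 (u + 1) = g1 u := by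
    intro u hu; simp only [g1, he1, h1 u hu]; ring
  have p2 : ∀ u ∈ strip τ.im, g2 (u + 1) = g2 u := by
    intro u hu
    simp only [g2, he1, show u + 1 - v = u - v + 1 by ring, thetaFn_add_one]; ring
  have q1 : ∀ u ∈ strip τ.im, u + τ ∈ strip τ.im → g1 (u + τ) = κ * ee (-u) * g1 u := by
    intro u hu hu'; simp only [g1, he2, h2 u hu hu', hκ]; ring
  have q2 : ∀ u ∈ strip τ.im, u + τ ∈ strip τ.im → g2 (u + τ) = κ * ee (-u) * g2 u := by
    intro u hu hu'
    simp only [g2, he2, show u + τ - v = u - v + τ by ring, thetaFn_add_tau, hκ, neg_sub]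
    rw [sub_eq_add_neg v u, ee_add]; ring
  have h0mem : (0 : ℂ) ∈ strip τ.im := by simpa [strip] using hτ
  -- Otherwise the theta function itself would vanish on the strip, so the quotient defining `K` is
  -- legitimate.
  have hc0 : fourierAt g2 0 0 ≠ 0 := by
    intro h0
    have := eqOn_zero_of_fourierAt hτ hκ0 d2 p2 q2 h0
    refine thetaFn_eq_zero_of_eventually hτ v 0 ?_
    filter_upwards [(isOpen_strip τ.im).mem_nhds h0mem] with u hu
    exact (mul_eq_zero.1 (this u hu)).resolve_left (exp_ne_zero _)
  set K := fourierAt g1 0 0 / fourierAt g2 0 0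
  refine ⟨K, fun u hu => ?_⟩
  have hint : ∀ g : ℂ → ℂ, DifferentiableOn ℂ g (strip τ.im) →
      IntervalIntegrable (fun x : ℝ => g (x + (0 : ℝ) * I) * ee (-(0 : ℤ) * (x + (0 : ℝ) * I)))
        MeasureTheory.volume 0 1 := by
    intro g hg
    refine Continuous.intervalIntegrable ?_ _ _
    refine (hg.continuousOn.comp_continuous (by fun_prop) fun x => ?_).mul (by fun_prop)
    simpa [strip] using hτ
  have key := eqOn_zero_of_fourierAt (f := fun u => g1 u - K * g2 u) hτ hκ0 (d1.sub (d2.const_mul K))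
    (fun u hu => by simp only [p1 u hu, p2 u hu])
    (fun u hu hu' => by simp only [q1 u hu hu', q2 u hu hu']; ring) (by
      have : fourierAt (fun u => g1 u - K * g2 u) 0 0 = fourierAt g1 0 0 - K * fourierAt g2 0 0 := by
        simp only [fourierAt]
        rw [← intervalIntegral.integral_const_mul, ← intervalIntegral.integral_sub (hint g1 d1)
          ((hint g2 d2).const_mul K)]
        refine intervalIntegral.integral_congr fun x _ => ?_
        ring
      rw [this]
      simp only [K]; field_simp; ring) u hu
  simp only [g1, g2] at key
  have e := exp_ne_zero (-(Real.pi * I * u))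
  have : exp (-(Real.pi * I * u)) * (Q u - K * thetaFn (u - v) τ) = 0 := by
    linear_combination key
  exact sub_eq_zero.1 ((mul_eq_zero.1 this).resolve_left e)

/-- The coefficients of the holomorphic part of the Kronecker series. -/
def kronCoef (τ y : ℂ) (n : ℤ) : ℂ :=
  if 0 ≤ n then ee (n * τ) * y / (1 - ee (n * τ) * y) else 1 / (1 - ee (n * τ) * y)

/-- The holomorphic part of the Kronecker series. -/
def kronH (τ y u : ℂ) : ℂ := ∑' n, kronCoef τ y n * ee (n * u)

/-- The Kronecker function, the sum of `∑ e(nu) / (1 - e(nτ) y)`. -/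
def kronS (τ y u : ℂ) : ℂ := 1 / (1 - ee u) + kronH τ y u

lemma norm_ee_lt_one {τ : ℂ} (hτ : 0 < τ.im) : ‖ee τ‖ < 1 := by
  rw [norm_ee, Real.exp_lt_one_iff, neg_lt_zero]
  positivity

/-- With `q = e(τ)`, the coefficient is `q^n y / (1 - q^n y)` for `n ≥ 0` and `q^m / (q^m - y)` for
`n = -m < 0`. In both directions the denominator tends to a nonzero limit; the finitely many other
indices, including those where a denominator is zero, are absorbed in the constant. -/
lemma exists_kronCoef_bound {τ : ℂ} (hτ : 0 < τ.im) {y : ℂ} (hy : y ≠ 0) :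
    ∃ C, 0 ≤ C ∧ ∀ n : ℤ, ‖kronCoef τ y n‖ ≤ C * ‖ee τ‖ ^ n.natAbs := by
  have hq := norm_ee_lt_one hτ
  have hq0 : 0 < ‖ee τ‖ := norm_pos_iff.2 (ee_ne_zero _)
  have hlim : Tendsto (fun n : ℕ => ee τ ^ n) atTop (𝓝 0) := tendsto_pow_atTop_nhds_zero_of_norm_lt_one hq
  have b1 : (fun n : ℕ => kronCoef τ y n) =O[atTop] fun n : ℕ => ‖ee τ‖ ^ n := by
    refine Asymptotics.IsBigO.of_bound (2 * ‖y‖) ?_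
    have : Tendsto (fun n : ℕ => ‖1 - ee τ ^ n * y‖) atTop (𝓝 ‖1 - 0 * y‖) :=
      (tendsto_const_nhds.sub (hlim.mul_const y)).norm
    filter_upwards [this.eventually_const_lt (u := 1 / 2) (by norm_num)] with n hn
    simp only [kronCoef, Int.natCast_nonneg, if_true, Int.cast_natCast, ee_nat_mul, norm_div, norm_mul,
      norm_pow, norm_norm]
    rw [div_le_iff₀ (by linarith)]
    have : 0 ≤ ‖y‖ * ‖ee τ‖ ^ n := by positivity
    nlinarith
  have b2 : (fun n : ℕ => kronCoef τ y (-(n + 1 : ℕ))) =O[atTop] fun n : ℕ => ‖ee τ‖ ^ (n + 1) := by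
    refine Asymptotics.IsBigO.of_bound (2 / ‖y‖) ?_
    have hy' : 0 < ‖y‖ := norm_pos_iff.2 hy
    have : Tendsto (fun n : ℕ => ‖ee τ ^ (n + 1) - y‖) atTop (𝓝 ‖0 - y‖) :=
      (((tendsto_add_atTop_iff_nat 1).2 hlim).sub_const y).norm
    filter_upwards [this.eventually_const_lt (u := ‖y‖ / 2) (by rw [zero_sub, norm_neg]; linarith)] with n hn
    have hn0 : ¬ (0 ≤ -((n + 1 : ℕ) : ℤ)) := by omega
    have e : kronCoef τ y (-(n + 1 : ℕ)) = ee τ ^ (n + 1) / (ee τ ^ (n + 1) - y) := by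
      have h0 : ee τ ^ (n + 1) ≠ 0 := pow_ne_zero _ (ee_ne_zero _)
      have h1 : ee τ ^ (n + 1) - y ≠ 0 := by
        intro h; rw [h, norm_zero] at hn; linarith
      rw [kronCoef, if_neg hn0]
      rw [ee_int_mul, zpow_neg, zpow_natCast]
      have : 1 - (ee τ ^ (n + 1))⁻¹ * y = (ee τ ^ (n + 1) - y) / ee τ ^ (n + 1) := by
        field_simp
      rw [this, one_div_div]
    rw [e, norm_div, norm_pow, norm_pow, norm_norm, div_le_iff₀ (by linarith)]
    have h2 : 0 ≤ ‖ee τ‖ ^ (n + 1) := by positivity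
    calc ‖ee τ‖ ^ (n + 1) = 2 / ‖y‖ * ‖ee τ‖ ^ (n + 1) * (‖y‖ / 2) := by field_simp
      _ ≤ _ := by gcongr
  obtain ⟨C1, hC1, h1⟩ := Asymptotics.bound_of_isBigO_nat_atTop b1
  obtain ⟨C2, hC2, h2⟩ := Asymptotics.bound_of_isBigO_nat_atTop b2
  refine ⟨max C1 C2, le_max_of_le_left hC1.le, fun n => ?_⟩
  obtain ⟨m, rfl | rfl⟩ := n.eq_nat_or_neg
  · have := h1 (x := m) (by positivity)
    simp only [Int.natAbs_natCast, norm_pow, norm_norm] at *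
    exact this.trans (by gcongr; exact le_max_left _ _)
  · rcases m with _ | m
    · have := h1 (x := 0) (by positivity)
      rw [pow_zero] at this
      simpa using Or.inl this
    · have := h2 (x := m) (by positivity)
      simp only [Int.natAbs_neg, Int.natAbs_natCast, norm_pow, norm_norm] at *
      exact this.trans (by gcongr; exact le_max_right _ _)

lemma norm_ee_int_mul_le {s : ℝ} {u : ℂ} (hu : |u.im| ≤ s) (n : ℤ) :
    ‖ee (n * u)‖ ≤ Real.exp (2 * Real.pi * s) ^ n.natAbs := by
  rw [norm_ee, ← Real.exp_nat_mul, Real.exp_le_exp]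
  have h1 : (n * u : ℂ).im = n * u.im := by simp
  have h2 : -(n * u.im : ℝ) ≤ (n.natAbs : ℝ) * s := by
    have := neg_le_abs ((n : ℝ) * u.im)
    rw [abs_mul] at this
    have h3 : |(n : ℝ)| = (n.natAbs : ℝ) := by
      rw [Nat.cast_natAbs, Int.cast_abs]
    rw [h3] at this
    exact this.trans (by gcongr)
  rw [h1]
  nlinarith [Real.pi_pos]

lemma summable_pow_natAbs {r : ℝ} (h0 : 0 ≤ r) (h1 : r < 1) : Summable fun n : ℤ => r ^ n.natAbs := by
  refine Summable.of_nat_of_neg ?_ ?_ <;> simpa using summable_geometric_of_lt_one h0 h1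

/-- A geometric majorant of ratio `|e(τ)| e^{2πs} < 1`, uniform on `|Im u| ≤ s`; it gives
convergence and holomorphy in the whole strip. -/
lemma kronCoef_term_bound {τ : ℂ} (hτ : 0 < τ.im) {y : ℂ} (hy : y ≠ 0) {s : ℝ} (hs : s < τ.im) :
    ∃ b : ℤ → ℝ, Summable b ∧ ∀ n u, |u.im| ≤ s → ‖kronCoef τ y n * ee (n * u)‖ ≤ b n := by
  obtain ⟨C, hC0, hC⟩ := exists_kronCoef_bound hτ hy
  refine ⟨fun n => C * (‖ee τ‖ * Real.exp (2 * Real.pi * s)) ^ n.natAbs,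
    (summable_pow_natAbs (by positivity) ?_).mul_left C, fun n u hu => ?_⟩
  · rw [norm_ee, ← Real.exp_add, Real.exp_lt_one_iff]
    nlinarith [Real.pi_pos]
  · beta_reduce
    rw [norm_mul, mul_pow, ← mul_assoc]
    exact mul_le_mul (hC n) (norm_ee_int_mul_le hu n) (norm_nonneg _) (by positivity)

lemma hasSum_kronH {τ : ℂ} (hτ : 0 < τ.im) {y : ℂ} (hy : y ≠ 0) {u : ℂ} (hu : u ∈ strip τ.im) :
    HasSum (fun n => kronCoef τ y n * ee (n * u)) (kronH τ y u) := by
  obtain ⟨b, hb, h⟩ := kronCoef_term_bound hτ hy (s := |u.im|) hu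
  exact (Summable.of_norm_bounded hb fun n => h n u le_rfl).hasSum

lemma differentiableOn_kronH {τ : ℂ} (hτ : 0 < τ.im) {y : ℂ} (hy : y ≠ 0) :
    DifferentiableOn ℂ (kronH τ y) (strip τ.im) := by
  intro u hu
  obtain ⟨s, hs1, hs2⟩ := exists_between (show |u.im| < τ.im from hu)
  obtain ⟨b, hb, h⟩ := kronCoef_term_bound hτ hy hs2
  have := differentiableOn_tsum_of_summable_norm (F := fun n u => kronCoef τ y n * ee (n * u))
    hb (fun n => ((differentiable_ee.comp (by fun_prop : Differentiable ℂ fun u : ℂ => n * u)).const_mul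
      (kronCoef τ y n)).differentiableOn) (isOpen_strip s) (fun n u hu => h n u (le_of_lt hu))
  exact (this.differentiableAt ((isOpen_strip s).mem_nhds hs1)).differentiableWithinAt

lemma hasSum_geom_nonneg {u : ℂ} (hu : 0 < u.im) :
    HasSum (fun n : ℤ => if 0 ≤ n then ee (n * u) else 0) (1 / (1 - ee u)) := by
  have h := hasSum_geometric_of_norm_lt_one (norm_ee_lt_one hu)
  rw [← one_div] at h
  refine (Function.Injective.hasSum_iff (f := fun n : ℤ => if 0 ≤ n then ee (n * u) else 0)
    Nat.cast_injective (g := (Nat.cast : ℕ → ℤ)) ?_).1 ?_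
  · intro n hn
    rw [if_neg]
    intro h0
    exact hn ⟨n.toNat, by simpa using h0⟩
  · refine h.congr_fun fun n => ?_
    simp [ee_nat_mul]

/-- The rational function `1/(1 - e(u))` has opposite expansions above and below the real axis. This
is why the Kronecker function has two different series, which the shift by `τ` compares. -/
lemma hasSum_geom_neg {u : ℂ} (hu : u.im < 0) :
    HasSum (fun n : ℤ => if n < 0 then ee (n * u) else 0) (-(1 / (1 - ee u))) := by
  have h := hasSum_geom_nonneg (u := -u) (by simpa using hu)
  have h1 : HasSum (fun n : ℤ => if n = 0 then (1 : ℂ) else 0) 1 := hasSum_ite_eq 0 1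
  have h2 := (Equiv.neg ℤ).hasSum_iff.2 (h.sub h1)
  have hne : ee u ≠ 1 := by
    intro h0
    have := norm_ee u
    rw [h0, norm_one, eq_comm, Real.exp_eq_one_iff] at this
    nlinarith [Real.pi_pos]
  have h3 : 1 / (1 - ee (-u)) - 1 = -(1 / (1 - ee u)) := by
    rw [ee_neg]
    have := ee_ne_zero u
    have h4 : 1 - ee u ≠ 0 := sub_ne_zero.2 (Ne.symm hne)
    have h5 : ee u - 1 ≠ 0 := sub_ne_zero.2 hne
    field_simp
    ring
  rw [← h3]
  refine h2.congr_fun fun n => ?_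
  simp only [Function.comp, Equiv.neg_apply]
  rcases lt_trichotomy n 0 with h | h | h
  · rw [if_pos h, if_pos (by omega), if_neg (by omega)]; push_cast; rw [neg_mul_neg, sub_zero]
  · subst h; simp
  · rw [if_neg (by omega), if_neg (by omega), if_neg (by omega)]; simp

lemma hasSum_kronS_upper_aux {τ : ℂ} (hτ : 0 < τ.im) {y : ℂ} (hy : y ≠ 0) {u : ℂ} (h0 : 0 < u.im)
    (h1 : u.im < τ.im) :
    HasSum (fun n : ℤ => (if 0 ≤ n then ee (n * u) else 0) + kronCoef τ y n * ee (n * u))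
      (kronS τ y u) :=
  (hasSum_geom_nonneg h0).add (hasSum_kronH hτ hy (by simpa [strip, abs_of_pos h0] using h1))

/-- The index `n = 0` is exempt from the nonvanishing condition so that `y = 1` is allowed: there
the zeroth term is `1/0 = 0`, which agrees with the zeroth `kronCoef`. -/
lemma hasSum_kronS_lower {τ : ℂ} (hτ : 0 < τ.im) {y : ℂ} (hy : y ≠ 0)
    (hy' : ∀ n : ℤ, n ≠ 0 → ee (n * τ) * y ≠ 1) {u : ℂ} (h0 : u.im < 0) (h1 : -τ.im < u.im) :
    HasSum (fun n : ℤ => ee (n * u) * (ee (n * τ) * y / (1 - ee (n * τ) * y))) (kronS τ y u) := by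
  have h := (hasSum_geom_neg h0).neg.add
    (hasSum_kronH hτ hy (u := u) (by simp only [strip, Set.mem_ofPred_eq, abs_of_neg h0]; linarith))
  rw [neg_neg] at h
  refine h.congr_fun fun n => ?_
  rw [kronCoef]
  by_cases hn : 0 ≤ n
  · rw [if_pos hn, if_neg (by omega)]; ring
  · have := sub_ne_zero.2 (hy' n (by omega)).symm
    rw [if_neg hn, if_pos (by omega)]; field_simp; ring

lemma hasSum_kronS_upper {τ : ℂ} (hτ : 0 < τ.im) {y : ℂ} (hy : y ≠ 0)
    (hy' : ∀ n : ℤ, ee (n * τ) * y ≠ 1) {u : ℂ} (h0 : 0 < u.im) (h1 : u.im < τ.im) :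
    HasSum (fun n : ℤ => ee (n * u) / (1 - ee (n * τ) * y)) (kronS τ y u) := by
  refine (hasSum_kronS_upper_aux hτ hy h0 h1).congr_fun fun n => ?_
  have := sub_ne_zero.2 (hy' n).symm
  rw [kronCoef]
  by_cases hn : 0 ≤ n
  · rw [if_pos hn, if_pos hn]; field_simp; ring
  · rw [if_neg hn, if_neg hn]; ring

lemma ee_int_mul_tau_ne_one {τ : ℂ} (hτ : 0 < τ.im) {n : ℤ} (hn : n ≠ 0) : ee (n * τ) ≠ 1 := by
  intro h
  obtain ⟨m, hm⟩ := (ee_eq_one_iff _).1 h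
  have := congrArg im hm
  simp only [mul_im, intCast_re, intCast_im, zero_mul, add_zero] at this
  rcases mul_eq_zero.1 this with h | h
  · exact hn (by exact_mod_cast h)
  · exact hτ.ne' h

/-- At `y = 1` the term `n = 0` is `1/0 = 0`, while the geometric series contributes `1` there;
hence the correction by `1`. -/
lemma hasSum_kronS_one_upper {τ : ℂ} (hτ : 0 < τ.im) {u : ℂ} (h0 : 0 < u.im) (h1 : u.im < τ.im) :
    HasSum (fun n : ℤ => ee (n * u) / (1 - ee (n * τ))) (kronS τ 1 u - 1) := by
  have h := (hasSum_kronS_upper_aux hτ one_ne_zero h0 h1).sub (hasSum_ite_eq (0 : ℤ) (1 : ℂ))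
  refine h.congr_fun fun n => ?_
  rw [kronCoef]
  by_cases hn0 : n = 0
  · subst hn0; simp
  have := sub_ne_zero.2 (ee_int_mul_tau_ne_one hτ hn0).symm
  by_cases hn : 0 ≤ n
  · rw [if_pos hn, if_pos hn, if_neg hn0, mul_one]; field_simp; ring
  · rw [if_neg hn, if_neg hn, if_neg hn0]; ring

/-- The upper series at `u + τ`, multiplied by `y`, is termwise the lower series at `u`. -/
lemma kronS_add_tau {τ : ℂ} (hτ : 0 < τ.im) {y : ℂ} (hy : y ≠ 0)
    (hy' : ∀ n : ℤ, ee (n * τ) * y ≠ 1) {u : ℂ} (h0 : u.im < 0) (h1 : -τ.im < u.im) :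
    y * kronS τ y (u + τ) = kronS τ y u := by
  have h := (hasSum_kronS_upper hτ hy hy' (u := u + τ) (by simp; linarith) (by simpa using h0)).mul_left y
  refine (h.congr_fun fun n => ?_).unique (hasSum_kronS_lower hτ hy (fun n _ => hy' n) h0 h1)
  rw [mul_add, ee_add]; ring

/-- At `y = 1` the same comparison leaves the missing zeroth term, so the function is additively
quasi-periodic, like `χ`. -/
lemma kronS_one_add_tau {τ : ℂ} (hτ : 0 < τ.im) {u : ℂ} (h0 : u.im < 0) (h1 : -τ.im < u.im) :
    kronS τ 1 (u + τ) = kronS τ 1 u + 1 := by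
  have h := hasSum_kronS_one_upper hτ (u := u + τ) (by simp; linarith) (by simpa using h0)
  have h2 := hasSum_kronS_lower hτ one_ne_zero (fun n hn => by
    rw [mul_one]; exact ee_int_mul_tau_ne_one hτ hn) h0 h1
  have := (h.congr_fun (g := fun n : ℤ => ee (n * u) * (ee (n * τ) * 1 / (1 - ee (n * τ) * 1)))
    fun n => by rw [mul_add, ee_add]; ring).unique h2
  linear_combination this

end Kronecker

/-! ### Zeros of `θ`, and the expansions of `σ` and `χ` as Kronecker series. -/

section KroneckerTheta

open Complex

/-- The lattice `ℤ + ℤτ`. -/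
def latt (τ : ℂ) : Set ℂ := {u | ∃ p q : ℤ, u = p + q * τ}

lemma mem_latt_iff {τ u : ℂ} : u ∈ latt τ ↔ ∃ n : ℤ, ee (n * τ) * ee (-u) = 1 := by
  constructor
  · rintro ⟨p, q, rfl⟩
    refine ⟨q, ?_⟩
    rw [← ee_add, show (q * τ + -(p + q * τ) : ℂ) = ((-p : ℤ) : ℂ) by push_cast; ring, ee_int]
  · rintro ⟨n, hn⟩
    rw [← ee_add] at hn
    obtain ⟨m, hm⟩ := (ee_eq_one_iff _).1 hn
    exact ⟨-m, n, by push_cast; linear_combination -hm⟩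

lemma latt_neg {τ u : ℂ} (h : u ∈ latt τ) : -u ∈ latt τ := by
  obtain ⟨p, q, rfl⟩ := h
  exact ⟨-p, -q, by push_cast; ring⟩

lemma latt_neg_iff {τ u : ℂ} : -u ∈ latt τ ↔ u ∈ latt τ :=
  ⟨fun h => by simpa using latt_neg h, latt_neg⟩

lemma latt_add {τ u v : ℂ} (h : u ∈ latt τ) (h' : v ∈ latt τ) : u + v ∈ latt τ := by
  obtain ⟨p, q, rfl⟩ := h
  obtain ⟨p', q', rfl⟩ := h'
  exact ⟨p + p', q + q', by push_cast; ring⟩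

lemma latt_add_iff {τ u v : ℂ} (h : v ∈ latt τ) : u + v ∈ latt τ ↔ u ∈ latt τ :=
  ⟨fun h' => by simpa using latt_add h' (latt_neg h), fun h' => latt_add h' h⟩

lemma int_mem_latt (τ : ℂ) (n : ℤ) : (n : ℂ) ∈ latt τ := ⟨n, 0, by simp⟩

lemma int_mul_mem_latt (τ : ℂ) (n : ℤ) : (n * τ : ℂ) ∈ latt τ := ⟨0, n, by simp⟩

lemma latt_countable (τ : ℂ) : (latt τ).Countable := by
  have : latt τ = Set.range fun p : ℤ × ℤ => (p.1 + p.2 * τ : ℂ) := by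
    ext u; constructor
    · rintro ⟨p, q, rfl⟩; exact ⟨(p, q), rfl⟩
    · rintro ⟨⟨p, q⟩, rfl⟩; exact ⟨p, q, rfl⟩
  rw [this]; exact Set.countable_range _

lemma kron_cond {τ w : ℂ} (hw : w ∉ latt τ) (n : ℤ) : ee (n * τ) * ee (-w) ≠ 1 :=
  fun h => hw (mem_latt_iff.2 ⟨n, h⟩)

lemma thetaFn_int (n : ℤ) (τ : ℂ) : thetaFn n τ = 0 := by
  induction n with
  | zero => simpa using thetaFn_zero τ
  | succ i hi => push_cast at *; rw [thetaFn_add_one, hi, neg_zero]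
  | pred i hi =>
    have := thetaFn_add_one (-i - 1) τ
    push_cast at *
    rw [sub_add_cancel, hi] at this
    linear_combination this

lemma thetaFn'_int {τ : ℂ} (hτ : 0 < τ.im) (h : thetaFn' 0 τ ≠ 0) (n : ℤ) : thetaFn' n τ ≠ 0 := by
  induction n with
  | zero => simpa using h
  | succ i hi => push_cast at *; rwa [thetaFn'_add_one hτ, neg_ne_zero]
  | pred i hi =>
    have := thetaFn'_add_one hτ (-i - 1)
    push_cast at *
    rw [sub_add_cancel] at this
    rwa [this, neg_ne_zero] at hi

/-- `θ` vanishes at the integers, which are the simple zeros of `1 - e(u)`. The entire quotient `E`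
replaces `θ(u)/(1 - e(u))` where `θ` is multiplied by a Kronecker function, without dividing at the
pole. -/
lemma exists_thetaFn_div {τ : ℂ} (hτ : 0 < τ.im) :
    ∃ E : ℂ → ℂ, Differentiable ℂ E ∧ (∀ u, thetaFn u τ = (1 - ee u) * E u) ∧
      thetaFn' 0 τ = -(2 * Real.pi * I) * E 0 := by
  have hd : ∀ u, HasDerivAt (fun u => 1 - ee u) (-(2 * Real.pi * I * ee u)) u := fun u => by
    simpa using (hasDerivAt_ee u).const_sub 1
  obtain ⟨E, hE, h⟩ := exists_entire_quotient (P := fun u => 1 - ee u) (F := fun u => thetaFn u τ)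
    (fun u => (hd u).differentiableAt) (differentiable_thetaFn hτ) (fun z hz => by
      refine ⟨?_, ?_⟩
      · rw [(hd z).deriv]
        exact neg_ne_zero.2 (mul_ne_zero two_pi_I_ne_zero (ee_ne_zero _))
      · obtain ⟨n, rfl⟩ := (ee_eq_one_iff z).1 (sub_eq_zero.1 hz).symm
        exact thetaFn_int n τ)
  refine ⟨E, hE, h, ?_⟩
  have h1 := hasDerivAt_thetaFn hτ 0
  have h2 := (hd 0).mul (hE 0).hasDerivAt
  rw [show (fun v => thetaFn v τ) = (fun u => 1 - ee u) * E from funext h] at h1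
  rw [h1.unique h2]; simp

/-- `θ` times the Kronecker function is a theta function of degree one. -/
lemma exists_thetaFn_mul_kronS {τ : ℂ} (hτ : 0 < τ.im) {w : ℂ} (hw : w ∉ latt τ) :
    ∃ K, (∀ u ∈ strip τ.im, ee u ≠ 1 →
        thetaFn u τ * kronS τ (ee (-w)) u = K * thetaFn (u - w) τ) ∧
      (∀ u ∈ strip τ.im, thetaFn u τ * (1 + (1 - ee u) * kronH τ (ee (-w)) u) =
        (1 - ee u) * (K * thetaFn (u - w) τ)) ∧
      thetaFn' 0 τ = 2 * Real.pi * I * K * thetaFn w τ := by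
  obtain ⟨E, hE, hEθ, hE0⟩ := exists_thetaFn_div hτ
  set y := ee (-w)
  have hy : y ≠ 0 := ee_ne_zero _
  -- `Q` is `θ` times the Kronecker function with the poles at the integers removed.
  set Q : ℂ → ℂ := fun u => E u + thetaFn u τ * kronH τ y u with hQdef
  have hQ : ∀ u, ee u ≠ 1 → Q u = thetaFn u τ * kronS τ y u := by
    intro u hu
    have : 1 - ee u ≠ 0 := sub_ne_zero.2 hu.symm
    simp only [Q, kronS, hEθ]; field_simp
  have hE1 : ∀ u, E (u + 1) = -E u := by
    have hcont : Continuous fun u => E (u + 1) + E u := by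
      have := hE.continuous; fun_prop
    intro u
    have hdense : Dense (Set.range ((↑) : ℤ → ℂ))ᶜ := (Set.countable_range _).dense_compl ℝ
    have h0 : (fun u => E (u + 1) + E u) = fun _ => 0 := by
      refine hcont.ext_on hdense continuous_const fun u hu => ?_
      have hne : 1 - ee u ≠ 0 := by
        intro h
        obtain ⟨n, rfl⟩ := (ee_eq_one_iff u).1 (sub_eq_zero.1 h).symm
        exact hu ⟨n, rfl⟩
      have h1 := hEθ (u + 1)
      rw [thetaFn_add_one, hEθ u, ee_add, ee_one, mul_one] at h1
      have : (1 - ee u) * (E (u + 1) + E u) = 0 := by linear_combination -h1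
      exact (mul_eq_zero.1 this).resolve_left hne
    exact eq_neg_of_add_eq_zero_left (congrFun h0 u)
  obtain ⟨K, hK⟩ := exists_eq_mul_thetaFn hτ (Q := Q) w
    (hE.differentiableOn.add ((differentiable_thetaFn hτ).differentiableOn.mul (differentiableOn_kronH hτ hy)))
    (fun u _ => by
      simp only [Q, hE1, thetaFn_add_one, kronH, mul_add, ee_add, ee_int, mul_one]; ring)
    (fun u hu hu' => by
      -- If `u` and `u + τ` both lie in the strip, then `Im u < 0 < Im (u + τ)`: both points avoid
      -- the poles and lie in the domains of the two series.
      have hu1 : -τ.im < u.im := (abs_lt.1 hu).1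
      have hu2 : u.im < 0 := by
        have := (abs_lt.1 (show |(u + τ).im| < τ.im from hu')).2; simp at this; linarith
      have hne : ∀ v : ℂ, v.im ≠ 0 → ee v ≠ 1 := fun v hv h => by
        obtain ⟨n, rfl⟩ := (ee_eq_one_iff v).1 h
        simp at hv
      rw [hQ _ (hne _ hu2.ne), hQ _ (hne _ (by simp; linarith)), thetaFn_add_tau,
        ← kronS_add_tau hτ hy (kron_cond hw) hu2 hu1]
      have : y * ee w = 1 := by rw [← ee_add]; simp
      linear_combination (-(-(exp (-(Real.pi * I * τ)) * ee (-u)) * thetaFn u τ * kronS τ y (u + τ))) * this)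
  refine ⟨K, fun u hu hu1 => by rw [← hQ u hu1, hK u hu], fun u hu => ?_, ?_⟩
  · rw [← hK u hu, hEθ]; simp only [Q, hEθ]; ring
  · have h0 := hK 0 (by simpa [strip] using hτ)
    simp only [Q, thetaFn_zero, zero_mul, add_zero, zero_sub, thetaFn_neg] at h0
    rw [hE0, h0]; ring

/-- If `θ'(0) = 0`, take `w` off the lattice with `θ(w) ≠ 0`. Then `K = 0` in the preceding lemma,
so `θ(u) (1 + (1 - e(u)) H(u))` vanishes near `0`, where `H` denotes `kronH`. The second factor is
`1` at `u = 0`, hence `θ` vanishes near `0`, a contradiction. -/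
lemma thetaFn'_zero_ne_zero {τ : ℂ} (hτ : 0 < τ.im) : thetaFn' 0 τ ≠ 0 := by
  intro h0
  obtain ⟨w, hwl, hw⟩ : ∃ w, w ∉ latt τ ∧ thetaFn w τ ≠ 0 := by
    obtain ⟨w, hw⟩ := thetaFn_ne_zero_function hτ
    have h1 : ∀ᶠ u in 𝓝 w, thetaFn u τ ≠ 0 :=
      (differentiable_thetaFn hτ).continuous.continuousAt.eventually_ne hw
    have hdense : Dense (latt τ)ᶜ := (latt_countable τ).dense_compl ℝ
    obtain ⟨v, hv, hv'⟩ := hdense.inter_nhds_nonempty h1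
    exact ⟨v, hv, hv'⟩
  obtain ⟨K, -, h2, h3⟩ := exists_thetaFn_mul_kronS hτ hwl
  have hK : K = 0 := by
    rw [h0] at h3
    rcases mul_eq_zero.1 h3.symm with h | h
    · exact (mul_eq_zero.1 h).resolve_left two_pi_I_ne_zero
    · exact absurd h hw
  have h0m : (0 : ℂ) ∈ strip τ.im := by simpa [strip] using hτ
  have hc : ContinuousAt (fun u => 1 + (1 - ee u) * kronH τ (ee (-w)) u) 0 := by
    have := ((differentiableOn_kronH hτ (ee_ne_zero (-w))).differentiableAt
      ((isOpen_strip _).mem_nhds h0m)).continuousAt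
    exact continuousAt_const.add ((continuousAt_const.sub continuous_ee.continuousAt).mul this)
  have hne := hc.eventually_ne (y := 0) (by simp)
  refine thetaFn_eq_zero_of_eventually hτ 0 0 ?_
  filter_upwards [hne, (isOpen_strip _).mem_nhds h0m] with u hu hu'
  have := h2 u hu'
  rw [hK, zero_mul, mul_zero] at this
  rw [sub_zero]
  exact (mul_eq_zero.1 this).resolve_right hu

/-- `θ(u)` is a factor of `θ'(0)`, by the construction with `w = u`; no counting of zeros is needed.
-/
lemma thetaFn_ne_zero {τ : ℂ} (hτ : 0 < τ.im) {u : ℂ} (hu : u ∉ latt τ) : thetaFn u τ ≠ 0 := by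
  obtain ⟨K, -, -, h⟩ := exists_thetaFn_mul_kronS hτ hu
  intro h0
  rw [h0, mul_zero] at h
  exact thetaFn'_zero_ne_zero hτ h

lemma thetaFn_latt_aux {τ : ℂ} (hτ : 0 < τ.im) (p q : ℤ) :
    thetaFn (p + q * τ) τ = 0 ∧ thetaFn' (p + q * τ) τ ≠ 0 := by
  induction q with
  | zero => simpa using ⟨thetaFn_int p τ, thetaFn'_int hτ (thetaFn'_zero_ne_zero hτ) p⟩
  | succ i hi =>
    have e : (p + ((i + 1 : ℤ) : ℂ) * τ) = p + (i : ℤ) * τ + τ := by push_cast; ring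
    rw [e, thetaFn_add_tau, thetaFn'_add_tau hτ, hi.1]
    refine ⟨by ring, mul_ne_zero (neg_ne_zero.2 (mul_ne_zero (exp_ne_zero _) (ee_ne_zero _))) ?_⟩
    simpa using hi.2
  | pred i hi =>
    have e : (p + ((-i : ℤ) : ℂ) * τ) = p + ((-i - 1 : ℤ) : ℂ) * τ + τ := by push_cast; ring
    rw [e, thetaFn_add_tau, thetaFn'_add_tau hτ] at hi
    have hm : ∀ v, -(exp (-(Real.pi * I * τ)) * ee (-v)) ≠ 0 :=
      fun v => neg_ne_zero.2 (mul_ne_zero (exp_ne_zero _) (ee_ne_zero _))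
    have h0 := (mul_eq_zero.1 hi.1).resolve_left (hm _)
    rw [h0] at hi
    refine ⟨h0, fun h => hi.2 ?_⟩
    rw [h]; ring

lemma thetaFn_eq_zero_iff {τ : ℂ} (hτ : 0 < τ.im) {u : ℂ} : thetaFn u τ = 0 ↔ u ∈ latt τ := by
  constructor
  · intro h; by_contra h'; exact thetaFn_ne_zero hτ h' h
  · rintro ⟨p, q, rfl⟩; exact (thetaFn_latt_aux hτ p q).1

lemma thetaFn'_ne_zero {τ : ℂ} (hτ : 0 < τ.im) {u : ℂ} (hu : u ∈ latt τ) : thetaFn' u τ ≠ 0 := by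
  obtain ⟨p, q, rfl⟩ := hu; exact (thetaFn_latt_aux hτ p q).2

lemma not_mem_latt_of_mem_strip {τ : ℂ} {u : ℂ} (hu : u ∈ strip τ.im) (h1 : ee u ≠ 1) :
    u ∉ latt τ := by
  rintro ⟨p, q, rfl⟩
  have h : |(q : ℝ) * τ.im| < τ.im := by simpa [strip] using hu
  have hτ : 0 < τ.im := (abs_nonneg _).trans_lt h
  have hq : q = 0 := by
    rw [abs_mul, abs_of_pos hτ] at h
    have : |(q : ℝ)| < 1 := by
      by_contra h'; push Not at h'; nlinarith
    have h2 : |q| < 1 := by exact_mod_cast this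
    exact Int.abs_lt_one_iff.1 h2
  apply h1; rw [hq]; simp

lemma ee_ne_one_of_im {u : ℂ} (h : u.im ≠ 0) : ee u ≠ 1 := fun h1 => by
  obtain ⟨n, rfl⟩ := (ee_eq_one_iff u).1 h1
  simp at h

/-- `θ` times the Kronecker function is `K θ(u - w)`, with `K = θ'(0) / (2πi θ(w))` read off at the
pole. -/
lemma sigmaFn_eq_kronS {τ : ℂ} (hτ : 0 < τ.im) {w : ℂ} (hw : w ∉ latt τ) {u : ℂ}
    (hu : u ∈ strip τ.im) (h1 : ee u ≠ 1) :
    sigmaFn w u τ = -(2 * Real.pi * I) * kronS τ (ee (-w)) u := by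
  obtain ⟨K, hK, -, h⟩ := exists_thetaFn_mul_kronS hτ hw
  have e1 := thetaFn_ne_zero hτ hw
  have e2 := thetaFn_ne_zero hτ (not_mem_latt_of_mem_strip hu h1)
  rw [sigmaFn, h, ← neg_sub u w, thetaFn_neg, div_eq_iff (mul_ne_zero e1 e2)]
  linear_combination (-(2 * Real.pi * I) * thetaFn w τ) * (-hK u hu h1)

/-- The Kronecker series of `σ`. -/
lemma hasSum_sigmaFn {τ : ℂ} (hτ : 0 < τ.im) {w : ℂ} (hw : w ∉ latt τ) {u : ℂ}
    (h0 : 0 < u.im) (h1 : u.im < τ.im) :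
    HasSum (fun n : ℤ => ee (n * u) / (1 - ee (n * τ - w))) (-(1 / (2 * Real.pi * I)) * sigmaFn w u τ) := by
  have hs : u ∈ strip τ.im := by simpa [strip, abs_of_pos h0] using h1
  rw [sigmaFn_eq_kronS hτ hw hs (ee_ne_one_of_im h0.ne')]
  have hpi : (2 * Real.pi * I : ℂ) ≠ 0 := two_pi_I_ne_zero
  rw [show -(1 / (2 * Real.pi * I)) * (-(2 * Real.pi * I) * kronS τ (ee (-w)) u) =
    kronS τ (ee (-w)) u by field_simp]
  refine (hasSum_kronS_upper hτ (ee_ne_zero _) (kron_cond hw) h0 h1).congr_fun fun n => ?_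
  rw [sub_eq_add_neg (n * τ : ℂ), ee_add]

lemma kronCoef_one_neg {τ : ℂ} (hτ : 0 < τ.im) (n : ℤ) : kronCoef τ 1 (-n) = -kronCoef τ 1 n := by
  have key : ∀ m : ℤ, 0 < m → kronCoef τ 1 (-m) = -kronCoef τ 1 m := by
    intro m hm
    have h := sub_ne_zero.2 (ee_int_mul_tau_ne_one hτ hm.ne').symm
    have h' : ee (m * τ) - 1 ≠ 0 := sub_ne_zero.2 (ee_int_mul_tau_ne_one hτ hm.ne')
    have h0 := ee_ne_zero (m * τ)
    rw [kronCoef, kronCoef, if_neg (by omega), if_pos hm.le]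
    push_cast
    rw [neg_mul, ee_neg]
    field_simp
    ring
  rcases lt_trichotomy n 0 with h | rfl | h
  · have := key (-n) (by omega); rw [neg_neg] at this; rw [this, neg_neg]
  · simp [kronCoef]
  · exact key n h

lemma kronH_one_neg {τ : ℂ} (hτ : 0 < τ.im) (u : ℂ) : kronH τ 1 (-u) = -kronH τ 1 u := by
  rw [kronH, kronH, ← (Equiv.neg ℤ).tsum_eq, ← tsum_neg]
  refine tsum_congr fun n => ?_
  simp only [Equiv.neg_apply, kronCoef_one_neg hτ]
  push_cast; rw [neg_mul_neg]; ring

/-- The additive defects of `χ` and of the Kronecker function at `y = 1` under `τ` cancel in `χ +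
2πi (S - 1/2)`, where `S` denotes `kronS τ 1`. So `θ` times this combination is a constant multiple
of `θ`, and parity makes the constant term drop out. -/
lemma chiFn_eq_kronS {τ : ℂ} (hτ : 0 < τ.im) {u : ℂ} (hu : u ∈ strip τ.im) (h1 : ee u ≠ 1) :
    chiFn u τ = -(2 * Real.pi * I) * (kronS τ 1 u - 1 / 2) := by
  obtain ⟨E, hE, hEθ, hE0⟩ := exists_thetaFn_div hτ
  set F : ℂ → ℂ := fun u => thetaFn' u τ + 2 * Real.pi * I *
    (E u + thetaFn u τ * (kronH τ 1 u - 1 / 2)) with hF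
  have hFS : ∀ u, ee u ≠ 1 → F u = thetaFn' u τ + 2 * Real.pi * I * (thetaFn u τ * (kronS τ 1 u - 1 / 2)) := by
    intro u hu
    have : 1 - ee u ≠ 0 := sub_ne_zero.2 hu.symm
    simp only [F, kronS, hEθ]; field_simp
    ring
  have hE1 : ∀ u, ee u ≠ 1 → E (u + 1) = -E u := by
    intro u hu
    have h1 := hEθ (u + 1)
    rw [thetaFn_add_one, hEθ u, ee_add, ee_one, mul_one] at h1
    have : (1 - ee u) * (E (u + 1) + E u) = 0 := by linear_combination -h1
    exact eq_neg_of_add_eq_zero_left ((mul_eq_zero.1 this).resolve_left (sub_ne_zero.2 hu.symm))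
  have hdense : Dense (Set.range ((↑) : ℤ → ℂ))ᶜ := (Set.countable_range _).dense_compl ℝ
  have hE1' : ∀ u, E (u + 1) = -E u := by
    have hc := hE.continuous
    refine congrFun ((by fun_prop : Continuous fun u => E (u + 1)).ext_on hdense hc.neg fun u hu => hE1 u ?_)
    intro h
    obtain ⟨n, rfl⟩ := (ee_eq_one_iff u).1 h
    exact hu ⟨n, rfl⟩
  have hdθ' : Differentiable ℂ fun u => thetaFn' u τ := by
    have h := ((differentiable_thetaFn hτ).differentiableOn (s := Set.univ)).deriv isOpen_univ
    exact differentiableOn_univ.1 h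
  obtain ⟨K, hK⟩ := exists_eq_mul_thetaFn hτ (Q := F) 0
    (hdθ'.differentiableOn.add ((hE.differentiableOn.add
      ((differentiable_thetaFn hτ).differentiableOn.mul
        ((differentiableOn_kronH hτ one_ne_zero).sub (differentiableOn_const _)))).const_mul _))
    (fun u _ => by
      simp only [F, hE1', thetaFn_add_one, thetaFn'_add_one hτ, kronH, mul_add, ee_add, ee_int, mul_one]
      ring)
    (fun u hu hu' => by
      have hu1 : -τ.im < u.im := (abs_lt.1 hu).1
      have hu2 : u.im < 0 := by
        have := (abs_lt.1 (show |(u + τ).im| < τ.im from hu')).2; simp at this; linarith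
      rw [hFS _ (ee_ne_one_of_im hu2.ne), hFS _ (ee_ne_one_of_im (by simp; linarith)),
        thetaFn_add_tau, thetaFn'_add_tau hτ, kronS_one_add_tau hτ hu2 hu1, ee_zero]
      ring)
  -- `F` is even and `θ` is odd, so adding the equations `F = K θ` at `u` and `-u` gives `F u = 0`.
  have hKu := hK u hu
  have hKn := hK (-u) (by simpa [strip] using hu)
  have hnu : ee (-u) ≠ 1 := by rw [ee_neg]; simpa using h1
  have h1' : 1 - ee u ≠ 0 := sub_ne_zero.2 h1.symm
  have hS : kronS τ 1 (-u) - 1 / 2 = -(kronS τ 1 u - 1 / 2) := by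
    rw [kronS, kronS, kronH_one_neg hτ, ee_neg]
    have h3 := ee_ne_zero u
    have h2 : ee u - 1 ≠ 0 := sub_ne_zero.2 h1
    have : 1 / (1 - (ee u)⁻¹) = -(ee u / (1 - ee u)) := by
      field_simp; ring
    rw [this]; field_simp; ring
  rw [hFS _ h1] at hKu
  rw [hFS _ hnu, hS] at hKn
  simp only [sub_zero, thetaFn_neg, thetaFn'_neg hτ] at hKu hKn
  have hne := thetaFn_ne_zero hτ (not_mem_latt_of_mem_strip hu h1)
  rw [chiFn, div_eq_iff hne]
  linear_combination (hKu + hKn) / 2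

lemma hasSum_chiFn {τ : ℂ} (hτ : 0 < τ.im) {u : ℂ} (h0 : 0 < u.im) (h1 : u.im < τ.im) :
    HasSum (fun n : ℤ => ee (n * u) / (1 - ee (n * τ))) (-(1 / (2 * Real.pi * I)) * chiFn u τ - 1 / 2) := by
  have hs : u ∈ strip τ.im := by simpa [strip, abs_of_pos h0] using h1
  have h := hasSum_kronS_one_upper hτ h0 h1
  have hpi : (2 * Real.pi * I : ℂ) ≠ 0 := two_pi_I_ne_zero
  convert! h using 1
  rw [chiFn_eq_kronS hτ hs (ee_ne_one_of_im h0.ne')]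
  field_simp; ring

end KroneckerTheta

/-! ## Identities for the functions `σ` and `χ` -/

section SigmaIdentities

open Complex

/-- The equality on the strip extends to the plane by the identity theorem. -/
lemma exists_eq_mul_thetaFn_entire {τ : ℂ} (hτ : 0 < τ.im) {Q : ℂ → ℂ} (v : ℂ)
    (hQ : Differentiable ℂ Q) (h1 : ∀ u, Q (u + 1) = -Q u)
    (h2 : ∀ u, Q (u + τ) = -(exp (-(Real.pi * I * τ)) * ee (-u)) * ee v * Q u) :
    ∃ K, ∀ u, Q u = K * thetaFn (u - v) τ := by
  obtain ⟨K, hK⟩ := exists_eq_mul_thetaFn hτ v hQ.differentiableOn (fun u _ => h1 u) (fun u _ _ => h2 u)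
  refine ⟨K, fun u => ?_⟩
  have hd : Differentiable ℂ fun u => K * thetaFn (u - v) τ :=
    ((differentiable_thetaFn hτ).comp (by fun_prop)).const_mul K
  have ha := (hQ.differentiableOn (s := Set.univ)).analyticOnNhd isOpen_univ
  have hb := (hd.differentiableOn (s := Set.univ)).analyticOnNhd isOpen_univ
  refine ha.eqOn_of_preconnected_of_eventuallyEq hb isPreconnected_univ (Set.mem_univ 0) ?_
    (Set.mem_univ u)
  filter_upwards [(isOpen_strip τ.im).mem_nhds (show (0 : ℂ) ∈ strip τ.im by simpa [strip] using hτ)]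
    with u hu using hK u hu

lemma thetaFn_sub_one (u τ : ℂ) : thetaFn (u - 1) τ = -thetaFn u τ := by
  have := thetaFn_add_one (u - 1) τ
  rw [sub_add_cancel] at this
  rw [this, neg_neg]

lemma thetaFn_sub_tau (u τ : ℂ) :
    thetaFn (u - τ) τ = -(exp (-(Real.pi * I * τ)) * ee u) * thetaFn u τ := by
  rw [← neg_sub τ u, thetaFn_neg, sub_eq_add_neg, add_comm, thetaFn_add_tau, neg_neg, thetaFn_neg]
  ring

/-- The three-term identity for theta functions. -/
lemma thetaFn_three_term {τ : ℂ} (hτ : 0 < τ.im) {a y : ℂ} (ha : a ∉ latt τ) (hy : y ∉ latt τ)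
    (b x : ℂ) :
    thetaFn (a - x) τ * thetaFn (b - y) τ * thetaFn (a + b) τ * thetaFn (x - y) τ =
      thetaFn (a - x + y) τ * thetaFn (a + b - y) τ * thetaFn b τ * thetaFn x τ -
      thetaFn (b - y + x) τ * thetaFn (a + b - x) τ * thetaFn a τ * thetaFn y τ := by
  set p := exp (-(Real.pi * I * τ))
  -- As a function of `x` the difference of the two sides is a theta function of degree two: all
  -- three products have the same multipliers. It vanishes at `x = 0`, hence on the lattice, and at
  -- `x = y`.
  set D : ℂ → ℂ := fun x => thetaFn (a - x) τ * thetaFn (b - y) τ * thetaFn (a + b) τ * thetaFn (x - y) τ -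
      (thetaFn (a - x + y) τ * thetaFn (a + b - y) τ * thetaFn b τ * thetaFn x τ -
      thetaFn (b - y + x) τ * thetaFn (a + b - x) τ * thetaFn a τ * thetaFn y τ) with hDdef
  have hθ := differentiable_thetaFn hτ
  have hD : Differentiable ℂ D := by
    have h1 : Differentiable ℂ fun x => thetaFn (a - x) τ := hθ.comp (by fun_prop)
    have h2 : Differentiable ℂ fun x => thetaFn (x - y) τ := hθ.comp (by fun_prop)
    have h3 : Differentiable ℂ fun x => thetaFn (a - x + y) τ := hθ.comp (by fun_prop)
    have h4 : Differentiable ℂ fun x => thetaFn (b - y + x) τ := hθ.comp (by fun_prop)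
    have h5 : Differentiable ℂ fun x => thetaFn (a + b - x) τ := hθ.comp (by fun_prop)
    fun_prop
  have hD1 : ∀ x, D (x + 1) = D x := by
    intro x
    simp only [D, show a - (x + 1) = a - x - 1 by ring, show x + 1 - y = x - y + 1 by ring,
      show a - x - 1 + y = a - x + y - 1 by ring, show b - y + (x + 1) = b - y + x + 1 by ring,
      show a + b - (x + 1) = a + b - x - 1 by ring, thetaFn_sub_one, thetaFn_add_one]
    ring
  have hDτ : ∀ x, D (x + τ) = p * p * (ee (a + y) * ee (-x) * ee (-x)) * D x := by
    intro x
    simp only [D, show a - (x + τ) = a - x - τ by ring, show x + τ - y = x - y + τ by ring,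
      show a - x - τ + y = a - x + y - τ by ring, show b - y + (x + τ) = b - y + x + τ by ring,
      show a + b - (x + τ) = a + b - x - τ by ring, thetaFn_sub_tau, thetaFn_add_tau]
    have e1 : ee (a - x) * ee (-(x - y)) = ee (a + y) * ee (-x) * ee (-x) := by
      simp only [← ee_add]; ring_nf
    have e2 : ee (a - x + y) * ee (-x) = ee (a + y) * ee (-x) * ee (-x) := by
      simp only [← ee_add]; ring_nf
    have e3 : ee (-(b - y + x)) * ee (a + b - x) = ee (a + y) * ee (-x) * ee (-x) := by
      simp only [← ee_add]; ring_nf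
    simp only [show exp (-(Real.pi * I * τ)) = p from rfl]
    linear_combination
      (p * p * (thetaFn (a - x) τ * thetaFn (b - y) τ * thetaFn (a + b) τ * thetaFn (x - y) τ)) * e1 -
      (p * p * (thetaFn (a - x + y) τ * thetaFn (a + b - y) τ * thetaFn b τ * thetaFn x τ)) * e2 +
      (p * p * (thetaFn (b - y + x) τ * thetaFn (a + b - x) τ * thetaFn a τ * thetaFn y τ)) * e3
  have hp0 : p ≠ 0 := exp_ne_zero _
  have hD0 : D 0 = 0 := by
    simp only [D, sub_zero, zero_sub, add_zero, thetaFn_neg, thetaFn_zero]; ring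
  have hDy : D y = 0 := by
    simp only [D, sub_self, thetaFn_zero, show a - y + y = a by ring, show b - y + y = b by ring]; ring
  have hDint : ∀ p : ℤ, D p = 0 := by
    intro p
    induction p with
    | zero => simpa using hD0
    | succ i hi => push_cast at *; rw [hD1, hi]
    | pred i hi => push_cast at *; rw [← hD1, sub_add_cancel, hi]
  have hDlatt : ∀ z ∈ latt τ, D z = 0 := by
    rintro z ⟨r, q, rfl⟩
    induction q with
    | zero => simpa using hDint r
    | succ i hi =>
      have e : (r + ((i + 1 : ℤ) : ℂ) * τ) = r + (i : ℤ) * τ + τ := by push_cast; ring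
      rw [e, hDτ, hi, mul_zero]
    | pred i hi =>
      have e : (r + ((-i : ℤ) : ℂ) * τ) = r + ((-i - 1 : ℤ) : ℂ) * τ + τ := by push_cast; ring
      rw [e, hDτ] at hi
      refine (mul_eq_zero.1 hi).resolve_left ?_
      exact mul_ne_zero (mul_ne_zero hp0 hp0) (mul_ne_zero (mul_ne_zero (ee_ne_zero _) (ee_ne_zero _)) (ee_ne_zero _))
  obtain ⟨G, hG, hDG⟩ := exists_entire_quotient hθ hD fun z hz =>
    have hz' := (thetaFn_eq_zero_iff hτ).1 hz
    ⟨thetaFn'_ne_zero hτ hz', hDlatt z hz'⟩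
  have hdense : Dense (latt τ)ᶜ := (latt_countable τ).dense_compl ℝ
  have hGc := hG.continuous
  have hG1 : ∀ u, G (u + 1) = -G u := by
    refine congrFun ((by fun_prop : Continuous fun u => G (u + 1)).ext_on hdense hGc.neg fun u hu => ?_)
    have h := hD1 u
    rw [hDG, hDG, thetaFn_add_one] at h
    have h2 : thetaFn u τ * (G (u + 1) + G u) = 0 := by linear_combination -h
    exact eq_neg_of_add_eq_zero_left ((mul_eq_zero.1 h2).resolve_left (thetaFn_ne_zero hτ hu))
  have hGτ : ∀ u, G (u + τ) = -(p * ee (-u)) * ee (a + y) * G u := by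
    refine congrFun ((by fun_prop : Continuous fun u => G (u + τ)).ext_on hdense
      (by fun_prop : Continuous fun u => -(p * ee (-u)) * ee (a + y) * G u) fun u hu => ?_)
    have h := hDτ u
    rw [hDG, hDG, thetaFn_add_tau] at h
    have h2 : (p * ee (-u) * thetaFn u τ) * (G (u + τ) - -(p * ee (-u)) * ee (a + y) * G u) = 0 := by
      linear_combination -h
    exact sub_eq_zero.1 ((mul_eq_zero.1 h2).resolve_left
      (mul_ne_zero (mul_ne_zero hp0 (ee_ne_zero _)) (thetaFn_ne_zero hτ hu)))
  obtain ⟨K, hK⟩ := exists_eq_mul_thetaFn_entire hτ (a + y) hG hG1 hGτ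
  -- After division by `θ(x)` only a multiple of `θ(x - a - y)` remains; at the second zero `x = y`
  -- this factor is `θ(-a) ≠ 0`.
  have hK0 : K = 0 := by
    rw [hDG, hK, show y - (a + y) = -a by ring, thetaFn_neg] at hDy
    have := thetaFn_ne_zero hτ ha
    have := thetaFn_ne_zero hτ hy
    simp_all
  have : D x = 0 := by rw [hDG, hK, hK0]; ring
  exact sub_eq_zero.1 this

lemma sigmaFn_neg_neg (w u τ : ℂ) : sigmaFn (-w) (-u) τ = -sigmaFn w u τ := by
  rw [sigmaFn, sigmaFn, show -w - -u = -(w - u) by ring, thetaFn_neg, thetaFn_neg, thetaFn_neg,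
    neg_mul_neg, neg_mul, neg_div]

lemma chiFn_neg {τ : ℂ} (hτ : 0 < τ.im) (u : ℂ) : chiFn (-u) τ = -chiFn u τ := by
  rw [chiFn, chiFn, thetaFn_neg, thetaFn'_neg hτ, div_neg]

lemma chiFn_add_one {τ : ℂ} (hτ : 0 < τ.im) (u : ℂ) : chiFn (u + 1) τ = chiFn u τ := by
  rw [chiFn, chiFn, thetaFn_add_one, thetaFn'_add_one hτ, neg_div_neg_eq]

lemma sigmaFn_add_one (w u τ : ℂ) : sigmaFn w (u + 1) τ = sigmaFn w u τ := by
  rw [sigmaFn, sigmaFn, show w - (u + 1) = w - u - 1 by ring, thetaFn_sub_one, thetaFn_add_one,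
    mul_neg, neg_mul, neg_div_neg_eq]

lemma sigmaFn_one_add (w u τ : ℂ) : sigmaFn (w + 1) u τ = sigmaFn w u τ := by
  rw [sigmaFn, sigmaFn, show w + 1 - u = w - u + 1 by ring, thetaFn_add_one, thetaFn_add_one,
    neg_mul, neg_mul, neg_div_neg_eq]

lemma sigmaFn_tau_add (w u τ : ℂ) : sigmaFn (w + τ) u τ = ee u * sigmaFn w u τ := by
  rw [sigmaFn, sigmaFn, show w + τ - u = w - u + τ by ring, thetaFn_add_tau, thetaFn_add_tau,
    show -(w - u) = -w + u by ring, ee_add]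
  have h1 := ee_ne_zero (-w)
  have h2 := exp_ne_zero (-(Real.pi * I * τ))
  have h3 := ee_ne_zero u
  field_simp

lemma sigmaFn_add_latt (w u τ : ℂ) (p q : ℤ) :
    sigmaFn (w + p + q * τ) u τ = ee (q * u) * sigmaFn w u τ := by
  have hp : ∀ w, sigmaFn (w + p) u τ = sigmaFn w u τ := by
    intro w
    induction p with
    | zero => simp
    | succ i hi => push_cast at *; rw [← add_assoc, sigmaFn_one_add, hi]
    | pred i hi =>
      push_cast at *
      rw [← sigmaFn_one_add, ← hi]; congr 1; ring
  induction q with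
  | zero => simp [hp]
  | succ i hi =>
    push_cast at *
    rw [add_mul, add_mul, one_mul, one_mul, ← add_assoc, sigmaFn_tau_add, hi, ee_add]; ring
  | pred i hi =>
    push_cast at *
    have := sigmaFn_tau_add (w + p + (-i - 1) * τ) u τ
    rw [show w + p + (-i - 1) * τ + τ = w + p + -i * τ by ring, hi,
      show (-i * u : ℂ) = (-i - 1) * u + u by ring, ee_add] at this
    have h0 := ee_ne_zero u
    exact (mul_left_cancel₀ h0 (by linear_combination this)).symm

/-- The derivative of `σ_w(u)` in `w`. -/
def dsigmaFn (w u τ : ℂ) : ℂ :=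
  (thetaFn' (w - u) τ * thetaFn w τ - thetaFn (w - u) τ * thetaFn' w τ) * thetaFn' 0 τ /
    (thetaFn w τ ^ 2 * thetaFn u τ)

lemma hasDerivAt_sigmaFn {τ : ℂ} (hτ : 0 < τ.im) {w u : ℂ} (hw : w ∉ latt τ) (hu : u ∉ latt τ) :
    HasDerivAt (fun w => sigmaFn w u τ) (dsigmaFn w u τ) w := by
  have h1 : HasDerivAt (fun w => thetaFn (w - u) τ) (thetaFn' (w - u) τ) w :=
    (hasDerivAt_thetaFn hτ (w - u)).comp_sub_const w u
  have h2 := hasDerivAt_thetaFn hτ w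
  have e1 := thetaFn_ne_zero hτ hw
  have e2 := thetaFn_ne_zero hτ hu
  have := (h1.mul_const (thetaFn' 0 τ)).div (h2.mul_const (thetaFn u τ)) (mul_ne_zero e1 e2)
  refine this.congr_deriv ?_
  rw [dsigmaFn]; field_simp

/-- The three-term identity for `σ`. -/
lemma sigmaFn_three_term {τ : ℂ} (hτ : 0 < τ.im) {a b x y : ℂ} (ha : a ∉ latt τ) (hb : b ∉ latt τ)
    (hab : a + b ∉ latt τ) (hx : x ∉ latt τ) (hy : y ∉ latt τ) (hxy : x - y ∉ latt τ) :
    sigmaFn a x τ * sigmaFn b y τ =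
      sigmaFn a (x - y) τ * sigmaFn (a + b) y τ + sigmaFn b (y - x) τ * sigmaFn (a + b) x τ := by
  have h := thetaFn_three_term hτ ha hy b x
  have e1 := thetaFn_ne_zero hτ ha
  have e2 := thetaFn_ne_zero hτ hb
  have e3 := thetaFn_ne_zero hτ hab
  have e4 := thetaFn_ne_zero hτ hx
  have e5 := thetaFn_ne_zero hτ hy
  have e6 := thetaFn_ne_zero hτ hxy
  simp only [sigmaFn]
  rw [show y - x = -(x - y) by ring, thetaFn_neg (x - y), show a - (x - y) = a - x + y by ring,
    show b - -(x - y) = b - y + x by ring]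
  field_simp
  linear_combination thetaFn' 0 τ ^ 2 * h

/-- The degenerate three-term identity. -/
lemma sigmaFn_chiFn_identity {τ : ℂ} (hτ : 0 < τ.im) {a x y : ℂ} (ha : a ∉ latt τ)
    (hx : x ∉ latt τ) (hy : y ∉ latt τ) (hxy : x - y ∉ latt τ) :
    sigmaFn a x τ * sigmaFn (-a) y τ + sigmaFn a (x - y) τ * (chiFn x τ - chiFn y τ) +
      dsigmaFn a (x - y) τ = 0 := by
  -- Differentiate in `b` at `b = -a`, where `θ(a + b)` vanishes and the identity in terms of `σ`
  -- itself would have a pole.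
  have h := fun b => thetaFn_three_term hτ ha hy b x
  have d : ∀ c : ℂ, HasDerivAt (fun b => thetaFn (b + c) τ) (thetaFn' (-a + c) τ) (-a) := fun c =>
    (hasDerivAt_thetaFn hτ (-a + c)).comp_add_const (-a) c
  have hl := ((((d (-y)).const_mul (thetaFn (a - x) τ)).mul (d a)).mul_const (thetaFn (x - y) τ))
  have hr := (((((d (a - y)).const_mul (thetaFn (a - x + y) τ)).mul (d 0)).mul_const (thetaFn x τ))).sub
    (((((d (x - y)).mul (d (a - x))).mul_const (thetaFn a τ)).mul_const (thetaFn y τ)))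
  have hlr := hl.unique (hr.congr_of_eventuallyEq (Eventually.of_forall fun b => by
    have := h b
    simp only [Pi.mul_apply, Pi.sub_apply]
    rw [show b + -y = b - y by ring, show b + a = a + b by ring, show b + (a - y) = a + b - y by ring,
      show b + 0 = b by ring, show b + (x - y) = b - y + x by ring,
      show b + (a - x) = a + b - x by ring]
    exact this))
  rw [show -a + a = 0 by ring, show -a + (a - y) = -y by ring, show -a + 0 = -a by ring,
    show -a + (x - y) = -(a - x + y) by ring, show -a + (a - x) = -x by ring,
    show -a + -y = -(a + y) by ring] at hlr
  simp only [thetaFn_neg, thetaFn'_neg hτ, thetaFn_zero] at hlr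
  have e1 := thetaFn_ne_zero hτ ha
  have e4 := thetaFn_ne_zero hτ hx
  have e5 := thetaFn_ne_zero hτ hy
  have e6 := thetaFn_ne_zero hτ hxy
  simp only [sigmaFn, dsigmaFn, chiFn]
  rw [show -a - y = -(a + y) by ring, thetaFn_neg, thetaFn_neg, show a - (x - y) = a - x + y by ring]
  field_simp
  linear_combination -thetaFn' 0 τ * hlr

lemma isOpen_compl_latt {τ : ℂ} (hτ : 0 < τ.im) : IsOpen (latt τ)ᶜ := by
  have : (latt τ)ᶜ = {u | thetaFn u τ ≠ 0} := by
    ext u; simp [thetaFn_eq_zero_iff hτ]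
  rw [this]
  exact isOpen_ne_fun (differentiable_thetaFn hτ).continuous continuous_const

/-- Two functions holomorphic off the lattice that agree on `0 < Im u < Im τ` agree. -/
lemma eqOn_compl_latt {τ : ℂ} (hτ : 0 < τ.im) {f g : ℂ → ℂ} (hf : DifferentiableOn ℂ f (latt τ)ᶜ)
    (hg : DifferentiableOn ℂ g (latt τ)ᶜ) (h : ∀ u : ℂ, 0 < u.im → u.im < τ.im → f u = g u)
    {u : ℂ} (hu : u ∉ latt τ) : f u = g u := by
  have hpre : IsPreconnected (latt τ)ᶜ :=
    ((latt_countable τ).isPathConnected_compl_of_one_lt_rank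
      (by simp)).isConnected.isPreconnected
  have hmem : (τ / 2) ∈ (latt τ)ᶜ := by
    refine not_mem_latt_of_mem_strip ?_ (ee_ne_one_of_im ?_)
    · simp only [strip, Set.mem_ofPred_eq, div_ofNat_im]; rw [abs_of_pos (by positivity)]; linarith
    · simp only [div_ofNat_im]; positivity
  refine (hf.analyticOnNhd (isOpen_compl_latt hτ)).eqOn_of_preconnected_of_eventuallyEq
    (hg.analyticOnNhd (isOpen_compl_latt hτ)) hpre hmem ?_ hu
  have h1 : ∀ᶠ u : ℂ in 𝓝 (τ / 2), 0 < u.im :=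
    continuous_im.continuousAt.eventually_const_lt (by simp only [div_ofNat_im]; positivity)
  have h2 : ∀ᶠ u : ℂ in 𝓝 (τ / 2), u.im < τ.im :=
    continuous_im.continuousAt.eventually_lt_const (by simp only [div_ofNat_im]; linarith)
  filter_upwards [h1, h2] with u hu1 hu2 using h u hu1 hu2

lemma differentiableOn_sigmaFn {τ : ℂ} (hτ : 0 < τ.im) (w : ℂ) (hw : w ∉ latt τ) :
    DifferentiableOn ℂ (fun u => sigmaFn w u τ) (latt τ)ᶜ := by
  intro u hu
  have hθ := differentiable_thetaFn hτ
  have h1 : Differentiable ℂ fun u => thetaFn (w - u) τ := hθ.comp (by fun_prop)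
  exact (((h1 u).mul_const _).div ((hθ u).const_mul (thetaFn w τ))
    (mul_ne_zero (thetaFn_ne_zero hτ hw) (thetaFn_ne_zero hτ hu))).differentiableWithinAt

lemma differentiable_thetaFn' {τ : ℂ} (hτ : 0 < τ.im) : Differentiable ℂ fun u => thetaFn' u τ :=
  differentiableOn_univ.1
    (((differentiable_thetaFn hτ).differentiableOn (s := Set.univ)).deriv isOpen_univ)

lemma differentiableOn_chiFn {τ : ℂ} (hτ : 0 < τ.im) :
    DifferentiableOn ℂ (fun u => chiFn u τ) (latt τ)ᶜ := fun u hu =>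
  ((differentiable_thetaFn' hτ u).div (differentiable_thetaFn hτ u)
    (thetaFn_ne_zero hτ hu)).differentiableWithinAt

lemma natCast_mul_im_pos {τ : ℂ} (hτ : 0 < τ.im) {N : ℕ} (hN : 0 < N) : 0 < (N * τ : ℂ).im := by
  have : (N * τ : ℂ).im = N * τ.im := by simp
  rw [this]; positivity

lemma add_mul_mem_latt {τ u : ℂ} {N l : ℕ} (h : u + l * τ ∈ latt (N * τ)) : u ∈ latt τ := by
  obtain ⟨p, q, h⟩ := h
  exact ⟨p, q * N - l, by push_cast; linear_combination h⟩

lemma mul_mem_latt {τ w : ℂ} {N : ℕ} (h : w ∈ latt τ) : N * w ∈ latt (N * τ) := by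
  obtain ⟨p, q, rfl⟩ := h
  exact ⟨N * p, q, by push_cast; ring⟩

lemma add_mul_im_bounds {τ u : ℂ} {N l : ℕ} (hl : l < N) (h0 : 0 < u.im) (h1 : u.im < τ.im) :
    0 < (u + l * τ).im ∧ (u + l * τ).im < (N * τ : ℂ).im := by
  have e1 : (u + l * τ).im = u.im + l * τ.im := by simp
  have e2 : (N * τ : ℂ).im = N * τ.im := by simp
  have h3 : (l : ℝ) + 1 ≤ N := by exact_mod_cast hl
  have h4 : 0 ≤ (l : ℝ) := Nat.cast_nonneg l
  rw [e1, e2]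
  constructor <;> nlinarith

lemma differentiableOn_comp_add {τ : ℂ} {N : ℕ} {f : ℂ → ℂ}
    (hf : DifferentiableOn ℂ f (latt (N * τ))ᶜ) (l : ℕ) :
    DifferentiableOn ℂ (fun u => f (u + l * τ)) (latt τ)ᶜ :=
  hf.comp (by fun_prop) fun _ hu h => hu (add_mul_mem_latt h)

lemma sum_pow_div {q : ℂ} {N : ℕ} (hq : q ^ N ≠ 1) :
    ∑ l ∈ Finset.range N, q ^ l / (1 - q ^ N) = 1 / (1 - q) := by
  have hq1 : q ≠ 1 := by rintro rfl; simp at hq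
  have h1 : 1 - q ≠ 0 := sub_ne_zero.2 hq1.symm
  have h2 : q - 1 ≠ 0 := sub_ne_zero.2 hq1
  have h3 : 1 - q ^ N ≠ 0 := sub_ne_zero.2 hq.symm
  rw [← Finset.sum_div, geom_sum_eq hq1, div_div, div_eq_div_iff (mul_ne_zero h2 h3) h1]
  ring

/-- Summation of `σ` over an isogeny. -/
lemma sum_sigmaFn {τ : ℂ} (hτ : 0 < τ.im) {N : ℕ} (hN : 0 < N) {w : ℂ} (hw : N * w ∉ latt (N * τ))
    {u : ℂ} (hu : u ∉ latt τ) :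
    ∑ l ∈ Finset.range N, ee (-(l * w)) * sigmaFn (N * w) (u + l * τ) (N * τ) = sigmaFn w u τ := by
  have hNτ := natCast_mul_im_pos hτ hN
  have hw' : w ∉ latt τ := fun h => hw (mul_mem_latt h)
  refine eqOn_compl_latt hτ (DifferentiableOn.fun_sum fun l _ =>
    (differentiableOn_comp_add (differentiableOn_sigmaFn hNτ _ hw) l).const_mul _)
    (differentiableOn_sigmaFn hτ w hw') (fun u h0 h1 => ?_) hu
  -- For `0 < Im u < Im τ` each `u + lτ` with `l < N` lies in the strip of convergence for modulus
  -- `Nτ`. The coefficients of `e(nu)` agree by `∑ q^l / (1 - q^N) = 1/(1 - q)` with `q = e(nτ -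
  -- w)`.
  have hs := hasSum_sum fun l (hl : l ∈ Finset.range N) =>
    have hb := add_mul_im_bounds (Finset.mem_range.1 hl) h0 h1
    (hasSum_sigmaFn hNτ hw hb.1 hb.2).mul_left (ee (-(l * w)))
  have hs2 := hs.unique ((hasSum_sigmaFn hτ hw' h0 h1).congr_fun fun n => ?_)
  · have hpi : (-(1 / (2 * Real.pi * I)) : ℂ) ≠ 0 := neg_ne_zero.2 (one_div_ne_zero two_pi_I_ne_zero)
    refine mul_left_cancel₀ hpi ?_
    rw [← hs2, Finset.mul_sum]
    exact Finset.sum_congr rfl fun l _ => by ring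
  · have e1 : ee (n * (N * τ) - N * w) = ee (n * τ - w) ^ N := by
      rw [← ee_nat_mul]; ring_nf
    have hne : ee (n * τ - w) ^ N ≠ 1 := by
      rw [← e1, sub_eq_add_neg, ee_add]; exact kron_cond hw n
    rw [div_eq_mul_one_div (ee (n * u)), ← sum_pow_div hne, Finset.mul_sum]
    refine Finset.sum_congr rfl fun l _ => ?_
    have e2 : ee (-(l * w)) * ee (n * (u + l * τ)) = ee (n * u) * ee (n * τ - w) ^ l := by
      rw [← ee_nat_mul l, ← ee_add, ← ee_add]; ring_nf
    rw [e1]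
    linear_combination (1 / (1 - ee (n * τ - w) ^ N)) * e2

/-- `e(-k/N)` is a nontrivial `N`-th root of unity. -/
lemma sum_ee_eq_zero {N : ℕ} {k : ℤ} (hk : ¬ (N : ℤ) ∣ k) (hN : 0 < N) :
    ∑ l ∈ Finset.range N, ee (-(k / N : ℂ)) ^ l = 0 ∧ ee (-(k / N : ℂ)) ≠ 1 ∧ ee (-(k / N : ℂ)) ^ N = 1 := by
  have hN' : (N : ℂ) ≠ 0 := by exact_mod_cast hN.ne'
  have h1 : ee (-(k / N : ℂ)) ≠ 1 := by
    intro h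
    obtain ⟨m, hm⟩ := (ee_eq_one_iff _).1 h
    refine hk ⟨-m, ?_⟩
    have : (k : ℂ) = N * -m := by rw [← hm]; field_simp
    exact_mod_cast this
  have h2 : ee (-(k / N : ℂ)) ^ N = 1 := by
    rw [← ee_nat_mul, show (N * -(k / N) : ℂ) = ((-k : ℤ) : ℂ) by push_cast; field_simp, ee_int]
  exact ⟨by rw [geom_sum_eq h1, h2, sub_self, zero_div], h1, h2⟩

lemma ee_int_mul_N_tau {τ : ℂ} (hτ : 0 < τ.im) {N : ℕ} (hN : 0 < N) {n : ℤ} (hn : n ≠ 0) :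
    ee (n * (N * τ)) ≠ 1 := ee_int_mul_tau_ne_one (natCast_mul_im_pos hτ hN) hn

/-- Twisted summation of `χ` over an isogeny. -/
lemma sum_chiFn_twisted {τ : ℂ} (hτ : 0 < τ.im) {N : ℕ} (hN : 0 < N) {k : ℤ} (hk : ¬ (N : ℤ) ∣ k)
    {u : ℂ} (hu : u ∉ latt τ) :
    ∑ l ∈ Finset.range N, ee (-(l * (k / N))) * chiFn (u + l * τ) (N * τ) -
      2 * Real.pi * I / (1 - ee (-(k / N : ℂ))) = sigmaFn (k / N) u τ := by
  have hNτ := natCast_mul_im_pos hτ hN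
  have hN' : (N : ℂ) ≠ 0 := by exact_mod_cast hN.ne'
  obtain ⟨hs0, hk1, hkN⟩ := sum_ee_eq_zero hk hN
  have hw' : (k / N : ℂ) ∉ latt τ := by
    rw [mem_latt_iff]
    rintro ⟨n, hn⟩
    by_cases hn0 : n = 0
    · subst hn0; simp at hn; exact hk1 hn
    · have := congrArg (· ^ N) hn
      simp only [mul_pow, hkN, mul_one, one_pow] at this
      rw [← ee_nat_mul] at this
      exact ee_int_mul_N_tau hτ hN hn0 (by rw [← this]; ring_nf)
  refine eqOn_compl_latt hτ ((DifferentiableOn.fun_sum fun l _ =>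
    (differentiableOn_comp_add (differentiableOn_chiFn hNτ) l).const_mul _).sub_const _)
    (differentiableOn_sigmaFn hτ _ hw') (fun u h0 h1 => ?_) hu
  have hs := hasSum_sum fun l (hl : l ∈ Finset.range N) =>
    have hb := add_mul_im_bounds (Finset.mem_range.1 hl) h0 h1
    (hasSum_chiFn hNτ hb.1 hb.2).mul_left (ee (-(l * (k / N))))
  -- The series of `χ` has no term `n = 0` (it is `1/0 = 0`), whereas that of `σ` has `1/(1 -
  -- e(-k/N))`; this is the correction in the statement. The constants `-1/2` of the `χ`-series
  -- cancel, being weighted by the powers of a nontrivial root of unity.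
  have hs2 := hs.unique (((hasSum_sigmaFn hτ hw' h0 h1).sub
    (hasSum_ite_eq (0 : ℤ) (1 / (1 - ee (-(k / N : ℂ)))))).congr_fun fun n => ?_)
  · have hpi : (2 * Real.pi * I : ℂ) ≠ 0 := two_pi_I_ne_zero
    have e0 : ∀ l : ℕ, ee (-(l * (k / N : ℂ))) = ee (-(k / N : ℂ)) ^ l := fun l => by
      rw [← ee_nat_mul]; ring_nf
    have e1 : ∑ l ∈ Finset.range N, ee (-(l * (k / N : ℂ))) *
        (-(1 / (2 * Real.pi * I)) * chiFn (u + l * τ) (N * τ) - 1 / 2) =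
        -(1 / (2 * Real.pi * I)) * ∑ l ∈ Finset.range N, ee (-(l * (k / N))) * chiFn (u + l * τ) (N * τ) := by
      rw [Finset.mul_sum, ← sub_eq_zero, ← Finset.sum_sub_distrib]
      rw [← mul_zero (-(1 / 2) : ℂ), ← hs0, Finset.mul_sum]
      refine Finset.sum_congr rfl fun l _ => ?_
      rw [← e0]; ring
    rw [e1] at hs2
    have h4 : 1 - ee (-(k / N : ℂ)) ≠ 0 := sub_ne_zero.2 hk1.symm
    set A := ∑ l ∈ Finset.range N, ee (-(l * (k / N : ℂ))) * chiFn (u + l * τ) (N * τ)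
    field_simp at hs2 ⊢
    linear_combination -hs2
  · by_cases hn0 : n = 0
    · subst hn0; simp
    have e1 : ee (n * (N * τ)) = ee (n * τ - k / N) ^ N := by
      have : (n * τ - k / N : ℂ) = n * τ + -(k / N) := by ring
      rw [this, ee_add, mul_pow, hkN, mul_one, ← ee_nat_mul]; ring_nf
    have hne : ee (n * τ - k / N) ^ N ≠ 1 := by
      rw [← e1]; exact ee_int_mul_N_tau hτ hN hn0
    rw [if_neg hn0, sub_zero, div_eq_mul_one_div (ee (n * u)), ← sum_pow_div hne, Finset.mul_sum]
    refine Finset.sum_congr rfl fun l _ => ?_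
    have e2 : ee (-(l * (k / N))) * ee (n * (u + l * τ)) = ee (n * u) * ee (n * τ - k / N) ^ l := by
      rw [← ee_nat_mul l, ← ee_add, ← ee_add]; ring_nf
    rw [e1]
    linear_combination (1 / (1 - ee (n * τ - k / N) ^ N)) * e2

/-- Summation of `χ` over an isogeny. -/
lemma sum_chiFn {τ : ℂ} (hτ : 0 < τ.im) {N : ℕ} (hN : 0 < N) {u : ℂ} (hu : u ∉ latt τ) :
    ∑ l ∈ Finset.range N, chiFn (u + l * τ) (N * τ) + Real.pi * I * (N - 1) = chiFn u τ := by
  have hNτ := natCast_mul_im_pos hτ hN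
  refine eqOn_compl_latt hτ ((DifferentiableOn.fun_sum fun l _ =>
    differentiableOn_comp_add (differentiableOn_chiFn hNτ) l).add_const _)
    (differentiableOn_chiFn hτ) (fun u h0 h1 => ?_) hu
  have hs := hasSum_sum fun l (hl : l ∈ Finset.range N) =>
    have hb := add_mul_im_bounds (Finset.mem_range.1 hl) h0 h1
    (hasSum_chiFn hNτ hb.1 hb.2)
  have hs2 := hs.unique ((hasSum_chiFn hτ h0 h1).congr_fun fun n => ?_)
  · have hpi : (2 * Real.pi * I : ℂ) ≠ 0 := two_pi_I_ne_zero
    -- `N` constants `1/2` on one side against a single one on the other account for `πi (N - 1)`.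
    rw [Finset.sum_sub_distrib, ← Finset.mul_sum, Finset.sum_const, Finset.card_range, nsmul_eq_mul] at hs2
    set A := ∑ l ∈ Finset.range N, chiFn (u + l * τ) (N * τ)
    field_simp at hs2 ⊢
    linear_combination -hs2
  · by_cases hn0 : n = 0
    · subst hn0; simp
    have e1 : ee (n * (N * τ)) = ee (n * τ) ^ N := by
      rw [← ee_nat_mul]; ring_nf
    have hne : ee (n * τ) ^ N ≠ 1 := by
      rw [← e1]; exact ee_int_mul_N_tau hτ hN hn0
    rw [div_eq_mul_one_div (ee (n * u)), ← sum_pow_div hne, Finset.mul_sum]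
    refine Finset.sum_congr rfl fun l _ => ?_
    have e2 : ee (n * (u + l * τ)) = ee (n * u) * ee (n * τ) ^ l := by
      rw [← ee_nat_mul l, ← ee_add]; ring_nf
    rw [e1, ← mul_div_assoc, e2]

end SigmaIdentities

namespace ChevalleyData

variable {𝔤 : Type*} [LieRing 𝔤] [LieAlgebra ℂ 𝔤] [FiniteDimensional ℂ 𝔤]
  [LieAlgebra.IsSimple ℂ 𝔤] (D : ChevalleyData 𝔤)

/-! ## Root space decomposition -/

section RootSpaces

open scoped Classical

attribute [-simp] Finset.univ_eq_attach

lemma root_injective : Function.Injective D.P.root := D.P.root.injective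

lemma rootVal_ext {α α' : D.H.root} (h : ∀ k, D.rootVal α k = D.rootVal α' k) : α = α' :=
  D.root_injective (LinearMap.ext h)

@[simp] lemma rootVal_neg (α : D.H.root) (h : D.H) : D.rootVal (D.neg α) h = -D.rootVal α h := by
  rw [rootVal, neg, RootPairing.root_reflectionPerm, RootPairing.reflection_apply_self]
  rfl

@[simp] lemma rootVal_add (α : D.H.root) (h k : D.H) :
    D.rootVal α (h + k) = D.rootVal α h + D.rootVal α k := map_add _ _ _

@[simp] lemma rootVal_sub (α : D.H.root) (h k : D.H) :
    D.rootVal α (h - k) = D.rootVal α h - D.rootVal α k := map_sub _ _ _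

@[simp] lemma rootVal_smul (α : D.H.root) (c : ℂ) (h : D.H) :
    D.rootVal α (c • h) = c * D.rootVal α h := by simp [rootVal]

@[simp] lemma rootVal_zero (α : D.H.root) : D.rootVal α 0 = 0 := map_zero _

lemma exists_rootVal_ne_zero (α : D.H.root) : ∃ h, D.rootVal α h ≠ 0 := by
  by_contra! h
  exact D.P.ne_zero α (LinearMap.ext h)

@[simp] lemma neg_neg_root (α : D.H.root) : D.neg (D.neg α) = α :=
  D.rootVal_ext fun k => by simp

lemma neg_inj {α α' : D.H.root} : D.neg α = D.neg α' ↔ α = α' :=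
  ⟨fun h => by rw [← D.neg_neg_root α, h, neg_neg_root], fun h => h ▸ rfl⟩

@[simp] lemma ht_neg (α : D.H.root) : D.ht (D.neg α) = -D.ht α :=
  D.base.height_reflectionPerm_self α

lemma ht_ne_zero (α : D.H.root) : D.ht α ≠ 0 := D.base.height_ne_zero α

lemma ht_le (α : D.H.root) : D.ht α ≤ D.ht D.θ := D.θ_max α

lemma neg_ht_le (α : D.H.root) : -D.ht D.θ ≤ D.ht α := by
  have := D.ht_le (D.neg α)
  rw [ht_neg] at this; omega

lemma ht_simple {α : D.H.root} (h : α ∈ D.base.support) : D.ht α = 1 :=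
  RootPairing.Base.height_one_of_mem_support h

lemma ht_θ_pos : 0 < D.ht D.θ := by
  have h1 := D.ht_le D.θ
  have h2 := D.neg_ht_le D.θ
  have h3 := D.ht_ne_zero D.θ
  omega

lemma ht_add {α α' α'' : D.H.root}
    (h : ∀ k, D.rootVal α'' k = D.rootVal α k + D.rootVal α' k) : D.ht α'' = D.ht α + D.ht α' :=
  D.base.height_add (LinearMap.ext h)

lemma rootVal_ρ (α : D.H.root) : D.rootVal α D.ρ = D.ht α := by
  refine D.base.induction_add α (p := fun α => D.rootVal α D.ρ = D.ht α) ?_ ?_ ?_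
  · intro i hi
    change D.rootVal (D.neg i) D.ρ = D.ht (D.neg i)
    rw [rootVal_neg, ht_neg, hi]; simp
  · intro i hi
    rw [D.ht_simple hi]
    simpa [rootVal] using D.ρ_spec i hi
  · intro i j k h hi hj
    have h' : ∀ t, D.rootVal k t = D.rootVal i t + D.rootVal j t := fun t =>
      LinearMap.congr_fun h t
    rw [h', D.ht_add h', hi, D.ht_simple hj, rootVal, D.ρ_spec j hj]; simp

lemma lie_H_E (h : D.H) (α : D.H.root) : ⁅(h : 𝔤), D.E α⁆ = D.rootVal α h • D.E α :=
  IsKilling.lie_eq_smul_of_mem_rootSpace (D.E_mem α) h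

lemma lie_E_H (h : D.H) (α : D.H.root) : ⁅D.E α, (h : 𝔤)⁆ = -(D.rootVal α h • D.E α) := by
  rw [← lie_skew, lie_H_E]

lemma lie_H_H (h k : D.H) : ⁅(h : 𝔤), (k : 𝔤)⁆ = 0 := by
  have : ⁅h, k⁆ = 0 := trivial_lie_zero _ _ _ _
  simpa using congrArg (Subtype.val) this

lemma form_lie (x y z : 𝔤) : D.form ⁅x, y⁆ z = D.form x ⁅y, z⁆ := by
  rw [← lie_skew, map_neg, LinearMap.neg_apply, D.form_inv, neg_neg]

lemma form_lie' (x y z : 𝔤) : D.form ⁅x, y⁆ z = -D.form y ⁅x, z⁆ := D.form_inv x y z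

lemma form_left_cancel {x y : 𝔤} (h : ∀ z, D.form x z = D.form y z) : x = y :=
  sub_eq_zero.1 (D.form_nondeg.1 _ fun z => by
    rw [map_sub, LinearMap.sub_apply, h, sub_self])

@[simp] lemma form_E_neg (α : D.H.root) : D.form (D.E α) (D.E (D.neg α)) = 1 := D.E_norm α

lemma form_E_E_of_ne {α α' : D.H.root} (h : α' ≠ D.neg α) : D.form (D.E α) (D.E α') = 0 := by
  have : ∃ k, D.rootVal α k + D.rootVal α' k ≠ 0 := by
    by_contra! h0
    exact h (D.rootVal_ext fun k => by rw [rootVal_neg]; linear_combination h0 k)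
  obtain ⟨k, hk⟩ := this
  have h1 := D.form_lie' k (D.E α) (D.E α')
  simp only [lie_H_E, map_smul, LinearMap.smul_apply, smul_eq_mul] at h1
  exact (mul_eq_zero.1 (show (D.rootVal α k + D.rootVal α' k) * D.form (D.E α) (D.E α') = 0 by
    linear_combination h1)).resolve_left hk

lemma form_E_E (α α' : D.H.root) :
    D.form (D.E α) (D.E α') = if α' = D.neg α then 1 else 0 := by
  split_ifs with h
  · rw [h, form_E_neg]
  · exact D.form_E_E_of_ne h

@[simp] lemma form_H_E (h : D.H) (α : D.H.root) : D.form (h : 𝔤) (D.E α) = 0 := by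
  obtain ⟨k, hk⟩ := D.exists_rootVal_ne_zero α
  have h1 := D.form_lie (h : 𝔤) (k : 𝔤) (D.E α)
  rw [lie_H_H, lie_H_E, map_zero, LinearMap.zero_apply, map_smul, smul_eq_mul] at h1
  exact (mul_eq_zero.1 h1.symm).resolve_left hk

@[simp] lemma form_E_H (h : D.H) (α : D.H.root) : D.form (D.E α) (h : 𝔤) = 0 := by
  rw [form_comm, form_H_E]

lemma E_ne_zero (α : D.H.root) : D.E α ≠ 0 := fun h => by
  have := D.form_E_neg α
  rw [h] at this; simp at this

lemma mem_rootSpace_iff_smul_E (α : D.H.root) {x : 𝔤}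
    (hx : x ∈ rootSpace D.H (α.1 : D.H → ℂ)) : ∃ c : ℂ, x = c • D.E α := by
  have h1 : Module.finrank ℂ (rootSpace D.H (α.1 : D.H → ℂ)) = 1 :=
    IsKilling.finrank_rootSpace_eq_one α.1 (LieSubalgebra.isNonZero_coe_root α)
  obtain ⟨c, hc⟩ := (finrank_eq_one_iff_of_nonzero'
    (⟨D.E α, D.E_mem α⟩ : rootSpace D.H (α.1 : D.H → ℂ))
    (fun h => D.E_ne_zero α (congrArg Subtype.val h))).1 h1 ⟨x, hx⟩
  exact ⟨c, (congrArg Subtype.val hc).symm⟩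

lemma mem_H_of_mem_rootSpace_zero {x : 𝔤} (hx : x ∈ rootSpace D.H (0 : D.H → ℂ)) : x ∈ D.H := by
  have := LieAlgebra.rootSpace_zero_eq ℂ 𝔤 D.H
  rw [this] at hx
  simpa using hx

@[elab_as_elim]
lemma induction_on {p : 𝔤 → Prop} (x : 𝔤) (hE : ∀ α, p (D.E α)) (hH : ∀ h : D.H, p h)
    (hadd : ∀ y z, p y → p z → p (y + z)) (hsmul : ∀ (c : ℂ) y, p y → p (c • y)) : p x := by
  have h1 : x ∈ (⨆ χ : Weight ℂ D.H 𝔤, genWeightSpace 𝔤 χ : LieSubmodule ℂ D.H 𝔤) := by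
    rw [iSup_genWeightSpace_eq_top' ℂ D.H 𝔤]; trivial
  have h0 : p 0 := by simpa using hH 0
  induction h1 using LieSubmodule.iSup_induction' with
  | mem χ y hy =>
    by_cases hχ : χ.IsNonZero
    · obtain ⟨c, rfl⟩ := D.mem_rootSpace_iff_smul_E ⟨χ, by simpa using hχ⟩ hy
      exact hsmul _ _ (hE _)
    · have h2 : (χ : D.H → ℂ) = 0 := not_not.1 hχ
      have h3 := D.mem_H_of_mem_rootSpace_zero (x := y) (by rw [← h2]; exact hy)
      exact hH ⟨y, h3⟩
  | zero => exact h0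
  | add y z _ _ hy hz => exact hadd _ _ hy hz

lemma linearMap_ext {V : Type*} [AddCommGroup V] [Module ℂ V] {f f' : 𝔤 →ₗ[ℂ] V}
    (hE : ∀ α, f (D.E α) = f' (D.E α)) (hH : ∀ h : D.H, f h = f' h) : f = f' := by
  ext x
  refine D.induction_on x hE hH ?_ ?_
  · intro y z hy hz; rw [map_add, map_add, hy, hz]
  · intro c y hy; rw [map_smul, map_smul, hy]

lemma proj_apply (α : D.H.root) (x : 𝔤) : D.proj α x = D.form x (D.E (D.neg α)) • D.E α := rfl

lemma proj_E (α α' : D.H.root) : D.proj α (D.E α') = if α = α' then D.E α' else 0 := by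
  rw [proj_apply, form_E_E]
  by_cases h : α = α'
  · subst h; simp
  · rw [if_neg (fun h' => h (D.neg_inj.1 h')), if_neg h, zero_smul]

@[simp] lemma proj_H (α : D.H.root) (h : D.H) : D.proj α h = 0 := by
  simp [proj_apply]

lemma proj₀_apply (x : 𝔤) : D.proj₀ x = x - ∑ α, D.proj α x := by simp [proj₀]

@[simp] lemma proj₀_H (h : D.H) : D.proj₀ h = h := by simp [proj₀_apply]

@[simp] lemma proj₀_E (α : D.H.root) : D.proj₀ (D.E α) = 0 := by
  simp [proj₀_apply, proj_E]

lemma proj₀_mem (x : 𝔤) : D.proj₀ x ∈ D.H := by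
  refine D.induction_on x (by simp) (by simp) ?_ ?_
  · intro y z hy hz; rw [map_add]; exact D.H.add_mem hy hz
  · intro c y hy; rw [map_smul]; exact D.H.smul_mem _ hy

lemma proj₀_add_sum (x : 𝔤) : D.proj₀ x + ∑ α, D.proj α x = x := by simp [proj₀_apply]

lemma proj_proj (α α' : D.H.root) (x : 𝔤) :
    D.proj α (D.proj α' x) = if α = α' then D.proj α x else 0 := by
  rw [D.proj_apply α' x, map_smul, proj_E]
  split_ifs with h
  · rw [h, proj_apply]
  · simp

lemma lie_H (h : D.H) (x : 𝔤) : ⁅(h : 𝔤), x⁆ = ∑ α, D.rootVal α h • D.proj α x := by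
  conv_lhs => rw [← D.proj₀_add_sum x]
  rw [lie_add, show ⁅(h : 𝔤), D.proj₀ x⁆ = 0 from D.lie_H_H h ⟨_, D.proj₀_mem x⟩, zero_add, lie_sum]
  refine Finset.sum_congr rfl fun α _ => ?_
  rw [proj_apply, lie_smul, lie_H_E, smul_comm]

lemma form_H_nondeg {h : D.H} (hh : ∀ k : D.H, D.form (h : 𝔤) k = 0) : h = 0 := by
  refine Subtype.ext (D.form_left_cancel fun z => ?_)
  rw [ZeroMemClass.coe_zero, map_zero, LinearMap.zero_apply]
  refine D.induction_on z (by simp) hh ?_ ?_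
  · intro y z hy hz; rw [map_add, hy, hz, add_zero]
  · intro c y hy; rw [map_smul, hy, smul_zero]

/-- An element on which `𝔥` acts by zero lies in `𝔥`. -/
lemma mem_H_of_lie {x : 𝔤} (hx : ∀ h : D.H, ⁅(h : 𝔤), x⁆ = 0) : x ∈ D.H := by
  have h1 : ∀ α, D.proj α x = 0 := by
    intro α
    obtain ⟨k, hk⟩ := D.exists_rootVal_ne_zero α
    have h2 : D.proj α ⁅(k : 𝔤), x⁆ = D.rootVal α k • D.proj α x := by
      rw [lie_H, map_sum]
      simp [proj_proj]
    rw [hx, map_zero] at h2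
    exact (smul_eq_zero.1 h2.symm).resolve_left hk
  rw [← D.proj₀_add_sum x]
  simpa [h1] using D.proj₀_mem x

/-- `h_α = [E_α, E_{-α}]`. -/
def cor (α : D.H.root) : D.H :=
  ⟨⁅D.E α, D.E (D.neg α)⁆, D.mem_H_of_lie fun h => by
    rw [leibniz_lie, lie_H_E, lie_H_E, rootVal_neg, smul_lie, lie_smul]; simp⟩

lemma lie_E_neg (α : D.H.root) : ⁅D.E α, D.E (D.neg α)⁆ = D.cor α := rfl

lemma form_cor (α : D.H.root) (h : D.H) : D.form (D.cor α : 𝔤) h = D.rootVal α h := by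
  rw [← lie_E_neg, form_lie, lie_E_H]
  simp

lemma form_cor' (α : D.H.root) (h : D.H) : D.form (h : 𝔤) (D.cor α) = D.rootVal α h := by
  rw [form_comm, form_cor]

lemma torusAd_apply (h : D.H) (x : 𝔤) :
    D.torusAd h x = D.proj₀ x + ∑ α, Complex.exp (D.rootVal α h) • D.proj α x := by
  simp [torusAd]

@[simp] lemma torusAd_E (h : D.H) (α : D.H.root) :
    D.torusAd h (D.E α) = Complex.exp (D.rootVal α h) • D.E α := by
  simp [torusAd_apply, proj_E]

@[simp] lemma torusAd_H (h k : D.H) : D.torusAd h k = k := by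
  simp [torusAd_apply]

/-- An eigenvector of `ad h` has components only in root spaces (and in `𝔥`) with that eigenvalue.
Thus a bracket of root vectors is covered whether its weight is a root, zero or neither. -/
lemma torusAd_of_lie {h : D.H} {x : 𝔤} {c : ℂ} (hx : ⁅(h : 𝔤), x⁆ = c • x) :
    D.torusAd h x = Complex.exp c • x := by
  have h1 : ∀ α, Complex.exp (D.rootVal α h) • D.proj α x = Complex.exp c • D.proj α x := by
    intro α
    have h2 : D.proj α ⁅(h : 𝔤), x⁆ = D.rootVal α h • D.proj α x := by
      rw [lie_H, map_sum]; simp [proj_proj]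
    rw [hx, map_smul] at h2
    by_cases h3 : D.proj α x = 0
    · simp [h3]
    · rw [smul_left_injective ℂ h3 h2]
  have h0 : D.proj₀ x = Complex.exp c • D.proj₀ x := by
    have h2 : D.proj₀ ⁅(h : 𝔤), x⁆ = 0 := by
      rw [lie_H, map_sum]; simp [proj_apply]
    rw [hx, map_smul] at h2
    rcases smul_eq_zero.1 h2 with rfl | h2
    · simp
    · simp [h2]
  rw [torusAd_apply, Finset.sum_congr rfl fun α _ => h1 α, h0, ← Finset.smul_sum, ← smul_add,
    proj₀_add_sum]

lemma torusAd_lie (h : D.H) (x y : 𝔤) :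
    D.torusAd h ⁅x, y⁆ = ⁅D.torusAd h x, D.torusAd h y⁆ := by
  refine D.induction_on x (fun α => ?_) (fun k => ?_) ?_ ?_
  · refine D.induction_on y (fun α' => ?_) (fun k => ?_) ?_ ?_
    · rw [torusAd_E, torusAd_E, smul_lie, lie_smul, smul_smul, ← Complex.exp_add]
      refine D.torusAd_of_lie ?_
      rw [leibniz_lie, lie_H_E, lie_H_E, smul_lie, lie_smul, add_smul]
    · rw [lie_E_H, map_neg, map_smul, torusAd_E, torusAd_H, smul_lie, lie_E_H, smul_neg,
        smul_comm]
    · intro y z hy hz; rw [lie_add, map_add, map_add, hy, hz, lie_add]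
    · intro c y hy; rw [lie_smul, map_smul, map_smul, hy, lie_smul]
  · refine D.induction_on y (fun α' => ?_) (fun k' => ?_) ?_ ?_
    · rw [lie_H_E, map_smul, torusAd_E, torusAd_H, lie_smul, lie_H_E, smul_comm]
    · rw [lie_H_H, torusAd_H, torusAd_H, lie_H_H, map_zero]
    · intro y z hy hz; rw [lie_add, map_add, map_add, hy, hz, lie_add]
    · intro c y hy; rw [lie_smul, map_smul, map_smul, hy, lie_smul]
  · intro y z hy hz; rw [add_lie, map_add, map_add, hy, hz, add_lie]
  · intro c y hy; rw [smul_lie, map_smul, map_smul, hy, smul_lie]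

lemma form_torusAd (h : D.H) (x y : 𝔤) :
    D.form (D.torusAd h x) (D.torusAd h y) = D.form x y := by
  refine D.induction_on x (fun α => ?_) (fun k => ?_) ?_ ?_
  · refine D.induction_on y (fun α' => ?_) (fun k => ?_) ?_ ?_
    · rw [torusAd_E, torusAd_E, map_smul, map_smul, LinearMap.smul_apply, form_E_E]
      split_ifs with h'
      · subst h'
        rw [rootVal_neg, smul_eq_mul, smul_eq_mul, mul_one, ← Complex.exp_add, neg_add_cancel,
          Complex.exp_zero]
      · simp
    · simp
    · intro y z hy hz; rw [map_add, map_add, map_add, hy, hz]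
    · intro c y hy; rw [map_smul, map_smul, map_smul, hy]
  · refine D.induction_on y (fun α' => ?_) (fun k' => ?_) ?_ ?_
    · simp
    · simp
    · intro y z hy hz; rw [map_add, map_add, map_add, hy, hz]
    · intro c y hy; rw [map_smul, map_smul, map_smul, hy]
  · intro y z hy hz; simp only [map_add, LinearMap.add_apply, hy, hz]
  · intro c y hy; simp only [map_smul, LinearMap.smul_apply, hy]

end RootSpaces

end ChevalleyData

namespace ChevalleyData

variable {𝔤 : Type*} [LieRing 𝔤] [LieAlgebra ℂ 𝔤] [FiniteDimensional ℂ 𝔤]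
  [LieAlgebra.IsSimple ℂ 𝔤] (D : ChevalleyData 𝔤)

/-! ### Simple root vectors generate `𝔤`; invariant forms are unique up to a scalar. -/

section Generation

open scoped Classical

attribute [-simp] Finset.univ_eq_attach

lemma exists_sl2 (α : D.H.root) : ∃ c : ℂ, c ≠ 0 ∧ ∃ f : 𝔤,
    IsSl2Triple (IsKilling.coroot α.1 : 𝔤) (c • D.E α) f := by
  obtain ⟨h, e, f, ht, he, hf⟩ := IsKilling.exists_isSl2Triple_of_weight_isNonZero
    (LieSubalgebra.isNonZero_coe_root α)
  obtain ⟨c, rfl⟩ := D.mem_rootSpace_iff_smul_E α he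
  have h1 := ht.h_eq_coroot (LieSubalgebra.isNonZero_coe_root α) he hf
  refine ⟨c, ?_, f, h1 ▸ ht⟩
  rintro rfl
  exact ht.e_ne_zero (zero_smul _ _)

/-- A vector killed by `E_α` is primitive for the `sl(2)` of `α`, and in finite dimension the weight
of a primitive vector is a natural number. -/
lemma exists_nat_of_lie_eq_zero {α : D.H.root} {x : 𝔤} {μ : ℂ} (hx : x ≠ 0)
    (hμ : ⁅(IsKilling.coroot α.1 : 𝔤), x⁆ = μ • x) (h0 : ⁅D.E α, x⁆ = 0) : ∃ n : ℕ, μ = n := by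
  obtain ⟨c, -, f, ht⟩ := D.exists_sl2 α
  have P : ht.HasPrimitiveVectorWith x μ :=
    { ne_zero := hx
      lie_h := hμ
      lie_e := by rw [smul_lie, h0, smul_zero] }
  exact P.exists_nat

lemma rootVal_coroot (α : D.H.root) : D.rootVal α (IsKilling.coroot α.1) = 2 :=
  IsKilling.root_apply_coroot (LieSubalgebra.isNonZero_coe_root α)

/-- If a sum of two roots is a root, the bracket of the root vectors is nonzero. -/
lemma lie_E_E {α α' α'' : D.H.root}
    (h : ∀ k, D.rootVal α'' k = D.rootVal α k + D.rootVal α' k) :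
    ∃ c : ℂ, c ≠ 0 ∧ ⁅D.E α, D.E α'⁆ = c • D.E α'' := by
  have h1 : ⁅D.E α, D.E α'⁆ ∈ rootSpace D.H (α''.1 : D.H → ℂ) := by
    have := lie_mem_genWeightSpace_of_mem_genWeightSpace (D.E_mem α) (D.E_mem α')
    have e : (α''.1 : D.H → ℂ) = (α.1 : D.H → ℂ) + (α'.1 : D.H → ℂ) := by
      funext k; exact h k
    rwa [e]
  obtain ⟨c, hc⟩ := D.mem_rootSpace_iff_smul_E α'' h1
  refine ⟨c, ?_, hc⟩
  rintro rfl
  rw [zero_smul] at hc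
  -- If the bracket vanished, `α'` would take a value `n ≥ 0` on the coroot of `α`, and by
  -- invariance `E_α` would also kill `E_{-α''}`. The latter would then be primitive of weight `-(n
  -- + 2) < 0`.
  obtain ⟨n, hn⟩ := D.exists_nat_of_lie_eq_zero (D.E_ne_zero α') (D.lie_H_E _ α') hc
  have h3 : ⁅D.E α, D.E (D.neg α'')⁆ = 0 := by
    have h4 : ⁅D.E α, D.E (D.neg α'')⁆ ∈ rootSpace D.H ((D.neg α').1 : D.H → ℂ) := by
      have := lie_mem_genWeightSpace_of_mem_genWeightSpace (D.E_mem α) (D.E_mem (D.neg α''))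
      have e : ((D.neg α').1 : D.H → ℂ) = (α.1 : D.H → ℂ) + ((D.neg α'').1 : D.H → ℂ) := by
        funext k
        change D.rootVal (D.neg α') k = D.rootVal α k + D.rootVal (D.neg α'') k
        rw [rootVal_neg, rootVal_neg, h]; ring
      rwa [e]
    obtain ⟨d, hd⟩ := D.mem_rootSpace_iff_smul_E _ h4
    have h5 := D.form_lie' (D.E α) (D.E α') (D.E (D.neg α''))
    rw [hc, hd, map_zero, LinearMap.zero_apply, map_smul, form_E_neg, smul_eq_mul, mul_one] at h5
    rw [hd, neg_eq_zero.1 h5.symm, zero_smul]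
  obtain ⟨m, hm⟩ := D.exists_nat_of_lie_eq_zero (D.E_ne_zero (D.neg α''))
    (D.lie_H_E _ _) h3
  rw [rootVal_neg, h, rootVal_coroot, hn] at hm
  have : ((m + n + 2 : ℕ) : ℂ) = 0 := by push_cast; linear_combination -hm
  exact absurd (Nat.cast_eq_zero.1 this) (by omega)

/-- Two elements of `𝔥` with the same simple root values are equal. -/
lemma H_ext_simple {h k : D.H} (e : ∀ i ∈ D.base.support, D.rootVal i h = D.rootVal i k) :
    h = k := by
  rw [← sub_eq_zero]
  refine (Module.forall_dual_apply_eq_zero_iff ℂ (h - k)).1 fun G => ?_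
  have hG : G ∈ Submodule.span ℂ (Set.range D.base.toWeightBasis) := by
    rw [Module.Basis.span_eq]; trivial
  refine Submodule.span_induction (p := fun G _ => G (h - k) = 0) ?_ (by simp) ?_ ?_ hG
  · rintro _ ⟨i, rfl⟩
    rw [RootPairing.Base.toWeightBasis_apply, map_sub]
    exact sub_eq_zero.2 (e i i.2)
  · intro G G' _ _ h h'; rw [LinearMap.add_apply, h, h', add_zero]
  · intro c G _ h; rw [LinearMap.smul_apply, h, smul_zero]

/-- The `h_{α_i}` span `𝔥`. -/
lemma span_cor : Submodule.span ℂ (Set.range fun i : D.base.support => D.cor i) = ⊤ := by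
  by_contra hS
  obtain ⟨k, hk⟩ := not_forall.1 (fun h => hS (eq_top_iff.2 fun x _ => h x))
  obtain ⟨F, hF, hF'⟩ := Submodule.exists_le_ker_of_notMem hk
  have h4 : F ∈ Submodule.span ℂ (Set.range D.base.toWeightBasis) := by
    rw [Module.Basis.span_eq]; trivial
  -- Simple roots span the dual of `𝔥` and are represented through the form by the `h_{α_i}`. A
  -- functional killing all of these is represented by an element with zero simple root values.
  have h5 : ∃ t : D.H, ∀ s : D.H, F s = D.form (t : 𝔤) s := by
    refine Submodule.span_induction (p := fun F _ => ∃ t : D.H, ∀ s : D.H, F s = D.form (t : 𝔤) s)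
      ?_ ⟨0, by simp⟩ ?_ ?_ h4
    · rintro _ ⟨i, rfl⟩
      exact ⟨D.cor i, fun s => by
        rw [form_cor, RootPairing.Base.toWeightBasis_apply]; rfl⟩
    · rintro F F' - - ⟨t, ht⟩ ⟨t', ht'⟩
      exact ⟨t + t', fun s => by simp [ht, ht']⟩
    · rintro c F - ⟨t, ht⟩
      exact ⟨c • t, fun s => by simp [ht]⟩
  obtain ⟨t, ht⟩ := h5
  have h6 : t = 0 := D.H_ext_simple fun i hi => by
    rw [← form_cor', ← ht, rootVal_zero]
    exact hF' (Submodule.subset_span ⟨⟨i, hi⟩, rfl⟩)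
  exact hF (by rw [ht, h6]; simp)

/-- The simple root vectors `E_{±α_i}` generate `𝔤`. -/
lemma lieHom_ext {L : Type*} [LieRing L] [LieAlgebra ℂ L] {f f' : 𝔤 →ₗ⁅ℂ⁆ L}
    (h : ∀ i ∈ D.base.support, f (D.E i) = f' (D.E i))
    (h' : ∀ i ∈ D.base.support, f (D.E (D.neg i)) = f' (D.E (D.neg i))) : f = f' := by
  have key : ∀ α, f (D.E α) = f' (D.E α) ∧ f (D.E (D.neg α)) = f' (D.E (D.neg α)) := by
    intro α
    refine D.base.induction_add α
      (p := fun α => f (D.E α) = f' (D.E α) ∧ f (D.E (D.neg α)) = f' (D.E (D.neg α))) ?_ ?_ ?_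
    · intro i hi
      change f (D.E (D.neg i)) = f' (D.E (D.neg i)) ∧
        f (D.E (D.neg (D.neg i))) = f' (D.E (D.neg (D.neg i)))
      rw [neg_neg_root]; exact hi.symm
    · exact fun i hi => ⟨h i hi, h' i hi⟩
    · intro i j k hk hi hj
      have hk' : ∀ t, D.rootVal k t = D.rootVal i t + D.rootVal j t := fun t =>
        LinearMap.congr_fun hk t
      have aux : ∀ i j k : D.H.root, (∀ t, D.rootVal k t = D.rootVal i t + D.rootVal j t) →
          f (D.E i) = f' (D.E i) → f (D.E j) = f' (D.E j) → f (D.E k) = f' (D.E k) := by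
        intro i j k hk hi hj
        obtain ⟨c, hc, e⟩ := D.lie_E_E hk
        have e1 := congrArg f e
        have e2 := congrArg f' e
        rw [LieHom.map_lie, map_smul] at e1 e2
        rw [hi, hj, e2] at e1
        exact (smul_right_injective L hc e1).symm
      exact ⟨aux i j k hk' hi.1 (h j hj), aux _ _ _ (fun t => by
        rw [rootVal_neg, rootVal_neg, rootVal_neg, hk']; ring) hi.2 (h' j hj)⟩
  have := D.linearMap_ext (f := (f : 𝔤 →ₗ[ℂ] L)) (f' := (f' : 𝔤 →ₗ[ℂ] L)) (fun α => (key α).1) ?_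
  · exact LieHom.ext fun x => LinearMap.congr_fun this x
  intro k
  have h2 : (k : 𝔤) ∈ Submodule.span ℂ (Set.range fun i : D.base.support => (D.cor i : 𝔤)) := by
    have h3 : k ∈ Submodule.span ℂ (Set.range fun i : D.base.support => D.cor i) := by
      rw [span_cor]; trivial
    have := Submodule.mem_map_of_mem (f := D.H.toSubmodule.subtype) h3
    rwa [Submodule.map_span, ← Set.range_comp] at this
  have h4 : Submodule.span ℂ (Set.range fun i : D.base.support => (D.cor i : 𝔤)) ≤
      LinearMap.eqLocus (f : 𝔤 →ₗ[ℂ] L) (f' : 𝔤 →ₗ[ℂ] L) := by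
    rw [Submodule.span_le]
    rintro _ ⟨α, rfl⟩
    change f (D.cor α) = f' (D.cor α)
    rw [← lie_E_neg, LieHom.map_lie, LieHom.map_lie, (key α).1, (key α).2]
  exact h4 h2

/-- Invariant bilinear forms on `𝔤` are proportional. -/
lemma exists_eq_smul_form (F : LinearMap.BilinForm ℂ 𝔤)
    (hF : ∀ x y z : 𝔤, F ⁅x, y⁆ z = -F y ⁅x, z⁆) : ∃ c : ℂ, F = c • D.form := by
  -- Schur's lemma: the operator relating `F` to the given form commutes with `ad 𝔤`, so each of its
  -- eigenspaces is an ideal, and a nonzero one is all of `𝔤`.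
  let A : 𝔤 →ₗ[ℂ] 𝔤 := (D.form.toDual D.form_nondeg).symm.toLinearMap ∘ₗ F
  have hA : ∀ x y, D.form (A x) y = F x y := fun x y =>
    LinearMap.congr_fun ((D.form.toDual D.form_nondeg).apply_symm_apply (F x)) y
  have hAl : ∀ x y, A ⁅x, y⁆ = ⁅x, A y⁆ := fun x y => D.form_left_cancel fun z => by
    rw [hA, hF, form_lie', hA]
  have : Nontrivial 𝔤 := ⟨⟨D.E D.θ, 0, D.E_ne_zero _⟩⟩
  obtain ⟨c, hc⟩ := Module.End.exists_eigenvalue A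
  let I : LieIdeal ℂ 𝔤 :=
    { Module.End.eigenspace A c with
      lie_mem := by
        intro x y hy
        have hy' : A y = c • y := Module.End.mem_eigenspace_iff.1 hy
        exact Module.End.mem_eigenspace_iff.2 (by rw [hAl, hy', lie_smul]) }
  have hI : I = ⊤ := by
    refine (LieAlgebra.IsSimple.eq_bot_or_eq_top I).resolve_left fun h => ?_
    obtain ⟨v, hv, hv0⟩ := hc.exists_hasEigenvector
    have : v ∈ I := hv
    rw [h] at this
    exact hv0 (by simpa using this)
  refine ⟨c, LinearMap.ext fun x => LinearMap.ext fun y => ?_⟩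
  have hx : x ∈ I := by rw [hI]; trivial
  rw [← hA, (Module.End.mem_eigenspace_iff.1 hx : A x = c • x)]; simp

end Generation

end ChevalleyData

namespace ChevalleyData

variable {𝔤 : Type*} [LieRing 𝔤] [LieAlgebra ℂ 𝔤] [FiniteDimensional ℂ 𝔤]
  [LieAlgebra.IsSimple ℂ 𝔤]

/-! ### The automorphism `β`: action on root vectors, on `𝔥` and on the form. -/

section TwistSection

open scoped Classical

attribute [-simp] Finset.univ_eq_attach

/-- The hypotheses on `g`, `T`, `B`, `β` of the twisted realization. -/
structure Twist (D : ChevalleyData 𝔤) (g : ℕ) (T : Equiv.Perm D.Node)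
    (B : D.Affine ≃ₗ⁅ℂ⁆ D.Affine) (β : 𝔤 ≃ₗ⁅ℂ⁆ 𝔤) : Prop where
  aut : D.IsDiagramAut T
  pos : 0 < g
  deg : ∀ i, D.degree g (T i) = D.degree g i
  lift : D.IsLift g T B
  ind : D.Induces g B β

variable (D : ChevalleyData 𝔤)

lemma mono_apply (m n : ℤ) (x : 𝔤) : (mono m x : Loop 𝔤) n = if m = n then x else 0 := by
  simp [mono, Finsupp.single_apply]

lemma loopElt_injective (m : ℤ) : Function.Injective (D.loopElt m) := by
  intro x y h
  have h1 : (mono m x : Loop 𝔤) = mono m y := congrArg Prod.fst h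
  have h2 := DFunLike.congr_fun h1 m
  simpa [mono_apply] using h2

lemma phiInv_loopElt_E (g : ℕ) (m : ℤ) (α : D.H.root) :
    D.phiInv g (D.loopElt m (D.E α)) = D.loopElt (D.ht α + m * g) (D.E α) := by
  refine Prod.ext ?_ (Prod.ext ?_ ?_)
  · change loopLift _ (mono m (D.E α)) - ((0 : ℂ) / g) • mono 0 (D.ρ : 𝔤) = mono _ (D.E α)
    rw [loopLift_mono, zero_div, zero_smul, sub_zero, LinearMap.add_apply, LinearMap.sum_apply,
      LinearMap.comp_apply, proj₀_E, map_zero, add_zero, Finset.sum_eq_single α]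
    · simp [proj_E]
    · intro α' _ h; simp [proj_E, h]
    · simp
  · change D.form D.ρ ((mono m (D.E α) : Loop 𝔤) 0) + g * (0 : ℂ) - 0 / g * D.form D.ρ D.ρ = 0
    rw [mono_apply]
    split_ifs <;> simp
  · change (0 : ℂ) / g = 0
    simp

lemma phiInv_loopElt_H (g : ℕ) (m : ℤ) (h : D.H) :
    D.phiInv g (D.loopElt m h) =
      D.loopElt (m * g) h + (if m = 0 then D.form D.ρ h else 0 : ℂ) • D.cElt := by
  refine Prod.ext ?_ (Prod.ext ?_ ?_)
  · change loopLift _ (mono m (h : 𝔤)) - ((0 : ℂ) / g) • mono 0 (D.ρ : 𝔤) =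
      mono _ (h : 𝔤) + (if m = 0 then D.form D.ρ h else 0 : ℂ) • (0 : Loop 𝔤)
    rw [loopLift_mono, zero_div, zero_smul, sub_zero, LinearMap.add_apply, LinearMap.sum_apply,
      LinearMap.comp_apply, proj₀_H, smul_zero, add_zero, Finset.sum_eq_zero, zero_add]
    intro α' _; simp
  · change D.form D.ρ ((mono m (h : 𝔤) : Loop 𝔤) 0) + g * (0 : ℂ) - 0 / g * D.form D.ρ D.ρ =
      0 + (if m = 0 then D.form D.ρ h else 0 : ℂ) * 1
    rw [mono_apply]
    split_ifs <;> simp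
  · change (0 : ℂ) / g = 0 + (if m = 0 then D.form D.ρ h else 0 : ℂ) * 0
    simp

lemma phiInv_cElt (g : ℕ) : D.phiInv g D.cElt = (g : ℂ) • D.cElt := by
  refine Prod.ext ?_ (Prod.ext ?_ ?_)
  · change loopLift _ (0 : Loop 𝔤) - ((0 : ℂ) / g) • mono 0 (D.ρ : 𝔤) = (g : ℂ) • (0 : Loop 𝔤)
    simp
  · change D.form D.ρ ((0 : Loop 𝔤) 0) + g * (1 : ℂ) - 0 / g * D.form D.ρ D.ρ = (g : ℂ) * 1
    simp
  · change (0 : ℂ) / g = (g : ℂ) * 0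
    simp

/-- The correction `-(ρ, h) c / g` in `φ(h)` cancels the central term which `φ⁻¹` produces at degree
zero. -/
lemma phiInv_phiH {g : ℕ} (hg : 0 < g) (h : D.H) :
    D.phiInv g (D.phiH g h) = D.loopElt 0 (h : 𝔤) := by
  have hg' : (g : ℂ) ≠ 0 := by exact_mod_cast hg.ne'
  rw [phiH, map_sub, map_smul, phiInv_cElt, phiInv_loopElt_H, smul_smul, if_pos rfl,
    div_mul_cancel₀ _ hg', zero_mul, add_sub_cancel_right]

variable {D} {g : ℕ} {T : Equiv.Perm D.Node} {B : D.Affine ≃ₗ⁅ℂ⁆ D.Affine} {β : 𝔤 ≃ₗ⁅ℂ⁆ 𝔤}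
  (W : D.Twist g T B β)

namespace Twist

include W

/-- In the twisted realization `e_i` is `E_{α_i} t^{deg e_i}`. Since `T` preserves degrees, `e_i`
and `e_{Ti}` carry the same power of `t`, and the coefficients can be compared. -/
lemma beta_E (i : D.Node) : β (D.E (D.nodeRoot i)) = D.E (D.nodeRoot (T i)) := by
  have h1 : ∀ i, D.phiInv g (D.eGen i) = D.loopElt (D.degree g i) (D.E (D.nodeRoot i)) :=
    fun i => D.phiInv_loopElt_E g _ _
  have h2 := W.ind _ _ _ (h1 i)
  rw [W.lift.1, h1, W.deg] at h2
  exact (D.loopElt_injective _ h2).symm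

lemma beta_E_neg (i : D.Node) :
    β (D.E (D.neg (D.nodeRoot i))) = D.E (D.neg (D.nodeRoot (T i))) := by
  have h1 : ∀ i, D.phiInv g (D.fGen i) =
      D.loopElt (-D.degree g i) (D.E (D.neg (D.nodeRoot i))) := fun i => by
    rw [fGen, phiInv_loopElt_E, ht_neg, degree]
    congr 1; ring
  have h2 := W.ind _ _ _ (h1 i)
  rw [W.lift.2.1, h1, W.deg] at h2
  exact (D.loopElt_injective _ h2).symm

lemma phiInv_iterate (l : ℕ) {y : D.Affine} {m : ℤ} {x : 𝔤}
    (h : D.phiInv g y = D.loopElt m x) : D.phiInv g (B^[l] y) = D.loopElt m (β^[l] x) := by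
  induction l with
  | zero => exact h
  | succ l ih => rw [Function.iterate_succ_apply', Function.iterate_succ_apply', W.ind _ _ _ ih]

/-- The pullback of the form by `β` is invariant, hence a multiple of it; the pair `E_{±α_0}`, sent
to another normalized pair, shows that the factor is `1`. -/
lemma form_beta (x y : 𝔤) : D.form (β x) (β y) = D.form x y := by
  obtain ⟨c, hc⟩ := D.exists_eq_smul_form
    (D.form.compl₁₂ (β : 𝔤 →ₗ[ℂ] 𝔤) (β : 𝔤 →ₗ[ℂ] 𝔤)) (fun x y z => by
      simp only [LinearMap.compl₁₂_apply]
      change D.form (β ⁅x, y⁆) (β z) = -D.form (β y) (β ⁅x, z⁆)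
      rw [LieEquiv.map_lie, LieEquiv.map_lie, form_lie'])
  have h : ∀ x y, D.form (β x) (β y) = c * D.form x y := fun x y =>
    LinearMap.congr_fun (LinearMap.congr_fun hc x) y
  have h1 := h (D.E (D.nodeRoot none)) (D.E (D.neg (D.nodeRoot none)))
  rw [W.beta_E, W.beta_E_neg, form_E_neg, form_E_neg, mul_one] at h1
  rw [h, ← h1, one_mul]

lemma beta_cor (i : D.Node) :
    β (D.cor (D.nodeRoot i) : 𝔤) = (D.cor (D.nodeRoot (T i)) : 𝔤) := by
  rw [← lie_E_neg, LieEquiv.map_lie, W.beta_E, W.beta_E_neg, lie_E_neg]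

lemma beta_mem_H (h : D.H) : β (h : 𝔤) ∈ D.H := by
  have h3 : h ∈ Submodule.span ℂ (Set.range fun i : D.base.support => D.cor i) := by
    rw [span_cor]; trivial
  refine Submodule.span_induction (p := fun (h : D.H) _ => β (h : 𝔤) ∈ D.H) ?_ (by simp) ?_ ?_ h3
  · rintro _ ⟨i, rfl⟩
    have := W.beta_cor (some i)
    rw [nodeRoot] at this
    rw [this]; exact (D.cor _).2
  · intro y z _ _ hy hz; rw [AddMemClass.coe_add, map_add]; exact D.H.add_mem hy hz
  · intro c y _ hy; rw [SetLike.val_smul, map_smul]; exact D.H.smul_mem _ hy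

omit W in
/-- The restriction of `β` to `𝔥`. -/
def betaH (W : D.Twist g T B β) : D.H →ₗ[ℂ] D.H :=
  (β : 𝔤 →ₗ[ℂ] 𝔤).restrict (p := D.H.toSubmodule) (q := D.H.toSubmodule)
    (fun h hh => W.beta_mem_H ⟨h, hh⟩)

omit W in
@[simp] lemma coe_betaH (W : D.Twist g T B β) (h : D.H) : (W.betaH h : 𝔤) = β h := rfl

lemma rootVal_betaH (i : D.Node) (h : D.H) :
    D.rootVal (D.nodeRoot (T i)) (W.betaH h) = D.rootVal (D.nodeRoot i) h := by
  have h1 := congrArg β (D.lie_H_E h (D.nodeRoot i))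
  rw [LieEquiv.map_lie, map_smul, W.beta_E, ← W.coe_betaH, lie_H_E] at h1
  exact smul_left_injective ℂ (D.E_ne_zero _) h1

omit W in
lemma _root_.ChevalleyData.mem_lSub_iff {h : D.H} :
    h ∈ D.lSub T ↔ ∀ i, D.rootVal (D.nodeRoot (T i)) h = D.rootVal (D.nodeRoot i) h := by
  simp only [lSub, Submodule.mem_iInf, LinearMap.mem_ker, LinearMap.sub_apply, sub_eq_zero, rootVal]

omit W in
lemma _root_.ChevalleyData.H_ext_node {h k : D.H}
    (e : ∀ i : D.Node, D.rootVal (D.nodeRoot i) h = D.rootVal (D.nodeRoot i) k) : h = k :=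
  D.H_ext_simple fun i hi => e (some ⟨i, hi⟩)

/-- `β` permutes the values of the affine simple roots according to `T`, so `𝔩` is the fixed space
of `β` in `𝔥`. -/
lemma mem_lSub_iff_beta {h : D.H} : h ∈ D.lSub T ↔ β (h : 𝔤) = h := by
  rw [ChevalleyData.mem_lSub_iff]
  constructor
  · intro hh
    have : W.betaH h = h := D.H_ext_node fun i => by
      obtain ⟨j, rfl⟩ := T.surjective i
      rw [W.rootVal_betaH, hh]
    exact congrArg Subtype.val this
  · intro hh i
    have : W.betaH h = h := Subtype.ext hh
    conv_lhs => rw [← this]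
    rw [W.rootVal_betaH]

lemma beta_iterate_E (l : ℕ) (i : D.Node) :
    β^[l] (D.E (D.nodeRoot i)) = D.E (D.nodeRoot ((T ^ l) i)) := by
  induction l with
  | zero => rfl
  | succ l ih => rw [Function.iterate_succ_apply', ih, W.beta_E, pow_succ', Equiv.Perm.mul_apply]

lemma beta_iterate_E_neg (l : ℕ) (i : D.Node) :
    β^[l] (D.E (D.neg (D.nodeRoot i))) = D.E (D.neg (D.nodeRoot ((T ^ l) i))) := by
  induction l with
  | zero => rfl
  | succ l ih =>
    rw [Function.iterate_succ_apply', ih, W.beta_E_neg, pow_succ', Equiv.Perm.mul_apply]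

omit W in
/-- The powers of an automorphism, as homomorphisms. -/
def _root_.ChevalleyData.lieIter (β : 𝔤 ≃ₗ⁅ℂ⁆ 𝔤) : ℕ → (𝔤 →ₗ⁅ℂ⁆ 𝔤)
  | 0 => LieHom.id
  | l + 1 => (β : 𝔤 →ₗ⁅ℂ⁆ 𝔤).comp (lieIter β l)

omit W in
lemma _root_.ChevalleyData.lieIter_apply (β : 𝔤 ≃ₗ⁅ℂ⁆ 𝔤) (l : ℕ) (x : 𝔤) :
    lieIter β l x = β^[l] x := by
  induction l with
  | zero => rfl
  | succ l ih => rw [Function.iterate_succ_apply', ← ih]; rfl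

/-- It suffices to check this on the generators `E_{±α_i}`, where `β` acts through `T`. -/
lemma beta_iterate_orderOf (x : 𝔤) : β^[orderOf T] x = x := by
  rw [← lieIter_apply]
  have : lieIter β (orderOf T) = LieHom.id := by
    refine D.lieHom_ext (fun i hi => ?_) fun i hi => ?_
    · rw [lieIter_apply]
      have := W.beta_iterate_E (orderOf T) (some ⟨i, hi⟩)
      rw [pow_orderOf_eq_one] at this
      exact this
    · rw [lieIter_apply]
      have := W.beta_iterate_E_neg (orderOf T) (some ⟨i, hi⟩)
      rw [pow_orderOf_eq_one] at this
      exact this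
  rw [this]; rfl

/-- An element of `𝔥` whose simple root values agree modulo `2πi` with those of its image under `T`
acts on `𝔤` by an automorphism that commutes with `β`. -/
lemma beta_torusAd {h : D.H} (hh : ∀ i, Complex.exp (D.rootVal (D.nodeRoot (T i)) h) =
    Complex.exp (D.rootVal (D.nodeRoot i) h)) (x : 𝔤) :
    β (D.torusAd h x) = D.torusAd h (β x) := by
  let A : 𝔤 →ₗ⁅ℂ⁆ 𝔤 := { D.torusAd h with map_lie' := fun {x y} => D.torusAd_lie h x y }
  have hA : ∀ x, A x = D.torusAd h x := fun x => rfl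
  have : (β : 𝔤 →ₗ⁅ℂ⁆ 𝔤).comp A = A.comp (β : 𝔤 →ₗ⁅ℂ⁆ 𝔤) := by
    refine D.lieHom_ext (fun i hi => ?_) fun i hi => ?_
    · have h1 := W.beta_E (some ⟨i, hi⟩)
      have h2 := hh (some ⟨i, hi⟩)
      change β (D.torusAd h _) = D.torusAd h (β _)
      change β (D.E i) = _ at h1
      rw [torusAd_E, map_smul, h1, torusAd_E, h2]; rfl
    · have h1 := W.beta_E_neg (some ⟨i, hi⟩)
      have h2 := hh (some ⟨i, hi⟩)
      change β (D.torusAd h _) = D.torusAd h (β _)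
      change β (D.E (D.neg i)) = _ at h1
      rw [torusAd_E, map_smul, h1, torusAd_E, rootVal_neg, rootVal_neg, Complex.exp_neg,
        Complex.exp_neg, h2]; rfl
  exact LieHom.congr_fun this x

omit W in
lemma _root_.ChevalleyData.rootVal_node_ρ (i : D.Node) :
    D.rootVal (D.nodeRoot i) D.ρ = D.degree g i - D.nodeLevel i * g := by
  rw [rootVal_ρ, degree]; push_cast; ring

omit W in
variable (D g) in
/-- `γ = Ad(e^{2πiρ/g})`. -/
def _root_.ChevalleyData.gam : 𝔤 →ₗ[ℂ] 𝔤 :=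
  D.torusAd ((2 * Real.pi * Complex.I / g) • D.ρ)

/-- On an affine simple root `ρ` takes the value `deg e_i` minus `g` times its `δ`-coefficient.
Degrees are `T`-invariant, so after scaling by `2πi/g` the values at `i` and `Ti` differ by a
multiple of `2πi`. -/
lemma beta_gam (x : 𝔤) : β (D.gam g x) = D.gam g (β x) := by
  refine W.beta_torusAd (fun i => ?_) x
  have hg' : (g : ℂ) ≠ 0 := by exact_mod_cast W.pos.ne'
  rw [rootVal_smul, rootVal_smul, ChevalleyData.rootVal_node_ρ (g := g),
    ChevalleyData.rootVal_node_ρ (g := g), W.deg, Complex.exp_eq_exp_iff_exists_int]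
  refine ⟨D.nodeLevel i - D.nodeLevel (T i), ?_⟩
  field_simp
  push_cast
  ring

/-- Either `T` fixes the affine node, or `g = |θ| + 1`. -/
lemma ρ_mem_or : D.ρ ∈ D.lSub T ∨ (g : ℤ) = D.ht D.θ + 1 := by
  by_cases h : T none = none
  · left
    rw [ChevalleyData.mem_lSub_iff]
    intro i
    rw [rootVal_ρ, rootVal_ρ]
    rcases i with _ | i
    · rw [h]
    · obtain ⟨j, hj⟩ : ∃ j, T (some i) = some j := by
        refine Option.ne_none_iff_exists'.1 fun h' => ?_
        exact Option.some_ne_none i (T.injective (h'.trans h.symm))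
      rw [hj]
      change ((D.ht j : ℤ) : ℂ) = (D.ht i : ℤ)
      rw [D.ht_simple j.2, D.ht_simple i.2]
  · right
    obtain ⟨j, hj⟩ := Option.ne_none_iff_exists'.1 h
    have h1 := W.deg none
    rw [hj, degree, degree, nodeRoot, nodeRoot, nodeLevel, nodeLevel, ht_neg, D.ht_simple j.2] at h1
    omega

/-- No root of height divisible by `g` vanishes on `𝔩`. -/
lemma not_dvd_ht {α : D.H.root} (h : ∀ k ∈ D.lSub T, D.rootVal α k = 0) : ¬(g : ℤ) ∣ D.ht α := by
  intro hd
  have h0 := D.ht_ne_zero α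
  rcases W.ρ_mem_or with h1 | h1
  · have := h _ h1
    rw [rootVal_ρ] at this
    exact h0 (by exact_mod_cast this)
  · have h2 := D.ht_le α
    have h3 := D.neg_ht_le α
    exact h0 (Int.eq_zero_of_abs_lt_dvd hd (abs_lt.2 ⟨by omega, by omega⟩))

lemma form_beta_sub (h : 𝔤) {k : D.H} (hk : k ∈ D.lSub T) : D.form (β h - h) k = 0 := by
  have h1 := W.form_beta h k
  rw [W.mem_lSub_iff_beta.1 hk] at h1
  rw [map_sub, LinearMap.sub_apply, h1, sub_self]

end Twist

end TwistSection

end ChevalleyData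

namespace ChevalleyData

variable {𝔤 : Type*} [LieRing 𝔤] [LieAlgebra ℂ 𝔤] [FiniteDimensional ℂ 𝔤]
  [LieAlgebra.IsSimple ℂ 𝔤]

/-! ### Orthogonal decomposition of `𝔥`, Cayley transforms, and the dimension of `𝔩`. -/

section Adapted

open scoped Classical

attribute [-simp] Finset.univ_eq_attach

variable {D : ChevalleyData 𝔤} {g : ℕ} {T : Equiv.Perm D.Node} {B : D.Affine ≃ₗ⁅ℂ⁆ D.Affine}
  {β : 𝔤 ≃ₗ⁅ℂ⁆ 𝔤} {a b : ℕ} {x : Module.Basis (Fin a ⊕ Fin b) ℂ D.H}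

lemma mem_lPerp_iff {h : D.H} : h ∈ D.lPerp T ↔ ∀ k ∈ D.lSub T, D.form (k : 𝔤) h = 0 := by
  simp only [lPerp, Submodule.mem_iInf, LinearMap.mem_ker, Subtype.forall]
  rfl

lemma IsAdapted.form_basis (hx : D.IsAdapted T x) (h : D.H) (i : Fin a ⊕ Fin b) :
    D.form (h : 𝔤) (x i) = x.repr h i := by
  conv_lhs => rw [← x.sum_repr h]
  simp only [AddSubmonoidClass.coe_finsetSum, SetLike.val_smul, map_sum, map_smul,
    LinearMap.sum_apply, LinearMap.smul_apply, hx.1, smul_eq_mul]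
  simp

lemma IsAdapted.sum_form (hx : D.IsAdapted T x) (h : D.H) :
    ∑ i, D.form (h : 𝔤) (x i) • x i = h := by
  simp only [hx.form_basis, x.sum_repr]

lemma IsAdapted.lSub_eq (hx : D.IsAdapted T x) :
    D.lSub T = Submodule.span ℂ (Set.range fun i => x (Sum.inl i)) := by
  refine le_antisymm (fun h hh => ?_) ?_
  · rw [← hx.sum_form h, Fintype.sum_sum_type]
    refine Submodule.add_mem _ ?_ ?_
    · exact Submodule.sum_mem _ fun i _ =>
        Submodule.smul_mem _ _ (Submodule.subset_span ⟨i, rfl⟩)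
    · rw [Finset.sum_eq_zero]
      · exact Submodule.zero_mem _
      · intro i _
        rw [mem_lPerp_iff.1 (hx.2.2 i) h hh, zero_smul]
  · rw [Submodule.span_le]
    rintro _ ⟨i, rfl⟩
    exact hx.2.1 i

lemma IsAdapted.finrank_lSub (hx : D.IsAdapted T x) : Module.finrank ℂ (D.lSub T) = a := by
  rw [hx.lSub_eq]
  have := finrank_span_eq_card (R := ℂ) (b := fun i => x (Sum.inl i : Fin a ⊕ Fin b))
    (x.linearIndependent.comp Sum.inl Sum.inl_injective)
  rw [this, Fintype.card_fin]

namespace Twist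

variable (W : D.Twist g T B β)

include W

lemma mem_lPerp_of_beta_sub (h : D.H) : W.betaH h - h ∈ D.lPerp T := by
  rw [mem_lPerp_iff]
  intro k hk
  rw [form_comm, AddSubgroupClass.coe_sub, W.coe_betaH]
  exact W.form_beta_sub h hk

lemma beta_mem_lPerp {h : D.H} (hh : h ∈ D.lPerp T) : W.betaH h ∈ D.lPerp T := by
  rw [← sub_add_cancel (W.betaH h) h]
  exact Submodule.add_mem _ (W.mem_lPerp_of_beta_sub h) hh

lemma eq_zero_of_mem_of_mem (hx : D.IsAdapted T x) {h : D.H} (h1 : h ∈ D.lSub T)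
    (h2 : h ∈ D.lPerp T) : h = 0 := by
  rw [← hx.sum_form h]
  refine Finset.sum_eq_zero fun i _ => ?_
  rcases i with i | i
  · rw [form_comm, mem_lPerp_iff.1 h2 _ (hx.2.1 i), zero_smul]
  · rw [mem_lPerp_iff.1 (hx.2.2 i) h h1, zero_smul]

/-- `β - 1` maps `𝔩^⊥` to itself injectively, because its kernel in `𝔥` is `𝔩` and `𝔩 ∩ 𝔩^⊥ = 0`. So
the equation has a solution and the choice operator returns one. -/
lemma betaCayley_spec (hx : D.IsAdapted T x) {h : D.H} (hh : h ∈ D.lPerp T) :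
    D.betaCayley T β h ∈ D.lPerp T ∧
      β (D.betaCayley T β h : 𝔤) - D.betaCayley T β h = β (h : 𝔤) + h := by
  let A : D.lPerp T →ₗ[ℂ] D.lPerp T :=
    (W.betaH - LinearMap.id).restrict (fun k _ => W.mem_lPerp_of_beta_sub k)
  have hA : Function.Injective A := by
    rw [← LinearMap.ker_eq_bot, LinearMap.ker_eq_bot']
    intro k hk
    have h1 : W.betaH k - k = (0 : D.H) := congrArg Subtype.val hk
    have h2 : (k : D.H) ∈ D.lSub T :=
      W.mem_lSub_iff_beta.2 (congrArg Subtype.val (sub_eq_zero.1 h1))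
    exact Subtype.ext (W.eq_zero_of_mem_of_mem hx h2 k.2)
  obtain ⟨y, hy⟩ := LinearMap.injective_iff_surjective.1 hA
    ⟨W.betaH h + h, Submodule.add_mem _ (W.beta_mem_lPerp hh) hh⟩
  have h1 : W.betaH y - y = W.betaH h + h := congrArg Subtype.val hy
  exact Classical.epsilon_spec (p := fun y => y ∈ D.lPerp T ∧ β (y : 𝔤) - y = β (h : 𝔤) + h)
    ⟨y, y.2, congrArg Subtype.val h1⟩

/-- The two defining predicates are equivalent, hence equal, so the choice operator picks the same
element; uniqueness of the solution is not involved. -/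
lemma cayley_eq (h : D.H) : D.cayley T h = D.betaCayley T β h := by
  unfold cayley betaCayley
  congr 1
  funext y
  refine propext (and_congr_right fun _ => ?_)
  rw [show (β (y : 𝔤) - y = β (h : 𝔤) + h ↔ W.betaH y - y = W.betaH h + h) from
    ⟨fun e => Subtype.ext e, fun e => congrArg Subtype.val e⟩]
  constructor
  · intro hy
    refine D.H_ext_node fun i => ?_
    obtain ⟨j, rfl⟩ := T.surjective i
    rw [rootVal_sub, rootVal_add, W.rootVal_betaH, W.rootVal_betaH]
    exact hy j
  · intro hy i
    rw [← W.rootVal_betaH i y, ← W.rootVal_betaH i h, ← rootVal_sub, hy, rootVal_add]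

end Twist

/-- The coefficients of the affine simple roots in the relation `∑ aᵢ αᵢ = 0` on `𝔥`. -/
def nodeMark (D : ChevalleyData 𝔤) : D.Node → ℂ
  | none => 1
  | some i => D.base.toWeightBasis.repr (D.P.root D.θ) i

lemma sum_nodeMark (D : ChevalleyData 𝔤) (v : D.Node → ℂ) (h : D.H)
    (hv : ∀ i : D.base.support, v (some i) = D.rootVal i h) :
    ∑ i, D.nodeMark i * v i = v none + D.rootVal D.θ h := by
  rw [Fintype.sum_option, nodeMark, one_mul]
  congr 1
  conv_rhs => rw [rootVal, ← D.base.toWeightBasis.sum_repr (D.P.root D.θ)]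
  rw [LinearMap.sum_apply]
  refine Finset.sum_congr rfl fun i _ => ?_
  rw [hv, LinearMap.smul_apply, RootPairing.Base.toWeightBasis_apply]; rfl

lemma exists_rootVal_eq (D : ChevalleyData 𝔤) (v : D.base.support → ℂ) :
    ∃ h : D.H, ∀ i : D.base.support, D.rootVal i h = v i := by
  let A : D.H →ₗ[ℂ] (D.base.support → ℂ) := LinearMap.pi fun i => D.P.root i
  have hA : Function.Injective A := fun h k e => D.H_ext_simple fun i hi => congrFun e ⟨i, hi⟩
  have hd : Module.finrank ℂ D.H = Module.finrank ℂ (D.base.support → ℂ) := by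
    rw [← Subspace.dual_finrank_eq, Module.finrank_eq_card_basis D.base.toWeightBasis,
      Module.finrank_fintype_fun_eq_card]
  obtain ⟨h, hh⟩ := (LinearMap.injective_iff_surjective_of_finrank_eq_finrank hd).1 hA v
  exact ⟨h, fun i => congrFun hh i⟩

/-- The dimension of `𝔩` is the number of orbits of `T` minus one. -/
lemma finrank_lSub_add_one (D : ChevalleyData 𝔤) (T : Equiv.Perm D.Node) :
    Module.finrank ℂ (D.lSub T) + 1 = Nat.card (Quotient (Equiv.Perm.SameCycle.setoid T)) := by
  let Q := Quotient (Equiv.Perm.SameCycle.setoid T)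
  have : Fintype Q := Fintype.ofFinite Q
  let mk : D.Node → Q := fun i => Quotient.mk _ i
  -- An element of `𝔩` is a function on the orbits of nodes subject only to the linear relation
  -- among the affine simple roots. Thus `𝔩` is the kernel of this functional on `ℂ^d`.
  let F : (Q → ℂ) →ₗ[ℂ] ℂ :=
    { toFun := fun v => ∑ i, D.nodeMark i * v (mk i)
      map_add' := fun v w => by simp [mul_add, Finset.sum_add_distrib]
      map_smul' := fun c v => by
        simp only [Pi.smul_apply, smul_eq_mul, RingHom.id_apply, Finset.mul_sum]
        exact Finset.sum_congr rfl fun i _ => by ring }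
  -- On the constant function `1` its value is `1 + |θ|`, as evaluation at `ρ` shows.
  have hF : F ≠ 0 := by
    intro h
    have h1 : ∑ i, D.nodeMark i * (1 : ℂ) = 0 := LinearMap.congr_fun h (fun _ => 1)
    rw [D.sum_nodeMark (fun _ => 1) D.ρ (fun i => by rw [rootVal_ρ, D.ht_simple i.2]; simp),
      rootVal_ρ] at h1
    have h2 : (1 + D.ht D.θ : ℤ) = 0 := by exact_mod_cast h1
    have := D.ht_θ_pos
    omega
  have hinv : ∀ h ∈ D.lSub T, ∀ i j, T.SameCycle i j →
      D.rootVal (D.nodeRoot i) h = D.rootVal (D.nodeRoot j) h := by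
    intro h hh i j hij
    rw [mem_lSub_iff] at hh
    have hn : ∀ (n : ℕ) i, D.rootVal (D.nodeRoot ((T ^ n) i)) h = D.rootVal (D.nodeRoot i) h := by
      intro n
      induction n with
      | zero => intro i; rfl
      | succ n ih => intro i; rw [pow_succ', Equiv.Perm.mul_apply, hh, ih]
    obtain ⟨n, -, -, hn'⟩ := hij.exists_pow_eq''
    rw [← hn', hn]
  let Φ : D.lSub T →ₗ[ℂ] LinearMap.ker F :=
    { toFun := fun h => ⟨fun q => Quotient.lift (fun i => D.rootVal (D.nodeRoot i) h.1)
          (fun i j hij => hinv h.1 h.2 i j hij) q, by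
        rw [LinearMap.mem_ker]
        change ∑ i, D.nodeMark i * D.rootVal (D.nodeRoot i) h.1 = 0
        rw [D.sum_nodeMark _ h.1 (fun i => rfl), nodeRoot, rootVal_neg, neg_add_cancel]⟩
      map_add' := fun h k => by
        refine Subtype.ext (funext fun q => ?_)
        obtain ⟨i, rfl⟩ := Quotient.exists_rep q
        exact D.rootVal_add _ _ _
      map_smul' := fun c k => by
        refine Subtype.ext (funext fun q => ?_)
        obtain ⟨i, rfl⟩ := Quotient.exists_rep q
        exact D.rootVal_smul _ _ _ }
  have hΦ : Function.Bijective Φ := by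
    constructor
    · intro h k e
      refine Subtype.ext (D.H_ext_node fun i => ?_)
      exact congrFun (congrArg Subtype.val e) (mk i)
    · rintro ⟨v, hv⟩
      obtain ⟨h, hh⟩ := D.exists_rootVal_eq fun i => v (mk (some i))
      have hall : ∀ i, D.rootVal (D.nodeRoot i) h = v (mk i) := by
        rintro (_ | i)
        · have h1 : ∑ i, D.nodeMark i * v (mk i) = 0 := hv
          rw [D.sum_nodeMark _ h (fun i => (hh i).symm)] at h1
          rw [nodeRoot, rootVal_neg]
          linear_combination -h1
        · exact hh i
      have hT : ∀ i, mk (T i) = mk i := fun i =>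
        Quotient.sound (Equiv.Perm.sameCycle_apply_left.2 (Equiv.Perm.SameCycle.refl T i))
      refine ⟨⟨h, mem_lSub_iff.2 fun i => ?_⟩, Subtype.ext (funext fun q => ?_)⟩
      · rw [hall, hall, hT]
      · obtain ⟨i, rfl⟩ := Quotient.exists_rep q
        exact hall i
  rw [(LinearEquiv.ofBijective Φ hΦ).finrank_eq]
  have h1 := F.finrank_range_add_finrank_ker
  rw [LinearMap.range_eq_top.2 (LinearMap.surjective hF), finrank_top, Module.finrank_self,
    Module.finrank_fintype_fun_eq_card, add_comm] at h1
  rw [h1, Nat.card_eq_fintype_card]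

end Adapted

end ChevalleyData

namespace ChevalleyData

variable {𝔤 : Type*} [LieRing 𝔤] [LieAlgebra ℂ 𝔤] [FiniteDimensional ℂ 𝔤]
  [LieAlgebra.IsSimple ℂ 𝔤]

/-! ### Tensors as operators through the invariant form. -/

section Contractions

variable (D : ChevalleyData 𝔤) {V : Type*} [AddCommGroup V] [Module ℂ V]

/-- The contraction `a ⊗ v ↦ (x, a) v`. -/
def contr : 𝔤 →ₗ[ℂ] 𝔤 ⊗[ℂ] V →ₗ[ℂ] V :=
  (TensorProduct.lift.equiv (RingHom.id ℂ) 𝔤 V V).toLinearMap ∘ₗ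
    (LinearMap.llcomp ℂ 𝔤 ℂ (V →ₗ[ℂ] V) (LinearMap.lsmul ℂ V)) ∘ₗ D.form

@[simp] lemma contr_tmul (x a : 𝔤) (v : V) : D.contr x (a ⊗ₜ[ℂ] v) = D.form x a • v := by
  simp [contr]

/-- The functional `a ⊗ b ↦ (x, a) (y, b)`. -/
def pr (x y : 𝔤) : Module.Dual ℂ (𝔤 ⊗[ℂ] 𝔤) := D.form y ∘ₗ D.contr x

@[simp] lemma pr_tmul (x y a b : 𝔤) : D.pr x y (a ⊗ₜ[ℂ] b) = D.form x a * D.form y b := by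
  simp [pr]

lemma pr_add_left (x x' y : 𝔤) : D.pr (x + x') y = D.pr x y + D.pr x' y := by
  ext t; simp [pr]

lemma pr_add_right (x y y' : 𝔤) : D.pr x (y + y') = D.pr x y + D.pr x y' := by
  ext t; simp [pr, mul_add]

lemma pr_smul_left (c : ℂ) (x y : 𝔤) : D.pr (c • x) y = c • D.pr x y := by
  ext t; simp [pr]

lemma pr_smul_right (c : ℂ) (x y : 𝔤) : D.pr x (c • y) = c • D.pr x y := by
  ext t; simp [pr]

/-- The contraction `a ⊗ b ↦ (y, b) a`. -/
def contr' (y : 𝔤) : 𝔤 ⊗[ℂ] 𝔤 →ₗ[ℂ] 𝔤 := D.contr y ∘ₗ (TensorProduct.comm ℂ 𝔤 𝔤).toLinearMap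

@[simp] lemma contr'_tmul (y a b : 𝔤) : D.contr' y (a ⊗ₜ[ℂ] b) = D.form y b • a := by
  simp [contr']

lemma form_contr' (x y : 𝔤) (t : 𝔤 ⊗[ℂ] 𝔤) : D.form x (D.contr' y t) = D.pr x y t := by
  induction t with
  | zero => simp
  | tmul a b => simp [mul_comm]
  | add s t hs ht => rw [map_add, map_add, map_add, hs, ht]

lemma form_contr (x y : 𝔤) (t : 𝔤 ⊗[ℂ] 𝔤) : D.form y (D.contr x t) = D.pr x y t := rfl

lemma exists_dual_bases : ∃ (n : ℕ) (e d : Fin n → 𝔤), ∀ v : 𝔤, ∑ i, D.form (d i) v • e i = v := by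
  classical
  let e := Module.finBasis ℂ 𝔤
  let d := D.form.dualBasis D.form_nondeg e
  refine ⟨_, e, d, fun v => ?_⟩
  conv_rhs => rw [← e.sum_repr v]
  refine Finset.sum_congr rfl fun i _ => ?_
  congr 1
  conv_lhs => rw [← e.sum_repr v]
  rw [map_sum, Finset.sum_eq_single i]
  · rw [map_smul, LinearMap.BilinForm.apply_dualBasis_left, if_pos rfl, smul_eq_mul, mul_one]
  · intro j _ hj
    rw [map_smul, LinearMap.BilinForm.apply_dualBasis_left, if_neg hj, smul_zero]
  · simp

lemma contr_ext {t : 𝔤 ⊗[ℂ] V} (h : ∀ x, D.contr x t = 0) : t = 0 := by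
  obtain ⟨n, e, d, hed⟩ := D.exists_dual_bases
  have h1 : ∀ t : 𝔤 ⊗[ℂ] V, ∑ i, e i ⊗ₜ[ℂ] D.contr (d i) t = t := by
    intro t
    induction t with
    | zero => simp
    | tmul a v =>
      simp only [contr_tmul, ← TensorProduct.smul_tmul]
      rw [← TensorProduct.sum_tmul, hed]
    | add s t hs ht =>
      simp only [map_add, TensorProduct.tmul_add, Finset.sum_add_distrib, hs, ht]
  rw [← h1 t]
  simp [h]

lemma form_right_cancel {x y : 𝔤} (h : ∀ z, D.form z x = D.form z y) : x = y :=
  D.form_left_cancel fun z => by rw [D.form_comm x, D.form_comm y, h]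

/-- By nondegeneracy, convergence and differentiability need to be checked only on products of
pairings with the form. -/
lemma dual_eq_sum_pr (ψ : Module.Dual ℂ (𝔤 ⊗[ℂ] 𝔤)) :
    ∃ (n : ℕ) (c : Fin n → Fin n → ℂ) (d : Fin n → 𝔤), ψ = ∑ i, ∑ j, c i j • D.pr (d i) (d j) := by
  obtain ⟨n, e, d, hed⟩ := D.exists_dual_bases
  refine ⟨n, fun i j => ψ (e i ⊗ₜ[ℂ] e j), d, TensorProduct.ext' fun a b => ?_⟩
  conv_lhs => rw [← hed a, ← hed b]
  simp only [TensorProduct.sum_tmul, TensorProduct.tmul_sum, map_sum, LinearMap.sum_apply,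
    LinearMap.smul_apply, pr_tmul, ← TensorProduct.smul_tmul', TensorProduct.tmul_smul, map_smul,
    smul_eq_mul, Finset.mul_sum]
  rw [Finset.sum_comm]
  exact Finset.sum_congr rfl fun i _ => Finset.sum_congr rfl fun j _ => by ring

end Contractions

/-! ### Joint eigenvectors of `ad 𝔩`, `γ` and `β`. -/

section Homogeneous

open scoped Classical

attribute [-simp] Finset.univ_eq_attach

variable (D : ChevalleyData 𝔤) (g : ℕ) (T : Equiv.Perm D.Node) (β : 𝔤 ≃ₗ⁅ℂ⁆ 𝔤) {a b : ℕ}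
  (x : Module.Basis (Fin a ⊕ Fin b) ℂ D.H)

/-- `v` is a common eigenvector of `ad 𝔩`, `γ` and `β`. -/
structure IsHom (μ : Fin a → ℂ) (j k : ℤ) (v : 𝔤) : Prop where
  lie : ∀ i, ⁅(x (Sum.inl i) : 𝔤), v⁆ = μ i • v
  gam : D.gam g v = ee (j / g) • v
  beta : β v = ee (k / orderOf T) • v

variable {D g T β x}

lemma gam_E (α : D.H.root) : D.gam g (D.E α) = ee (D.ht α / g) • D.E α := by
  rw [gam, torusAd_E, rootVal_smul, rootVal_ρ, ee]
  congr 2; ring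

@[simp] lemma gam_H (h : D.H) : D.gam g h = h := by rw [gam, torusAd_H]

lemma form_gam (u v : 𝔤) : D.form (D.gam g u) (D.gam g v) = D.form u v := D.form_torusAd _ _ _

lemma gam_lie (u v : 𝔤) : D.gam g ⁅u, v⁆ = ⁅D.gam g u, D.gam g v⁆ := D.torusAd_lie _ _ _

lemma orderOf_T_pos : 0 < orderOf T := orderOf_pos T

/-- The projection, up to a factor, to an eigenspace of `β`. -/
def eigProj (T : Equiv.Perm D.Node) (β : 𝔤 ≃ₗ⁅ℂ⁆ 𝔤) (k : ℤ) (v : 𝔤) : 𝔤 :=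
  ∑ l ∈ Finset.range (orderOf T), ee (-(l * (k / orderOf T))) • β^[l] v

variable {B : D.Affine ≃ₗ⁅ℂ⁆ D.Affine} (W : D.Twist g T B β)

lemma ee_orderOf (k : ℤ) : ee ((orderOf T : ℕ) * (k / orderOf T : ℂ)) = 1 := by
  have : ((orderOf T : ℕ) : ℂ) ≠ 0 := by exact_mod_cast (orderOf_T_pos (T := T)).ne'
  rw [mul_div_cancel₀ _ this, ee_int]

namespace Twist

include W

/-- Applying `β` shifts the summation index cyclically, since `β^N = 1`. -/
lemma beta_eigProj (k : ℤ) (v : 𝔤) :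
    β (eigProj T β k v) = ee (k / orderOf T) • eigProj T β k v := by
  let f : ℕ → 𝔤 := fun l => ee (-(l * (k / orderOf T))) • β^[l] v
  have h0 : f (orderOf T) = f 0 := by
    simp only [f]
    rw [W.beta_iterate_orderOf, ee_neg, ee_orderOf]; simp [ee_zero]
  have h1 : ∑ l ∈ Finset.range (orderOf T), f (l + 1) = ∑ l ∈ Finset.range (orderOf T), f l := by
    have h2 := Finset.sum_range_succ f (orderOf T)
    rw [Finset.sum_range_succ', h0] at h2
    exact add_right_cancel h2
  change _ = _ • ∑ l ∈ Finset.range (orderOf T), f l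
  rw [← h1, eigProj, map_sum, Finset.smul_sum]
  refine Finset.sum_congr rfl fun l _ => ?_
  simp only [f]
  rw [map_smul, Function.iterate_succ_apply', smul_smul, ← ee_add]
  congr 2; push_cast; ring

-- Orthogonality of characters of `ℤ/N`: after exchanging the sums only `l = 0` survives.
omit W in
lemma _root_.ChevalleyData.sum_eigProj (v : 𝔤) :
    ∑ k ∈ Finset.range (orderOf T), eigProj T β k v = (orderOf T : ℂ) • v := by
  unfold eigProj
  rw [Finset.sum_comm, Finset.sum_eq_single 0]
  · simp [ee_zero, Nat.cast_smul_eq_nsmul]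
  · intro l hl hl0
    rw [← Finset.sum_smul]
    have h1 : ¬((orderOf T : ℕ) : ℤ) ∣ (l : ℤ) := by
      intro h
      have := Nat.le_of_dvd (Nat.pos_of_ne_zero hl0) (Int.natCast_dvd_natCast.1 h)
      exact absurd (Finset.mem_range.1 hl) (by omega)
    have h2 := sum_ee_eq_zero h1 (orderOf_T_pos (T := T))
    rw [show ∑ k ∈ Finset.range (orderOf T), ee (-((l : ℕ) * (((k : ℕ) : ℤ) / (orderOf T : ℕ) : ℂ))) =
      ∑ k ∈ Finset.range (orderOf T), ee (-((k : ℕ) * (((l : ℕ) : ℤ) / (orderOf T : ℕ) : ℂ))) from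
      Finset.sum_congr rfl fun k _ => by congr 1; push_cast; ring]
    rw [Finset.sum_congr rfl fun k _ => show ee (-((k : ℕ) * (((l : ℕ) : ℤ) / (orderOf T : ℕ) : ℂ)))
      = ee (-(((l : ℕ) : ℤ) / (orderOf T : ℕ) : ℂ)) ^ k by rw [← ee_nat_mul]; congr 1; ring]
    rw [h2.1, zero_smul]
  · intro h; exact absurd (Finset.mem_range.2 (orderOf_T_pos (T := T))) h

lemma beta_lie_lSub {h : D.H} (hh : h ∈ D.lSub T) (v : 𝔤) : ⁅(h : 𝔤), β v⁆ = β ⁅(h : 𝔤), v⁆ := by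
  rw [LieEquiv.map_lie, W.mem_lSub_iff_beta.1 hh]

lemma isHom_eigProj (hx : D.IsAdapted T x) {μ : Fin a → ℂ} {j : ℤ} {v : 𝔤}
    (h1 : ∀ i, ⁅(x (Sum.inl i) : 𝔤), v⁆ = μ i • v) (h2 : D.gam g v = ee (j / g) • v) (k : ℤ) :
    D.IsHom g T β x μ j k (eigProj T β k v) where
  lie i := by
    have : ∀ l, ⁅(x (Sum.inl i) : 𝔤), β^[l] v⁆ = μ i • β^[l] v := by
      intro l
      induction l with
      | zero => exact h1 i
      | succ l ih => rw [Function.iterate_succ_apply', W.beta_lie_lSub (hx.2.1 i), ih, map_smul]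
    rw [eigProj, lie_sum, Finset.smul_sum]
    exact Finset.sum_congr rfl fun l _ => by rw [lie_smul, this, smul_comm]
  gam := by
    have : ∀ l, D.gam g (β^[l] v) = ee (j / g) • β^[l] v := by
      intro l
      induction l with
      | zero => exact h2
      | succ l ih => rw [Function.iterate_succ_apply', ← W.beta_gam, ih, map_smul]
    rw [eigProj, map_sum, Finset.smul_sum]
    exact Finset.sum_congr rfl fun l _ => by rw [map_smul, this, smul_comm]
  beta := W.beta_eigProj k v

/-- Homogeneous elements span `𝔤`. -/
lemma hom_induction (hx : D.IsAdapted T x) {p : 𝔤 → Prop} (v : 𝔤)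
    (hh : ∀ μ j k v, D.IsHom g T β x μ j k v → p v) (hadd : ∀ y z, p y → p z → p (y + z))
    (hsmul : ∀ (c : ℂ) y, p y → p (c • y)) : p v := by
  have hN : ((orderOf T : ℕ) : ℂ) ≠ 0 := by exact_mod_cast (orderOf_T_pos (T := T)).ne'
  have h0 : p 0 := hh 0 0 0 0 ⟨by simp, by simp, by simp⟩
  have key : ∀ (μ : Fin a → ℂ) (j : ℤ) (v : 𝔤), (∀ i, ⁅(x (Sum.inl i) : 𝔤), v⁆ = μ i • v) →
      D.gam g v = ee (j / g) • v → p v := by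
    intro μ j v h1 h2
    -- Averaging over `β` splits a joint eigenvector of `ad 𝔩` and `γ` without changing its weights,
    -- because `β` commutes with both. Root vectors and elements of `𝔥` are such eigenvectors.
    have h3 : v = (orderOf T : ℂ)⁻¹ • ∑ k ∈ Finset.range (orderOf T), eigProj T β k v := by
      rw [sum_eigProj, smul_smul, inv_mul_cancel₀ hN, one_smul]
    rw [h3]
    exact hsmul _ _ (Finset.sum_induction _ p hadd h0
      fun k _ => hh μ j k _ (W.isHom_eigProj hx h1 h2 k))
  refine D.induction_on v (fun α => ?_) (fun h => ?_) hadd hsmul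
  · exact key _ (D.ht α) _ (fun i => D.lie_H_E _ _) (gam_E α)
  · exact key 0 0 _ (fun i => by simp [lie_H_H]) (by simp [ee_zero])

lemma form_iterate (l : ℕ) (u v : 𝔤) : D.form (β^[l] u) (β^[l] v) = D.form u v := by
  induction l with
  | zero => rfl
  | succ l ih => rw [Function.iterate_succ_apply', Function.iterate_succ_apply', W.form_beta, ih]

end Twist

variable {μ μ' μ'' : Fin a → ℂ} {j j' j'' k k' k'' : ℤ} {u v w : 𝔤}

lemma ee_div_eq_one_iff {n : ℕ} (hn : 0 < n) (j : ℤ) : ee (j / n) = 1 ↔ (n : ℤ) ∣ j := by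
  have hn' : (n : ℂ) ≠ 0 := by exact_mod_cast hn.ne'
  rw [ee_eq_one_iff]
  constructor
  · rintro ⟨m, hm⟩
    refine ⟨m, ?_⟩
    rw [div_eq_iff hn'] at hm
    exact_mod_cast hm.trans (mul_comm _ _)
  · rintro ⟨m, rfl⟩
    exact ⟨m, by push_cast; field_simp⟩

/-- Homogeneous elements that are not orthogonal have opposite types. -/
lemma IsHom.opposite (W : D.Twist g T B β) (hu : D.IsHom g T β x μ j k u)
    (hv : D.IsHom g T β x μ' j' k' v) (h : D.form u v ≠ 0) :
    μ' = -μ ∧ (g : ℤ) ∣ j + j' ∧ (orderOf T : ℤ) ∣ k + k' := by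
  refine ⟨funext fun i => ?_, ?_, ?_⟩
  · have h1 := D.form_lie' (x (Sum.inl i)) u v
    rw [hu.lie, hv.lie, map_smul, map_smul, LinearMap.smul_apply, smul_eq_mul, smul_eq_mul] at h1
    have h2 : (μ i + μ' i) * D.form u v = 0 := by linear_combination h1
    rw [Pi.neg_apply]
    linear_combination (mul_eq_zero.1 h2).resolve_right h
  · have h1 := form_gam (D := D) (g := g) u v
    rw [hu.gam, hv.gam, map_smul, map_smul, LinearMap.smul_apply, smul_eq_mul, smul_eq_mul,
      ← mul_assoc, ← ee_add] at h1
    rw [← ee_div_eq_one_iff W.pos]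
    have := mul_right_cancel₀ h (h1.trans (one_mul _).symm)
    rw [← this]; congr 1; push_cast; ring
  · have h1 := W.form_beta u v
    rw [hu.beta, hv.beta, map_smul, map_smul, LinearMap.smul_apply, smul_eq_mul, smul_eq_mul,
      ← mul_assoc, ← ee_add] at h1
    rw [← ee_div_eq_one_iff orderOf_T_pos]
    have := mul_right_cancel₀ h (h1.trans (one_mul _).symm)
    rw [← this]; congr 1; push_cast; ring

lemma IsHom.lie_mem (hu : D.IsHom g T β x μ j k u) (hv : D.IsHom g T β x μ' j' k' v) :
    D.IsHom g T β x (μ + μ') (j + j') (k + k') ⁅u, v⁆ where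
  lie i := by
    rw [leibniz_lie, hu.lie, hv.lie, smul_lie, lie_smul, ← add_smul]; rfl
  gam := by
    rw [gam_lie, hu.gam, hv.gam, smul_lie, lie_smul, smul_smul, ← ee_add]
    congr 2; push_cast; ring
  beta := by
    rw [LieEquiv.map_lie, hu.beta, hv.beta, smul_lie, lie_smul, smul_smul, ← ee_add]
    congr 2; push_cast; ring

lemma IsHom.iterate (hv : D.IsHom g T β x μ j k v) (l : ℕ) :
    β^[l] v = ee (l * (k / orderOf T)) • v := by
  induction l with
  | zero => simp [ee_zero]
  | succ l ih =>
    rw [Function.iterate_succ_apply', ih, map_smul, hv.beta, smul_smul, ← ee_add]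
    congr 2; push_cast; ring

lemma IsHom.form_beta_iterate (W : D.Twist g T B β) (hv : D.IsHom g T β x μ j k v) (l : ℕ) (u : 𝔤) :
    D.form v (β^[l] u) = ee (-(l * (k / orderOf T))) * D.form v u := by
  have h1 := W.form_iterate l v u
  rw [hv.iterate, map_smul, LinearMap.smul_apply, smul_eq_mul] at h1
  rw [← h1, ← mul_assoc, ← ee_add, neg_add_cancel, ee_zero, one_mul]

/-- The root vectors pairing nontrivially with a homogeneous element. -/
lemma IsHom.of_form_E (W : D.Twist g T B β) (hv : D.IsHom g T β x μ j k v) {α : D.H.root}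
    (h : D.form v (D.E (D.neg α)) ≠ 0) :
    (∀ i, D.rootVal α (x (Sum.inl i)) = μ i) ∧ (g : ℤ) ∣ D.ht α - j := by
  constructor
  · intro i
    have h1 := D.form_lie' (x (Sum.inl i)) v (D.E (D.neg α))
    rw [hv.lie, lie_H_E, map_smul, map_smul, LinearMap.smul_apply, smul_eq_mul, smul_eq_mul,
      rootVal_neg] at h1
    have h2 : (D.rootVal α (x (Sum.inl i)) - μ i) * D.form v (D.E (D.neg α)) = 0 := by
      linear_combination -h1
    exact sub_eq_zero.1 ((mul_eq_zero.1 h2).resolve_right h)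
  · have h1 := form_gam (D := D) (g := g) v (D.E (D.neg α))
    rw [hv.gam, gam_E, map_smul, map_smul, LinearMap.smul_apply, smul_eq_mul, smul_eq_mul,
      ← mul_assoc, ← ee_add, ht_neg] at h1
    have := mul_right_cancel₀ h (h1.trans (one_mul _).symm)
    rw [← dvd_neg, ← ee_div_eq_one_iff W.pos, ← this]; congr 1; push_cast; ring

/-- `𝔥` has weight zero under `𝔩` and is fixed by `γ`. Nothing follows for `k`, since `h` need not
be an eigenvector of `β`. -/
lemma IsHom.of_form_H (W : D.Twist g T B β) (hv : D.IsHom g T β x μ j k v) {h : D.H}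
    (hh : D.form v h ≠ 0) : μ = 0 ∧ (g : ℤ) ∣ j := by
  constructor
  · funext i
    have h1 := D.form_lie' (x (Sum.inl i)) v h
    rw [hv.lie, lie_H_H, map_smul, LinearMap.smul_apply, smul_eq_mul, map_zero, neg_zero] at h1
    exact (mul_eq_zero.1 h1).resolve_right hh
  · have h1 := form_gam (D := D) (g := g) v h
    rw [hv.gam, gam_H, map_smul, LinearMap.smul_apply, smul_eq_mul] at h1
    exact (ee_div_eq_one_iff W.pos j).1 (mul_right_cancel₀ hh (h1.trans (one_mul _).symm))

end Homogeneous

end ChevalleyData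

namespace ChevalleyData

variable {𝔤 : Type*} [LieRing 𝔤] [LieAlgebra ℂ 𝔤] [FiniteDimensional ℂ 𝔤]
  [LieAlgebra.IsSimple ℂ 𝔤]

/-! ### The scalar attached to a type, and the contributions of roots and of `𝔥` to it. -/

section Coefficients

open scoped Classical
open Complex

attribute [-simp] Finset.univ_eq_attach

variable {D : ChevalleyData 𝔤} {g : ℕ} {T : Equiv.Perm D.Node} {B : D.Affine ≃ₗ⁅ℂ⁆ D.Affine}
  {β : 𝔤 ≃ₗ⁅ℂ⁆ 𝔤} {a b : ℕ} {x : Module.Basis (Fin a ⊕ Fin b) ℂ D.H} {τ : ℂ}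
  {μ μ' : Fin a → ℂ} {j j' k k' : ℤ} {u : ℂ} {v w : 𝔤} {lam : Fin a → ℂ}

/-- `λ` avoids the poles of the coefficients at all roots. -/
def Gen (D : ChevalleyData 𝔤) (g : ℕ) (T : Equiv.Perm D.Node)
    (x : Module.Basis (Fin a ⊕ Fin b) ℂ D.H) (τ : ℂ) (lam : Fin a → ℂ) : Prop :=
  ∀ α, orderOf T * (D.val g x τ lam α / (2 * Real.pi * I)) ∉ latt (orderOf T * τ)

/-- The dynamical argument of the coefficient of type `(μ, j, k)`. -/
def omg (g N : ℕ) (τ : ℂ) (lam μ : Fin a → ℂ) (j k : ℤ) : ℂ :=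
  (∑ i, μ i * lam i) / (2 * Real.pi * I) - τ * j / g + k / N

/-- The type of the elements of `𝔩`. -/
def IsTriv (g N : ℕ) (μ : Fin a → ℂ) (j k : ℤ) : Prop := μ = 0 ∧ (g : ℤ) ∣ j ∧ (N : ℤ) ∣ k

/-- The factor by which the elliptic r-matrix acts on elements of type `(μ, j, k)`. -/
def coef (g N : ℕ) (τ : ℂ) (μ : Fin a → ℂ) (j k : ℤ) (lam : Fin a → ℂ) (u : ℂ) : ℂ :=
  -(1 / (2 * Real.pi * I)) * if IsTriv g N μ j k then chiFn u τ else
    ee (j * u / g) * sigmaFn (omg g N τ lam μ j k) u τ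

lemma two_pi_I_ne : (2 * Real.pi * I : ℂ) ≠ 0 := Complex.two_pi_I_ne_zero

/-- Changing `j` by `gm` moves the index of `σ` by `-mτ`, which costs `e(-mu)`; the prefactor
`e(ju/g)` compensates it. So the scalar depends only on the residue classes of `j` and `k`. -/
lemma twisted_sigma_congr {g N : ℕ} (hg : 0 < g) (hN : 0 < N) {j j' k k' : ℤ}
    (hj : (g : ℤ) ∣ j - j') (hk : (N : ℤ) ∣ k - k') (c u τ : ℂ) :
    ee (j * u / g) * sigmaFn (c - τ * j / g + k / N) u τ =
      ee (j' * u / g) * sigmaFn (c - τ * j' / g + k' / N) u τ := by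
  have hg' : (g : ℂ) ≠ 0 := by exact_mod_cast hg.ne'
  have hN' : (N : ℂ) ≠ 0 := by exact_mod_cast hN.ne'
  obtain ⟨m, hm⟩ := hj
  obtain ⟨n, hn⟩ := hk
  obtain rfl : j = j' + g * m := by omega
  obtain rfl : k = k' + N * n := by omega
  have e : c - τ * (j' + g * m : ℤ) / g + (k' + N * n : ℤ) / N =
      (c - τ * j' / g + k' / N) + (n : ℤ) + ((-m : ℤ) : ℂ) * τ := by
    push_cast; field_simp; ring
  rw [e, sigmaFn_add_latt, ← mul_assoc, ← ee_add]
  congr 2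
  push_cast; field_simp; ring

lemma coef_congr {g N : ℕ} (hg : 0 < g) (hN : 0 < N) (hj : (g : ℤ) ∣ j - j')
    (hk : (N : ℤ) ∣ k - k') (μ lam : Fin a → ℂ) (u τ : ℂ) :
    coef g N τ μ j k lam u = coef g N τ μ j' k' lam u := by
  have h : IsTriv g N μ j k ↔ IsTriv g N μ j' k' := by
    unfold IsTriv
    rw [(dvd_iff_dvd_of_dvd_sub hj), (dvd_iff_dvd_of_dvd_sub hk)]
  unfold coef omg
  rw [twisted_sigma_congr hg hN hj hk]
  simp only [h]

lemma rootVal_lamH (α : D.H.root) :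
    D.rootVal α (D.lamH x lam) = ∑ i, D.rootVal α (x (Sum.inl i)) * lam i := by
  rw [lamH, rootVal, map_sum]
  exact Finset.sum_congr rfl fun i _ => by rw [map_smul, smul_eq_mul, mul_comm]; rfl

lemma IsHom.val_eq (W : D.Twist g T B β) (hv : D.IsHom g T β x μ j k v) {α : D.H.root}
    (h : D.form v (D.E (D.neg α)) ≠ 0) :
    D.val g x τ lam α / (2 * Real.pi * I) + k / orderOf T =
      omg g (orderOf T) τ lam μ (D.ht α) k := by
  rw [val, rootVal_lamH, omg, Finset.sum_congr rfl fun i _ => by rw [(hv.of_form_E W h).1 i]]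
  field_simp [two_pi_I_ne]

/-- A root occurring in a vector of trivial type would vanish on `𝔩` and have height divisible by
`g`. -/
lemma IsHom.not_triv (W : D.Twist g T B β) (hx : D.IsAdapted T x) (hv : D.IsHom g T β x μ j k v)
    {α : D.H.root} (h : D.form v (D.E (D.neg α)) ≠ 0) : ¬IsTriv g (orderOf T) μ j k := by
  rintro ⟨rfl, hj, -⟩
  obtain ⟨h1, h2⟩ := hv.of_form_E W h
  refine W.not_dvd_ht (α := α) (fun l hl => ?_) ?_
  · rw [hx.lSub_eq] at hl
    refine Submodule.span_induction (p := fun l _ => D.rootVal α l = 0) ?_ (by simp) ?_ ?_ hl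
    · rintro _ ⟨i, rfl⟩; exact h1 i
    · intro y z _ _ hy hz; rw [rootVal_add, hy, hz, add_zero]
    · intro c y _ hy; rw [rootVal_smul, hy, mul_zero]
  · exact (dvd_iff_dvd_of_dvd_sub h2).2 hj

/-- The phase `e(-lk/N)` by which `β^l` acts shifts the index `w = (α, λ̃)/2πi` to `w + k/N`. As
`Nw` only changes by the integer `k`, the functions `σ` of modulus `Nτ` are unaffected and the
isogeny sum applies at the new index. The height `|α|` may then be replaced by `j`, to which it is
congruent modulo `g`. -/
lemma IsHom.sum_root_coef (W : D.Twist g T B β) (hτ : 0 < τ.im) (hx : D.IsAdapted T x)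
    (hv : D.IsHom g T β x μ j k v) {α : D.H.root} (h : D.form v (D.E (D.neg α)) ≠ 0)
    (hgen : D.Gen g T x τ lam) (hu : u ∉ latt τ) :
    ∑ l ∈ Finset.range (orderOf T), (1 / (2 * Real.pi * Complex.I) *
        Complex.exp (-l * D.val g x τ lam α + 2 * Real.pi * Complex.I * D.ht α * u / g) *
        sigmaFn (orderOf T / (2 * Real.pi * Complex.I) * D.val g x τ lam α) (u + l * τ)
          (orderOf T * τ)) * ee (-(l * (k / orderOf T))) =
      -coef g (orderOf T) τ μ j k lam u := by
  have hN := orderOf_T_pos (T := T)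
  have hN' : ((orderOf T : ℕ) : ℂ) ≠ 0 := by exact_mod_cast hN.ne'
  set y := D.val g x τ lam α / (2 * Real.pi * I) with hy
  have hval : D.val g x τ lam α = 2 * Real.pi * I * y := by
    rw [hy, mul_div_cancel₀ _ two_pi_I_ne]
  set y' := y + k / orderOf T with hy'
  have e1 : (orderOf T : ℂ) * y' = orderOf T * y + k + ((0 : ℤ) : ℂ) * (orderOf T * τ) := by
    rw [hy']; field_simp; push_cast; ring
  have e2 : ∀ z, sigmaFn (orderOf T * y') z (orderOf T * τ) =
      sigmaFn (orderOf T * y) z (orderOf T * τ) := fun z => by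
    rw [e1, sigmaFn_add_latt]; simp [ee_zero]
  have e3 : (orderOf T : ℂ) * y' ∉ latt (orderOf T * τ) := by
    intro hm
    obtain ⟨p, q, hpq⟩ := hm
    refine hgen α ⟨p - k, q, ?_⟩
    rw [← hy]
    push_cast
    linear_combination hpq - e1
  have e4 : ∀ l : ℕ, Complex.exp (-l * D.val g x τ lam α + 2 * Real.pi * I * D.ht α * u / g) *
      ee (-(l * (k / orderOf T))) = ee (-(l * y')) * ee (D.ht α * u / g) := by
    intro l
    rw [hval, ee, ee, ee, ← Complex.exp_add, ← Complex.exp_add]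
    congr 1
    rw [hy']; ring
  have e5 : ((orderOf T : ℕ) : ℂ) / (2 * Real.pi * I) * D.val g x τ lam α = orderOf T * y := by
    rw [hval]; field_simp [two_pi_I_ne]
  calc _ = ∑ l ∈ Finset.range (orderOf T), 1 / (2 * Real.pi * I) * ee (D.ht α * u / g) *
        (ee (-(l * y')) * sigmaFn (orderOf T * y') (u + l * τ) (orderOf T * τ)) := by
        refine Finset.sum_congr rfl fun l _ => ?_
        rw [e5, e2]
        linear_combination (1 / (2 * Real.pi * I) * sigmaFn (orderOf T * y) (u + l * τ)
          (orderOf T * τ)) * e4 l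
    _ = 1 / (2 * Real.pi * I) * (ee (D.ht α * u / g) * sigmaFn y' u τ) := by
        rw [← Finset.mul_sum, sum_sigmaFn hτ hN e3 hu, mul_assoc]
    _ = _ := by
        rw [coef, if_neg (hv.not_triv W hx h), hy', hy, hv.val_eq W h, omg, omg,
          twisted_sigma_congr W.pos hN (hv.of_form_E W h).2 (k' := k) (by simp)]
        ring

lemma form_proj₀ (y : 𝔤) (h : D.H) : D.form (D.proj₀ y) h = D.form y h := by
  conv_rhs => rw [← D.proj₀_add_sum y]
  rw [map_add, LinearMap.add_apply, map_sum, LinearMap.sum_apply, Finset.sum_eq_zero, add_zero]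
  intro α _; simp [proj_apply]

/-- The component in `𝔥` of a homogeneous element. -/
lemma IsHom.beta_proj₀ (W : D.Twist g T B β) (hv : D.IsHom g T β x μ j k v) :
    β (D.proj₀ v) = ee (k / orderOf T) • D.proj₀ v := by
  have h0 := W.beta_mem_H ⟨_, D.proj₀_mem v⟩
  have hb : ∀ h : D.H, ∃ h' : D.H, β (h' : 𝔤) = h := by
    have : Function.Surjective W.betaH := LinearMap.injective_iff_surjective.1 fun p q e =>
      Subtype.ext (β.injective (congrArg Subtype.val e))
    intro h
    obtain ⟨h', e⟩ := this h
    exact ⟨h', congrArg Subtype.val e⟩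
  have h1 : (⟨_, h0⟩ : D.H) - ee (k / orderOf T) • (⟨_, D.proj₀_mem v⟩ : D.H) = 0 := by
    refine D.form_H_nondeg fun h => ?_
    obtain ⟨h', e⟩ := hb h
    change D.form (β (D.proj₀ v) - ee (k / orderOf T) • D.proj₀ v) h = 0
    rw [map_sub, LinearMap.sub_apply, map_smul, LinearMap.smul_apply, form_proj₀, ← e,
      W.form_beta, form_proj₀,
      ← W.form_beta, hv.beta, map_smul, LinearMap.smul_apply, sub_self]
  exact congrArg Subtype.val (sub_eq_zero.1 h1)

/-- Eigenvectors of `β` in `𝔥` for eigenvalues other than `1` lie in `𝔩^⊥`. -/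
lemma Twist.mem_lPerp_of_eigen (W : D.Twist g T B β) {h : D.H} {z : ℂ} (hz : z ≠ 1)
    (hh : β (h : 𝔤) = z • (h : 𝔤)) : h ∈ D.lPerp T := by
  rw [mem_lPerp_iff]
  intro l hl
  have h1 := W.form_beta l h
  rw [W.mem_lSub_iff_beta.1 hl, hh, map_smul, smul_eq_mul] at h1
  have : (z - 1) * D.form (l : 𝔤) h = 0 := by linear_combination h1
  exact (mul_eq_zero.1 this).resolve_left (sub_ne_zero.2 hz)

/-- The Cayley term on an eigenvector of `β`. -/
lemma Twist.sum_cayley (W : D.Twist g T B β) (hx : D.IsAdapted T x) {h : D.H} {z : ℂ}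
    (hh : β (h : 𝔤) = z • (h : 𝔤)) :
    ∑ i : Fin b, D.form (h : 𝔤) (x (Sum.inr i)) • D.betaCayley T β (x (Sum.inr i)) =
      (if z = 1 then 0 else (z + 1) / (z - 1)) • h := by
  split_ifs with hz
  · rw [hz, one_smul] at hh
    rw [zero_smul]
    refine Finset.sum_eq_zero fun i _ => ?_
    rw [mem_lPerp_iff.1 (hx.2.2 i) h (W.mem_lSub_iff_beta.2 hh), zero_smul]
  · have hp := W.mem_lPerp_of_eigen hz hh
    have hz' : z - 1 ≠ 0 := sub_ne_zero.2 hz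
    set Y := ∑ i : Fin b, D.form (h : 𝔤) (x (Sum.inr i)) • D.betaCayley T β (x (Sum.inr i)) with hY
    have hYp : Y ∈ D.lPerp T := Submodule.sum_mem _ fun i _ =>
      Submodule.smul_mem _ _ (W.betaCayley_spec hx (hx.2.2 i)).1
    have hhb : W.betaH h = z • h := Subtype.ext hh
    have hsum : ∑ i : Fin b, D.form (h : 𝔤) (x (Sum.inr i)) • x (Sum.inr i) = h := by
      conv_rhs => rw [← hx.sum_form h, Fintype.sum_sum_type]
      rw [right_eq_add]
      exact Finset.sum_eq_zero fun i _ => by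
        rw [form_comm, mem_lPerp_iff.1 hp _ (hx.2.1 i), zero_smul]
    have hYb : W.betaH Y - Y = W.betaH h + h := by
      have h2 : ∀ i, W.betaH (D.betaCayley T β (x (Sum.inr i))) - D.betaCayley T β (x (Sum.inr i)) =
          W.betaH (x (Sum.inr i)) + x (Sum.inr i) := fun i =>
        Subtype.ext (W.betaCayley_spec hx (hx.2.2 i)).2
      rw [hY, map_sum, ← Finset.sum_sub_distrib]
      simp only [map_smul, ← smul_sub, h2, smul_add, Finset.sum_add_distrib]
      rw [hsum]
      congr 1
      conv_rhs => rw [← hsum, map_sum]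
      simp only [map_smul]
    -- The difference satisfies the homogeneous equation `β d = d` and lies in `𝔩^⊥`, hence is zero.
    set d := Y - ((z + 1) / (z - 1)) • h with hd
    have hd1 : W.betaH d = d := by
      have : W.betaH d - d = 0 := by
        rw [hd, map_sub, map_smul, sub_sub_sub_comm, hYb, hhb, smul_smul, ← sub_smul]
        have e : (z + 1) / (z - 1) * z - (z + 1) / (z - 1) = z + 1 := by field_simp
        rw [e]; module
      exact sub_eq_zero.1 this
    have hd0 : d = 0 := W.eq_zero_of_mem_of_mem hx
      (W.mem_lSub_iff_beta.2 (congrArg Subtype.val hd1))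
      (Submodule.sub_mem _ hYp (Submodule.smul_mem _ _ hp))
    exact sub_eq_zero.1 hd0

end Coefficients

end ChevalleyData

namespace ChevalleyData

variable {𝔤 : Type*} [LieRing 𝔤] [LieAlgebra ℂ 𝔤] [FiniteDimensional ℂ 𝔤]
  [LieAlgebra.IsSimple ℂ 𝔤]

/-! ### The elliptic r-matrix is scalar on each type. -/

section Diagonalization

open scoped Classical
open Complex

attribute [-simp] Finset.univ_eq_attach

variable {D : ChevalleyData 𝔤} {g : ℕ} {T : Equiv.Perm D.Node} {B : D.Affine ≃ₗ⁅ℂ⁆ D.Affine}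
  {β : 𝔤 ≃ₗ⁅ℂ⁆ 𝔤} {a b : ℕ} {x : Module.Basis (Fin a ⊕ Fin b) ℂ D.H} {τ : ℂ}
  {μ μ' : Fin a → ℂ} {j j' k k' : ℤ} {u : ℂ} {v w : 𝔤} {lam : Fin a → ℂ}

lemma form_eq_sum (hx : D.IsAdapted T x) (w v : 𝔤) :
    D.form w v = ∑ α, D.form w (D.E α) * D.form v (D.E (D.neg α)) +
      ∑ i, D.form w (x i) * D.form v (x i) := by
  have h1 : ∑ i, D.form w (x i) * D.form v (x i) = D.form w (D.proj₀ v) := by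
    have h2 := hx.sum_form ⟨_, D.proj₀_mem v⟩
    have h3 := congrArg (fun h : D.H => D.form w h) h2
    simp only [AddSubmonoidClass.coe_finsetSum, SetLike.val_smul, map_sum, map_smul,
      form_proj₀] at h3
    rw [← h3]
    exact Finset.sum_congr rfl fun i _ => mul_comm _ _
  conv_lhs => rw [← D.proj₀_add_sum v]
  rw [h1, map_add, map_sum, add_comm]
  congr 1
  refine Finset.sum_congr rfl fun α _ => ?_
  rw [proj_apply, map_smul, smul_eq_mul, mul_comm]

/-- The coefficient of the Cartan part on a homogeneous element. -/
lemma cartan_coef (hτ : 0 < τ.im) (hg : 0 < g) (hj : (g : ℤ) ∣ j) (hu : u ∉ latt τ) :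
    -(∑ l ∈ Finset.range (orderOf T), ((if l = 0 then 0 else 1 / 2) +
        1 / (2 * Real.pi * Complex.I) * chiFn (u + l * τ) (orderOf T * τ)) *
          ee (-(l * (k / orderOf T)))) +
      1 / 2 * (if ee (k / orderOf T) = 1 then 0 else
        (ee (k / orderOf T) + 1) / (ee (k / orderOf T) - 1)) =
      coef g (orderOf T) τ 0 j k lam u := by
  have hN := orderOf_T_pos (T := T)
  have hpi := two_pi_I_ne
  have hsplit : ∑ l ∈ Finset.range (orderOf T), ((if l = 0 then 0 else 1 / 2) +
        1 / (2 * Real.pi * Complex.I) * chiFn (u + l * τ) (orderOf T * τ)) *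
          ee (-(l * (k / orderOf T))) =
      ∑ l ∈ Finset.range (orderOf T), (if l = 0 then 0 else 1 / 2 : ℂ) *
        ee (-(l * (k / orderOf T))) + 1 / (2 * Real.pi * I) *
      ∑ l ∈ Finset.range (orderOf T), ee (-(l * (k / orderOf T))) *
        chiFn (u + l * τ) (orderOf T * τ) := by
    rw [Finset.mul_sum, ← Finset.sum_add_distrib]
    exact Finset.sum_congr rfl fun l _ => by ring
  rw [hsplit]
  have h1 : ∑ l ∈ Finset.range (orderOf T), (if l = 0 then 0 else 1 / 2 : ℂ) *
      ee (-(l * (k / orderOf T))) =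
      1 / 2 * (∑ l ∈ Finset.range (orderOf T), ee (-(l * (k / orderOf T : ℂ))) - 1) := by
    have h2 : ∀ l ∈ Finset.range (orderOf T), (if l = 0 then 0 else 1 / 2 : ℂ) *
        ee (-(l * (k / orderOf T))) = 1 / 2 * ee (-(l * (k / orderOf T : ℂ))) -
          if l = 0 then 1 / 2 else 0 := by
      intro l _
      split_ifs with h
      · subst h; simp [ee_zero]
      · ring
    rw [Finset.sum_congr rfl h2, Finset.sum_sub_distrib, ← Finset.mul_sum,
      Finset.sum_ite_eq' (Finset.range (orderOf T)) 0, if_pos (Finset.mem_range.2 hN)]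
    ring
  rw [h1]
  -- If `β` acts by `1`, the `N - 1` constants `1/2` match the constant of the isogeny sum of `χ`.
  -- Otherwise, with `z = e(k/N)`, the weighted constants sum to `-1/2`, and `1/2 + (1/2)(z + 1)/(z
  -- - 1) = z/(z - 1)` is the constant of the twisted sum: the Cayley term is what makes the answer
  -- a pure `σ`.
  by_cases hk : (orderOf T : ℤ) ∣ k
  · have hk1 : ee ((k : ℂ) / (orderOf T : ℕ)) = 1 := (ee_div_eq_one_iff hN k).2 hk
    have hk2 : ∀ l : ℕ, ee (-(l * ((k : ℂ) / (orderOf T : ℕ)))) = 1 := fun l => by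
      rw [ee_neg, ee_nat_mul, hk1, one_pow, inv_one]
    rw [if_pos hk1, coef, if_pos ⟨rfl, hj, hk⟩, ← sum_chiFn hτ hN hu]
    simp only [hk2, one_mul, Finset.sum_const, Finset.card_range, nsmul_eq_mul, mul_one]
    generalize ∑ l ∈ Finset.range (orderOf T), chiFn (u + l * τ) (orderOf T * τ) = S
    field_simp
    ring
  · have hk1 : ee ((k : ℂ) / (orderOf T : ℕ)) ≠ 1 := fun h => hk ((ee_div_eq_one_iff hN k).1 h)
    have hs := sum_chiFn_twisted hτ hN hk hu
    have hz := sum_ee_eq_zero hk hN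
    have hz1 : ∑ l ∈ Finset.range (orderOf T), ee (-(l * (k / orderOf T : ℂ))) = 0 := by
      rw [← hz.1]
      exact Finset.sum_congr rfl fun l _ => by rw [← ee_nat_mul]; congr 1; ring
    have e0 : omg g (orderOf T) τ lam 0 0 k = (k : ℂ) / (orderOf T : ℕ) := by simp [omg]
    rw [if_neg hk1, coef_congr hg hN (j' := 0) (by simpa using hj) (k' := k) (by simp), coef,
      if_neg (fun h => hk h.2.2), e0, hz1, ← hs]
    have hk3 : ee ((k : ℂ) / (orderOf T : ℕ)) - 1 ≠ 0 := sub_ne_zero.2 hk1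
    have hk4 := ee_ne_zero ((k : ℂ) / (orderOf T : ℕ))
    rw [show ee (((0 : ℤ) : ℂ) * u / g) = 1 by simp [ee_zero], ee_neg]
    generalize ∑ l ∈ Finset.range (orderOf T), ee (-(l * (k / orderOf T : ℂ))) *
      chiFn (u + l * τ) (orderOf T * τ) = S
    generalize ee ((k : ℂ) / (orderOf T : ℕ)) = z at *
    have : 1 - z⁻¹ = (z - 1) / z := by field_simp
    rw [this]
    field_simp
    ring

/-- If the `𝔥`-component of `v` is zero both sides vanish. Otherwise `μ = 0` and `g ∣ j`, that
component is an eigenvector of `β`, and the sums reduce to a scalar. -/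
lemma IsHom.sum_cartan (W : D.Twist g T B β) (hτ : 0 < τ.im) (hx : D.IsAdapted T x)
    (hv : D.IsHom g T β x μ j k v) (hu : u ∉ latt τ) (w : 𝔤) :
    -(∑ i, ∑ l ∈ Finset.range (orderOf T), ((if l = 0 then 0 else 1 / 2) +
        1 / (2 * Real.pi * Complex.I) * chiFn (u + l * τ) (orderOf T * τ)) *
          (D.form w (x i) * D.form v (β^[l] (x i : 𝔤)))) +
      1 / 2 * ∑ i : Fin b, D.form w (D.betaCayley T β (x (Sum.inr i))) *
        D.form v (x (Sum.inr i)) =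
    coef g (orderOf T) τ μ j k lam u * ∑ i, D.form w (x i) * D.form v (x i) := by
  set h : D.H := ⟨_, D.proj₀_mem v⟩ with hh
  have hc := W.sum_cayley hx (h := h) (hv.beta_proj₀ W)
  have hc' := congrArg (fun h : D.H => D.form w h) hc
  have hvh : ∀ p : D.H, D.form (h : 𝔤) p = D.form v p := form_proj₀ v
  simp only [AddSubmonoidClass.coe_finsetSum, SetLike.val_smul, map_sum, map_smul, smul_eq_mul,
    hvh] at hc'
  have hwh : ∑ i, D.form w (x i) * D.form v (x i) = D.form w h := by
    have h3 := congrArg (fun h : D.H => D.form w h) (hx.sum_form h)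
    simp only [AddSubmonoidClass.coe_finsetSum, SetLike.val_smul, map_sum, map_smul, hvh,
      smul_eq_mul] at h3
    rw [← h3]
    exact Finset.sum_congr rfl fun i _ => mul_comm _ _
  rw [Finset.sum_congr rfl fun (i : Fin b) _ => mul_comm (D.form w (D.betaCayley T β
    (x (Sum.inr i)))) (D.form v (x (Sum.inr i))), hc']
  by_cases h0 : ∀ p : D.H, D.form v p = 0
  · have : h = 0 := D.form_H_nondeg fun p => (hvh p).trans (h0 p)
    rw [this]
    simp [hv.form_beta_iterate W, h0]
  obtain ⟨p, hp⟩ := not_forall.1 h0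
  obtain ⟨rfl, hj⟩ := hv.of_form_H W hp
  have hcc := cartan_coef (T := T) (k := k) (lam := lam) hτ W.pos hj hu
  rw [← hcc, add_mul, hwh, neg_mul, ← mul_assoc]
  congr 2
  rw [Finset.sum_comm, Finset.sum_mul, ← hwh]
  refine Finset.sum_congr rfl fun l _ => ?_
  rw [Finset.mul_sum]
  refine Finset.sum_congr rfl fun i _ => ?_
  rw [hv.form_beta_iterate W]
  ring

/-- The elliptic r-matrix acts on homogeneous elements by scalars. -/
lemma IsHom.pr_ellipticR (W : D.Twist g T B β) (hτ : 0 < τ.im) (hx : D.IsAdapted T x)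
    (hv : D.IsHom g T β x μ j k v) (hgen : D.Gen g T x τ lam) (hu : u ∉ latt τ) (w : 𝔤) :
    D.pr w v (D.ellipticR g T β x τ lam u) =
      coef g (orderOf T) τ μ j k lam u * D.form w v := by
  rw [form_eq_sum hx w v, mul_add, ← hv.sum_cartan W hτ hx hu w, ellipticR]
  simp only [map_add, map_sub, map_neg, map_sum, map_smul, pr_tmul, smul_eq_mul]
  rw [sub_eq_add_neg, add_assoc]
  congr 1
  rw [← Finset.sum_neg_distrib, Finset.mul_sum]
  refine Finset.sum_congr rfl fun α _ => ?_
  by_cases h : D.form v (D.E (D.neg α)) = 0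
  · rw [Finset.sum_eq_zero fun l _ => by rw [hv.form_beta_iterate W, h]; ring, h]; ring
  rw [← neg_neg (coef _ _ _ _ _ _ _ _), ← hv.sum_root_coef W hτ hx h hgen hu, neg_mul, _root_.neg_inj,
    Finset.sum_mul]
  refine Finset.sum_congr rfl fun l _ => ?_
  rw [hv.form_beta_iterate W]
  ring

lemma IsHom.contr'_ellipticR (W : D.Twist g T B β) (hτ : 0 < τ.im) (hx : D.IsAdapted T x)
    (hv : D.IsHom g T β x μ j k v) (hgen : D.Gen g T x τ lam) (hu : u ∉ latt τ) :
    D.contr' v (D.ellipticR g T β x τ lam u) = coef g (orderOf T) τ μ j k lam u • v :=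
  D.form_right_cancel fun w => by
    rw [form_contr', hv.pr_ellipticR W hτ hx hgen hu, map_smul, smul_eq_mul]

/-- Only vectors of opposite types pair nontrivially, so contraction of the first leg acts by the
scalar of the opposite type. -/
lemma IsHom.contr_ellipticR (W : D.Twist g T B β) (hτ : 0 < τ.im) (hx : D.IsAdapted T x)
    (hv : D.IsHom g T β x μ j k v) (hgen : D.Gen g T x τ lam) (hu : u ∉ latt τ) :
    D.contr v (D.ellipticR g T β x τ lam u) = coef g (orderOf T) τ (-μ) (-j) (-k) lam u • v := by
  refine D.form_right_cancel fun w => ?_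
  rw [form_contr, map_smul, smul_eq_mul]
  refine W.hom_induction hx (p := fun w => D.pr v w (D.ellipticR g T β x τ lam u) =
    coef g (orderOf T) τ (-μ) (-j) (-k) lam u * D.form w v) w (fun μ' j' k' w hw => ?_) ?_ ?_
  · rw [hw.pr_ellipticR W hτ hx hgen hu, D.form_comm w]
    by_cases h : D.form v w = 0
    · rw [h, mul_zero, mul_zero]
    obtain ⟨rfl, h2, h3⟩ := hv.opposite W hw h
    rw [coef_congr W.pos orderOf_T_pos (by rwa [sub_neg_eq_add, add_comm])
      (by rwa [sub_neg_eq_add, add_comm])]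
  · intro y z hy hz
    rw [pr_add_right, LinearMap.add_apply, hy, hz, map_add, LinearMap.add_apply, mul_add]
  · intro c y hy
    rw [pr_smul_right, LinearMap.smul_apply, hy, map_smul, LinearMap.smul_apply, smul_eq_mul,
      smul_eq_mul]
    ring

/-- Genericity in terms of lattices. -/
lemma gen_of_isGeneric (h : D.IsGeneric g T x τ lam) : D.Gen g T x τ lam := by
  have key : ∀ (α : D.H.root) (p q : ℤ), (0 < q ∨ (q = 0 ∧ 0 < D.ht α)) →
      (orderOf T : ℂ) * (D.val g x τ lam α / (2 * Real.pi * I)) ≠ p + q * (orderOf T * τ) := by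
    intro α p q hq e
    refine h ⟨(α, q), hq⟩ ?_
    have hval : D.val g x τ lam α = 2 * Real.pi * I * (D.val g x τ lam α / (2 * Real.pi * I)) := by
      rw [mul_div_cancel₀ _ two_pi_I_ne]
    have : -(orderOf T) * D.affVal g x τ lam α q = 2 * Real.pi * I * (((-p : ℤ) : ℂ)) := by
      rw [affVal]
      push_cast
      linear_combination -(orderOf T : ℂ) * hval - 2 * Real.pi * I * e
    rw [this]
    exact ee_int (-p)
  rintro α ⟨p, q, e⟩
  have hneg : D.val g x τ lam (D.neg α) = -D.val g x τ lam α := by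
    rw [val, val, rootVal_neg, ht_neg]; push_cast; ring
  have h0 := D.ht_ne_zero α
  -- Genericity is given for positive roots only; the lattice condition is symmetric under `α + qδ ↦
  -- -(α + qδ)`, and one of the two is positive.
  rcases lt_trichotomy q 0 with hq | hq | hq
  · refine key (D.neg α) (-p) (-q) (Or.inl (by omega)) ?_
    rw [hneg]; push_cast; linear_combination -e
  · rcases lt_or_gt_of_ne h0 with h1 | h1
    · refine key (D.neg α) (-p) (-q) (Or.inr ⟨by omega, by rw [ht_neg]; omega⟩) ?_
      rw [hneg]; push_cast; linear_combination -e
    · exact key α p q (Or.inr ⟨hq, h1⟩) e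
  · exact key α p q (Or.inl hq) e

end Diagonalization

end ChevalleyData

namespace ChevalleyData

variable {𝔤 : Type*} [LieRing 𝔤] [LieAlgebra ℂ 𝔤] [FiniteDimensional ℂ 𝔤]
  [LieAlgebra.IsSimple ℂ 𝔤]

/-! ### Avoidance of poles, and differentiability in `λ`. -/

section Derivatives

open scoped Classical
open Complex

attribute [-simp] Finset.univ_eq_attach

variable {D : ChevalleyData 𝔤} {g : ℕ} {T : Equiv.Perm D.Node} {B : D.Affine ≃ₗ⁅ℂ⁆ D.Affine}
  {β : 𝔤 ≃ₗ⁅ℂ⁆ 𝔤} {a b : ℕ} {x : Module.Basis (Fin a ⊕ Fin b) ℂ D.H} {τ : ℂ}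
  {μ μ' : Fin a → ℂ} {j j' k k' : ℤ} {u : ℂ} {v w : 𝔤} {lam : Fin a → ℂ}

lemma int_div_not_mem_latt (hτ : 0 < τ.im) {N : ℕ} (hN : 0 < N) (hk : ¬(N : ℤ) ∣ k) (m : ℤ) :
    (k : ℂ) / N - m * τ ∉ latt τ := by
  rintro ⟨p, q, h⟩
  have hN' : (N : ℂ) ≠ 0 := by exact_mod_cast hN.ne'
  have hN'' : (N : ℝ) ≠ 0 := by exact_mod_cast hN.ne'
  have h1 : (k : ℂ) = N * p + (N * (q + m)) * τ := by
    field_simp at h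
    linear_combination h
  have h2 := congrArg Complex.im h1
  simp only [Complex.intCast_im, Complex.add_im, Complex.mul_im, Complex.natCast_re,
    Complex.natCast_im, Complex.intCast_re, Complex.mul_re, Complex.add_re] at h2
  have h3 : (N * (q + m) : ℝ) * τ.im = 0 := by linarith
  have h4 : (q + m : ℝ) = 0 :=
    (mul_eq_zero.1 ((mul_eq_zero.1 h3).resolve_right hτ.ne')).resolve_left hN''
  have h5 : (q + m : ℂ) = 0 := by exact_mod_cast h4
  rw [h5, mul_zero, zero_mul, add_zero] at h1
  exact hk ⟨p, by exact_mod_cast h1⟩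

/-- A homogeneous element with no component in the root spaces lies in `𝔥`. -/
lemma mem_H_of_form_E {v : 𝔤} (h : ∀ α, D.form v (D.E (D.neg α)) = 0) : v ∈ D.H := by
  rw [← D.proj₀_add_sum v, Finset.sum_eq_zero fun α _ => by rw [proj_apply, h, zero_smul], add_zero]
  exact D.proj₀_mem v

lemma IsHom.mem_lSub (W : D.Twist g T B β) (hx : D.IsAdapted T x) (hv : D.IsHom g T β x μ j k v)
    (h : IsTriv g (orderOf T) μ j k) : ∃ l ∈ D.lSub T, (l : 𝔤) = v := by
  have h1 : v ∈ D.H := mem_H_of_form_E fun α => by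
    by_contra hα
    exact hv.not_triv W hx hα h
  refine ⟨⟨v, h1⟩, W.mem_lSub_iff_beta.2 ?_, rfl⟩
  change β v = v
  rw [hv.beta, (ee_div_eq_one_iff orderOf_T_pos k).2 h.2.2, one_smul]

/-- If a root `α` occurs in `v`, then modulo `ℤτ` the index is `(α, λ̃)/2πi + k/N`, and
multiplication by `N` leads back to genericity at `α`. If none occurs, `v` lies in `𝔥`, the index is
`k/N` modulo `ℤτ` with `N ∤ k`, and it avoids the lattice for every `λ`. -/
lemma IsHom.omg_not_mem (W : D.Twist g T B β) (hτ : 0 < τ.im)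
    (hv : D.IsHom g T β x μ j k v) (hgen : D.Gen g T x τ lam) (hv0 : v ≠ 0)
    (ht : ¬IsTriv g (orderOf T) μ j k) : omg g (orderOf T) τ lam μ j k ∉ latt τ := by
  have hN := orderOf_T_pos (T := T)
  have hg' : (g : ℂ) ≠ 0 := by exact_mod_cast W.pos.ne'
  by_cases h : ∃ α, D.form v (D.E (D.neg α)) ≠ 0
  · obtain ⟨α, hα⟩ := h
    intro hm
    obtain ⟨m, hm'⟩ := (hv.of_form_E W hα).2
    have h1 := hv.val_eq W hα (τ := τ) (lam := lam)
    have e1 : omg g (orderOf T) τ lam μ (D.ht α) k =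
        omg g (orderOf T) τ lam μ j k + ((-m : ℤ) : ℂ) * τ := by
      have : (D.ht α : ℂ) = j + g * m := by exact_mod_cast (sub_eq_iff_eq_add'.1 hm')
      rw [omg, omg, this]
      push_cast; field_simp; ring
    have h2 : D.val g x τ lam α / (2 * Real.pi * I) + k / orderOf T ∈ latt τ := by
      rw [h1, e1, latt_add_iff (int_mul_mem_latt τ _)]; exact hm
    refine hgen α ?_
    have h3 := mul_mem_latt (N := orderOf T) h2
    have hN' : ((orderOf T : ℕ) : ℂ) ≠ 0 := by exact_mod_cast hN.ne'
    rwa [mul_add, mul_div_cancel₀ (k : ℂ) hN', latt_add_iff (int_mem_latt _ _)] at h3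
  · push Not at h
    have h1 : v ∈ D.H := mem_H_of_form_E h
    obtain ⟨p, hp⟩ : ∃ p : D.H, D.form v p ≠ 0 := by
      by_contra! h2
      exact hv0 (congrArg Subtype.val (D.form_H_nondeg (h := ⟨v, h1⟩) h2))
    obtain ⟨rfl, m, rfl⟩ := hv.of_form_H W hp
    have hk : ¬(orderOf T : ℤ) ∣ k := fun hk => ht ⟨rfl, ⟨m, rfl⟩, hk⟩
    have e : omg g (orderOf T) τ lam 0 (g * m) k = (k : ℂ) / (orderOf T : ℕ) - m * τ := by
      rw [omg]; simp; field_simp; ring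
    rw [e]
    exact int_div_not_mem_latt hτ hN hk m

/-- The derivative of `coef` in the `i`-th coordinate of `λ`. -/
def dcoef (g N : ℕ) (τ : ℂ) (μ : Fin a → ℂ) (j k : ℤ) (lam : Fin a → ℂ) (u : ℂ) (i : Fin a) : ℂ :=
  if IsTriv g N μ j k then 0 else
    (1 / (2 * Real.pi * I)) ^ 2 *
      -(ee (j * u / g) * dsigmaFn (omg g N τ lam μ j k) u τ * μ i)

lemma hasDerivAt_omg (g N : ℕ) (τ : ℂ) (μ : Fin a → ℂ) (j k : ℤ) (lam : Fin a → ℂ) (i : Fin a) :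
    HasDerivAt (fun s => omg g N τ (Function.update lam i s) μ j k) (μ i / (2 * Real.pi * I))
      (lam i) := by
  have h1 : ∀ s, omg g N τ (Function.update lam i s) μ j k =
      μ i / (2 * Real.pi * I) * s +
        (omg g N τ lam μ j k - μ i / (2 * Real.pi * I) * lam i) := by
    intro s
    have h2 : ∑ l, μ l * Function.update lam i s l = μ i * s + (∑ l, μ l * lam l - μ i * lam i) := by
      rw [← Finset.add_sum_erase _ _ (Finset.mem_univ i), ← Finset.add_sum_erase _ (fun l => μ l * lam l)
        (Finset.mem_univ i), Function.update_self, add_sub_cancel_left]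
      congr 1
      exact Finset.sum_congr rfl fun l hl => by
        rw [Function.update_of_ne (Finset.ne_of_mem_erase hl)]
    rw [omg, omg, h2]; ring
  simp only [h1]
  simpa using ((hasDerivAt_id (lam i)).const_mul (μ i / (2 * Real.pi * I))).add_const
    (omg g N τ lam μ j k - μ i / (2 * Real.pi * I) * lam i)

lemma IsHom.hasDerivAt_coef (W : D.Twist g T B β) (hτ : 0 < τ.im)
    (hv : D.IsHom g T β x μ j k v) (hgen : D.Gen g T x τ lam) (hv0 : v ≠ 0) (hu : u ∉ latt τ)
    (i : Fin a) :
    HasDerivAt (fun s => coef g (orderOf T) τ μ j k (Function.update lam i s) u)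
      (dcoef g (orderOf T) τ μ j k lam u i) (lam i) := by
  unfold coef dcoef
  split_ifs with ht
  · exact hasDerivAt_const _ _
  · have h0 := hv.omg_not_mem W hτ hgen hv0 ht
    have h1 : Function.update lam i (lam i) = lam := Function.update_eq_self i lam
    have h2 : HasDerivAt (fun w => sigmaFn w u τ) (dsigmaFn (omg g (orderOf T) τ lam μ j k) u τ)
        (omg g (orderOf T) τ (Function.update lam i (lam i)) μ j k) := by
      rw [h1]; exact hasDerivAt_sigmaFn hτ h0 hu
    have h3 := (((h2.comp (lam i) (hasDerivAt_omg g (orderOf T) τ μ j k lam i)).const_mul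
      (ee (j * u / g))).const_mul (-(1 / (2 * Real.pi * I) : ℂ)))
    refine h3.congr_deriv ?_
    ring

lemma continuous_val_update (α : D.H.root) (i : Fin a) :
    Continuous fun s => D.val g x τ (Function.update lam i s) α := by
  simp only [val, rootVal_lamH]
  refine Continuous.sub (continuous_finsetSum _ fun l _ => continuous_const.mul ?_) continuous_const
  by_cases h : l = i
  · subst h; simpa using continuous_id'
  · simpa [Function.update_of_ne h] using continuous_const

lemma eventually_gen (hτ : 0 < τ.im) (hgen : D.Gen g T x τ lam) (i : Fin a) :
    ∀ᶠ s in 𝓝 (lam i), D.Gen g T x τ (Function.update lam i s) := by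
  unfold Gen
  rw [eventually_all]
  intro α
  have h1 : Continuous fun s => (orderOf T : ℂ) *
      (D.val g x τ (Function.update lam i s) α / (2 * Real.pi * I)) :=
    continuous_const.mul ((continuous_val_update α i).div_const _)
  refine h1.continuousAt.eventually_mem
    ((isOpen_compl_latt (natCast_mul_im_pos hτ orderOf_T_pos)).mem_nhds ?_)
  rw [Function.update_eq_self]
  exact hgen α

lemma IsHom.hasDerivAt_pr (W : D.Twist g T B β) (hτ : 0 < τ.im) (hx : D.IsAdapted T x)
    (hv : D.IsHom g T β x μ j k v) (hgen : D.Gen g T x τ lam) (hu : u ∉ latt τ) (w : 𝔤)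
    (i : Fin a) :
    HasDerivAt (fun s => D.pr w v (D.ellipticR g T β x τ (Function.update lam i s) u))
      (dcoef g (orderOf T) τ μ j k lam u i * D.form w v) (lam i) := by
  -- The zero vector has every type, including types whose scalar may have a pole at `λ`.
  by_cases hv0 : v = 0
  · subst hv0
    have : ∀ t, D.pr w 0 t = 0 := fun t => by
      have := D.pr_smul_right 0 w 0
      rw [zero_smul, zero_smul] at this
      rw [this]; rfl
    simp only [this, map_zero, mul_zero]
    exact hasDerivAt_const _ _
  refine ((hv.hasDerivAt_coef W hτ hgen hv0 hu i).mul_const (D.form w v)).congr_of_eventuallyEq ?_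
  filter_upwards [eventually_gen hτ hgen i] with s hs
  exact hv.pr_ellipticR W hτ hx hs hu w

/-- The elliptic r-matrix is differentiable in `λ`. -/
lemma Twist.exists_deriv (W : D.Twist g T B β) (hτ : 0 < τ.im) (hx : D.IsAdapted T x)
    (hgen : D.Gen g T x τ lam) (hu : u ∉ latt τ) (i : Fin a) :
    ∃ t : 𝔤 ⊗[ℂ] 𝔤, ∀ ψ : Module.Dual ℂ (𝔤 ⊗[ℂ] 𝔤),
      HasDerivAt (fun s => ψ (D.ellipticR g T β x τ (Function.update lam i s) u)) (ψ t) (lam i) := by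
  have h1 : ∀ ψ : Module.Dual ℂ (𝔤 ⊗[ℂ] 𝔤), ∃ d,
      HasDerivAt (fun s => ψ (D.ellipticR g T β x τ (Function.update lam i s) u)) d (lam i) := by
    intro ψ
    have h2 : ∀ w v, ∃ d, HasDerivAt
        (fun s => D.pr w v (D.ellipticR g T β x τ (Function.update lam i s) u)) d (lam i) := by
      intro w v
      refine W.hom_induction hx (p := fun v => ∃ d, HasDerivAt (fun s =>
        D.pr w v (D.ellipticR g T β x τ (Function.update lam i s) u)) d (lam i)) v
        (fun μ j k v hv => ⟨_, hv.hasDerivAt_pr W hτ hx hgen hu w i⟩) ?_ ?_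
      · rintro y z ⟨d, hd⟩ ⟨d', hd'⟩
        exact ⟨d + d', by simpa only [pr_add_right, LinearMap.add_apply] using hd.fun_add hd'⟩
      · rintro c y ⟨d, hd⟩
        exact ⟨c * d, by
          simpa only [pr_smul_right, LinearMap.smul_apply, smul_eq_mul] using hd.const_mul c⟩
    obtain ⟨n, c, d, rfl⟩ := D.dual_eq_sum_pr ψ
    choose d' hd' using h2
    simp only [LinearMap.sum_apply, LinearMap.smul_apply, smul_eq_mul]
    exact ⟨_, HasDerivAt.fun_sum fun p _ => HasDerivAt.fun_sum fun q _ =>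
      (hd' (d p) (d q)).const_mul (c p q)⟩
  choose d hd using h1
  -- By uniqueness of derivatives the derivative is linear in the functional; finite dimension
  -- realizes it as evaluation at a tensor.
  let F : Module.Dual ℂ (Module.Dual ℂ (𝔤 ⊗[ℂ] 𝔤)) :=
    { toFun := d
      map_add' := fun ψ ψ' => (hd (ψ + ψ')).unique (by
        simpa only [LinearMap.add_apply] using (hd ψ).fun_add (hd ψ'))
      map_smul' := fun c ψ => (hd (c • ψ)).unique (by
        simp only [LinearMap.smul_apply, smul_eq_mul, RingHom.id_apply]
        exact (hd ψ).const_mul c) }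
  refine ⟨(Module.evalEquiv ℂ (𝔤 ⊗[ℂ] 𝔤)).symm F, fun ψ => ?_⟩
  have : ψ ((Module.evalEquiv ℂ (𝔤 ⊗[ℂ] 𝔤)).symm F) = d ψ := by
    rw [Module.apply_evalEquiv_symm_apply]; rfl
  rw [this]
  exact hd ψ

end Derivatives

end ChevalleyData

namespace ChevalleyData

variable {𝔤 : Type*} [LieRing 𝔤] [LieAlgebra ℂ 𝔤] [FiniteDimensional ℂ 𝔤]
  [LieAlgebra.IsSimple ℂ 𝔤]

/-! ### The dynamical Yang-Baxter equation on homogeneous vectors. -/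

section YangBaxter

open scoped Classical
open Complex

attribute [-simp] Finset.univ_eq_attach

variable {D : ChevalleyData 𝔤} {g : ℕ} {T : Equiv.Perm D.Node} {B : D.Affine ≃ₗ⁅ℂ⁆ D.Affine}
  {β : 𝔤 ≃ₗ⁅ℂ⁆ 𝔤} {a b : ℕ} {x : Module.Basis (Fin a ⊕ Fin b) ℂ D.H} {τ : ℂ}
  {μ₁ μ₂ μ₃ μ : Fin a → ℂ} {j₁ j₂ j₃ k₁ k₂ k₃ j k : ℤ} {p q u : ℂ} {X Y Z v : 𝔤} {lam : Fin a → ℂ}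

lemma dvd_neg_sub_of_dvd_add {n p q : ℤ} (h : n ∣ q + p) : n ∣ -p - q := by
  obtain ⟨m, hm⟩ := h
  exact ⟨-m, by linear_combination -hm⟩

lemma isTriv_neg_iff {g N : ℕ} : IsTriv g N (-μ) (-j) (-k) ↔ IsTriv g N μ j k := by
  unfold IsTriv
  rw [neg_eq_zero, dvd_neg, dvd_neg]

lemma omg_neg (g N : ℕ) (τ : ℂ) (lam μ : Fin a → ℂ) (j k : ℤ) :
    omg g N τ lam (-μ) (-j) (-k) = -omg g N τ lam μ j k := by
  simp only [omg, Pi.neg_apply, neg_mul, Finset.sum_neg_distrib]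
  push_cast; ring

lemma omg_add (g N : ℕ) (τ : ℂ) (lam μ μ' : Fin a → ℂ) (j k j' k' : ℤ) :
    omg g N τ lam (μ + μ') (j + j') (k + k') = omg g N τ lam μ j k + omg g N τ lam μ' j' k' := by
  simp only [omg, Pi.add_apply, add_mul, Finset.sum_add_distrib]
  push_cast; ring

lemma coef_of_triv {g N : ℕ} (h : IsTriv g N μ j k) (lam : Fin a → ℂ) (u : ℂ) :
    coef g N τ μ j k lam u = -(1 / (2 * Real.pi * I)) * chiFn u τ := by rw [coef, if_pos h]

lemma coef_of_not_triv {g N : ℕ} (h : ¬IsTriv g N μ j k) (lam : Fin a → ℂ) (u : ℂ) :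
    coef g N τ μ j k lam u = -(1 / (2 * Real.pi * I)) *
      (ee (j * u / g) * sigmaFn (omg g N τ lam μ j k) u τ) := by rw [coef, if_neg h]

lemma isHom_basis (W : D.Twist g T B β) (hx : D.IsAdapted T x) (i : Fin a) :
    D.IsHom g T β x 0 0 0 (x (Sum.inl i) : 𝔤) where
  lie l := by rw [lie_H_H]; simp
  gam := by rw [gam_H]; simp [ee_zero]
  beta := by rw [W.mem_lSub_iff_beta.1 (hx.2.1 i)]; simp [ee_zero]

lemma IsHom.form_basis_eq_zero (W : D.Twist g T B β) (hx : D.IsAdapted T x)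
    (hX : D.IsHom g T β x μ j k X) (ht : ¬IsTriv g (orderOf T) μ j k) (i : Fin a) :
    D.form X (x (Sum.inl i)) = 0 := by
  by_contra h
  obtain ⟨h1, h2, h3⟩ := hX.opposite W (isHom_basis W hx i) h
  exact ht ⟨neg_eq_zero.1 h1.symm, by simpa using h2, by simpa using h3⟩

lemma IsHom.lie_triv (W : D.Twist g T B β) (hx : D.IsAdapted T x)
    (hX : D.IsHom g T β x μ j k X) (ht : IsTriv g (orderOf T) μ j k)
    (hZ : D.IsHom g T β x μ₃ j₃ k₃ Z) :
    ⁅X, Z⁆ = (∑ i, D.form X (x (Sum.inl i)) * μ₃ i) • Z := by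
  obtain ⟨l, hl, rfl⟩ := hX.mem_lSub W hx ht
  have h1 : (l : 𝔤) = ∑ i : Fin a, D.form (l : 𝔤) (x (Sum.inl i)) • (x (Sum.inl i) : 𝔤) := by
    have h2 := congrArg Subtype.val (hx.sum_form l)
    rw [Fintype.sum_sum_type, Finset.sum_eq_zero (s := (Finset.univ : Finset (Fin b)))
      (fun i _ => by rw [mem_lPerp_iff.1 (hx.2.2 i) l hl, zero_smul]), add_zero] at h2
    simpa only [AddSubmonoidClass.coe_finsetSum, SetLike.val_smul] using h2.symm
  conv_lhs => rw [h1]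
  rw [sum_lie, Finset.sum_smul]
  exact Finset.sum_congr rfl fun i _ => by rw [smul_lie, hZ.lie, smul_smul]

lemma sum_form_dcoef (N : ℕ) (X : 𝔤) (ht : ¬IsTriv g N μ j k) (u : ℂ) :
    ∑ i, D.form X (x (Sum.inl i)) * dcoef g N τ μ j k lam u i =
      -((1 / (2 * Real.pi * I)) ^ 2 * ee (j * u / g) * dsigmaFn (omg g N τ lam μ j k) u τ) *
        ∑ i, D.form X (x (Sum.inl i)) * μ i := by
  rw [Finset.mul_sum]
  refine Finset.sum_congr rfl fun i _ => ?_
  rw [dcoef, if_neg ht]; ring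

lemma sum_form_dcoef_triv (N : ℕ) (X : 𝔤) (ht : IsTriv g N μ j k) (u : ℂ) :
    ∑ i, D.form X (x (Sum.inl i)) * dcoef g N τ μ j k lam u i = 0 :=
  Finset.sum_eq_zero fun i _ => by rw [dcoef, if_pos ht, mul_zero]

lemma IsHom.sum_form_dcoef_eq_zero (W : D.Twist g T B β) (hx : D.IsAdapted T x)
    (hX : D.IsHom g T β x μ₁ j₁ k₁ X) (ht : ¬IsTriv g (orderOf T) μ₁ j₁ k₁) (N : ℕ) (u : ℂ) :
    ∑ i, D.form X (x (Sum.inl i)) * dcoef g N τ μ j k lam u i = 0 :=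
  Finset.sum_eq_zero fun i _ => by rw [hX.form_basis_eq_zero W hx ht, zero_mul]

lemma IsHom.isTriv_of_form (W : D.Twist g T B β) (hX : D.IsHom g T β x μ₁ j₁ k₁ X)
    (hY : D.IsHom g T β x μ₂ j₂ k₂ Y) (h : D.form X Y ≠ 0) :
    IsTriv g (orderOf T) μ₁ j₁ k₁ ↔ IsTriv g (orderOf T) μ₂ j₂ k₂ := by
  obtain ⟨rfl, h2, h3⟩ := hX.opposite W hY h
  unfold IsTriv
  rw [neg_eq_zero, (dvd_iff_dvd_of_dvd_sub (a := (g : ℤ)) (b := j₁) (c := -j₂) (by simpa using h2)),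
    (dvd_iff_dvd_of_dvd_sub (a := (orderOf T : ℤ)) (b := k₁) (c := -k₂) (by simpa using h3)),
    dvd_neg, dvd_neg]

lemma IsHom.lie_eq_zero_of_triv (W : D.Twist g T B β) (hx : D.IsAdapted T x)
    (hX : D.IsHom g T β x μ₁ j₁ k₁ X) (hY : D.IsHom g T β x μ₂ j₂ k₂ Y)
    (h1 : IsTriv g (orderOf T) μ₁ j₁ k₁) (h2 : IsTriv g (orderOf T) μ₂ j₂ k₂) : ⁅X, Y⁆ = 0 := by
  obtain ⟨l, -, rfl⟩ := hX.mem_lSub W hx h1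
  obtain ⟨l', -, rfl⟩ := hY.mem_lSub W hx h2
  exact D.lie_H_H l l'

/-- The dynamical Yang-Baxter equation, paired with homogeneous elements. -/
lemma IsHom.yangBaxter (W : D.Twist g T B β) (hτ : 0 < τ.im) (hx : D.IsAdapted T x)
    (hgen : D.Gen g T x τ lam) (hX : D.IsHom g T β x μ₁ j₁ k₁ X) (hY : D.IsHom g T β x μ₂ j₂ k₂ Y)
    (hZ : D.IsHom g T β x μ₃ j₃ k₃ Z) (hp : p ∉ latt τ) (hq : q ∉ latt τ) (hqp : q - p ∉ latt τ) :
    (∑ i, D.form X (x (Sum.inl i)) * dcoef g (orderOf T) τ μ₃ j₃ k₃ lam (q - p) i) * D.form Y Z -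
      (∑ i, D.form Y (x (Sum.inl i)) * dcoef g (orderOf T) τ μ₃ j₃ k₃ lam q i) * D.form X Z +
      (∑ i, D.form Z (x (Sum.inl i)) * dcoef g (orderOf T) τ μ₂ j₂ k₂ lam p i) * D.form X Y +
      (coef g (orderOf T) τ μ₂ j₂ k₂ lam p * coef g (orderOf T) τ μ₃ j₃ k₃ lam q +
        coef g (orderOf T) τ (-μ₁) (-j₁) (-k₁) lam q *
          coef g (orderOf T) τ (-μ₂) (-j₂) (-k₂) lam (q - p) -
        coef g (orderOf T) τ (-μ₁) (-j₁) (-k₁) lam p *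
          coef g (orderOf T) τ μ₃ j₃ k₃ lam (q - p)) * D.form X ⁅Y, Z⁆ = 0 := by
  set N := orderOf T with hN
  have hpq : p - q ∉ latt τ := fun h => hqp (by simpa using latt_neg h)
  set K : ℂ := 1 / (2 * Real.pi * I) with hK
  have hf1 : D.form X ⁅Y, Z⁆ = -D.form Y ⁅X, Z⁆ := by rw [← form_lie, form_lie']
  have hf2 : D.form X ⁅Y, Z⁆ = -D.form X ⁅Z, Y⁆ := by rw [← lie_skew, map_neg]
  have hYZ := hY.lie_mem hZ
  -- Here `p`, `q`, `q - p` stand for `u₁ - u₂`, `u₁ - u₃`, `u₂ - u₃`. If at least two types are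
  -- trivial, every term vanishes: elements of `𝔩` commute with each other, act on homogeneous
  -- vectors by scalars and are orthogonal to nontrivial types.
  by_cases t1 : IsTriv g N μ₁ j₁ k₁ <;> by_cases t2 : IsTriv g N μ₂ j₂ k₂ <;>
    by_cases t3 : IsTriv g N μ₃ j₃ k₃
  · rw [sum_form_dcoef_triv N X t3, sum_form_dcoef_triv N Y t3, sum_form_dcoef_triv N Z t2,
      hY.lie_eq_zero_of_triv W hx hZ t2 t3]
    simp
  · rw [sum_form_dcoef_triv N Z t2, hf1, hX.lie_triv W hx t1 hZ, map_smul, smul_eq_mul,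
      show D.form Y Z = 0 from by_contra fun h => t3 ((hY.isTriv_of_form W hZ h).1 t2),
      show D.form X Z = 0 from by_contra fun h => t3 ((hX.isTriv_of_form W hZ h).1 t1)]
    ring
  · rw [sum_form_dcoef_triv N X t3, sum_form_dcoef_triv N Y t3, hf2, hZ.lie_triv W hx t3 hY,
      map_smul, smul_eq_mul,
      show D.form X Y = 0 from by_contra fun h => t2 ((hX.isTriv_of_form W hY h).1 t1)]
    ring
  -- Only `X` lies in `𝔩`: it acts on `Z` by a scalar, so `Y` and `Z` must have opposite types. The
  -- identity is the degenerate one at the index of `Z`, with arguments `q` and `p`.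
  · rw [hY.sum_form_dcoef_eq_zero W hx t2, hZ.sum_form_dcoef_eq_zero W hx t3,
      sum_form_dcoef N X t3, hf1, hX.lie_triv W hx t1 hZ, map_smul, smul_eq_mul]
    by_cases h0 : D.form Y Z = 0
    · rw [h0]; ring
    obtain ⟨h1, h2, h3⟩ := hZ.opposite W hY (by rwa [form_comm])
    have hZ0 : Z ≠ 0 := by rintro rfl; simp at h0
    have hb := hZ.omg_not_mem W hτ hgen hZ0 t3
    have hid := sigmaFn_chiFn_identity hτ hb hq hp hqp
    rw [h1, coef_congr W.pos orderOf_T_pos (j' := -j₃) (by rwa [sub_neg_eq_add, add_comm])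
      (k' := -k₃) (by rwa [sub_neg_eq_add, add_comm]), coef_congr W.pos orderOf_T_pos (j := -j₂)
      (j' := j₃) (dvd_neg_sub_of_dvd_add h2)
      (k := -k₂) (k' := k₃) (dvd_neg_sub_of_dvd_add h3), neg_neg,
      coef_of_not_triv (isTriv_neg_iff.not.2 t3), coef_of_not_triv t3, coef_of_not_triv t3,
      coef_of_triv (isTriv_neg_iff.2 t1), coef_of_triv (isTriv_neg_iff.2 t1), omg_neg]
    rw [← hK]
    have e1 : ee (j₃ * q / g) = ee (j₃ * (q - p) / g) * ee (j₃ * p / g) := by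
      rw [← ee_add]; congr 1; ring
    have e2 : ee (((-j₃ : ℤ) : ℂ) * p / g) * ee (j₃ * p / g) = 1 := by
      rw [← ee_add, ← ee_zero]; congr 1; push_cast; ring
    rw [e1]
    linear_combination (-(K ^ 2 * ee (j₃ * (q - p) / g) *
      (∑ i, D.form X (x (Sum.inl i)) * μ₃ i) * D.form Y Z)) * hid -
      K ^ 2 * ee (j₃ * (q - p) / g) * (∑ i, D.form X (x (Sum.inl i)) * μ₃ i) * D.form Y Z *
      sigmaFn (omg g N τ lam μ₃ j₃ k₃) q τ * sigmaFn (-omg g N τ lam μ₃ j₃ k₃) p τ * e2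
  · rw [sum_form_dcoef_triv N X t3, sum_form_dcoef_triv N Y t3, sum_form_dcoef_triv N Z t2,
      hY.lie_eq_zero_of_triv W hx hZ t2 t3]
    simp
  -- Only `Y` lies in `𝔩`: the degenerate identity at the index of `Z`, with arguments `p` and `q`.
  · rw [hX.sum_form_dcoef_eq_zero W hx t1, sum_form_dcoef_triv N Z t2,
      sum_form_dcoef N Y t3, hY.lie_triv W hx t2 hZ, map_smul, smul_eq_mul]
    by_cases h0 : D.form X Z = 0
    · rw [h0]; ring
    obtain ⟨h1, h2, h3⟩ := hZ.opposite W hX (by rwa [form_comm])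
    have hZ0 : Z ≠ 0 := by rintro rfl; simp at h0
    have hb := hZ.omg_not_mem W hτ hgen hZ0 t3
    have hid := sigmaFn_chiFn_identity hτ hb hp hpq (by rwa [sub_sub_cancel])
    rw [h1, neg_neg, coef_congr W.pos orderOf_T_pos (j := -j₁)
      (j' := j₃) (dvd_neg_sub_of_dvd_add h2)
      (k := -k₁) (k' := k₃) (dvd_neg_sub_of_dvd_add h3),
      coef_congr W.pos orderOf_T_pos (j := -j₁)
      (j' := j₃) (dvd_neg_sub_of_dvd_add h2)
      (k := -k₁) (k' := k₃) (dvd_neg_sub_of_dvd_add h3),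
      coef_of_not_triv t3, coef_of_not_triv t3, coef_of_not_triv t3,
      coef_of_triv (isTriv_neg_iff.2 t2), coef_of_triv t2]
    rw [← hK]
    have e1 : ee (j₃ * q / g) = ee (j₃ * p / g) * ee (j₃ * (q - p) / g) := by
      rw [← ee_add]; congr 1; ring
    have e2 : sigmaFn (-omg g N τ lam μ₃ j₃ k₃) (p - q) τ =
        -sigmaFn (omg g N τ lam μ₃ j₃ k₃) (q - p) τ := by
      rw [← sigmaFn_neg_neg, neg_sub]
    have e3 : chiFn (p - q) τ = -chiFn (q - p) τ := by rw [← chiFn_neg hτ, neg_sub]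
    rw [e2, e3, sub_sub_cancel] at hid
    rw [e1]
    linear_combination (K ^ 2 * ee (j₃ * p / g) * ee (j₃ * (q - p) / g) *
      (∑ i, D.form Y (x (Sum.inl i)) * μ₃ i) * D.form X Z) * hid
  -- Only `Z` lies in `𝔩`: the degenerate identity at the index of `Y`, with arguments `q` and `q -
  -- p`.
  · rw [sum_form_dcoef_triv N X t3, sum_form_dcoef_triv N Y t3,
      sum_form_dcoef N Z t2, hf2, hZ.lie_triv W hx t3 hY, map_smul, smul_eq_mul]
    by_cases h0 : D.form X Y = 0
    · rw [h0]; ring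
    obtain ⟨h1, h2, h3⟩ := hY.opposite W hX (by rwa [form_comm])
    have hY0 : Y ≠ 0 := by rintro rfl; simp at h0
    have ha := hY.omg_not_mem W hτ hgen hY0 t2
    have hid := sigmaFn_chiFn_identity hτ ha hq hqp (by rwa [sub_sub_cancel])
    rw [sub_sub_cancel] at hid
    rw [h1, neg_neg, coef_congr W.pos orderOf_T_pos (j := -j₁)
      (j' := j₂) (dvd_neg_sub_of_dvd_add h2)
      (k := -k₁) (k' := k₂) (dvd_neg_sub_of_dvd_add h3),
      coef_congr W.pos orderOf_T_pos (j := -j₁)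
      (j' := j₂) (dvd_neg_sub_of_dvd_add h2)
      (k := -k₁) (k' := k₂) (dvd_neg_sub_of_dvd_add h3),
      coef_of_not_triv t2, coef_of_not_triv t2, coef_of_not_triv (isTriv_neg_iff.not.2 t2),
      coef_of_triv t3, coef_of_triv t3, omg_neg]
    rw [← hK]
    have e1 : ee (j₂ * q / g) * ee (((-j₂ : ℤ) : ℂ) * (q - p) / g) = ee (j₂ * p / g) := by
      rw [← ee_add]; congr 1; push_cast; ring
    linear_combination (-(K ^ 2 * ee (j₂ * p / g) *
      (∑ i, D.form Z (x (Sum.inl i)) * μ₂ i) * D.form X Y)) * hid -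
      K ^ 2 * sigmaFn (omg g N τ lam μ₂ j₂ k₂) q τ * sigmaFn (-omg g N τ lam μ₂ j₂ k₂) (q - p) τ *
      (∑ i, D.form Z (x (Sum.inl i)) * μ₂ i) * D.form X Y * e1
  -- No vector is in `𝔩`: the derivative terms vanish by orthogonality. The type of `X` is opposite
  -- to that of `[Y, Z]`, whose index is the sum of those of `Y` and `Z`, so the three-term identity
  -- applies.
  · rw [hX.sum_form_dcoef_eq_zero W hx t1, hY.sum_form_dcoef_eq_zero W hx t2,
      hZ.sum_form_dcoef_eq_zero W hx t3]
    by_cases h0 : D.form X ⁅Y, Z⁆ = 0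
    · rw [h0]; ring
    have hX0 : X ≠ 0 := by rintro rfl; simp at h0
    have hYZ0 : ⁅Y, Z⁆ ≠ 0 := by intro h; simp [h] at h0
    have hY0 : Y ≠ 0 := by rintro rfl; simp at hYZ0
    have hZ0 : Z ≠ 0 := by rintro rfl; simp at hYZ0
    have t4 : ¬IsTriv g N (μ₂ + μ₃) (j₂ + j₃) (k₂ + k₃) :=
      (hX.isTriv_of_form W hYZ h0).not.1 t1
    obtain ⟨h1, h2, h3⟩ := hYZ.opposite W hX (by rwa [form_comm])
    have ha := hY.omg_not_mem W hτ hgen hY0 t2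
    have hb := hZ.omg_not_mem W hτ hgen hZ0 t3
    have hab := hYZ.omg_not_mem W hτ hgen hYZ0 t4
    rw [← hN, omg_add] at hab
    have hid := sigmaFn_three_term hτ ha hb hab hp hq hpq
    rw [h1, neg_neg, coef_congr W.pos orderOf_T_pos (j := -j₁)
      (j' := j₂ + j₃) (dvd_neg_sub_of_dvd_add h2)
      (k := -k₁) (k' := k₂ + k₃) (dvd_neg_sub_of_dvd_add h3),
      coef_congr W.pos orderOf_T_pos (j := -j₁)
      (j' := j₂ + j₃) (dvd_neg_sub_of_dvd_add h2)
      (k := -k₁) (k' := k₂ + k₃) (dvd_neg_sub_of_dvd_add h3),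
      coef_of_not_triv t2, coef_of_not_triv t3, coef_of_not_triv t4,
      coef_of_not_triv (isTriv_neg_iff.not.2 t2), coef_of_not_triv t4, coef_of_not_triv t3,
      omg_neg, omg_add]
    rw [← hK]
    have e0 : sigmaFn (-omg g N τ lam μ₂ j₂ k₂) (q - p) τ =
        -sigmaFn (omg g N τ lam μ₂ j₂ k₂) (p - q) τ := by
      rw [← sigmaFn_neg_neg, neg_sub]
    have e1 : ee (((j₂ + j₃ : ℤ) : ℂ) * q / g) * ee (((-j₂ : ℤ) : ℂ) * (q - p) / g) =
        ee (j₂ * p / g) * ee (j₃ * q / g) := by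
      rw [← ee_add, ← ee_add]; congr 1; push_cast; ring
    have e2 : ee (((j₂ + j₃ : ℤ) : ℂ) * p / g) * ee (j₃ * (q - p) / g) =
        ee (j₂ * p / g) * ee (j₃ * q / g) := by
      rw [← ee_add, ← ee_add]; congr 1; push_cast; ring
    rw [e0]
    linear_combination (K ^ 2 * ee (j₂ * p / g) * ee (j₃ * q / g) * D.form X ⁅Y, Z⁆) * hid -
      K ^ 2 * sigmaFn (omg g N τ lam μ₂ j₂ k₂ + omg g N τ lam μ₃ j₃ k₃) q τ *
        sigmaFn (omg g N τ lam μ₂ j₂ k₂) (p - q) τ * D.form X ⁅Y, Z⁆ * e1 -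
      K ^ 2 * sigmaFn (omg g N τ lam μ₂ j₂ k₂ + omg g N τ lam μ₃ j₃ k₃) p τ *
        sigmaFn (omg g N τ lam μ₃ j₃ k₃) (q - p) τ * D.form X ⁅Y, Z⁆ * e2

end YangBaxter

end ChevalleyData

namespace ChevalleyData

variable {𝔤 : Type*} [LieRing 𝔤] [LieAlgebra ℂ 𝔤] [FiniteDimensional ℂ 𝔤]
  [LieAlgebra.IsSimple ℂ 𝔤]

/-! ### Pairings on `𝔤 ⊗ 𝔤 ⊗ 𝔤`. -/

section TripleTensors

open CDYBE

variable (D : ChevalleyData 𝔤)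

/-- The functional `a ⊗ b ⊗ c ↦ (X, a) (Y, b) (Z, c)`. -/
def pr3 (X Y Z : 𝔤) : Module.Dual ℂ (𝔤 ⊗[ℂ] (𝔤 ⊗[ℂ] 𝔤)) := D.pr Y Z ∘ₗ D.contr X

@[simp] lemma pr3_tmul (X Y Z a b c : 𝔤) :
    D.pr3 X Y Z (a ⊗ₜ[ℂ] (b ⊗ₜ[ℂ] c)) = D.form X a * (D.form Y b * D.form Z c) := by
  simp [pr3]

@[simp] lemma brk_tmul (a b : 𝔤) : brk (a ⊗ₜ[ℂ] b) = ⁅a, b⁆ := by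
  simp [brk]

lemma br1213_tmul (p q r s : 𝔤) :
    br1213 (p ⊗ₜ[ℂ] q) (r ⊗ₜ[ℂ] s) = ⁅p, r⁆ ⊗ₜ[ℂ] (q ⊗ₜ[ℂ] s) := by
  simp [br1213]

lemma br1323_tmul (p q r s : 𝔤) :
    br1323 (p ⊗ₜ[ℂ] q) (r ⊗ₜ[ℂ] s) = p ⊗ₜ[ℂ] (r ⊗ₜ[ℂ] ⁅q, s⁆) := by
  simp [br1323]

lemma br1223_tmul (p q r s : 𝔤) :
    br1223 (p ⊗ₜ[ℂ] q) (r ⊗ₜ[ℂ] s) = p ⊗ₜ[ℂ] (⁅q, r⁆ ⊗ₜ[ℂ] s) := by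
  simp [br1223]

lemma tensor_induction₂ {p : 𝔤 ⊗[ℂ] 𝔤 → 𝔤 ⊗[ℂ] 𝔤 → Prop} (r s : 𝔤 ⊗[ℂ] 𝔤)
    (h : ∀ a b c d, p (a ⊗ₜ b) (c ⊗ₜ d)) (h1 : ∀ r r' s, p r s → p r' s → p (r + r') s)
    (h2 : ∀ r s s', p r s → p r s' → p r (s + s')) : p r s := by
  have h0 : ∀ a b s, p (a ⊗ₜ b) s := fun a b s => by
    induction s with
    | zero => simpa using h a b 0 0
    | tmul c d => exact h a b c d
    | add s t hs ht => exact h2 _ _ _ hs ht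
  induction r with
  | zero => simpa using h0 0 0 s
  | tmul a b => exact h0 a b s
  | add r t hr ht => exact h1 _ _ _ hr ht

/-- The legs that are not bracketed are contracted away. So a commutator of r-matrices is expressed
by brackets of the operators they define, which are scalar on homogeneous vectors. -/
lemma pr3_br1213 (X Y Z : 𝔤) (r s : 𝔤 ⊗[ℂ] 𝔤) :
    D.pr3 X Y Z (br1213 r s) = D.form X ⁅D.contr' Y r, D.contr' Z s⁆ := by
  refine tensor_induction₂ (p := fun r s => D.pr3 X Y Z (br1213 r s) =
    D.form X ⁅D.contr' Y r, D.contr' Z s⁆) r s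
    (fun a b c d => ?_) (fun r r' s h h' => ?_) fun r s s' h h' => ?_
  · rw [br1213_tmul]; simp; ring
  · rw [map_add, add_lie, map_add, ← h, ← h', ← map_add]; congr 1
    simp only [br1213, TensorProduct.add_tmul, map_add]
  · rw [map_add, lie_add, map_add, ← h, ← h', ← map_add]; congr 1
    simp only [br1213, TensorProduct.tmul_add, map_add]

lemma pr3_br1323 (X Y Z : 𝔤) (r s : 𝔤 ⊗[ℂ] 𝔤) :
    D.pr3 X Y Z (br1323 r s) = D.form Z ⁅D.contr X r, D.contr Y s⁆ := by
  refine tensor_induction₂ (p := fun r s => D.pr3 X Y Z (br1323 r s) =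
    D.form Z ⁅D.contr X r, D.contr Y s⁆) r s
    (fun a b c d => ?_) (fun r r' s h h' => ?_) fun r s s' h h' => ?_
  · rw [br1323_tmul]; simp; ring
  · rw [map_add, add_lie, map_add, ← h, ← h', ← map_add]; congr 1
    simp only [br1323, TensorProduct.add_tmul, map_add]
  · rw [map_add, lie_add, map_add, ← h, ← h', ← map_add]; congr 1
    simp only [br1323, TensorProduct.tmul_add, map_add]

lemma pr3_br1223 (X Y Z : 𝔤) (r s : 𝔤 ⊗[ℂ] 𝔤) :
    D.pr3 X Y Z (br1223 r s) = D.form Y ⁅D.contr X r, D.contr' Z s⁆ := by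
  refine tensor_induction₂ (p := fun r s => D.pr3 X Y Z (br1223 r s) =
    D.form Y ⁅D.contr X r, D.contr' Z s⁆) r s
    (fun a b c d => ?_) (fun r r' s h h' => ?_) fun r s s' h h' => ?_
  · rw [br1223_tmul]; simp; ring
  · rw [map_add, add_lie, map_add, ← h, ← h', ← map_add]; congr 1
    simp only [br1223, TensorProduct.add_tmul, map_add]
  · rw [map_add, lie_add, map_add, ← h, ← h', ← map_add]; congr 1
    simp only [br1223, TensorProduct.tmul_add, map_add]

lemma pr3_ins1 (X Y Z v : 𝔤) (r : 𝔤 ⊗[ℂ] 𝔤) :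
    D.pr3 X Y Z (ins1 v r) = D.form X v * D.pr Y Z r := by
  simp [pr3, ins1]

lemma pr3_ins2 (X Y Z v : 𝔤) (r : 𝔤 ⊗[ℂ] 𝔤) :
    D.pr3 X Y Z (ins2 v r) = D.form Y v * D.pr X Z r := by
  induction r with
  | zero => simp [ins2]
  | tmul a b => simp [ins2]; ring
  | add r s hr hs =>
    rw [map_add, mul_add, ← hr, ← hs, ← map_add]; congr 1
    simp only [ins2, TensorProduct.tmul_add, map_add]

lemma pr3_ins3 (X Y Z v : 𝔤) (r : 𝔤 ⊗[ℂ] 𝔤) :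
    D.pr3 X Y Z (ins3 v r) = D.form Z v * D.pr X Y r := by
  induction r with
  | zero => simp [ins3]
  | tmul a b => simp [ins3]; ring
  | add r s hr hs =>
    rw [map_add, mul_add, ← hr, ← hs, ← map_add]; congr 1
    simp only [ins3, TensorProduct.add_tmul, map_add]

end TripleTensors

/-! ### Yang-Baxter equation for tensors, `𝔩`-invariance, and Felder's case. -/

section HoldsAt

open scoped Classical
open Complex CDYBE

attribute [-simp] Finset.univ_eq_attach

variable {D : ChevalleyData 𝔤} {g : ℕ} {T : Equiv.Perm D.Node} {B : D.Affine ≃ₗ⁅ℂ⁆ D.Affine}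
  {β : 𝔤 ≃ₗ⁅ℂ⁆ 𝔤} {a b : ℕ} {x : Module.Basis (Fin a ⊕ Fin b) ℂ D.H} {τ : ℂ} {lam : Fin a → ℂ}

lemma Twist.pr3_eq_zero (W : D.Twist g T B β) (hx : D.IsAdapted T x) {t : 𝔤 ⊗[ℂ] (𝔤 ⊗[ℂ] 𝔤)}
    (h : ∀ μ₁ j₁ k₁ X, D.IsHom g T β x μ₁ j₁ k₁ X → ∀ μ₂ j₂ k₂ Y, D.IsHom g T β x μ₂ j₂ k₂ Y →
      ∀ μ₃ j₃ k₃ Z, D.IsHom g T β x μ₃ j₃ k₃ Z → D.pr3 X Y Z t = 0) : t = 0 := by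
  refine D.contr_ext fun X => ?_
  refine W.hom_induction hx (p := fun X => D.contr X t = 0) X (fun μ₁ j₁ k₁ X hX => ?_) ?_ ?_
  · refine D.contr_ext fun Y => ?_
    refine W.hom_induction hx (p := fun Y => D.contr Y (D.contr X t) = 0) Y
      (fun μ₂ j₂ k₂ Y hY => ?_) ?_ ?_
    · refine D.form_right_cancel fun Z => ?_
      rw [map_zero]
      refine W.hom_induction hx (p := fun Z => D.form Z (D.contr Y (D.contr X t)) = 0) Z
        (fun μ₃ j₃ k₃ Z hZ => h _ _ _ X hX _ _ _ Y hY _ _ _ Z hZ) ?_ ?_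
      · intro y z hy hz; rw [map_add, LinearMap.add_apply, hy, hz, add_zero]
      · intro c y hy; rw [map_smul, LinearMap.smul_apply, hy, smul_zero]
    · intro y z hy hz; rw [map_add, LinearMap.add_apply, hy, hz, add_zero]
    · intro c y hy; rw [map_smul, LinearMap.smul_apply, hy, smul_zero]
  · intro y z hy hz; rw [map_add, LinearMap.add_apply, hy, hz, add_zero]
  · intro c y hy; rw [map_smul, LinearMap.smul_apply, hy, smul_zero]

lemma exists_exp_eq (g : ℕ) (hg : 0 < g) {z : ℂ} (hz : z ≠ 0) :
    ∃ u : ℂ, Complex.exp (2 * Real.pi * I * u / g) = z := by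
  refine ⟨g / (2 * Real.pi * I) * Complex.log z, ?_⟩
  have hg' : (g : ℂ) ≠ 0 := by exact_mod_cast hg.ne'
  have hpi := Complex.two_pi_I_ne_zero
  rw [show 2 * Real.pi * I * (g / (2 * Real.pi * I) * Complex.log z) / g = Complex.log z by
    field_simp, Complex.exp_log hz]

lemma not_mem_latt_of_pow_ne (hg : 0 < g) {u : ℂ}
    (h : ∀ k : ℤ, Complex.exp (2 * Real.pi * I * u / g) ^ g ≠
      Complex.exp (2 * Real.pi * I * k * τ)) : u ∉ latt τ := by
  rintro ⟨p, q, rfl⟩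
  have hg' : (g : ℂ) ≠ 0 := by exact_mod_cast hg.ne'
  refine h q ?_
  rw [← Complex.exp_nat_mul, show (g : ℂ) * (2 * Real.pi * I * (p + q * τ) / g) =
    2 * Real.pi * I * q * τ + p * (2 * Real.pi * I) by field_simp; ring,
    Complex.exp_periodic.int_mul p]

/-- The elliptic r-matrix satisfies the dynamical Yang-Baxter equation. -/
lemma Twist.holdsAt (W : D.Twist g T B β) (hτ : 0 < τ.im) (hx : D.IsAdapted T x)
    {R : (Fin a → ℂ) → ℂ → 𝔤 ⊗[ℂ] 𝔤}
    (hR : ∀ lam u, R lam (Complex.exp (2 * Real.pi * I * u / g)) = D.ellipticR g T β x τ lam u)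
    (hgen : D.Gen g T x τ lam) {z₁ z₂ z₃ : ℂ} (h1 : z₁ ≠ 0) (h2 : z₂ ≠ 0) (h3 : z₃ ≠ 0)
    (hz : ∀ z ∈ ({z₁ / z₂, z₁ / z₃, z₂ / z₃} : Set ℂ), ∀ k : ℤ,
      z ^ g ≠ Complex.exp (2 * Real.pi * I * k * τ)) :
    HoldsAt (fun j => (x (Sum.inl j) : 𝔤)) R lam z₁ z₂ z₃ := by
  obtain ⟨u₁, rfl⟩ := exists_exp_eq g W.pos h1
  obtain ⟨u₂, rfl⟩ := exists_exp_eq g W.pos h2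
  obtain ⟨u₃, rfl⟩ := exists_exp_eq g W.pos h3
  have hd : ∀ u u' : ℂ, Complex.exp (2 * Real.pi * I * u / g) /
      Complex.exp (2 * Real.pi * I * u' / g) = Complex.exp (2 * Real.pi * I * (u - u') / g) := by
    intro u u'
    rw [← Complex.exp_sub]; congr 1; ring
  rw [hd, hd, hd] at hz
  have h12 : u₁ - u₂ ∉ latt τ := not_mem_latt_of_pow_ne W.pos (hz _ (by simp))
  have h13 : u₁ - u₃ ∉ latt τ := not_mem_latt_of_pow_ne W.pos (hz _ (by simp))
  have h23 : u₂ - u₃ ∉ latt τ := not_mem_latt_of_pow_ne W.pos (hz _ (by simp))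
  have hdiff := fun (u : ℂ) (hu : u ∉ latt τ) => W.exists_deriv hτ hx hgen hu
  let P : Fin a → ℂ → 𝔤 ⊗[ℂ] 𝔤 → Prop := fun j z t => ∀ ψ : Module.Dual ℂ (𝔤 ⊗[ℂ] 𝔤),
    HasDerivAt (fun s : ℂ => ψ (R (Function.update lam j s) z)) (ψ t) (lam j)
  -- The default `0` is harmless: a derivative exists at each of the three ratios that occur.
  let R' : Fin a → ℂ → 𝔤 ⊗[ℂ] 𝔤 := fun j z => if h : ∃ t, P j z t then h.choose else 0
  have hR' : ∀ j (u : ℂ), u ∉ latt τ → P j (Complex.exp (2 * Real.pi * I * u / g))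
      (R' j (Complex.exp (2 * Real.pi * I * u / g))) := by
    intro j u hu
    have h : ∃ t, P j (Complex.exp (2 * Real.pi * I * u / g)) t := by
      obtain ⟨t, ht⟩ := hdiff u hu j
      exact ⟨t, fun ψ => by simpa only [hR] using ht ψ⟩
    simp only [R', dif_pos h]
    exact h.choose_spec
  have hpr : ∀ i (u : ℂ), u ∉ latt τ → ∀ w μ j k v, D.IsHom g T β x μ j k v →
      D.pr w v (R' i (Complex.exp (2 * Real.pi * I * u / g))) =
        dcoef g (orderOf T) τ μ j k lam u i * D.form w v := by
    intro i u hu w μ j k v hv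
    have e1 := hR' i u hu (D.pr w v)
    simp only [hR] at e1
    exact e1.unique (hv.hasDerivAt_pr W hτ hx hgen hu w i)
  refine ⟨R', ?_, ?_⟩
  · intro j z hz'
    rw [hd, hd, hd] at hz'
    rcases hz' with rfl | rfl | rfl
    · exact hR' j _ h12
    · exact hR' j _ h13
    · exact hR' j _ h23
  · rw [hd, hd, hd, hR, hR, hR]
    refine W.pr3_eq_zero hx fun μ₁ j₁ k₁ X hX μ₂ j₂ k₂ Y hY μ₃ j₃ k₃ Z hZ => ?_
    have hyb := hX.yangBaxter W hτ hx hgen hY hZ (p := u₁ - u₂) (q := u₁ - u₃) h12 h13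
      (by rwa [sub_sub_sub_cancel_left])
    have e23 : u₁ - u₃ - (u₁ - u₂) = u₂ - u₃ := by ring
    rw [e23] at hyb
    simp only [map_add, map_sub, map_sum, pr3_br1213, pr3_br1323, pr3_br1223, pr3_ins1, pr3_ins2,
      pr3_ins3, hpr _ _ h12 X _ _ _ Y hY, hpr _ _ h13 X _ _ _ Z hZ, hpr _ _ h23 Y _ _ _ Z hZ,
      hY.contr'_ellipticR W hτ hx hgen h12, hZ.contr'_ellipticR W hτ hx hgen h13,
      hX.contr_ellipticR W hτ hx hgen h13, hY.contr_ellipticR W hτ hx hgen h23,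
      hX.contr_ellipticR W hτ hx hgen h12, hZ.contr'_ellipticR W hτ hx hgen h23,
      smul_lie, lie_smul, map_smul, smul_eq_mul]
    rw [← hyb]
    have f1 : D.form Z ⁅X, Y⁆ = D.form X ⁅Y, Z⁆ := by rw [D.form_comm, form_lie]
    have f2 : D.form Y ⁅X, Z⁆ = -D.form X ⁅Y, Z⁆ := by
      rw [← D.form_lie X Y Z, form_lie', neg_neg]
    rw [f1, f2, Finset.sum_add_distrib, Finset.sum_sub_distrib, Finset.sum_mul, Finset.sum_mul,
      Finset.sum_mul]
    simp only [mul_assoc]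
    ring

/-- The elliptic r-matrix is `𝔩`-invariant. -/
lemma Twist.lie_ellipticR (W : D.Twist g T B β) {h : D.H} (hh : h ∈ D.lSub T) (lam : Fin a → ℂ)
    (u : ℂ) : ⁅(h : 𝔤), D.ellipticR g T β x τ lam u⁆ = 0 := by
  -- Each elementary tensor in the formula is annihilated separately, because `β` commutes with `ad
  -- 𝔩`. The coefficients play no role, so invariance holds for all `λ` and `u`.
  have hit : ∀ (l : ℕ) (v : 𝔤), ⁅(h : 𝔤), β^[l] v⁆ = β^[l] ⁅(h : 𝔤), v⁆ := by
    intro l v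
    induction l with
    | zero => rfl
    | succ l ih =>
      rw [Function.iterate_succ_apply', Function.iterate_succ_apply', W.beta_lie_lSub hh, ih]
  have hsm : ∀ (l : ℕ) (c : ℂ) (v : 𝔤), β^[l] (c • v) = c • β^[l] v := by
    intro l c v
    rw [← lieIter_apply, map_smul, lieIter_apply]
  have hz : ∀ l : ℕ, β^[l] (0 : 𝔤) = 0 := fun l => by rw [← lieIter_apply, map_zero]
  have e1 : ∀ (l : ℕ) α, ⁅(h : 𝔤), D.E α ⊗ₜ[ℂ] β^[l] (D.E (D.neg α))⁆ = 0 := by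
    intro l α
    rw [TensorProduct.LieModule.lie_tmul_right, hit, lie_H_E, lie_H_E, rootVal_neg, hsm,
      TensorProduct.tmul_smul, ← TensorProduct.smul_tmul', ← add_smul, add_neg_cancel, zero_smul]
  have e2 : ∀ (l : ℕ) i, ⁅(h : 𝔤), (x i : 𝔤) ⊗ₜ[ℂ] β^[l] (x i : 𝔤)⁆ = 0 := by
    intro l i
    rw [TensorProduct.LieModule.lie_tmul_right, hit, lie_H_H, hz]; simp
  have e3 : ∀ i, ⁅(h : 𝔤), (D.betaCayley T β (x (Sum.inr i)) : 𝔤) ⊗ₜ[ℂ] (x (Sum.inr i) : 𝔤)⁆ = 0 := by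
    intro i
    rw [TensorProduct.LieModule.lie_tmul_right, lie_H_H, lie_H_H]; simp
  rw [ellipticR, lie_add, lie_sub, lie_neg, lie_sum, lie_sum, lie_smul, lie_sum]
  simp only [lie_sum, lie_smul, e1, e2, e3, smul_zero, Finset.sum_const_zero, neg_zero, sub_zero,
    add_zero]

/-- For `T = 1` the elliptic r-matrix is gauge equivalent to Felder's. -/
lemma Twist.ellipticR_felder (W : D.Twist g T B β) (hx : D.IsAdapted T x) (hT : T = 1)
    (lam : Fin a → ℂ) (u : ℂ) :
    D.ellipticR g T β x τ lam u = (-(1 / (2 * Real.pi * I)) : ℂ) •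
      TensorProduct.map (D.torusAd ((2 * Real.pi * I * u / g) • D.ρ)) LinearMap.id
        (D.felderR x τ ((1 / (2 * Real.pi * I) : ℂ) • D.lamH x lam - (τ / g) • D.ρ) u) := by
  have hN : orderOf T = 1 := by rw [hT, orderOf_one]
  -- For `T = 1` one has `𝔩 = 𝔥`, so members of `𝔩^⊥` lie in `𝔩 ∩ 𝔩^⊥ = 0` and the Cayley term drops
  -- out.
  have hb : ∀ i : Fin b, x (Sum.inr i) = 0 := by
    intro i
    refine W.eq_zero_of_mem_of_mem hx ?_ (hx.2.2 i)
    rw [mem_lSub_iff, hT]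
    intro i; rfl
  have hpi := two_pi_I_ne
  rw [ellipticR, felderR, hN]
  simp only [Finset.range_one, Finset.sum_singleton, hb, ZeroMemClass.coe_zero,
    TensorProduct.tmul_zero, Finset.sum_const_zero, smul_zero, add_zero, Function.iterate_zero,
    id_eq, if_true, Nat.cast_zero, zero_mul, Nat.cast_one, one_mul, neg_zero, zero_add,
    map_add, map_smul, map_sum, TensorProduct.map_tmul, torusAd_E, torusAd_H, LinearMap.id_apply,
    smul_add]
  rw [sub_eq_add_neg, add_comm]
  congr 1
  · rw [← Finset.smul_sum, smul_smul, ← neg_smul]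
    congr 1; ring
  · rw [← Finset.sum_neg_distrib, Finset.smul_sum]
    refine Finset.sum_congr rfl fun α _ => ?_
    rw [← TensorProduct.smul_tmul', smul_smul, smul_smul, ← neg_smul]
    congr 1
    have e1 : D.rootVal α ((1 / (2 * Real.pi * I) : ℂ) • D.lamH x lam - (τ / g) • D.ρ) =
        1 / (2 * Real.pi * I) * D.val g x τ lam α := by
      rw [rootVal_sub, rootVal_smul, rootVal_smul, rootVal_ρ, val]
      field_simp
    rw [e1, rootVal_smul, rootVal_ρ]
    rw [show 2 * Real.pi * I * u / g * D.ht α = 2 * Real.pi * I * D.ht α * u / g by ring]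
    ring

end HoldsAt

end ChevalleyData

/-! ### Expansions of `σ` and `χ` in the strip corresponding to the annulus. -/

section LaurentSeries

open Complex

/-- The coefficients of the Laurent expansion of the elliptic functions in the strip
`-Im τ < Im u < 0`. -/
def laurentTerm (w u τ : ℂ) (m : ℤ) : ℂ := ee (m * u) * (ee (m * τ - w) / (1 - ee (m * τ - w)))

/-- By `q/(1 - q) = -1/(1 - q⁻¹)`, the expansion below the real axis is the one above it after
changing the signs of `u`, `w` and `m`. At `q = 1` both sides are `0` by convention. -/
lemma laurentTerm_eq (w u τ : ℂ) (m : ℤ) :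
    laurentTerm w u τ m =
      -(ee (((-m : ℤ) : ℂ) * -u) / (1 - ee (((-m : ℤ) : ℂ) * τ - -w))) := by
  have e1 : ee (((-m : ℤ) : ℂ) * τ - -w) = (ee (m * τ - w))⁻¹ := by
    rw [← ee_neg]; congr 1; push_cast; ring
  have e2 : ee (((-m : ℤ) : ℂ) * -u) = ee (m * u) := by congr 1; push_cast; ring
  rw [laurentTerm, e1, e2]
  have hq := ee_ne_zero (m * τ - w)
  generalize ee (m * τ - w) = q at *
  by_cases h : q = 1
  · simp [h]
  have h1 : 1 - q ≠ 0 := sub_ne_zero.2 (Ne.symm h)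
  have h2 : q - 1 ≠ 0 := sub_ne_zero.2 h
  have h3 : 1 - q⁻¹ = (q - 1) / q := by field_simp
  rw [h3, div_div_eq_mul_div, mul_div_assoc, ← mul_neg]
  congr 1
  rw [← div_neg, neg_sub]

variable {τ u w : ℂ}

lemma hasSum_laurentTerm (hτ : 0 < τ.im) (hw : w ∉ latt τ) (h0 : u.im < 0) (h1 : -τ.im < u.im) :
    HasSum (laurentTerm w u τ) (-(1 / (2 * Real.pi * I)) * sigmaFn w u τ) := by
  have h := hasSum_sigmaFn hτ (w := -w) (u := -u) (fun h => hw (latt_neg_iff.1 h))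
    (by simpa using h0) (by simpa using neg_lt.1 h1)
  have h' := ((Equiv.neg ℤ).hasSum_iff.2 h).neg
  rw [sigmaFn_neg_neg] at h'
  convert! h' using 1
  · funext m; rw [laurentTerm_eq]; rfl
  · ring

/-- The term `m = 0` is `1/0 = 0` and contributes nothing; the `1/2` is the constant of the
Kronecker series of `χ`, with its sign changed by `u ↦ -u`. -/
lemma hasSum_laurentTerm_zero (hτ : 0 < τ.im) (h0 : u.im < 0) (h1 : -τ.im < u.im) :
    HasSum (laurentTerm 0 u τ) (-(1 / (2 * Real.pi * I)) * chiFn u τ + 1 / 2) := by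
  have h := hasSum_chiFn hτ (u := -u) (by simpa using h0) (by simpa using neg_lt.1 h1)
  have h' := ((Equiv.neg ℤ).hasSum_iff.2 h).neg
  rw [chiFn_neg hτ] at h'
  convert! h' using 1
  · funext m; rw [laurentTerm_eq]; simp
  · ring

lemma laurentTerm_int_add (n : ℤ) (w u τ : ℂ) (m : ℤ) :
    laurentTerm (w + n) u τ m = laurentTerm w u τ m := by
  have : ee (m * τ - (w + n)) = ee (m * τ - w) := by
    rw [show m * τ - (w + n) = m * τ - w + ((-n : ℤ) : ℂ) by push_cast; ring, ee_add, ee_int, mul_one]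
  rw [laurentTerm, laurentTerm, this]

/-- Moving the index by a multiple of `τ` only renumbers the expansion; this lets the `δ`-strings of
different roots be compared. -/
lemma laurentTerm_sub_mul (n : ℤ) (w u τ : ℂ) (m : ℤ) :
    ee (n * u) * laurentTerm (w - n * τ) u τ m = laurentTerm w u τ (m + n) := by
  have e1 : ee (m * τ - (w - n * τ)) = ee (((m + n : ℤ) : ℂ) * τ - w) := by
    congr 1; push_cast; ring
  have e2 : ee (((m + n : ℤ) : ℂ) * u) = ee (n * u) * ee (m * u) := by
    rw [← ee_add]; congr 1; push_cast; ring
  rw [laurentTerm, laurentTerm, e1, e2, mul_assoc]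

lemma laurentTerm_div_of_dvd {N : ℕ} (hN : 0 < N) {k : ℤ} (hk : (N : ℤ) ∣ k) :
    laurentTerm (k / N) u τ = laurentTerm 0 u τ := by
  obtain ⟨n, rfl⟩ := hk
  have hN' : (N : ℂ) ≠ 0 := by exact_mod_cast hN.ne'
  funext m
  rw [show ((N * n : ℤ) : ℂ) / N = 0 + n by push_cast; field_simp; ring, laurentTerm_int_add]

/-- This collapses the sum over the powers of `B` in a term of `r_T`, once `β` acts by a scalar. -/
lemma sum_Icc_pow_div {q : ℂ} {N : ℕ} (hq : q ^ N ≠ 1) :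
    ∑ l ∈ Finset.Icc 1 N, q ^ l / (1 - q ^ N) = q / (1 - q) := by
  have h1 : ∑ l ∈ Finset.Icc 1 N, q ^ l / (1 - q ^ N) =
      ∑ l ∈ Finset.range N, q ^ (l + 1) / (1 - q ^ N) := by
    rw [Finset.range_eq_Ico, Finset.sum_Ico_add' (fun l => q ^ l / (1 - q ^ N))]
    refine Finset.sum_congr ?_ fun _ _ => rfl
    ext l; simp only [Finset.mem_Icc, Finset.mem_Ico]; omega
  rw [h1, div_eq_mul_one_div q, ← sum_pow_div hq, Finset.mul_sum]
  exact Finset.sum_congr rfl fun l _ => by rw [pow_succ']; ring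

end LaurentSeries

/-! ### Pairing of positive and negative indices in sums. -/

section PositiveHalf

/-- A sum over a set on which an involution acts freely, as a sum over a half of the set. -/
lemma hasSum_half {A : Type*} {f : A → ℂ} {s : ℂ} (hf : HasSum f s) (i : A ≃ A)
    (P : A → Prop) (h1 : ∀ y, P y → ¬P (i y)) (hi : ∀ y, i (i y) = y)
    (h2 : ∀ y, ¬P y → ¬P (i y) → f y = 0) :
    HasSum (fun y : {y // P y} => f y + f (i y)) s := by
  have s1 : Summable fun y : {y // P y} => f y := hf.summable.subtype {y | P y}
  have s2 : Summable fun y : {y // P y} => f (i y) :=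
    (i.summable_iff.2 hf.summable).subtype {y | P y}
  have e1 := (hasSum_subtype_iff_indicator (s := {y | P y}) (f := f)).1 s1.hasSum
  have e2 := i.hasSum_iff.2
    ((hasSum_subtype_iff_indicator (s := {y | P y}) (f := fun y => f (i y))).1 s2.hasSum)
  have e3 := e1.add e2
  have e4 : (fun y => {y | P y}.indicator f y +
      ({y | P y}.indicator (fun y => f (i y)) ∘ i) y) = f := by
    funext y
    simp only [Function.comp_apply]
    by_cases h : P y
    · simp [h, h1 y h]
    · by_cases h' : P (i y)
      · simp [h, h', hi]
      · simp [h, h', h2 y h h']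
  rw [e4] at e3
  rw [hf.unique e3]
  exact s1.hasSum.add s2.hasSum

lemma hasSum_fintype_prod {ι A : Type*} [Fintype ι] {f : ι → A → ℂ} {s : ι → ℂ}
    (h : ∀ i, HasSum (f i) (s i)) : HasSum (fun p : ι × A => f p.1 p.2) (∑ i, s i) := by
  classical
  have h1 : ∀ i, HasSum (fun p : ι × A => if p.1 = i then f p.1 p.2 else 0) (s i) := by
    intro i
    have hinj : Function.Injective fun y : A => (i, y) := fun y z e => (Prod.ext_iff.1 e).2
    refine (hinj.hasSum_iff ?_).1 ?_
    · rintro ⟨i', y⟩ hy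
      refine if_neg ?_
      rintro rfl
      exact hy ⟨y, rfl⟩
    · simpa [Function.comp_def] using h i
  refine (hasSum_sum (s := Finset.univ) fun i _ => h1 i).congr_fun fun p => ?_
  simp

end PositiveHalf

namespace ChevalleyData

variable {𝔤 : Type*} [LieRing 𝔤] [LieAlgebra ℂ 𝔤] [FiniteDimensional ℂ 𝔤]
  [LieAlgebra.IsSimple ℂ 𝔤]

/-! ### Matrix coefficients of the series: real and imaginary affine roots. -/

section Series

open scoped Classical
open Complex

attribute [-simp] Finset.univ_eq_attach

variable {D : ChevalleyData 𝔤} {g : ℕ} {T : Equiv.Perm D.Node} {B : D.Affine ≃ₗ⁅ℂ⁆ D.Affine}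
  {β : 𝔤 ≃ₗ⁅ℂ⁆ 𝔤} {a b : ℕ} {x : Module.Basis (Fin a ⊕ Fin b) ℂ D.H} {τ : ℂ} {lam : Fin a → ℂ}
  {μ μ' : Fin a → ℂ} {j j' k k' : ℤ} {v w : 𝔤} {u : ℂ}

@[simp] lemma ev_loopElt (z : ℂ) (m : ℤ) (y : 𝔤) : D.ev z (D.loopElt m y) = z ^ m • y := by
  change loopLift _ (mono m y) = _
  rw [loopLift_mono]; simp

@[simp] lemma ev_cElt (z : ℂ) : D.ev z D.cElt = 0 := by
  change loopLift (fun n => (z ^ n) • (LinearMap.id : 𝔤 →ₗ[ℂ] 𝔤)) (0 : Loop 𝔤) = 0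
  rw [map_zero]

/-- The matrix coefficients of the terms of the series. -/
lemma Twist.pr_evTensor (W : D.Twist g T B β) (hw : D.IsHom g T β x μ' j' k' w)
    (hv : D.IsHom g T β x μ j k v) {e f : D.Affine} {d : ℤ} {y y' : 𝔤}
    (he : D.phiInv g e = D.loopElt d y) (hf : D.phiInv g f = D.loopElt (-d) y') (z : ℂ) {s : ℂ}
    (hs : Complex.exp (-(orderOf T) * s) ≠ 1) :
    D.pr w v (D.evTensor g z (-(f ⊗ₜ[ℂ] e) + ∑ l ∈ Finset.Icc 1 (orderOf T),
      (Complex.exp (-l * s) / (1 - Complex.exp (-(orderOf T) * s))) •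
        (e ⊗ₜ[ℂ] B^[l] f - B^[l] f ⊗ₜ[ℂ] e))) =
    z ^ d * (Complex.exp (-s) * ee (-(k / orderOf T)) /
        (1 - Complex.exp (-s) * ee (-(k / orderOf T)))) * (D.form w y * D.form v y') -
      z ^ (-d) * (1 / (1 - Complex.exp (-s) * ee (-(k' / orderOf T)))) *
        (D.form w y' * D.form v y) := by
  have hN := orderOf_T_pos (T := T)
  have hp : ∀ (k : ℤ) (l : ℕ), (Complex.exp (-s) * ee (-(k / orderOf T))) ^ l =
      Complex.exp (-l * s) * ee (-(l * (k / orderOf T))) := by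
    intro k l
    rw [mul_pow, ← ee_nat_mul, ← Complex.exp_nat_mul]
    congr 2 <;> ring
  have hpN : ∀ k : ℤ, (Complex.exp (-s) * ee (-(k / orderOf T))) ^ orderOf T =
      Complex.exp (-(orderOf T) * s) := by
    intro k
    rw [hp, ee_neg, ee_orderOf, inv_one, mul_one]
  have hq : ∀ k : ℤ, (Complex.exp (-s) * ee (-(k / orderOf T))) ^ orderOf T ≠ 1 := fun k => by
    rwa [hpN]
  have hsum : ∀ k : ℤ, ∑ l ∈ Finset.Icc 1 (orderOf T), Complex.exp (-l * s) /
      (1 - Complex.exp (-(orderOf T) * s)) * ee (-(l * (k / orderOf T))) =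
      Complex.exp (-s) * ee (-(k / orderOf T)) /
        (1 - Complex.exp (-s) * ee (-(k / orderOf T))) := by
    intro k
    rw [← sum_Icc_pow_div (hq k)]
    refine Finset.sum_congr rfl fun l _ => ?_
    rw [hpN, hp]; ring
  have hev : ∀ l, D.phiInv g (B^[l] f) = D.loopElt (-d) (β^[l] y') := fun l =>
    W.phiInv_iterate l hf
  simp only [evTensor, map_add, map_neg, map_sum, map_smul, map_sub, TensorProduct.map_tmul,
    LinearMap.comp_apply, he, hf, hev, ev_loopElt, one_zpow, one_smul, pr_tmul,
    hv.form_beta_iterate W, hw.form_beta_iterate W, smul_eq_mul, mul_sub, Finset.sum_sub_distrib]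
  rw [show ∑ l ∈ Finset.Icc 1 (orderOf T), Complex.exp (-l * s) /
      (1 - Complex.exp (-(orderOf T) * s)) * (z ^ d * D.form w y *
        (ee (-(l * (k / orderOf T))) * D.form v y')) =
      (∑ l ∈ Finset.Icc 1 (orderOf T), Complex.exp (-l * s) /
      (1 - Complex.exp (-(orderOf T) * s)) * ee (-(l * (k / orderOf T)))) *
        (z ^ d * D.form w y * D.form v y') by
      rw [Finset.sum_mul]; exact Finset.sum_congr rfl fun l _ => by ring,
    show ∑ l ∈ Finset.Icc 1 (orderOf T), Complex.exp (-l * s) /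
      (1 - Complex.exp (-(orderOf T) * s)) * (z ^ (-d) *
        (ee (-(l * (k' / orderOf T))) * D.form w y') * D.form v y) =
      (∑ l ∈ Finset.Icc 1 (orderOf T), Complex.exp (-l * s) /
      (1 - Complex.exp (-(orderOf T) * s)) * ee (-(l * (k' / orderOf T)))) *
        (z ^ (-d) * D.form w y' * D.form v y) by
      rw [Finset.sum_mul]; exact Finset.sum_congr rfl fun l _ => by ring, hsum, hsum]
  have h1 : Complex.exp (-s) * ee (-(k' / orderOf T)) ≠ 1 := fun h => hq k' (by rw [h, one_pow])
  have h2 : 1 - Complex.exp (-s) * ee (-(k' / orderOf T)) ≠ 0 := sub_ne_zero.2 h1.symm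
  generalize Complex.exp (-s) * ee (-(k' / orderOf T)) = q at *
  -- The isolated tensor `-f ⊗ e` supplies the missing `l = 0` term of the second geometric sum.
  have h3 : 1 / (1 - q) = 1 + q / (1 - q) := by field_simp; ring
  rw [h3]; ring

/-- The argument of the elliptic function attached to a root and an eigenvalue of `β`. -/
def rootArg (D : ChevalleyData 𝔤) (g : ℕ) (T : Equiv.Perm D.Node)
    (x : Module.Basis (Fin a ⊕ Fin b) ℂ D.H) (τ : ℂ) (lam : Fin a → ℂ) (α : D.H.root) (k : ℤ) : ℂ :=
  D.val g x τ lam α / (2 * Real.pi * I) + k / orderOf T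

lemma val_neg (α : D.H.root) : D.val g x τ lam (D.neg α) = -D.val g x τ lam α := by
  rw [val, val, rootVal_neg, ht_neg]; push_cast; ring

lemma rootArg_neg (α : D.H.root) (k : ℤ) :
    D.rootArg g T x τ lam (D.neg α) (-k) = -D.rootArg g T x τ lam α k := by
  rw [rootArg, rootArg, val_neg]; push_cast; ring

lemma rootArg_not_mem (hgen : D.Gen g T x τ lam) (α : D.H.root) (k : ℤ) :
    D.rootArg g T x τ lam α k ∉ latt τ := by
  intro h
  have hN' : ((orderOf T : ℕ) : ℂ) ≠ 0 := by exact_mod_cast (orderOf_T_pos (T := T)).ne'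
  have h1 := mul_mem_latt (N := orderOf T) h
  rw [rootArg, mul_add, mul_div_cancel₀ _ hN', latt_add_iff (int_mem_latt _ k)] at h1
  exact hgen α h1

/-- The contribution of the affine root `α + mδ` to a matrix coefficient of the series: it
depends on `k` for a positive root and on `k'` for a negative one. -/
def rootTerm (D : ChevalleyData 𝔤) (g : ℕ) (T : Equiv.Perm D.Node)
    (x : Module.Basis (Fin a ⊕ Fin b) ℂ D.H) (τ : ℂ) (lam : Fin a → ℂ) (u : ℂ) (k k' : ℤ)
    (α : D.H.root) (m : ℤ) : ℂ :=
  ee (D.ht α * u / g) * if 0 < m ∨ (m = 0 ∧ 0 < D.ht α) then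
    laurentTerm (D.rootArg g T x τ lam α k) u τ m
  else laurentTerm (D.rootArg g T x τ lam α k') u τ m

lemma exp_zpow_eq (hg : 0 < g) (u : ℂ) (h m : ℤ) :
    Complex.exp (2 * Real.pi * I * u / g) ^ (h + m * g) = ee (h * u / g) * ee (m * u) := by
  have hg' : (g : ℂ) ≠ 0 := by exact_mod_cast hg.ne'
  rw [← Complex.exp_int_mul, ← ee_add, ee]; congr 1; push_cast; field_simp

lemma exp_neg_affVal (α : D.H.root) (m : ℤ) (k : ℤ) :
    Complex.exp (-D.affVal g x τ lam α m) * ee (-(k / orderOf T)) =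
      ee (m * τ - D.rootArg g T x τ lam α k) := by
  have hpi := two_pi_I_ne
  rw [rootArg, ee, ee, ← Complex.exp_add, affVal]; congr 1; field_simp; ring

/-- The two halves of the wedge product are attributed to the root and to its negative. By `-1/(1 -
q) = q⁻¹/(1 - q⁻¹)` the second half is again a Laurent term, now at the negative affine root and
with `-k'` in place of `k`. -/
lemma Twist.pr_evTensor_real (W : D.Twist g T B β) (hw : D.IsHom g T β x μ' j' k' w)
    (hv : D.IsHom g T β x μ j k v) (hgen : D.IsGeneric g T x τ lam) (u : ℂ) (p : D.PosReal) :
    D.pr w v (D.evTensor g (Complex.exp (2 * Real.pi * I * u / g))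
      (D.rTerm g T B x τ lam (Sum.inl p : D.PosRoot a b))) =
    D.rootTerm g T x τ lam u k (-k') p.1.1 p.1.2 *
        (D.form w (D.E p.1.1) * D.form v (D.E (D.neg p.1.1))) +
      D.rootTerm g T x τ lam u k (-k') (D.neg p.1.1) (-p.1.2) *
        (D.form w (D.E (D.neg p.1.1)) * D.form v (D.E (D.neg (D.neg p.1.1)))) := by
  obtain ⟨⟨α, m⟩, hp⟩ := p
  have hp' : ¬(0 < -m ∨ (-m = 0 ∧ 0 < D.ht (D.neg α))) := by
    rw [ht_neg]; simp only at hp; omega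
  have hf : D.phiInv g (D.loopElt (-m) (D.E (D.neg α))) =
      D.loopElt (-(D.ht α + m * g)) (D.E (D.neg α)) := by
    rw [phiInv_loopElt_E, ht_neg]; congr 1; ring
  refine (W.pr_evTensor hw hv (D.phiInv_loopElt_E g m α) hf _ (hgen ⟨(α, m), hp⟩)).trans ?_
  simp only
  rw [neg_neg_root, rootTerm, rootTerm, if_pos hp, if_neg hp', rootArg_neg,
    show -(D.ht α + m * g) = D.ht (D.neg α) + (-m) * g by rw [ht_neg]; ring,
    exp_zpow_eq W.pos, exp_zpow_eq W.pos, exp_neg_affVal, exp_neg_affVal, laurentTerm, laurentTerm]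
  have e1 : ee (((-m : ℤ) : ℂ) * τ - -D.rootArg g T x τ lam α k') =
      (ee (m * τ - D.rootArg g T x τ lam α k'))⁻¹ := by
    rw [← ee_neg]; congr 1; push_cast; ring
  have h0 := ee_ne_zero (m * τ - D.rootArg g T x τ lam α k')
  have h1 : ee (m * τ - D.rootArg g T x τ lam α k') ≠ 1 := by
    intro h
    obtain ⟨n, hn⟩ := (ee_eq_one_iff _).1 h
    exact rootArg_not_mem (gen_of_isGeneric hgen) α k' ⟨-n, m, by push_cast; linear_combination -hn⟩
  rw [e1]
  generalize ee (m * τ - D.rootArg g T x τ lam α k') = q at *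
  have h2 : 1 - q ≠ 0 := sub_ne_zero.2 h1.symm
  have h3 : q - 1 ≠ 0 := sub_ne_zero.2 h1
  have h4 : q⁻¹ / (1 - q⁻¹) = -(1 / (1 - q)) := by
    rw [show 1 - q⁻¹ = (q - 1) / q by field_simp, ← neg_sub q 1]; field_simp
  rw [h4]; ring

/-- The contribution of `mδ` to a matrix coefficient of the series. -/
def cartanTerm (N : ℕ) (τ u : ℂ) (k k' m : ℤ) : ℂ :=
  if 0 < m then laurentTerm (k / N) u τ m else if m = 0 then 0 else laurentTerm (k' / N) u τ m

lemma Twist.pr_evTensor_imag (W : D.Twist g T B β) (hτ : 0 < τ.im)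
    (hw : D.IsHom g T β x μ' j' k' w) (hv : D.IsHom g T β x μ j k v) (u : ℂ)
    (p : {m : ℤ // 0 < m} × (Fin a ⊕ Fin b)) :
    D.pr w v (D.evTensor g (Complex.exp (2 * Real.pi * I * u / g))
      (D.rTerm g T B x τ lam (Sum.inr p : D.PosRoot a b))) =
    (cartanTerm (orderOf T) τ u k (-k') p.1.1 + cartanTerm (orderOf T) τ u k (-k') (-p.1.1)) *
      (D.form w (x p.2) * D.form v (x p.2)) := by
  obtain ⟨⟨m, hm⟩, i⟩ := p
  have hN := orderOf_T_pos (T := T)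
  have hφ : ∀ n : ℤ, n ≠ 0 → D.phiInv g (D.loopElt n (x i)) = D.loopElt (n * g) (x i : 𝔤) := by
    intro n hn
    rw [phiInv_loopElt_H, if_neg hn, zero_smul, add_zero]
  have hf : D.phiInv g (D.loopElt (-m) (x i)) = D.loopElt (-(m * g)) (x i : 𝔤) := by
    rw [hφ _ (by omega)]; congr 1; ring
  have hs : Complex.exp (-(orderOf T) * -(2 * Real.pi * I * τ * m)) ≠ 1 := by
    rw [show -(orderOf T : ℂ) * -(2 * Real.pi * I * τ * m) =
      2 * Real.pi * I * (((orderOf T * m : ℤ) : ℂ) * τ) by push_cast; ring]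
    exact ee_int_mul_tau_ne_one hτ (mul_ne_zero (by exact_mod_cast hN.ne') hm.ne')
  refine (W.pr_evTensor hw hv (hφ m hm.ne') hf _ hs).trans ?_
  have hq : ∀ k : ℤ, Complex.exp (- -(2 * Real.pi * I * τ * m)) * ee (-(k / orderOf T)) =
      ee (m * τ - k / orderOf T) := by
    intro k
    rw [ee, ee, ← Complex.exp_add]; congr 1; ring
  have hz := exp_zpow_eq (g := g) W.pos u 0
  simp only [zero_add, Int.cast_zero, zero_mul, zero_div, ee_zero, one_mul] at hz
  simp only
  rw [hq, hq, ← neg_mul, hz, hz, cartanTerm, cartanTerm, if_pos hm, if_neg (by omega),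
    if_neg (by omega), laurentTerm, laurentTerm]
  have e1 : ee (((-m : ℤ) : ℂ) * τ - ((-k' : ℤ) : ℂ) / orderOf T) =
      (ee (m * τ - k' / orderOf T))⁻¹ := by
    rw [← ee_neg]; congr 1; push_cast; ring
  have h0 := ee_ne_zero (m * τ - k' / orderOf T)
  have h1 : ee (m * τ - k' / orderOf T) ≠ 1 := by
    intro h
    refine hs ?_
    have h2 : ee (orderOf T * (m * τ - k' / orderOf T)) = 1 := by
      rw [ee_nat_mul, h, one_pow]
    rw [mul_sub, ee_sub, ee_orderOf, div_one] at h2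
    rw [← h2, ee]; congr 1; ring
  rw [e1]
  generalize ee (m * τ - k' / orderOf T) = q at *
  have h2 : 1 - q ≠ 0 := sub_ne_zero.2 h1.symm
  have h3 : q - 1 ≠ 0 := sub_ne_zero.2 h1
  have h4 : q⁻¹ / (1 - q⁻¹) = -(1 / (1 - q)) := by
    rw [show 1 - q⁻¹ = (q - 1) / q by field_simp, ← neg_sub q 1]; field_simp
  rw [h4]; ring

lemma summable_rootTerm (hτ : 0 < τ.im) (hgen : D.Gen g T x τ lam) (h0 : u.im < 0)
    (h1 : -τ.im < u.im) (k k' : ℤ) (α : D.H.root) : Summable (D.rootTerm g T x τ lam u k k' α) := by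
  have s1 := fun k => (hasSum_laurentTerm hτ (rootArg_not_mem hgen α k) h0 h1).summable
  have e1 := ((s1 k).indicator {m | 0 < m ∨ (m = 0 ∧ 0 < D.ht α)}).add
    ((s1 k').indicator {m | 0 < m ∨ (m = 0 ∧ 0 < D.ht α)}ᶜ)
  refine (e1.mul_left (ee (D.ht α * u / g))).congr fun m => ?_
  rw [rootTerm]
  by_cases h : 0 < m ∨ (m = 0 ∧ 0 < D.ht α)
  · simp [h]
  · simp [h]

/-- Roots occurring in one homogeneous vector agree on `𝔩`, and the height is the value at `ρ`. -/
lemma IsHom.ht_eq (hx : D.IsAdapted T x) (hv : D.IsHom g T β x μ j k v)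
    (W : D.Twist g T B β) (hρ : D.ρ ∈ D.lSub T)
    {α α' : D.H.root} (h : D.form v (D.E (D.neg α)) ≠ 0) (h' : D.form v (D.E (D.neg α')) ≠ 0) :
    D.ht α = D.ht α' := by
  have key : ∀ l ∈ D.lSub T, D.rootVal α l = D.rootVal α' l := by
    intro l hl
    rw [hx.lSub_eq] at hl
    refine Submodule.span_induction (p := fun l _ => D.rootVal α l = D.rootVal α' l) ?_ ?_ ?_ ?_ hl
    · rintro _ ⟨i, rfl⟩; rw [(hv.of_form_E W h).1, (hv.of_form_E W h').1]
    · rw [rootVal_zero, rootVal_zero]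
    · intro y z _ _ hy hz; rw [rootVal_add, rootVal_add, hy, hz]
    · intro c y _ hy; rw [rootVal_smul, rootVal_smul, hy]
  have := key _ hρ
  rw [rootVal_ρ, rootVal_ρ] at this
  exact_mod_cast this

/-- The sum over the `mδ`-strings of roots does not depend on the root. -/
lemma IsHom.tsum_rootTerm_eq (W : D.Twist g T B β) (hx : D.IsAdapted T x)
    (hv : D.IsHom g T β x μ j k v) {α α' : D.H.root} (h : D.form v (D.E (D.neg α)) ≠ 0)
    (h' : D.form v (D.E (D.neg α')) ≠ 0) (u : ℂ) (k₁ k₂ : ℤ) :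
    ∑' m, D.rootTerm g T x τ lam u k₁ k₂ α m = ∑' m, D.rootTerm g T x τ lam u k₁ k₂ α' m := by
  have hg' : (g : ℂ) ≠ 0 := by exact_mod_cast W.pos.ne'
  have hpi := two_pi_I_ne
  have hval : D.rootVal α (D.lamH x lam) = D.rootVal α' (D.lamH x lam) := by
    rw [rootVal_lamH, rootVal_lamH]
    exact Finset.sum_congr rfl fun i _ => by rw [(hv.of_form_E W h).1, (hv.of_form_E W h').1]
  obtain ⟨r, hr⟩ : (g : ℤ) ∣ D.ht α' - D.ht α := by
    have := dvd_sub (hv.of_form_E W h').2 (hv.of_form_E W h).2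
    rwa [sub_sub_sub_cancel_right] at this
  have hht : D.ht α' = D.ht α + g * r := by omega
  have harg : ∀ k, D.rootArg g T x τ lam α' k = D.rootArg g T x τ lam α k - r * τ := by
    intro k
    rw [rootArg, rootArg, val, val, hval, hht]
    push_cast
    field_simp
    ring
  -- Positivity must be compatible with the shift `m ↦ m + r`. If `ρ ∈ 𝔩` the two heights agree and
  -- `r = 0`. If `g = |θ| + 1`, then `α + mδ` is positive exactly when its `t`-degree `|α| + gm` is,
  -- and the shift preserves that degree.
  have hpos : ∀ m : ℤ, (0 < m ∨ (m = 0 ∧ 0 < D.ht α')) ↔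
      (0 < m + r ∨ (m + r = 0 ∧ 0 < D.ht α)) := by
    intro m
    rcases W.ρ_mem_or with hρ | hθ
    · have hr0 : r = 0 := by
        rw [hv.ht_eq hx W hρ h h', left_eq_add, mul_eq_zero] at hht
        exact hht.resolve_left (by exact_mod_cast W.pos.ne')
      rw [hht, hr0, mul_zero, add_zero, add_zero]
    · have hd : ∀ (α : D.H.root) (m : ℤ), (0 < m ∨ (m = 0 ∧ 0 < D.ht α)) ↔ 0 < D.ht α + g * m := by
        intro α m
        have h1 := D.ht_le α
        have h2 := D.neg_ht_le α
        have h3 := W.pos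
        rcases lt_trichotomy m 0 with hm | rfl | hm
        · have : (g : ℤ) * m ≤ -g := by nlinarith
          omega
        · simp
        · have : (g : ℤ) * 1 ≤ g * m := by gcongr; omega
          omega
      rw [hd, hd, hht, mul_add, add_assoc, add_comm ((g : ℤ) * r)]
  rw [← (Equiv.addRight r).tsum_eq]
  refine tsum_congr fun m => ?_
  rw [Equiv.coe_addRight, rootTerm, rootTerm, harg, harg]
  simp only [hpos]
  have e1 : ee (D.ht α' * u / g) = ee (D.ht α * u / g) * ee (r * u) := by
    rw [← ee_add, hht]; congr 1; push_cast; field_simp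
  rw [e1, mul_assoc]
  congr 1
  rw [mul_ite, laurentTerm_sub_mul, laurentTerm_sub_mul]

lemma rootArg_add_mul (α : D.H.root) (k : ℤ) (n : ℤ) :
    D.rootArg g T x τ lam α (k + orderOf T * n) = D.rootArg g T x τ lam α k + n := by
  have hN' : ((orderOf T : ℕ) : ℂ) ≠ 0 := by exact_mod_cast (orderOf_T_pos (T := T)).ne'
  rw [rootArg, rootArg]; push_cast; field_simp; ring

/-- When `N ∣ k + k'` the indices used for positive and for negative affine roots differ by an
integer, so the two halves form one full Laurent expansion of `σ`. -/
lemma IsHom.tsum_rootTerm (W : D.Twist g T B β) (hτ : 0 < τ.im) (hx : D.IsAdapted T x)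
    (hv : D.IsHom g T β x μ j k v) (hgen : D.Gen g T x τ lam) (h0 : u.im < 0) (h1 : -τ.im < u.im)
    {k' : ℤ} (hk : (orderOf T : ℤ) ∣ k + k') {α : D.H.root} (h : D.form v (D.E (D.neg α)) ≠ 0) :
    ∑' m, D.rootTerm g T x τ lam u k (-k') α m = coef g (orderOf T) τ μ j k lam u := by
  obtain ⟨n, hn⟩ := hk
  have e1 : D.rootTerm g T x τ lam u k (-k') α =
      fun m => ee (D.ht α * u / g) * laurentTerm (D.rootArg g T x τ lam α k) u τ m := by
    funext m
    rw [rootTerm, show -k' = k + orderOf T * (-n) by rw [mul_neg, ← hn]; ring, rootArg_add_mul,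
      laurentTerm_int_add, ite_id]
  rw [e1, tsum_mul_left, (hasSum_laurentTerm hτ (rootArg_not_mem hgen α k) h0 h1).tsum_eq,
    coef_of_not_triv (hv.not_triv W hx h), rootArg, hv.val_eq W h, omg, omg,
    ← twisted_sigma_congr W.pos orderOf_T_pos (hv.of_form_E W h).2 (show _ ∣ k - k by simp)]
  ring

/-- The string sum is the same for all roots that contribute, so it factors out as a number `s`. If
`N ∤ k + k'` its value is irrelevant, since the factor multiplying it turns out to be zero. -/
lemma IsHom.exists_hasSum_real (W : D.Twist g T B β) (hτ : 0 < τ.im) (hx : D.IsAdapted T x)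
    (hw : D.IsHom g T β x μ' j' k' w) (hv : D.IsHom g T β x μ j k v)
    (hgen : D.IsGeneric g T x τ lam) (h0 : u.im < 0) (h1 : -τ.im < u.im) :
    ∃ s, HasSum (fun p : D.PosReal => D.pr w v (D.evTensor g
        (Complex.exp (2 * Real.pi * I * u / g)) (D.rTerm g T B x τ lam (Sum.inl p : D.PosRoot a b))))
        (s * ∑ α, D.form w (D.E α) * D.form v (D.E (D.neg α))) ∧
      ((orderOf T : ℤ) ∣ k + k' → s * ∑ α, D.form w (D.E α) * D.form v (D.E (D.neg α)) =
        coef g (orderOf T) τ μ j k lam u * ∑ α, D.form w (D.E α) * D.form v (D.E (D.neg α))) := by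
  have hgen' := gen_of_isGeneric hgen
  have hs := hasSum_fintype_prod fun α => ((summable_rootTerm hτ hgen' h0 h1 k (-k') α).hasSum).mul_right
    (D.form w (D.E α) * D.form v (D.E (D.neg α)))
  let i : D.H.root × ℤ ≃ D.H.root × ℤ :=
    ⟨fun p => (D.neg p.1, -p.2), fun p => (D.neg p.1, -p.2), fun p => by simp [neg_neg_root],
      fun p => by simp [neg_neg_root]⟩
  have hs' := hasSum_half hs i (fun p => 0 < p.2 ∨ (p.2 = 0 ∧ 0 < D.ht p.1))
    (fun p hp => by simp only [i, Equiv.coe_fn_mk, ht_neg]; omega)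
    (fun p => by simp [i, neg_neg_root])
    (fun p hp hp' => by
      have := D.ht_ne_zero p.1
      simp only [i, Equiv.coe_fn_mk, ht_neg] at hp'; omega)
  have hs'' : HasSum (fun p : D.PosReal => D.pr w v (D.evTensor g
        (Complex.exp (2 * Real.pi * I * u / g)) (D.rTerm g T B x τ lam (Sum.inl p : D.PosRoot a b))))
        (∑ α, (∑' m, D.rootTerm g T x τ lam u k (-k') α m) *
          (D.form w (D.E α) * D.form v (D.E (D.neg α)))) := by
    refine hs'.congr_fun fun p => ?_
    exact W.pr_evTensor_real hw hv hgen u p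
  by_cases hM : ∀ α, D.form w (D.E α) * D.form v (D.E (D.neg α)) = 0
  · refine ⟨0, ?_, fun _ => by simp [hM]⟩
    simpa [hM] using hs''
  · push Not at hM
    obtain ⟨α₀, hα₀⟩ := hM
    have hc : ∀ α, (∑' m, D.rootTerm g T x τ lam u k (-k') α m) *
        (D.form w (D.E α) * D.form v (D.E (D.neg α))) =
        (∑' m, D.rootTerm g T x τ lam u k (-k') α₀ m) *
        (D.form w (D.E α) * D.form v (D.E (D.neg α))) := by
      intro α
      by_cases h : D.form v (D.E (D.neg α)) = 0
      · rw [h, mul_zero, mul_zero, mul_zero]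
      · rw [hv.tsum_rootTerm_eq W hx h (right_ne_zero_of_mul hα₀)]
    refine ⟨∑' m, D.rootTerm g T x τ lam u k (-k') α₀ m, ?_, fun hk => ?_⟩
    · rw [Finset.mul_sum]
      simpa only [hc] using hs''
    · rw [hv.tsum_rootTerm W hτ hx hgen' h0 h1 hk (right_ne_zero_of_mul hα₀)]

end Series

end ChevalleyData

namespace ChevalleyData

variable {𝔤 : Type*} [LieRing 𝔤] [LieAlgebra ℂ 𝔤] [FiniteDimensional ℂ 𝔤]
  [LieAlgebra.IsSimple ℂ 𝔤]

/-! ### Summation of the series to the elliptic r-matrix. -/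

section SeriesSum

open scoped Classical
open Complex

attribute [-simp] Finset.univ_eq_attach

variable {D : ChevalleyData 𝔤} {g : ℕ} {T : Equiv.Perm D.Node} {B : D.Affine ≃ₗ⁅ℂ⁆ D.Affine}
  {β : 𝔤 ≃ₗ⁅ℂ⁆ 𝔤} {a b : ℕ} {x : Module.Basis (Fin a ⊕ Fin b) ℂ D.H} {τ : ℂ} {lam : Fin a → ℂ}
  {μ μ' : Fin a → ℂ} {j j' k k' : ℤ} {v w : 𝔤} {u : ℂ}

lemma summable_laurentTerm_div (hτ : 0 < τ.im) (h0 : u.im < 0) (h1 : -τ.im < u.im) {N : ℕ}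
    (hN : 0 < N) (k : ℤ) : Summable (laurentTerm (k / N) u τ) := by
  by_cases hk : (N : ℤ) ∣ k
  · rw [laurentTerm_div_of_dvd hN hk]
    exact (hasSum_laurentTerm_zero hτ h0 h1).summable
  · have := int_div_not_mem_latt hτ hN hk 0
    rw [Int.cast_zero, zero_mul, sub_zero] at this
    exact (hasSum_laurentTerm hτ this h0 h1).summable

lemma summable_cartanTerm (hτ : 0 < τ.im) (h0 : u.im < 0) (h1 : -τ.im < u.im) {N : ℕ}
    (hN : 0 < N) (k k' : ℤ) : Summable (cartanTerm N τ u k k') := by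
  have e1 := ((summable_laurentTerm_div hτ h0 h1 hN k).indicator {m | 0 < m}).add
    ((summable_laurentTerm_div hτ h0 h1 hN k').indicator {m | m < 0})
  refine e1.congr fun m => ?_
  rw [cartanTerm]
  rcases lt_trichotomy m 0 with h | rfl | h
  · simp [h, h.not_gt, h.ne]
  · simp
  · simp [h, h.not_gt]

/-- The eigenvalue of the Cartan part of `r_T` on `𝔥`. -/
def cartanEigenvalue (ζ : ℂ) : ℂ := if ζ = 1 then -(1 / 2) else 1 / (ζ - 1)

/-- The imaginary roots give a full Laurent expansion except for its term `m = 0`. For `ζ = e(k/N) ≠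
1` that term is `1/(ζ - 1)`, the eigenvalue of the Cartan part; for `ζ = 1` it is `0`, and the
constant `1/2` of the `χ`-expansion takes its place. -/
lemma tsum_cartanTerm (hτ : 0 < τ.im) (h0 : u.im < 0) (h1 : -τ.im < u.im) (hg : 0 < g)
    (hk : (orderOf T : ℤ) ∣ k + k') (hj : (g : ℤ) ∣ j) :
    ∑' m, cartanTerm (orderOf T) τ u k (-k') m =
      coef g (orderOf T) τ 0 j k lam u - cartanEigenvalue (ee (k / orderOf T)) := by
  have hN := orderOf_T_pos (T := T)
  have hN' : ((orderOf T : ℕ) : ℂ) ≠ 0 := by exact_mod_cast hN.ne'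
  obtain ⟨n, hn⟩ := hk
  have e1 : cartanTerm (orderOf T) τ u k (-k') = fun m =>
      laurentTerm (k / orderOf T) u τ m -
        if m = 0 then laurentTerm (k / orderOf T) u τ 0 else 0 := by
    funext m
    rw [cartanTerm, show ((-k' : ℤ) : ℂ) / orderOf T = k / orderOf T + ((-n : ℤ) : ℂ) by
      have : (k + k' : ℂ) = orderOf T * n := by exact_mod_cast hn
      field_simp; push_cast; linear_combination -this, laurentTerm_int_add]
    rcases lt_trichotomy m 0 with h | rfl | h
    · simp [h.not_gt, h.ne]
    · simp
    · simp [h, h.ne']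
  rw [e1, ((summable_laurentTerm_div hτ h0 h1 hN k).hasSum.sub
    (hasSum_ite_eq 0 (laurentTerm (k / orderOf T) u τ 0))).tsum_eq]
  have e2 : laurentTerm (k / orderOf T) u τ 0 =
      (ee (k / orderOf T))⁻¹ / (1 - (ee (k / orderOf T))⁻¹) := by
    rw [laurentTerm, ← ee_neg]; simp [ee_zero]
  rw [e2, cartanEigenvalue]
  by_cases hk' : (orderOf T : ℤ) ∣ k
  · rw [laurentTerm_div_of_dvd hN hk', (hasSum_laurentTerm_zero hτ h0 h1).tsum_eq,
      (ee_div_eq_one_iff hN k).2 hk', if_pos rfl, coef_of_triv ⟨rfl, hj, hk'⟩]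
    simp
  · have h2 := int_div_not_mem_latt hτ hN hk' 0
    rw [Int.cast_zero, zero_mul, sub_zero] at h2
    have h3 : ee (k / orderOf T) ≠ 1 := fun h => hk' ((ee_div_eq_one_iff hN k).1 h)
    have h4 := twisted_sigma_congr hg hN (show (g : ℤ) ∣ j - 0 by simpa using hj)
      (show (orderOf T : ℤ) ∣ k - k by simp) 0 u τ
    rw [(hasSum_laurentTerm hτ h2 h0 h1).tsum_eq, if_neg h3,
      coef_of_not_triv (fun h => hk' h.2.2), omg]
    simp only [Pi.zero_apply, zero_mul, Finset.sum_const_zero, zero_div]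
    rw [h4]
    simp only [Int.cast_zero, zero_mul, zero_div, ee_zero, mul_zero, sub_zero, zero_add, one_mul]
    have h5 := ee_ne_zero (k / orderOf T)
    have h6 := sub_ne_zero.2 h3
    generalize ee (k / orderOf T) = q at *
    congr 1
    rw [show 1 - q⁻¹ = (q - 1) / q by field_simp]; field_simp

lemma sum_form_basis (hx : D.IsAdapted T x) (w v : 𝔤) :
    ∑ i, D.form w (x i) * D.form v (x i) = D.form w (D.proj₀ v) := by
  have h1 := form_eq_sum hx w v
  have h2 : D.form w v = D.form w (D.proj₀ v) +
      ∑ α, D.form w (D.E α) * D.form v (D.E (D.neg α)) := by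
    conv_lhs => rw [← D.proj₀_add_sum v]
    rw [map_add, map_sum]
    congr 1
    exact Finset.sum_congr rfl fun α _ => by rw [proj_apply, map_smul, smul_eq_mul, mul_comm]
  linear_combination h2 - h1

/-- The `𝔥`-component of a `β`-eigenvector is an eigenvector with the same eigenvalue, and `β`
preserves the form. -/
lemma IsHom.form_proj₀_eq_zero (W : D.Twist g T B β) (hw : D.IsHom g T β x μ' j' k' w)
    (hv : D.IsHom g T β x μ j k v) (hk : ¬(orderOf T : ℤ) ∣ k + k') :
    D.form w (D.proj₀ v) = 0 := by
  by_contra h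
  have h1 := W.form_beta w (D.proj₀ v)
  rw [hv.beta_proj₀ W, hw.beta, map_smul, map_smul, LinearMap.smul_apply, smul_eq_mul, smul_eq_mul,
    ← mul_assoc, ← ee_add] at h1
  refine hk ((ee_div_eq_one_iff orderOf_T_pos _).1 ?_)
  have := mul_right_cancel₀ h (h1.trans (one_mul _).symm)
  rw [← this]; congr 1; push_cast; ring

lemma IsHom.exists_hasSum_imag (W : D.Twist g T B β) (hτ : 0 < τ.im) (hx : D.IsAdapted T x)
    (hw : D.IsHom g T β x μ' j' k' w) (hv : D.IsHom g T β x μ j k v)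
    (h0 : u.im < 0) (h1 : -τ.im < u.im) :
    ∃ s, HasSum (fun p : {m : ℤ // 0 < m} × (Fin a ⊕ Fin b) => D.pr w v (D.evTensor g
        (Complex.exp (2 * Real.pi * I * u / g)) (D.rTerm g T B x τ lam (Sum.inr p : D.PosRoot a b))))
        (s * D.form w (D.proj₀ v)) ∧
      ((orderOf T : ℤ) ∣ k + k' → s * D.form w (D.proj₀ v) =
        (coef g (orderOf T) τ μ j k lam u - cartanEigenvalue (ee (k / orderOf T))) *
          D.form w (D.proj₀ v)) := by
  refine ⟨∑' m, cartanTerm (orderOf T) τ u k (-k') m, ?_, fun hk => ?_⟩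
  · have hs := (summable_cartanTerm hτ h0 h1 (orderOf_T_pos (T := T)) k (-k')).hasSum
    have hs' := hasSum_half hs (Equiv.neg ℤ) (fun m => 0 < m) (fun m hm => by simpa using hm.le)
      (fun m => by simp) (fun m hm hm' => by
        simp only [Equiv.neg_apply] at hm'
        obtain rfl : m = 0 := by omega
        simp [cartanTerm])
    have hs'' := hasSum_fintype_prod fun i =>
      hs'.mul_right (D.form w (x i) * D.form v (x i))
    rw [← Finset.mul_sum, sum_form_basis hx] at hs''
    refine ((Equiv.prodComm _ _).hasSum_iff.2 hs'').congr_fun fun p => ?_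
    exact W.pr_evTensor_imag hτ hw hv u p
  · by_cases hz : ∀ p : D.H, D.form v p = 0
    · have : D.form w (D.proj₀ v) = 0 := by
        rw [← sum_form_basis hx]
        exact Finset.sum_eq_zero fun i _ => by rw [hz, mul_zero]
      rw [this, mul_zero, mul_zero]
    · obtain ⟨p, hp⟩ := not_forall.1 hz
      obtain ⟨rfl, hj⟩ := hv.of_form_H W hp
      rw [tsum_cartanTerm (lam := lam) hτ h0 h1 W.pos hk hj]

lemma ev_phiInv_H (g : ℕ) (z : ℂ) (h : D.H) : D.ev z (D.phiInv g (D.loopElt 0 h)) = (h : 𝔤) := by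
  rw [phiInv_loopElt_H, map_add, map_smul, ev_cElt, smul_zero, add_zero, ev_loopElt]; simp

lemma IsHom.pr_rCartan (W : D.Twist g T B β) (hx : D.IsAdapted T x)
    (hv : D.IsHom g T β x μ j k v) (w : 𝔤) (z : ℂ) :
    D.pr w v (D.evTensor g z (D.rCartan g T x)) =
      cartanEigenvalue (ee (k / orderOf T)) * D.form w (D.proj₀ v) := by
  have hc := congrArg (fun h : D.H => D.form w h)
    (W.sum_cayley hx (h := ⟨_, D.proj₀_mem v⟩) (hv.beta_proj₀ W))
  simp only [AddSubmonoidClass.coe_finsetSum, SetLike.val_smul, map_sum, map_smul, smul_eq_mul,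
    form_proj₀] at hc
  simp only [rCartan, evTensor, map_add, map_smul, map_sum, TensorProduct.map_tmul,
    LinearMap.comp_apply, ev_phiInv_H, D.phiInv_phiH W.pos, phiInv_cElt, ev_cElt, ev_loopElt,
    smul_zero, TensorProduct.zero_tmul, TensorProduct.tmul_zero, add_zero, zpow_zero, one_smul,
    W.cayley_eq, pr_tmul, smul_eq_mul]
  rw [sum_form_basis hx]
  simp only [mul_comm (D.form w (D.betaCayley T β _ : 𝔤))]
  rw [hc, cartanEigenvalue]
  split_ifs with h
  · ring
  · have := sub_ne_zero.2 h
    field_simp; ring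

/-- If `N ∣ k + k'`, the root part and the `𝔥`-part carry the same scalar, and the Cartan eigenvalue
cancels. If not, the pairing of `w` with `v` and that of `w` with the `𝔥`-component of `v` both
vanish; hence so does the root part, and both sides are zero. -/
lemma IsHom.hasSum_pr (W : D.Twist g T B β) (hτ : 0 < τ.im) (hx : D.IsAdapted T x)
    (hw : D.IsHom g T β x μ' j' k' w) (hv : D.IsHom g T β x μ j k v)
    (hgen : D.IsGeneric g T x τ lam) (h0 : u.im < 0) (h1 : -τ.im < u.im) :
    HasSum (fun p : D.PosRoot a b => D.pr w v (D.evTensor g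
        (Complex.exp (2 * Real.pi * I * u / g)) (D.rTerm g T B x τ lam p)))
      (D.pr w v (D.ellipticR g T β x τ lam u -
        D.evTensor g (Complex.exp (2 * Real.pi * I * u / g)) (D.rCartan g T x))) := by
  obtain ⟨s, hs, hs'⟩ := hw.exists_hasSum_real W hτ hx hv hgen h0 h1
  obtain ⟨t, ht, ht'⟩ := hw.exists_hasSum_imag (lam := lam) W hτ hx hv h0 h1
  have hu : u ∉ latt τ := by
    rintro ⟨p, q, rfl⟩
    simp only [add_im, intCast_im, mul_im, intCast_re, zero_mul, add_zero, zero_add] at h0 h1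
    have h2 : (q : ℝ) < 0 := by nlinarith
    have h3 : (-1 : ℝ) < q := by nlinarith
    have h2' : q < 0 := by exact_mod_cast h2
    have h3' : -1 < q := by exact_mod_cast h3
    omega
  rw [map_sub, hv.pr_rCartan W hx, hv.pr_ellipticR W hτ hx (gen_of_isGeneric hgen) hu]
  have hst : HasSum (fun p : D.PosRoot a b => D.pr w v (D.evTensor g
        (Complex.exp (2 * Real.pi * I * u / g)) (D.rTerm g T B x τ lam p)))
      (s * ∑ α, D.form w (D.E α) * D.form v (D.E (D.neg α)) + t * D.form w (D.proj₀ v)) :=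
    HasSum.sum hs ht
  convert hst using 1
  have h2 := form_eq_sum hx w v
  rw [sum_form_basis hx] at h2
  by_cases hk : (orderOf T : ℤ) ∣ k + k'
  · rw [hs' hk, ht' hk, h2]; ring
  · have h3 : D.form w v = 0 := by
      by_contra h
      refine hk ?_
      rw [add_comm]
      exact (hw.opposite W hv h).2.2
    have h4 := hw.form_proj₀_eq_zero W hv hk
    rw [h3, h4, add_zero] at h2
    rw [h3, h4, ← h2]; ring

/-- The series `r̄_T` converges to the elliptic r-matrix. -/
lemma Twist.seriesConvergesTo (W : D.Twist g T B β) (hτ : 0 < τ.im) (hx : D.IsAdapted T x)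
    (hgen : D.IsGeneric g T x τ lam) (h0 : u.im < 0) (h1 : -τ.im < u.im) :
    D.SeriesConvergesTo g T B x τ lam (Complex.exp (2 * Real.pi * I * u / g))
      (D.ellipticR g T β x τ lam u) := by
  intro ψ
  have key : ∀ w v, HasSum (fun p : D.PosRoot a b => D.pr w v (D.evTensor g
        (Complex.exp (2 * Real.pi * I * u / g)) (D.rTerm g T B x τ lam p)))
      (D.pr w v (D.ellipticR g T β x τ lam u -
        D.evTensor g (Complex.exp (2 * Real.pi * I * u / g)) (D.rCartan g T x))) := by
    intro w v
    refine W.hom_induction hx (p := fun w => HasSum (fun p : D.PosRoot a b => D.pr w v (D.evTensor g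
        (Complex.exp (2 * Real.pi * I * u / g)) (D.rTerm g T B x τ lam p)))
      (D.pr w v (D.ellipticR g T β x τ lam u -
        D.evTensor g (Complex.exp (2 * Real.pi * I * u / g)) (D.rCartan g T x)))) w
      (fun μ' j' k' w hw => ?_) (fun y z hy hz => ?_) (fun c y hy => ?_)
    · refine W.hom_induction hx (p := fun v => HasSum (fun p : D.PosRoot a b =>
        D.pr w v (D.evTensor g (Complex.exp (2 * Real.pi * I * u / g)) (D.rTerm g T B x τ lam p)))
        (D.pr w v (D.ellipticR g T β x τ lam u -
          D.evTensor g (Complex.exp (2 * Real.pi * I * u / g)) (D.rCartan g T x)))) v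
        (fun μ j k v hv => hw.hasSum_pr W hτ hx hv hgen h0 h1) (fun y z hy hz => ?_)
        (fun c y hy => ?_)
      · simp only [pr_add_right, LinearMap.add_apply]; exact hy.add hz
      · simp only [pr_smul_right, LinearMap.smul_apply]; exact hy.const_smul c
    · simp only [pr_add_left, LinearMap.add_apply]; exact hy.add hz
    · simp only [pr_smul_left, LinearMap.smul_apply]; exact hy.const_smul c
  obtain ⟨n, c, d, rfl⟩ := D.dual_eq_sum_pr ψ
  simp only [LinearMap.sum_apply, LinearMap.smul_apply]
  exact hasSum_sum fun i _ => hasSum_sum fun l _ => (key _ _).const_smul _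

/-- `|e^{2πiu/g}| = e^{-2π Im u / g}`, so the annulus is the image of the strip `-Im τ < Im u < 0`.
-/
lemma exists_im_bounds (hg : 0 < g) {z : ℂ} (h0 : 1 < ‖z‖)
    (h1 : ‖z‖ < Real.exp (2 * Real.pi * τ.im / g)) :
    ∃ u : ℂ, Complex.exp (2 * Real.pi * I * u / g) = z ∧ u.im < 0 ∧ -τ.im < u.im := by
  obtain ⟨u, rfl⟩ := exists_exp_eq g hg (z := z) (fun h => by simp [h] at h0; linarith)
  have hg' : (0 : ℝ) < g := by exact_mod_cast hg
  have e : ‖Complex.exp (2 * Real.pi * I * u / g)‖ = Real.exp (-(2 * Real.pi * (u.im / g))) := by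
    rw [show 2 * Real.pi * I * u / g = 2 * Real.pi * I * (u / (g : ℝ)) by push_cast; ring,
      ← Complex.div_ofReal_im, ← norm_ee, ee]
  rw [e] at h0 h1
  rw [← Real.exp_zero, Real.exp_lt_exp] at h0
  rw [Real.exp_lt_exp] at h1
  have hpi := Real.pi_pos
  refine ⟨u, rfl, ?_, ?_⟩
  · by_contra h
    push Not at h
    have : 0 ≤ 2 * Real.pi * (u.im / g) := by positivity
    linarith
  · have h2 : -(u.im / g) < τ.im / g := by
      have : 2 * Real.pi * -(u.im / g) < 2 * Real.pi * (τ.im / g) := by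
        calc _ = -(2 * Real.pi * (u.im / g)) := by ring
          _ < _ := h1
          _ = _ := by ring
      exact lt_of_mul_lt_mul_left this (by positivity)
    rw [← neg_div, div_lt_div_iff_of_pos_right hg'] at h2
    linarith

end SeriesSum

end ChevalleyData

/-! ### Quotients of analytic functions of several variables. -/

section Meromorphy

open Complex

variable {V : Type*} [NormedAddCommGroup V] [NormedSpace ℂ V]

/-- `d` is analytic at `p` and does not vanish identically on any small open set near `p`. -/
def IsDenominator (d : V → ℂ) (p : V) : Prop :=
  AnalyticAt ℂ d p ∧ ∀ᶠ q in 𝓝 p, ∃ᶠ q' in 𝓝 q, d q' ≠ 0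

/-- `f` is a quotient of analytic functions near `p`. -/
def IsQuotientAt (f : V → ℂ) (p : V) : Prop :=
  ∃ n d : V → ℂ, AnalyticAt ℂ n p ∧ IsDenominator d p ∧ ∀ᶠ q in 𝓝 p, d q ≠ 0 → f q = n q / d q

variable {f f' d d' : V → ℂ} {p : V}

/-- Near `q` there is a point where `d` is nonzero; it stays nonzero around that point, and
arbitrarily close to it `d'` is nonzero. For this the nonvanishing of `d'` is needed near all points
close to `p`, not only at `p`. -/
lemma IsDenominator.mul (h : IsDenominator d p) (h' : IsDenominator d' p) :
    IsDenominator (fun q => d q * d' q) p := by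
  refine ⟨h.1.mul h'.1, ?_⟩
  have hc := h.1.eventually_analyticAt
  filter_upwards [h.2, h'.2.eventually_nhds, hc.eventually_nhds] with q h1 h2 h3
  have h4 := h1.and_eventually (h2.and h3)
  rw [frequently_iff_forall_eventually_exists_and] at h4 ⊢
  intro s hs
  obtain ⟨q', ⟨h5, h6, h7⟩, h8⟩ := h4 hs.eventually_nhds
  obtain ⟨q'', h9, h10, h11⟩ :=
    (h6.and_eventually ((h7.continuousAt.eventually_ne h5).and h8)).exists
  exact ⟨q'', mul_ne_zero h10 h9, h11⟩

lemma isDenominator_one : IsDenominator (fun _ : V => (1 : ℂ)) p :=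
  ⟨analyticAt_const, Eventually.of_forall fun _ => (Eventually.of_forall fun _ => one_ne_zero).frequently⟩

lemma AnalyticAt.isQuotientAt (h : AnalyticAt ℂ f p) : IsQuotientAt f p :=
  ⟨f, fun _ => 1, h, isDenominator_one, Eventually.of_forall fun _ _ => (div_one _).symm⟩

lemma isQuotientAt_div (h : AnalyticAt ℂ f p) (hd : IsDenominator d p) :
    IsQuotientAt (fun q => f q / d q) p :=
  ⟨f, d, h, hd, Eventually.of_forall fun _ _ => rfl⟩

lemma IsQuotientAt.add (h : IsQuotientAt f p) (h' : IsQuotientAt f' p) :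
    IsQuotientAt (fun q => f q + f' q) p := by
  obtain ⟨n, d, hn, hd, e⟩ := h
  obtain ⟨n', d', hn', hd', e'⟩ := h'
  refine ⟨fun q => n q * d' q + d q * n' q, fun q => d q * d' q,
    (hn.mul hd'.1).add (hd.1.mul hn'), hd.mul hd', ?_⟩
  filter_upwards [e, e'] with q h1 h2 h3
  rw [h1 (left_ne_zero_of_mul h3), h2 (right_ne_zero_of_mul h3),
    div_add_div _ _ (left_ne_zero_of_mul h3) (right_ne_zero_of_mul h3)]

lemma IsQuotientAt.mul (h : IsQuotientAt f p) (h' : IsQuotientAt f' p) :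
    IsQuotientAt (fun q => f q * f' q) p := by
  obtain ⟨n, d, hn, hd, e⟩ := h
  obtain ⟨n', d', hn', hd', e'⟩ := h'
  refine ⟨fun q => n q * n' q, fun q => d q * d' q, hn.mul hn', hd.mul hd', ?_⟩
  filter_upwards [e, e'] with q h1 h2 h3
  rw [h1 (left_ne_zero_of_mul h3), h2 (right_ne_zero_of_mul h3), div_mul_div_comm]

lemma isQuotientAt_const (c : ℂ) : IsQuotientAt (fun _ : V => c) p :=
  AnalyticAt.isQuotientAt analyticAt_const

lemma isQuotientAt_sum {ι : Type*} (s : Finset ι) {F : ι → V → ℂ}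
    (h : ∀ i ∈ s, IsQuotientAt (F i) p) : IsQuotientAt (fun q => ∑ i ∈ s, F i q) p := by
  classical
  induction s using Finset.induction_on with
  | empty => simpa using isQuotientAt_const (p := p) 0
  | insert i s hi ih =>
    simp only [Finset.sum_insert hi]
    exact (h i (Finset.mem_insert_self i s)).add
      (ih fun j hj => h j (Finset.mem_insert_of_mem hj))

lemma IsQuotientAt.congr (h : IsQuotientAt f p) (e : ∀ᶠ q in 𝓝 p, f' q = f q) :
    IsQuotientAt f' p := by
  obtain ⟨n, d, hn, hd, e'⟩ := h
  refine ⟨n, d, hn, hd, ?_⟩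
  filter_upwards [e, e'] with q h1 h2 h3
  rw [h1, h2 h3]

lemma isMeromorphicOn_of_isQuotientAt {U : Set V} (h : ∀ p ∈ U, IsQuotientAt f p) :
    IsMeromorphicOn f U := by
  intro p hp
  obtain ⟨n, d, hn, hd, e⟩ := h p hp
  exact ⟨n, d, hn, hd.1, hd.2.self_of_nhds, e⟩

variable {τ : ℂ}

/-- A real line meets the lattice in a countable set, whose complement in the line is dense. -/
lemma frequently_thetaFn_ne_zero (hτ : 0 < τ.im) (y : ℂ) {c : ℂ} (hc : c ≠ 0) :
    ∃ᶠ s : ℝ in 𝓝 0, thetaFn (y + c * s) τ ≠ 0 := by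
  have hinj : Function.Injective fun s : ℝ => y + c * (s : ℂ) := fun s t h => by
    simpa [hc] using h
  have h1 := (latt_countable τ).preimage_of_injOn (f := fun s : ℝ => y + c * (s : ℂ)) hinj.injOn
  have h2 := h1.dense_compl ℝ
  refine (mem_closure_iff_frequently.1 (h2 0)).mono fun s hs => ?_
  exact thetaFn_ne_zero hτ hs

/-- A theta function along a family of lines or logarithmic spirals. -/
lemma isDenominator_thetaFn (hτ : 0 < τ.im) {W : V → ℂ} (hW : AnalyticAt ℂ W p)
    (h : ∀ᶠ q in 𝓝 p, ∃ (γ : ℝ → V) (c : ℂ), Tendsto γ (𝓝 0) (𝓝 q) ∧ c ≠ 0 ∧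
      ∀ s, W (γ s) = W q + c * s) : IsDenominator (fun q => thetaFn (W q) τ) p := by
  refine ⟨((differentiable_thetaFn hτ).analyticAt (W p)).comp hW, ?_⟩
  filter_upwards [h] with q hq
  obtain ⟨γ, c, h1, h2, h3⟩ := hq
  refine h1.frequently ((frequently_thetaFn_ne_zero hτ (W q) h2).mono fun s hs => ?_)
  rwa [h3]

lemma isQuotientAt_sigmaFn (hτ : 0 < τ.im) {W U : V → ℂ} (hW : AnalyticAt ℂ W p)
    (hU : AnalyticAt ℂ U p) (dW : IsDenominator (fun q => thetaFn (W q) τ) p)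
    (dU : IsDenominator (fun q => thetaFn (U q) τ) p) :
    IsQuotientAt (fun q => sigmaFn (W q) (U q) τ) p := by
  refine isQuotientAt_div (AnalyticAt.mul ?_ analyticAt_const) (dW.mul dU)
  exact ((differentiable_thetaFn hτ).analyticAt (W p - U p)).comp (f := fun q => W q - U q) (hW.sub hU)

lemma isQuotientAt_chiFn (hτ : 0 < τ.im) {U : V → ℂ} (hU : AnalyticAt ℂ U p)
    (dU : IsDenominator (fun q => thetaFn (U q) τ) p) :
    IsQuotientAt (fun q => chiFn (U q) τ) p :=
  isQuotientAt_div (((differentiable_thetaFn' hτ).analyticAt (U p)).comp hU) dU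

end Meromorphy

namespace ChevalleyData

variable {𝔤 : Type*} [LieRing 𝔤] [LieAlgebra ℂ 𝔤] [FiniteDimensional ℂ 𝔤]
  [LieAlgebra.IsSimple ℂ 𝔤]

/-! ### The continuation in `z`, and its meromorphy. -/

section Continuation

open scoped Classical
open Complex

attribute [-simp] Finset.univ_eq_attach

variable {D : ChevalleyData 𝔤} {g : ℕ} {T : Equiv.Perm D.Node} {B : D.Affine ≃ₗ⁅ℂ⁆ D.Affine}
  {β : 𝔤 ≃ₗ⁅ℂ⁆ 𝔤} {a b : ℕ} {x : Module.Basis (Fin a ⊕ Fin b) ℂ D.H} {τ : ℂ} {lam : Fin a → ℂ}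
  {u : ℂ}

/-- `σ` and `χ` have period `1` in `u`, and `e(|α|u/g)` has period `g`. So the formula is a function
of `z`, and the branch of the logarithm in `continuedR` is immaterial. -/
lemma ellipticR_add_mul (hτ : 0 < τ.im) (hg : 0 < g) (u : ℂ) (n : ℤ) :
    D.ellipticR g T β x τ lam (u + g * n) = D.ellipticR g T β x τ lam u := by
  have hg' : (g : ℂ) ≠ 0 := by exact_mod_cast hg.ne'
  have hN := natCast_mul_im_pos hτ (orderOf_T_pos (T := T))
  have e1 : ∀ w (l : ℕ), sigmaFn w (u + g * n + l * τ) (orderOf T * τ) =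
      sigmaFn w (u + l * τ) (orderOf T * τ) := by
    intro w l
    have h : Function.Periodic (fun u => sigmaFn w u (orderOf T * τ)) 1 := fun u =>
      sigmaFn_add_one w u _
    refine Eq.trans ?_ (h.int_mul (g * n) (u + l * τ))
    congr 1; push_cast; ring
  have e2 : ∀ (l : ℕ), chiFn (u + g * n + l * τ) (orderOf T * τ) =
      chiFn (u + l * τ) (orderOf T * τ) := by
    intro l
    have h : Function.Periodic (fun u => chiFn u (orderOf T * τ)) 1 := fun u =>
      chiFn_add_one hN u
    refine Eq.trans ?_ (h.int_mul (g * n) (u + l * τ))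
    congr 1; push_cast; ring
  have e3 : ∀ α (l : ℕ), Complex.exp (-l * D.val g x τ lam α +
      2 * Real.pi * I * D.ht α * (u + g * n) / g) =
      Complex.exp (-l * D.val g x τ lam α + 2 * Real.pi * I * D.ht α * u / g) := by
    intro α l
    refine Eq.trans ?_ (Complex.exp_periodic.int_mul (D.ht α * n) _)
    congr 1; push_cast; field_simp; ring
  simp only [ellipticR, e1, e2, e3]

/-- The continuation of the series, as a function of `z`. -/
def continuedR (D : ChevalleyData 𝔤) (g : ℕ) (T : Equiv.Perm D.Node) (β : 𝔤 ≃ₗ⁅ℂ⁆ 𝔤)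
    (x : Module.Basis (Fin a ⊕ Fin b) ℂ D.H) (τ : ℂ) (lam : Fin a → ℂ) (z : ℂ) : 𝔤 ⊗[ℂ] 𝔤 :=
  D.ellipticR g T β x τ lam (g / (2 * Real.pi * I) * Complex.log z)

lemma continuedR_exp (hτ : 0 < τ.im) (hg : 0 < g) (u : ℂ) :
    D.continuedR g T β x τ lam (Complex.exp (2 * Real.pi * I * u / g)) =
      D.ellipticR g T β x τ lam u := by
  have hg' : (g : ℂ) ≠ 0 := by exact_mod_cast hg.ne'
  have hpi := two_pi_I_ne
  obtain ⟨n, hn⟩ := Complex.exp_eq_exp_iff_exists_int.1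
    (Complex.exp_log (Complex.exp_ne_zero (2 * Real.pi * I * u / g)))
  rw [continuedR, hn, ← ellipticR_add_mul hτ hg u n]
  congr 1; field_simp

lemma analyticAt_val (α : D.H.root) (p : (Fin a → ℂ) × ℂ) :
    AnalyticAt ℂ (fun q : (Fin a → ℂ) × ℂ => D.val g x τ q.1 α) p := by
  simp only [val, rootVal_lamH]
  refine AnalyticAt.sub (Finset.analyticAt_fun_sum _ fun i _ => analyticAt_const.mul ?_)
    analyticAt_const
  exact ((ContinuousLinearMap.proj (R := ℂ) (φ := fun _ : Fin a => ℂ) i).comp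
    (ContinuousLinearMap.fst ℂ (Fin a → ℂ) ℂ)).analyticAt p

/-- A root that vanishes on `𝔩` takes a value off the lattice. -/
lemma Twist.val_not_mem_latt (W : D.Twist g T B β) (hτ : 0 < τ.im) (hx : D.IsAdapted T x)
    {α : D.H.root} (h : ∀ i, D.rootVal α (x (Sum.inl i)) = 0) (lam : Fin a → ℂ) :
    orderOf T * (D.val g x τ lam α / (2 * Real.pi * I)) ∉ latt (orderOf T * τ) := by
  have hN := orderOf_T_pos (T := T)
  have hg' : (g : ℂ) ≠ 0 := by exact_mod_cast W.pos.ne'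
  have hpi := two_pi_I_ne
  have hnd := W.not_dvd_ht (α := α) fun l hl => by
    rw [hx.lSub_eq] at hl
    refine Submodule.span_induction (p := fun l _ => D.rootVal α l = 0) ?_ (by simp) ?_ ?_ hl
    · rintro _ ⟨i, rfl⟩; exact h i
    · intro y z _ _ hy hz; rw [rootVal_add, hy, hz, add_zero]
    · intro c y _ hy; rw [rootVal_smul, hy, mul_zero]
  have hc : orderOf T * (D.val g x τ lam α / (2 * Real.pi * I)) =
      orderOf T * (-(D.ht α / g) * τ) := by
    simp only [val, rootVal_lamH, h, zero_mul, Finset.sum_const_zero]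
    field_simp; ring
  rw [hc]
  rintro ⟨p, q, e⟩
  refine hnd ?_
  have h1 : ((orderOf T * (-(D.ht α / g : ℝ) - q) : ℝ) : ℂ) * τ = ((p : ℝ) : ℂ) := by
    push_cast; linear_combination e
  have h2 := congrArg Complex.im h1
  rw [Complex.im_ofReal_mul, Complex.ofReal_im, mul_eq_zero, or_iff_left hτ.ne', mul_eq_zero,
    or_iff_right (by exact_mod_cast hN.ne')] at h2
  have hg'' : (g : ℝ) ≠ 0 := by exact_mod_cast W.pos.ne'
  have h3 : (D.ht α : ℝ) = g * (-q) := by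
    field_simp at h2
    linear_combination -h2
  exact ⟨-q, by exact_mod_cast h3⟩

/-- If `α` is nonzero on `𝔩`, moving one coordinate of `λ` moves the argument along a line. If `α`
vanishes on `𝔩`, the argument is constant and off the lattice. -/
lemma Twist.isDenominator_val (W : D.Twist g T B β) (hτ : 0 < τ.im) (hx : D.IsAdapted T x)
    (α : D.H.root) (p : (Fin a → ℂ) × ℂ) :
    IsDenominator (fun q : (Fin a → ℂ) × ℂ => thetaFn (orderOf T / (2 * Real.pi * I) *
      D.val g x τ q.1 α) (orderOf T * τ)) p := by
  have hN := orderOf_T_pos (T := T)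
  have hN' : ((orderOf T : ℕ) : ℂ) ≠ 0 := by exact_mod_cast hN.ne'
  have hg' : (g : ℂ) ≠ 0 := by exact_mod_cast W.pos.ne'
  have hpi := two_pi_I_ne
  have hNτ := natCast_mul_im_pos hτ hN
  by_cases h : ∃ i, D.rootVal α (x (Sum.inl i)) ≠ 0
  · obtain ⟨i, hi⟩ := h
    refine isDenominator_thetaFn hNτ (analyticAt_const.mul (analyticAt_val α p))
      (Eventually.of_forall fun q => ⟨fun s => (q.1 + Pi.single i (s : ℂ), q.2),
        orderOf T / (2 * Real.pi * I) * D.rootVal α (x (Sum.inl i)), ?_,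
        mul_ne_zero (div_ne_zero hN' hpi) hi, fun s => ?_⟩)
    · have h1 : Continuous fun s : ℝ => (q.1 + Pi.single i (s : ℂ), q.2) :=
        (continuous_const.add ((continuous_single i).comp continuous_ofReal)).prodMk continuous_const
      have := h1.tendsto 0
      simpa using this
    · simp only [val, rootVal_lamH, Pi.add_apply, mul_add, Finset.sum_add_distrib]
      have hsum : ∑ l, D.rootVal α (x (Sum.inl l)) * (Pi.single i (s : ℂ) : Fin a → ℂ) l =
          D.rootVal α (x (Sum.inl i)) * s := by simp [Pi.single_apply]
      rw [hsum]
      ring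
  · push Not at h
    have hc : ∀ q : (Fin a → ℂ) × ℂ, orderOf T / (2 * Real.pi * I) * D.val g x τ q.1 α =
        orderOf T * (-(D.ht α / g) * τ) := by
      intro q
      simp only [val, rootVal_lamH, h, zero_mul, Finset.sum_const_zero]
      field_simp; ring
    have hnm := W.val_not_mem_latt hτ hx h p.1
    rw [mul_div_assoc', ← div_mul_eq_mul_div, hc p] at hnm
    simp only [hc]
    exact ⟨analyticAt_const, Eventually.of_forall fun _ => (Eventually.of_forall fun _ =>
      thetaFn_ne_zero hNτ hnm).frequently⟩

lemma Twist.isQuotientAt_ellipticR (W : D.Twist g T B β) (hτ : 0 < τ.im) (hx : D.IsAdapted T x)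
    (ψ : Module.Dual ℂ (𝔤 ⊗[ℂ] 𝔤)) {U : (Fin a → ℂ) × ℂ → ℂ} {p : (Fin a → ℂ) × ℂ}
    (hU : AnalyticAt ℂ U p)
    (hUl : ∀ l : ℕ, IsDenominator (fun q => thetaFn (U q + l * τ) (orderOf T * τ)) p) :
    IsQuotientAt (fun q : (Fin a → ℂ) × ℂ => ψ (D.ellipticR g T β x τ q.1 (U q))) p := by
  have hg' : (g : ℂ) ≠ 0 := by exact_mod_cast W.pos.ne'
  have hNτ := natCast_mul_im_pos hτ (orderOf_T_pos (T := T))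
  have e1 : ∀ (α : D.H.root) (l : ℕ), IsQuotientAt (fun q : (Fin a → ℂ) × ℂ =>
      1 / (2 * Real.pi * Complex.I) * Complex.exp (-l * D.val g x τ q.1 α +
        2 * Real.pi * Complex.I * D.ht α * U q / g) *
      sigmaFn (orderOf T / (2 * Real.pi * Complex.I) * D.val g x τ q.1 α) (U q + l * τ)
        (orderOf T * τ)) p := by
    intro α l
    refine ((isQuotientAt_const _).mul (AnalyticAt.isQuotientAt (AnalyticAt.cexp ?_))).mul
      (isQuotientAt_sigmaFn hNτ (analyticAt_const.mul (analyticAt_val α p))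
        (hU.add analyticAt_const) (W.isDenominator_val hτ hx α p) (hUl l))
    exact (analyticAt_const.mul (analyticAt_val α p)).add
      ((analyticAt_const.mul hU).div analyticAt_const hg')
  have e2 : ∀ l : ℕ, IsQuotientAt (fun q : (Fin a → ℂ) × ℂ => (if l = 0 then 0 else 1 / 2) +
      1 / (2 * Real.pi * Complex.I) * chiFn (U q + l * τ) (orderOf T * τ)) p := fun l =>
    (isQuotientAt_const _).add ((isQuotientAt_const _).mul
      (isQuotientAt_chiFn hNτ (hU.add analyticAt_const) (hUl l)))
  simp only [ellipticR, map_add, map_neg, map_sum, map_smul, smul_eq_mul,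
    sub_eq_add_neg, neg_eq_neg_one_mul (Finset.sum _ _)]
  refine IsQuotientAt.add (IsQuotientAt.add ?_ ?_) (isQuotientAt_const _)
  · exact (isQuotientAt_const _).mul (isQuotientAt_sum _ fun α _ => isQuotientAt_sum _ fun l _ =>
      (e1 α l).mul (isQuotientAt_const _))
  · exact (isQuotientAt_const _).mul (isQuotientAt_sum _ fun i _ => isQuotientAt_sum _ fun l _ =>
      (e2 l).mul (isQuotientAt_const _))

/-- The matrix coefficients of `r̄_T` are meromorphic. -/
lemma Twist.isMeromorphicOn (W : D.Twist g T B β) (hτ : 0 < τ.im) (hx : D.IsAdapted T x)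
    (ψ : Module.Dual ℂ (𝔤 ⊗[ℂ] 𝔤)) :
    IsMeromorphicOn (fun q : (Fin a → ℂ) × ℂ => ψ (D.continuedR g T β x τ q.1 q.2))
      {q | q.2 ≠ 0} := by
  have hN := orderOf_T_pos (T := T)
  have hg' : (g : ℂ) ≠ 0 := by exact_mod_cast W.pos.ne'
  have hpi := two_pi_I_ne
  have hNτ := natCast_mul_im_pos hτ hN
  refine isMeromorphicOn_of_isQuotientAt fun p hp => ?_
  set z₀ := p.2 with hz₀
  have hz₀' : z₀ ≠ 0 := hp
  -- A branch of the logarithm analytic near `z₀`; the principal one is not if `z₀` lies on its cut.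
  let U : (Fin a → ℂ) × ℂ → ℂ := fun q =>
    g / (2 * Real.pi * I) * (Complex.log (q.2 / z₀) + Complex.log z₀)
  have hU : AnalyticAt ℂ U p := by
    refine analyticAt_const.mul (AnalyticAt.add ?_ analyticAt_const)
    refine AnalyticAt.clog (analyticAt_snd.div analyticAt_const hz₀') ?_
    rw [← hz₀, div_self hz₀']; exact one_mem_slitPlane
  have hne : ∀ᶠ q : (Fin a → ℂ) × ℂ in 𝓝 p, q.2 ≠ 0 :=
    continuous_snd.continuousAt.eventually_ne hz₀'
  have hUl : ∀ l : ℕ, IsDenominator (fun q => thetaFn (U q + l * τ) (orderOf T * τ)) p := by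
    intro l
    refine isDenominator_thetaFn hNτ (hU.add analyticAt_const) ?_
    filter_upwards [hne] with q hq
    -- Scaling `z` by the positive number `e^s` changes no argument, so the logarithm moves by
    -- exactly `s` and `U` along a line.
    refine ⟨fun s => (q.1, (Real.exp s : ℂ) * q.2), g / (2 * Real.pi * I), ?_,
      div_ne_zero hg' hpi, fun s => ?_⟩
    · have h1 : Continuous fun s : ℝ => (q.1, (Real.exp s : ℂ) * q.2) :=
        continuous_const.prodMk ((continuous_ofReal.comp Real.continuous_exp).mul continuous_const)
      have := h1.tendsto 0
      simpa using this
    · simp only [U]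
      rw [mul_div_assoc, Complex.log_ofReal_mul (Real.exp_pos s) (div_ne_zero hq hz₀'),
        Real.log_exp]
      ring
  have key := W.isQuotientAt_ellipticR hτ hx ψ hU hUl
  refine key.congr ?_
  filter_upwards [hne] with q hq
  rw [← continuedR_exp hτ W.pos (U q)]
  congr 2
  simp only [U]
  rw [show 2 * Real.pi * I * (g / (2 * Real.pi * I) * (Complex.log (q.2 / z₀) + Complex.log z₀)) / g =
    Complex.log (q.2 / z₀) + Complex.log z₀ by field_simp, Complex.exp_add, Complex.exp_log hz₀',
    Complex.exp_log (div_ne_zero hq hz₀'), div_mul_cancel₀ _ hz₀']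

end Continuation

end ChevalleyData

/-! ### The matrices `J_{p,c}` as joint eigenvectors of clock and shift conjugation. -/

section ClockShift

open Complex

variable {n : ℕ} [NeZero n]

lemma heisJ_apply (p c i j : Fin n) :
    heisJ n p c i j = if j = i + p then ee ((c : ℕ) * (i : ℕ) / n) else 0 := by
  have e : ∀ l : Fin n, Complex.exp (2 * Real.pi * Complex.I * (c * l : ℕ) / n) =
      ee ((c : ℕ) * (l : ℕ) / n) := fun l => by rw [ee]; congr 1; push_cast; ring
  simp only [heisJ, e, Matrix.sum_apply, Matrix.smul_apply, Matrix.single_apply, smul_eq_mul,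
    mul_ite, mul_one, mul_zero]
  rw [Finset.sum_eq_single i]
  · simp [eq_comm]
  · intro l _ hl; simp [hl]
  · simp

lemma heisJdual_apply (p c r s : Fin n) :
    heisJdual n p c r s = 1 / n * if r = s + p then ee (-((c : ℕ) * (s : ℕ) / n)) else 0 := by
  have e : ∀ l : Fin n, Complex.exp (-(2 * Real.pi * Complex.I * (c * l : ℕ) / n)) =
      ee (-((c : ℕ) * (l : ℕ) / n)) := fun l => by rw [ee]; congr 1; push_cast; ring
  simp only [heisJdual, e, Matrix.sum_apply, Matrix.smul_apply, Matrix.single_apply, smul_eq_mul,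
    mul_ite, mul_one, mul_zero]
  rw [Finset.sum_eq_single s]
  · simp [eq_comm]
  · intro l _ hl; simp [hl]
  · simp

lemma sum_ee_fin (i s : Fin n) :
    ∑ c : Fin n, ee ((c : ℕ) * (i : ℕ) / n) * ee (-((c : ℕ) * (s : ℕ) / n)) =
      if i = s then (n : ℂ) else 0 := by
  have hn : 0 < n := NeZero.pos n
  split_ifs with h
  · subst h
    simp [← ee_add, ee_zero]
  · have hk : ¬(n : ℤ) ∣ (s : ℤ) - (i : ℤ) := by
      intro hd
      have := Int.eq_zero_of_abs_lt_dvd hd (abs_lt.2 ⟨by omega, by omega⟩)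
      exact h (Fin.ext (by omega))
    rw [← (sum_ee_eq_zero hk hn).1, ← Fin.sum_univ_eq_sum_range
      (fun l => ee (-((((s : ℤ) - (i : ℤ) : ℤ) : ℂ) / n)) ^ l) n]
    refine Finset.sum_congr rfl fun c _ => ?_
    rw [← ee_add, ← ee_nat_mul]; congr 1; push_cast; ring

lemma trace_heisJ_mul (p c : Fin n) (M : Matrix (Fin n) (Fin n) ℂ) :
    (heisJ n p c * M).trace = ∑ i : Fin n, ee ((c : ℕ) * (i : ℕ) / n) * M (i + p) i := by
  simp only [Matrix.trace, Matrix.diag_apply, Matrix.mul_apply, heisJ_apply]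
  exact Finset.sum_congr rfl fun i _ => by simp

lemma trace_heisJ {p c : Fin n} (h : ¬(p = 0 ∧ c = 0)) : (heisJ n p c).trace = 0 := by
  simp only [Matrix.trace, Matrix.diag_apply, heisJ_apply]
  by_cases hp : p = 0
  · have hc : c ≠ 0 := fun hc => h ⟨hp, hc⟩
    have := sum_ee_fin c 0
    rw [if_neg hc] at this
    rw [← this]
    refine Finset.sum_congr rfl fun i _ => ?_
    rw [if_pos (by rw [hp, add_zero]), ← ee_add]; congr 1; simp; ring
  · exact Finset.sum_eq_zero fun i _ => if_neg fun e => hp (by simpa using e.symm)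

lemma trace_heisJdual {p c : Fin n} (h : ¬(p = 0 ∧ c = 0)) : (heisJdual n p c).trace = 0 := by
  simp only [Matrix.trace, Matrix.diag_apply, heisJdual_apply]
  rw [← Finset.mul_sum]
  by_cases hp : p = 0
  · have hc : c ≠ 0 := fun hc => h ⟨hp, hc⟩
    have := sum_ee_fin 0 c
    rw [if_neg (Ne.symm hc)] at this
    rw [← mul_zero (1 / (n : ℂ)), ← this]
    congr 1
    refine Finset.sum_congr rfl fun i _ => ?_
    rw [if_pos (by rw [hp, add_zero]), ← ee_add]; congr 1; simp; ring
  · rw [Finset.sum_eq_zero, mul_zero]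
    exact fun i _ => if_neg fun e => hp (by simpa using e.symm)

/-- The index `p` selects a cyclic diagonal, and on it the sum over `c` is Fourier inversion on
`ℤ/n`. So the two families are dual bases for the trace form. -/
lemma sum_trace_heisJ (M : Matrix (Fin n) (Fin n) ℂ) :
    ∑ p, ∑ c, (heisJ n p c * M).trace • heisJdual n p c = M := by
  have hn : (n : ℂ) ≠ 0 := by exact_mod_cast NeZero.ne n
  ext r s
  simp only [Matrix.sum_apply, Matrix.smul_apply, heisJdual_apply, smul_eq_mul, trace_heisJ_mul]
  rw [Finset.sum_eq_single (r - s)]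
  · have h1 : ∀ c : Fin n, (∑ i : Fin n, ee ((c : ℕ) * (i : ℕ) / n) * M (i + (r - s)) i) *
        (1 / n * if r = s + (r - s) then ee (-((c : ℕ) * (s : ℕ) / n)) else 0) =
        ∑ i : Fin n, ee ((c : ℕ) * (i : ℕ) / n) * ee (-((c : ℕ) * (s : ℕ) / n)) *
          (1 / n * M (i + (r - s)) i) := by
      intro c
      rw [if_pos (by abel), Finset.sum_mul]
      exact Finset.sum_congr rfl fun i _ => by ring
    simp only [h1]
    rw [Finset.sum_comm]
    simp only [← Finset.sum_mul, sum_ee_fin]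
    rw [Finset.sum_eq_single s]
    · rw [if_pos rfl, show s + (r - s) = r by abel]; field_simp
    · intro i _ hi; rw [if_neg hi, zero_mul]
    · simp
  · intro p _ hp
    refine Finset.sum_eq_zero fun c _ => ?_
    rw [if_neg, mul_zero, mul_zero]
    rintro rfl
    exact hp (by abel)
  · simp

/-- The wrap-around of indices modulo `n` is invisible to `e(·/n)`. -/
lemma ee_val_add_sub (i p : Fin n) :
    ee ((((i + p : Fin n) : ℕ) - (i : ℕ) : ℂ) / n) = ee ((p : ℕ) / n) := by
  have hn : (n : ℂ) ≠ 0 := by exact_mod_cast NeZero.ne n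
  obtain ⟨m, hm⟩ : ∃ m : ℤ, (((i + p : Fin n) : ℕ) : ℤ) = (i : ℕ) + (p : ℕ) + n * m := by
    refine ⟨-(((i : ℕ) + (p : ℕ)) / n : ℕ), ?_⟩
    have := Nat.mod_add_div ((i : ℕ) + (p : ℕ)) n
    rw [Fin.val_add]
    push_cast at this ⊢
    rw [mul_neg]
    zify at this
    linarith
  have hm' : (((i + p : Fin n) : ℕ) : ℂ) = (i : ℕ) + (p : ℕ) + n * m := by exact_mod_cast hm
  rw [hm', show (((i : ℕ) + (p : ℕ) + n * m - (i : ℕ) : ℂ)) / n = (p : ℕ) / n + m by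
    field_simp; ring, ee_add, ee_int, mul_one]

attribute [local instance] LieRing.ofAssociativeRing

/-- Conjugation by the clock matrix. -/
def clockConj (n : ℕ) [NeZero n] : Matrix (Fin n) (Fin n) ℂ →ₗ⁅ℂ⁆ Matrix (Fin n) (Fin n) ℂ where
  toFun M := Matrix.of fun i j => ee (((j : ℕ) - (i : ℕ) : ℂ) / n) * M i j
  map_add' M M' := by ext i j; simp [mul_add]
  map_smul' c M := by ext i j; simp; ring
  map_lie' {M M'} := by
    have key : ∀ M M' : Matrix (Fin n) (Fin n) ℂ,
        (Matrix.of fun i j : Fin n => ee (((j : ℕ) - (i : ℕ) : ℂ) / n) * (M * M') i j) =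
        (Matrix.of fun i j : Fin n => ee (((j : ℕ) - (i : ℕ) : ℂ) / n) * M i j) *
          Matrix.of fun i j : Fin n => ee (((j : ℕ) - (i : ℕ) : ℂ) / n) * M' i j := by
      intro M M'
      ext i j
      simp only [Matrix.of_apply, Matrix.mul_apply, Finset.mul_sum]
      refine Finset.sum_congr rfl fun l _ => ?_
      rw [show (((j : ℕ) - (i : ℕ) : ℂ)) / n = ((l : ℕ) - (i : ℕ) : ℂ) / n +
        ((j : ℕ) - (l : ℕ) : ℂ) / n by ring, ee_add]
      ring
    simp only [Ring.lie_def]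
    rw [← key, ← key]
    ext i j
    simp [mul_sub]

/-- Conjugation by a power of the shift matrix. -/
def shiftConj {n : ℕ} [NeZero n] (s : Fin n) :
    Matrix (Fin n) (Fin n) ℂ →ₗ⁅ℂ⁆ Matrix (Fin n) (Fin n) ℂ where
  toFun M := M.submatrix (Equiv.subRight s) (Equiv.subRight s)
  map_add' M M' := rfl
  map_smul' c M := rfl
  map_lie' {M M'} := by
    simp only [Ring.lie_def]
    rw [Matrix.submatrix_mul_equiv, Matrix.submatrix_mul_equiv]; rfl

lemma clockConj_apply (M : Matrix (Fin n) (Fin n) ℂ) (i j : Fin n) :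
    clockConj n M i j = ee (((j : ℕ) - (i : ℕ) : ℂ) / n) * M i j := rfl

lemma shiftConj_apply (s : Fin n) (M : Matrix (Fin n) (Fin n) ℂ) (i j : Fin n) :
    shiftConj s M i j = M (i - s) (j - s) := rfl

lemma clockConj_single (i j : Fin n) :
    clockConj n (Matrix.single i j 1) =
      ee (((j : ℕ) - (i : ℕ) : ℂ) / n) • Matrix.single i j (1 : ℂ) := by
  ext r s
  rw [clockConj_apply, Matrix.smul_apply, Matrix.single_apply, smul_eq_mul]
  split_ifs with h
  · rw [h.1, h.2]
  · simp

lemma shiftConj_single (s i j : Fin n) :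
    shiftConj s (Matrix.single i j 1) = Matrix.single (i + s) (j + s) 1 := by
  ext p q
  rw [shiftConj_apply, Matrix.single_apply, Matrix.single_apply]
  simp only [eq_sub_iff_add_eq]

lemma clockConj_heisJ (p c : Fin n) : clockConj n (heisJ n p c) = ee ((p : ℕ) / n) • heisJ n p c := by
  ext i j
  rw [clockConj_apply, Matrix.smul_apply, heisJ_apply, smul_eq_mul]
  split_ifs with h
  · rw [h, ee_val_add_sub]
  · simp

lemma shiftConj_heisJ (p c s : Fin n) :
    shiftConj s (heisJ n p c) = ee (-((c : ℕ) * (s : ℕ)) / n) • heisJ n p c := by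
  have hn : (n : ℂ) ≠ 0 := by exact_mod_cast NeZero.ne n
  ext i j
  rw [shiftConj_apply, Matrix.smul_apply, heisJ_apply, heisJ_apply, smul_eq_mul]
  have h : j - s = i - s + p ↔ j = i + p := by
    rw [sub_add_eq_add_sub, sub_left_inj]
  simp only [h]
  split_ifs with h
  · have h1 := ee_val_add_sub (i - s) s
    rw [sub_add_cancel] at h1
    have h2 : ee ((((i : ℕ) - ((i - s : Fin n) : ℕ) : ℂ) / n - (s : ℕ) / n)) = 1 := by
      rw [ee_sub, h1, div_self (ee_ne_zero _)]
    have h3 : ee ((c : ℕ) * (((i : ℕ) - ((i - s : Fin n) : ℕ) : ℂ) / n - (s : ℕ) / n)) = 1 := by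
      rw [ee_nat_mul, h2, one_pow]
    rw [← ee_add, ← mul_one (ee ((c : ℕ) * ((i - s : Fin n) : ℕ) / n)), ← h3, ← ee_add]
    congr 1; ring
  · simp

end ClockShift

namespace ChevalleyData

variable {𝔤 : Type*} [LieRing 𝔤] [LieAlgebra ℂ 𝔤] [FiniteDimensional ℂ 𝔤]
  [LieAlgebra.IsSimple ℂ 𝔤]

/-! ### The case of `sl(n)` with a rotation: Belavin's r-matrix. -/

section Belavin

open scoped Classical
open Complex

attribute [local instance] LieRing.ofAssociativeRing

attribute [-simp] Finset.univ_eq_attach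

lemma val_nsmul_ofNat {n : ℕ} [NeZero n] (k m : ℕ) :
    ((m • Fin.ofNat n k : Fin n) : ℕ) = m * k % n := by
  induction m with
  | zero => simp
  | succ m ih =>
    rw [succ_nsmul, Fin.val_add, ih, Fin.val_ofNat, ← Nat.add_mod]
    congr 1; ring

lemma nsmul_one_eq_zero_iff {n : ℕ} [NeZero n] (m : ℕ) : (m • (1 : Fin n)) = 0 ↔ n ∣ m := by
  have h : (1 : Fin n) = Fin.ofNat n 1 := rfl
  rw [← Fin.val_eq_zero_iff, h, val_nsmul_ofNat, mul_one, Nat.dvd_iff_mod_eq_zero]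

/-- `Φ` identifies `𝔤` with the traceless matrices of size `n`, in such a way that the affine simple
root vectors become matrix units, and `T` is the rotation by `k`. -/
structure IsSlModel (D : ChevalleyData 𝔤) (T : Equiv.Perm D.Node) (n k : ℕ) [NeZero n]
    (ν : D.Node ≃ Fin n) (Φ : 𝔤 →ₗ⁅ℂ⁆ Matrix (Fin n) (Fin n) ℂ) : Prop where
  coprime : k.Coprime n
  apply_E : ∀ i, Φ (D.E (D.nodeRoot i)) = Matrix.single (ν i) (ν i + 1) 1
  apply_E_neg : ∀ i, Φ (D.E (D.neg (D.nodeRoot i))) = Matrix.single (ν i + 1) (ν i) 1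
  injective : Function.Injective Φ
  trace : ∀ y, (Φ y).trace = 0
  exists_of_trace : ∀ M : Matrix (Fin n) (Fin n) ℂ, M.trace = 0 → ∃ y, Φ y = M
  rotation : ∀ i, ν (T i) = ν i + Fin.ofNat n k

variable {D : ChevalleyData 𝔤} {g : ℕ} {T : Equiv.Perm D.Node} {B : D.Affine ≃ₗ⁅ℂ⁆ D.Affine}
  {β : 𝔤 ≃ₗ⁅ℂ⁆ 𝔤} {a b : ℕ} {x : Module.Basis (Fin a ⊕ Fin b) ℂ D.H} {τ : ℂ} {lam : Fin a → ℂ}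
  {n k : ℕ} [NeZero n] {ν : D.Node ≃ Fin n} {Φ : 𝔤 →ₗ⁅ℂ⁆ Matrix (Fin n) (Fin n) ℂ}

/-- The composition of a Lie algebra isomorphism `ψ : 𝔤 ≃ sl(n)` and the inclusion of `sl(n)` into
the matrices. -/
def slHom {n : ℕ} (ψ : 𝔤 ≃ₗ⁅ℂ⁆ SpecialLinear.sl (Fin n) ℂ) :
    𝔤 →ₗ⁅ℂ⁆ Matrix (Fin n) (Fin n) ℂ :=
  (SpecialLinear.sl (Fin n) ℂ).incl.comp (ψ : 𝔤 →ₗ⁅ℂ⁆ SpecialLinear.sl (Fin n) ℂ)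

lemma isSlModel_slHom {ψ : 𝔤 ≃ₗ⁅ℂ⁆ SpecialLinear.sl (Fin n) ℂ} (hk : k.Coprime n)
    (hE : ∀ i, slIncl n (ψ (D.E (D.nodeRoot i))) = Matrix.single (ν i) (ν i + 1) 1)
    (hF : ∀ i, slIncl n (ψ (D.E (D.neg (D.nodeRoot i)))) = Matrix.single (ν i + 1) (ν i) 1)
    (hrot : ∀ i, ν (T i) = ν i + Fin.ofNat n k) : D.IsSlModel T n k ν (slHom ψ) where
  coprime := hk
  apply_E := hE
  apply_E_neg := hF
  injective := Subtype.val_injective.comp ψ.injective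
  trace y := (ψ y).2
  exists_of_trace M hM := ⟨ψ.symm ⟨M, hM⟩, congrArg Subtype.val (ψ.apply_symm_apply ⟨M, hM⟩)⟩
  rotation := hrot

namespace IsSlModel

variable (S : D.IsSlModel T n k ν Φ)

include S

lemma two_le : 2 ≤ n := by
  have h0 := NeZero.ne n
  by_contra h
  obtain rfl : n = 1 := by omega
  have h1 := S.trace (D.E (D.nodeRoot none))
  rw [S.apply_E, Subsingleton.elim (ν none + 1) (ν none), Matrix.trace_single_eq_same] at h1
  exact one_ne_zero h1

lemma apply_pow (m : ℕ) (i : D.Node) : ν ((T ^ m) i) = ν i + m • Fin.ofNat n k := by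
  induction m with
  | zero => simp
  | succ m ih => rw [pow_succ', Equiv.Perm.mul_apply, S.rotation, ih, succ_nsmul, add_assoc]

lemma nsmul_eq_zero_iff (m : ℕ) : m • Fin.ofNat n k = 0 ↔ n ∣ m := by
  rw [← Fin.val_eq_zero_iff, val_nsmul_ofNat, ← Nat.dvd_iff_mod_eq_zero]
  exact S.coprime.symm.dvd_mul_right

/-- `T^m` is the rotation by `mk`, which is trivial exactly when `n ∣ m`, since `k` is prime to `n`.
-/
lemma orderOf_eq : orderOf T = n := by
  have h : ∀ m, orderOf T ∣ m ↔ n ∣ m := by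
    intro m
    rw [orderOf_dvd_iff_pow_eq_one, ← S.nsmul_eq_zero_iff]
    constructor
    · intro h
      have := S.apply_pow m none
      rw [h, Equiv.Perm.one_apply] at this
      exact left_eq_add.1 this
    · intro h
      ext1 i
      refine ν.injective ?_
      rw [S.apply_pow, h, add_zero, Equiv.Perm.one_apply]
  exact Nat.dvd_antisymm ((h n).2 dvd_rfl) ((h _).1 dvd_rfl)

lemma sameCycle (i j : D.Node) : T.SameCycle i j := by
  have hinj : Function.Injective fun m : Fin n => ((m : ℕ) • Fin.ofNat n k : Fin n) := by
    intro m m' h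
    have h1 := congrArg Fin.val h
    simp only [val_nsmul_ofNat] at h1
    have h2 : (m : ℕ) ≡ m' [MOD n] := Nat.ModEq.cancel_right_of_coprime S.coprime.symm h1
    exact Fin.ext (h2.eq_of_lt_of_lt m.2 m'.2)
  obtain ⟨m, hm⟩ := Finite.surjective_of_injective hinj (ν j - ν i)
  refine ⟨(m : ℕ), ν.injective ?_⟩
  rw [zpow_natCast, S.apply_pow, show ((m : ℕ) • Fin.ofNat n k : Fin n) = ν j - ν i from hm]
  abel

/-- `T` is transitive on the nodes, so there is a single orbit. -/
lemma finrank_lSub_eq : Module.finrank ℂ (D.lSub T) = 0 := by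
  have h := D.finrank_lSub_add_one T
  have : Subsingleton (Quotient (Equiv.Perm.SameCycle.setoid T)) := ⟨fun p q => by
    induction p using Quotient.inductionOn
    induction q using Quotient.inductionOn
    exact Quotient.sound (S.sameCycle _ _)⟩
  have : Nonempty (Quotient (Equiv.Perm.SameCycle.setoid T)) := ⟨Quotient.mk _ none⟩
  rw [Nat.card_of_subsingleton (Classical.arbitrary _)] at h
  omega

/-- Successive brackets of the simple root vectors met when going round the cycle from the node
after the affine one. Fewer than `n` steps never reach the affine node, and each bracket raises the
`ρ`-weight by one. -/
lemma exists_path {m : ℕ} (hm : m + 1 < n) :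
    ∃ v : 𝔤, Φ v = Matrix.single (ν none + 1) (ν none + 1 + (m + 1) • 1) 1 ∧
      ⁅(D.ρ : 𝔤), v⁆ = ((m + 1 : ℕ) : ℂ) • v := by
  have step : ∀ m, m + 1 < n → ∃ w : 𝔤,
      Φ w = Matrix.single (ν none + 1 + m • 1) (ν none + 1 + (m + 1) • 1) 1 ∧
      ⁅(D.ρ : 𝔤), w⁆ = w := by
    intro m hm
    obtain ⟨i, hi⟩ := ν.surjective (ν none + 1 + m • 1)
    refine ⟨D.E (D.nodeRoot i), ?_, ?_⟩
    · rw [S.apply_E, hi, succ_nsmul, add_assoc (ν none + 1)]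
    · rcases i with _ | i
      · have h1 : (m + 1) • (1 : Fin n) = 0 := by
          rw [succ_nsmul']
          rw [add_assoc] at hi
          exact left_eq_add.1 hi
        have := Nat.le_of_dvd (by omega) ((nsmul_one_eq_zero_iff _).1 h1)
        omega
      · rw [lie_H_E, rootVal_ρ, nodeRoot, D.ht_simple i.2]; simp
  induction m with
  | zero =>
    obtain ⟨w, h1, h2⟩ := step 0 hm
    exact ⟨w, by simpa using h1, by simpa using h2⟩
  | succ m ih =>
    obtain ⟨v, h1, h2⟩ := ih (by omega)
    obtain ⟨w, h3, h4⟩ := step (m + 1) hm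
    refine ⟨⁅v, w⁆, ?_, ?_⟩
    · rw [LieHom.map_lie, h1, h3, Ring.lie_def, Matrix.single_mul_single_same,
        Matrix.single_mul_single_of_ne, sub_zero, mul_one]
      intro h
      have := Nat.le_of_dvd (by omega) ((nsmul_one_eq_zero_iff _).1 (add_eq_left.1 h))
      omega
    · rw [leibniz_lie, h2, h4, smul_lie]
      push_cast
      module

/-- The path through all `n - 1` simple nodes ends at the matrix unit of `E_θ`, whose `ρ`-weight is
`|θ|`. -/
lemma ht_θ_add_one : D.ht D.θ + 1 = n := by
  have hn := S.two_le
  obtain ⟨v, h1, h2⟩ := S.exists_path (m := n - 2) (by omega)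
  have h3 : ν none + 1 + (n - 2 + 1) • 1 = ν none := by
    rw [add_assoc, ← succ_nsmul', (nsmul_one_eq_zero_iff _).2 (by
      rw [show n - 2 + 1 + 1 = n by omega]), add_zero]
  have h4 : v = D.E D.θ := by
    refine S.injective ?_
    have := S.apply_E_neg none
    rw [nodeRoot, neg_neg_root] at this
    rw [h1, h3, this]
  rw [h4, lie_H_E, rootVal_ρ] at h2
  have h5 := smul_left_injective ℂ (D.E_ne_zero D.θ) h2
  have h6 : D.ht D.θ = ((n - 2 + 1 : ℕ) : ℤ) := by exact_mod_cast h5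
  omega

/-- As `𝔩 = 0` does not contain `ρ`, necessarily `g = |θ| + 1`. -/
lemma eq_of_twist (W : D.Twist g T B β) : g = n := by
  have h1 := S.ht_θ_add_one
  have h2 := D.ht_θ_pos
  rcases W.ρ_mem_or with h | h
  · have : D.lSub T = ⊥ := Submodule.finrank_eq_zero.1 S.finrank_lSub_eq
    rw [this, Submodule.mem_bot] at h
    have h3 := D.rootVal_ρ D.θ
    rw [h] at h3
    have h4 : (D.ht D.θ : ℂ) = 0 := by rw [← h3]; simp [rootVal]
    have : D.ht D.θ = 0 := by exact_mod_cast h4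
    omega
  · omega

/-- The trace form is invariant, hence proportional to the given one; on `E_{±α_0}` both equal `1`.
-/
lemma trace_mul (y z : 𝔤) : (Φ y * Φ z).trace = D.form y z := by
  let F : LinearMap.BilinForm ℂ 𝔤 := LinearMap.mk₂ ℂ (fun y z => (Φ y * Φ z).trace)
    (fun _ _ _ => by simp [add_mul]) (fun _ _ _ => by simp)
    (fun _ _ _ => by simp [mul_add]) (fun _ _ _ => by simp)
  have hF : ∀ y z, F y z = (Φ y * Φ z).trace := fun _ _ => rfl
  obtain ⟨c, hc⟩ := D.exists_eq_smul_form F fun X Y Z => by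
    rw [hF, hF, LieHom.map_lie, LieHom.map_lie, Ring.lie_def, Ring.lie_def, sub_mul, mul_sub,
      Matrix.trace_sub, Matrix.trace_sub, mul_assoc, Matrix.trace_mul_comm (Φ X), ← mul_assoc,
      ← mul_assoc, mul_assoc]
    ring
  have h1 := hF (D.E (D.nodeRoot none)) (D.E (D.neg (D.nodeRoot none)))
  rw [hc, S.apply_E, S.apply_E_neg, Matrix.single_mul_single_same,
    Matrix.trace_single_eq_same, LinearMap.smul_apply, LinearMap.smul_apply, form_E_neg] at h1
  have hc1 : c = 1 := by simpa using h1
  rw [← hF, hc, hc1, one_smul]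

/-- Both sides are homomorphisms multiplying the simple root vectors by `e(1/n)` and their opposites
by `e(-1/n)`. -/
lemma apply_gam (hg : g = n) (y : 𝔤) : Φ (D.gam g y) = clockConj n (Φ y) := by
  have hn := S.two_le
  let G : 𝔤 →ₗ⁅ℂ⁆ 𝔤 := { D.gam g with map_lie' := D.gam_lie _ _ }
  have e : ∀ j : Fin n, ee ((((j + 1 : Fin n) : ℕ) - (j : ℕ) : ℂ) / n) = ee (1 / n) := by
    intro j
    rw [ee_val_add_sub, Fin.val_one', Nat.mod_eq_of_lt (by omega), Nat.cast_one]
  have h : Φ.comp G = (clockConj n).comp Φ := by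
    refine lieHom_ext (D := D) (fun i hi => ?_) (fun i hi => ?_)
    · change Φ (D.gam g (D.E i)) = clockConj n (Φ (D.E i))
      have h1 := S.apply_E (some ⟨i, hi⟩)
      rw [nodeRoot] at h1
      rw [gam_E, map_smul, h1, clockConj_single, e, D.ht_simple hi, hg, Int.cast_one]
    · change Φ (D.gam g (D.E (D.neg i))) = clockConj n (Φ (D.E (D.neg i)))
      have h1 := S.apply_E_neg (some ⟨i, hi⟩)
      rw [nodeRoot] at h1
      rw [gam_E, map_smul, h1, clockConj_single, ← neg_sub, neg_div, ee_neg, e, ht_neg,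
        D.ht_simple hi, hg, ← ee_neg]
      congr 2; push_cast; ring
  exact LieHom.congr_fun h y

lemma apply_beta (W : D.Twist g T B β) (y : 𝔤) : Φ (β y) = shiftConj (Fin.ofNat n k) (Φ y) := by
  have h : Φ.comp (β : 𝔤 →ₗ⁅ℂ⁆ 𝔤) = (shiftConj (Fin.ofNat n k)).comp Φ := by
    refine lieHom_ext (D := D) (fun i hi => ?_) (fun i hi => ?_)
    · change Φ (β (D.E (D.nodeRoot (some ⟨i, hi⟩)))) =
        shiftConj (Fin.ofNat n k) (Φ (D.E (D.nodeRoot (some ⟨i, hi⟩))))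
      rw [W.beta_E, S.apply_E, S.apply_E, shiftConj_single, S.rotation, add_right_comm]
    · change Φ (β (D.E (D.neg (D.nodeRoot (some ⟨i, hi⟩))))) =
        shiftConj (Fin.ofNat n k) (Φ (D.E (D.neg (D.nodeRoot (some ⟨i, hi⟩)))))
      rw [W.beta_E_neg, S.apply_E_neg, S.apply_E_neg, shiftConj_single, S.rotation, add_right_comm]
  exact LieHom.congr_fun h y

/-- With `γ` the clock and `β` the `k`-th power of the shift, `J_{p,c}` has eigenvalues `e(p/n)` and
`e(-ck/n)`. -/
lemma isHom (W : D.Twist g T B β) (ha : a = 0) {v : 𝔤} {p c : Fin n} (hv : Φ v = heisJ n p c) :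
    D.IsHom g T β x 0 (p : ℕ) (-((c : ℕ) * k)) v where
  lie i := by subst ha; exact i.elim0
  gam := S.injective <| by
    rw [S.apply_gam (S.eq_of_twist W), map_smul, hv, clockConj_heisJ, S.eq_of_twist W,
      Int.cast_natCast]
  beta := S.injective <| by
    have hn : (n : ℂ) ≠ 0 := by exact_mod_cast NeZero.ne n
    rw [S.apply_beta W, map_smul, hv, shiftConj_heisJ, S.orderOf_eq, Fin.val_ofNat]
    congr 1
    obtain ⟨q, hq⟩ : ∃ q : ℕ, k = k % n + n * q := ⟨k / n, (Nat.mod_add_div k n).symm⟩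
    have h1 : (k : ℂ) = (k % n : ℕ) + n * q := by exact_mod_cast hq
    push_cast
    rw [h1, show -((c : ℕ) * ((k % n : ℕ) + n * q) : ℂ) / n =
      -((c : ℕ) * (k % n : ℕ)) / n + ((-((c : ℕ) * q) : ℤ) : ℂ) by
        push_cast; field_simp; ring, ee_add, ee_int, mul_one]

lemma not_isTriv (p c : Fin n) (h : ¬(p = 0 ∧ c = 0)) :
    ¬IsTriv n n (0 : Fin a → ℂ) (p : ℕ) (-((c : ℕ) * k)) := by
  rintro ⟨-, h1, h2⟩
  refine h ⟨Fin.val_eq_zero_iff.1 (Nat.eq_zero_of_dvd_of_lt (by exact_mod_cast h1) p.2),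
    Fin.val_eq_zero_iff.1 (Nat.eq_zero_of_dvd_of_lt ?_ c.2)⟩
  rw [dvd_neg] at h2
  exact S.coprime.symm.dvd_of_dvd_mul_right (by exact_mod_cast h2)

lemma map_ellipticR (W : D.Twist g T B β) (hτ : 0 < τ.im) (hx : D.IsAdapted T x) {u : ℂ}
    (hu : u ∉ latt τ) :
    TensorProduct.map (Φ : 𝔤 →ₗ[ℂ] Matrix (Fin n) (Fin n) ℂ)
        (Φ : 𝔤 →ₗ[ℂ] Matrix (Fin n) (Fin n) ℂ) (D.ellipticR g T β x τ lam u) =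
      (-(1 / (2 * Real.pi * I)) : ℂ) • belavinR n k τ u := by
  have ha : a = 0 := by rw [← hx.finrank_lSub, S.finrank_lSub_eq]
  -- Since `𝔩 = 0`, every root vanishes on `𝔩`, so genericity is automatic.
  have hgen : D.Gen g T x τ lam := fun α =>
    W.val_not_mem_latt hτ hx (fun i => by subst ha; exact i.elim0) lam
  have hgn := S.eq_of_twist W
  have hT := S.orderOf_eq
  -- `J_{0,0}` is the identity matrix and is not in `sl(n)`; it is replaced by `0`, which loses
  -- nothing because its trace pairing with `sl(n)` is zero.
  choose V hV using fun p c : Fin n => S.exists_of_trace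
    (if p = 0 ∧ c = 0 then 0 else heisJ n p c) (by
      split_ifs with h
      · simp
      · exact trace_heisJ h)
  choose V' hV' using fun p c : Fin n => S.exists_of_trace
    (if p = 0 ∧ c = 0 then 0 else heisJdual n p c) (by
      split_ifs with h
      · simp
      · exact trace_heisJdual h)
  have hrec : ∀ y, ∑ p, ∑ c, D.form (V p c) y • V' p c = y := by
    refine fun y => S.injective ?_
    rw [map_sum, ← sum_trace_heisJ (Φ y)]
    refine Finset.sum_congr rfl fun p _ => ?_
    rw [map_sum]
    refine Finset.sum_congr rfl fun c _ => ?_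
    rw [map_smul, hV', ← S.trace_mul, hV]
    split_ifs with h
    · rw [h.1, h.2, trace_heisJ_mul]
      have := S.trace y
      rw [Matrix.trace] at this
      simp only [Matrix.diag_apply] at this
      simp [ee_zero, this]
    · rfl
  -- Expanding the second leg in the dual basis expresses `R` by its contractions with the
  -- `J_{p,c}`, on which it acts by scalars.
  have hrecT : ∀ R : 𝔤 ⊗[ℂ] 𝔤, R = ∑ p, ∑ c, D.contr' (V p c) R ⊗ₜ[ℂ] V' p c := by
    intro R
    induction R with
    | zero => simp
    | tmul y z =>
      conv_lhs => rw [← hrec z]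
      simp only [contr'_tmul, TensorProduct.tmul_sum, TensorProduct.tmul_smul,
        TensorProduct.smul_tmul']
    | add s t hs ht =>
      simp only [map_add, TensorProduct.add_tmul, Finset.sum_add_distrib]
      rw [← hs, ← ht]
  rw [hrecT (D.ellipticR g T β x τ lam u), belavinR, Finset.smul_sum, map_sum]
  refine Finset.sum_congr rfl fun p _ => ?_
  rw [Finset.smul_sum, map_sum]
  refine Finset.sum_congr rfl fun c _ => ?_
  rw [TensorProduct.map_tmul, LieHom.coe_toLinearMap, hV']
  have hVpc := hV p c
  split_ifs at hVpc ⊢ with h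
  · simp
  · rw [(S.isHom W ha hVpc).contr'_ellipticR W hτ hx hgen hu, map_smul, hVpc, hgn, hT,
      coef_of_not_triv (S.not_isTriv p c h), ← TensorProduct.smul_tmul', smul_smul, omg, ee]
    congr 4
    · push_cast; ring
    · push_cast; simp; ring

end IsSlModel

end Belavin

end ChevalleyData

end

/-! ### Assembly: the continuation `continuedR` has all the required properties. -/

theorem mainTheorem5 {𝔤 : Type*} [LieRing 𝔤] [LieAlgebra ℂ 𝔤] [FiniteDimensional ℂ 𝔤]
    [LieAlgebra.IsSimple ℂ 𝔤] (D : ChevalleyData 𝔤)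
    (T : Equiv.Perm D.Node) (hT : D.IsDiagramAut T)
    (g : ℕ) (hg : 0 < g) (hdeg : ∀ i, D.degree g (T i) = D.degree g i)
    (B : D.Affine ≃ₗ⁅ℂ⁆ D.Affine) (hB : D.IsLift g T B)
    (β : 𝔤 ≃ₗ⁅ℂ⁆ 𝔤) (hβ : D.Induces g B β)
    {a b : ℕ} (x : Module.Basis (Fin a ⊕ Fin b) ℂ D.H) (hx : D.IsAdapted T x)
    (τ : ℂ) (hτ : 0 < τ.im) :
    -- the number of dynamical variables
    Module.finrank ℂ (D.lSub T) = a ∧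
    a + 1 = Nat.card (Quotient (Equiv.Perm.SameCycle.setoid T)) ∧
    ∃ R : (Fin a → ℂ) → ℂ → 𝔤 ⊗[ℂ] 𝔤,
      -- the explicit formula, with `z = e^{2πiu/g}`
      (∀ lam u, R lam (Complex.exp (2 * Real.pi * Complex.I * u / g)) =
        D.ellipticR g T β x τ lam u) ∧
      -- `R` is the meromorphic continuation of the series from an annulus
      (∀ ψ : Module.Dual ℂ (𝔤 ⊗[ℂ] 𝔤),
        IsMeromorphicOn (fun q : (Fin a → ℂ) × ℂ => ψ (R q.1 q.2)) {q | q.2 ≠ 0}) ∧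
      (∀ lam z, D.IsGeneric g T x τ lam → 1 < ‖z‖ → ‖z‖ < Real.exp (2 * Real.pi * τ.im / g) →
        D.SeriesConvergesTo g T B x τ lam z (R lam z)) ∧
      -- `R` is a dynamical r-matrix with spectral parameter
      (∀ lam z, z ≠ 0 → ∀ h ∈ D.lSub T, ⁅(h : 𝔤), R lam z⁆ = 0) ∧
      (∀ lam z₁ z₂ z₃, D.IsGeneric g T x τ lam → z₁ ≠ 0 → z₂ ≠ 0 → z₃ ≠ 0 →
        (∀ z ∈ ({z₁ / z₂, z₁ / z₃, z₂ / z₃} : Set ℂ), ∀ k : ℤ,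
          z ^ g ≠ Complex.exp (2 * Real.pi * Complex.I * k * τ)) →
        CDYBE.HoldsAt (fun j => (x (Sum.inl j) : 𝔤)) R lam z₁ z₂ z₃) ∧
      -- Felder's r-matrix, up to a gauge transformation
      (T = 1 → ∀ lam u, R lam (Complex.exp (2 * Real.pi * Complex.I * u / g)) =
        (-(1 / (2 * Real.pi * Complex.I)) : ℂ) •
          TensorProduct.map (D.torusAd ((2 * Real.pi * Complex.I * u / g) • D.ρ)) LinearMap.id
            (D.felderR x τ ((1 / (2 * Real.pi * Complex.I) : ℂ) • D.lamH x lam -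
              (τ / g) • D.ρ) u)) ∧
      -- Belavin's r-matrix
      (∀ (n : ℕ) [NeZero n] (k : ℕ) (ν : D.Node ≃ Fin n)
        (ψ : 𝔤 ≃ₗ⁅ℂ⁆ LieAlgebra.SpecialLinear.sl (Fin n) ℂ), k.Coprime n →
        (∀ i, slIncl n (ψ (D.E (D.nodeRoot i))) =
          Matrix.single (ν i) (ν i + 1) 1) →
        (∀ i, slIncl n (ψ (D.E (D.neg (D.nodeRoot i)))) =
          Matrix.single (ν i + 1) (ν i) 1) →
        (∀ i, ν (T i) = ν i + Fin.ofNat n k) →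
        a = 0 ∧ ∀ lam u, (∀ p q : ℤ, u ≠ p + q * τ) →
          TensorProduct.map
            (slIncl n ∘ₗ (ψ : 𝔤 →ₗ[ℂ] LieAlgebra.SpecialLinear.sl (Fin n) ℂ))
            (slIncl n ∘ₗ (ψ : 𝔤 →ₗ[ℂ] LieAlgebra.SpecialLinear.sl (Fin n) ℂ))
            (R lam (Complex.exp (2 * Real.pi * Complex.I * u / g))) =
          (-(1 / (2 * Real.pi * Complex.I)) : ℂ) • belavinR n k τ u) := by
  have W : D.Twist g T B β := ⟨hT, hg, hdeg, hB, hβ⟩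
  have hexp : ∀ lam u, D.continuedR g T β x τ lam
      (Complex.exp (2 * Real.pi * Complex.I * u / g)) = D.ellipticR g T β x τ lam u :=
    fun lam u => ChevalleyData.continuedR_exp hτ hg u
  refine ⟨hx.finrank_lSub, by rw [← D.finrank_lSub_add_one T, hx.finrank_lSub],
    D.continuedR g T β x τ, hexp, W.isMeromorphicOn hτ hx, ?_, ?_, ?_, ?_, ?_⟩
  · intro lam z hgen h0 h1
    obtain ⟨u, rfl, h2, h3⟩ := ChevalleyData.exists_im_bounds hg h0 h1
    rw [hexp]
    exact W.seriesConvergesTo hτ hx hgen h2 h3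
  · intro lam z hz h hh
    obtain ⟨u, rfl⟩ := ChevalleyData.exists_exp_eq g hg hz
    rw [hexp]
    exact W.lie_ellipticR hh lam u
  · intro lam z₁ z₂ z₃ hgen h1 h2 h3 hz
    exact W.holdsAt hτ hx hexp (ChevalleyData.gen_of_isGeneric hgen) h1 h2 h3 hz
  · intro h1 lam u
    rw [hexp]
    exact W.ellipticR_felder hx h1 lam u
  · intro n _ k ν ψ hk hE hF hrot
    have S := ChevalleyData.isSlModel_slHom hk hE hF hrot
    refine ⟨by rw [← hx.finrank_lSub, S.finrank_lSub_eq], fun lam u hu => ?_⟩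
    rw [hexp]
    exact S.map_ellipticR W hτ hx fun ⟨p, q, h⟩ => hu p q h
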